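/- Let $\mathbf F_q$ be a finite field with $q$ elements, $A=\mathbf F_q[t]$, $F=\mathbf F_q(t)$ and $F_\infty=\mathbf F_q((1/t))$. Let $K$ be a finite extension of $\mathbf F_q(\theta)$ contained in $\mathbf F_q((1/\theta))$, let $O_K$ be the integral closure of $\mathbf F_q[\theta]$ in $K$, and let $i:A\to K$ be the $\mathbf F_q$-algebra homomorphism with $i(t)=\theta$. An effective $t$-motive over $K$ is a finitely generated projective $K[t]$-module $M$ of some rank $r$ with an additive map $\sigma:M\to M$ that is $A$-linear and satisfies $\sigma(xm)=x^q\sigma(m)$ for $x\in K$, which is non-degenerate ($\wedge^r\sigma\neq0$) and for which $(\wedge^rM,\wedge^r\sigma)$ is isomorphic to $(K[t]e,\ e\mapsto\alpha(t-\theta)^ne)$ for some $\alpha\in K^\times$ and $n\ge0$. For a non-zero prime ideal $\lambda$ of $A$ let $F_\lambda=A_\lambda\otimes_AF$, let $$V_\lambda(M)=\Bigl(\varprojlim_n\bigl(M_{K^{\rm sep}}/\lambda^nM_{K^{\rm sep}}\bigr)^{\sigma=1}\Bigr)\otimes_{A_\lambda}F_\lambda ,$$ and let $V_\lambda(M^\vee)$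 be the $F_\lambda$-linear dual of $V_\lambda(M)$ with the contragredient action $\rho_\lambda$ of $\mathrm{Gal}(K^{\rm sep}/K)$. A finite set $S$ of finite places of $K$ (non-zero primes of $O_K$) is called exceptional for $(V_\lambda(M^\vee))_\lambda$ if for every finite place $v\notin S$: for all $\lambda$ with $i(\lambda)$ coprime to $v$ the representation $\rho_\lambda$ is unramified at $v$, and there is a polynomial $P_v(X)\in F[X]$ with $P_v(X)=\det(1-X\rho_\lambda(\mathrm{Frob}_v))$ for all such $\lambda$, where $\mathrm{Frob}_v$ is a geometric Frobenius at $v$. For $n\in\mathbf Z$ the Euler product is $$L_S(M^\vee,n)=\prod_{v\notin S}P_v(\mathcal Nv^{-n})^{-1},$$ where $v$ runs through the finite places outside $S$ and $\mathcal Nv\in A$ is the monic generator of the norm of $v$ to $\mathbf F_q[\theta]$, with $\theta$ replaced by $t$. Proposition. Let $M$ be an effective $t$-motive over $K$ that is finitely generated as a left $K[\tau]$-module, where $\tau a=a^q\tau$ for $a\in K$ and $\tau$ acts on $M$ as $\sigma$. Then an exceptional set for $(V_\lambda(M^\vee))_\lambda$ exists, and for every exceptional set $S$ the Euler product defining $L_S(M^\vee,0)$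 converges in $F_\infty$: one has $P_v(1)\neq0$ for all finite places $v\notin S$, and the product $\prod_{v\notin S}P_v(1)^{-1}$ converges, independently of the order of its factors, to a non-zero element of $F_\infty$. -/

import Mathlib

open scoped Polynomial TensorProduct

noncomputable section

namespace TMotive

/-!
Throughout, `Fq` is a finite field with `q` elements, `Fq[X]` plays two roles which are kept apart:

* as coefficient ring `A = 𝔽_q[t]` it acts on `K[X] = K ⊗ A = K[t]`-modules through the
  variable `X = t`;
* as base ring `𝔽_q[θ]` it acts on `K` through `algebraMap Fq[X] K`, so that
  `θ = algebraMap Fq[X] K X`.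

The map `i : A → K`, `t ↦ θ`, is `algebraMap Fq[X] K`.
-/

section SigmaModules

variable (Fq : Type*) [Field Fq] [Fintype Fq]

/-- The ring endomorphism of `R[t]` raising the coefficients to the `q`-th power and fixing `t`. -/
def coeffFrob (R : Type*) [CommRing R] [Algebra Fq R] : R[X] →+* R[X] :=
  Polynomial.mapRingHom (FiniteField.frobeniusAlgHom Fq R : R →+* R)

variable {Fq} {K : Type*} [Field K] [Algebra Fq K]
variable {M : Type*} [AddCommGroup M] [Module K[X] M]

/-- The determinant of a `σ`-module is non-zero: `∧^r σ ≠ 0` on `∧^r M`, `r` the rank of `M`. -/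
def IsNondegenerate (σ : M →ₛₗ[coeffFrob Fq K] M) : Prop :=
  ∃ m : Fin (Module.finrank K[X] M) → M,
    exteriorPower.ιMulti K[X] (Module.finrank K[X] M) (fun i => σ (m i)) ≠ 0

/-- A `σ`-module over `K`, that is a finitely generated projective `K[t]`-module `M` with a
semilinear `σ` (over a field its rank is constant), is an effective `t`-motive when it is
non-degenerate and its determinant `∧^r M`, on which `σ` acts by
`σ(m₁ ∧ ⋯ ∧ m_r) = σ(m₁) ∧ ⋯ ∧ σ(m_r)`, is isomorphic to the `σ`-module
`(K[t] e, e ↦ α (t - θ)^n e)` for some `α ∈ Kˣ` and some `n ≥ 0`. -/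
structure IsEffective [Algebra Fq[X] K] (σ : M →ₛₗ[coeffFrob Fq K] M) : Prop where
  finite : Module.Finite K[X] M
  projective : Module.Projective K[X] M
  nondegenerate : IsNondegenerate σ
  det_iso : ∃ (e : (⋀[K[X]]^(Module.finrank K[X] M) M) ≃ₗ[K[X]] K[X]) (α : K) (n : ℕ), α ≠ 0 ∧
    ∀ m : Fin (Module.finrank K[X] M) → M,
      e (exteriorPower.ιMulti K[X] (Module.finrank K[X] M) (fun i => σ (m i))) =
        coeffFrob Fq K (e (exteriorPower.ιMulti K[X] (Module.finrank K[X] M) m)) *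
          (Polynomial.C α *
            (Polynomial.X - Polynomial.C (algebraMap Fq[X] K Polynomial.X)) ^ n)

/-- `M` is finitely generated as a left `K[τ]`-module, `τ` acting as `σ`: there are finitely many
elements `m` such that the elements `a τ^j m` (`a ∈ K`, `j ≥ 0`) generate `M` additively. -/
def IsFinitelyGeneratedOverTau (σ : M →ₛₗ[coeffFrob Fq K] M) : Prop :=
  ∃ s : Finset M, AddSubgroup.closure
    {x : M | ∃ (a : K) (j : ℕ), ∃ m ∈ s, x = (Polynomial.C a : K[X]) • (σ^[j] m)} = ⊤

end SigmaModules

section SeparableExtension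

attribute [local instance] Polynomial.algebra

variable (Fq : Type*) [Field Fq] (K : Type*) [Field K] [Algebra Fq K]
variable (M : Type*) [AddCommGroup M] [Module K[X] M]

/-- `M_{K^sep} = M ⊗_K K^sep`, written as `K^sep[t] ⊗_{K[t]} M`, where `K[t] → K^sep[t]`
sends `t` to `t`. -/
@[nolint unusedArguments]
def SepExt (_Fq : Type*) (K : Type*) [Field K] (M : Type*) [AddCommGroup M] [Module K[X] M] :
    Type _ :=
  (SeparableClosure K)[X] ⊗[K[X]] M

namespace SepExt

instance : AddCommGroup (SepExt Fq K M) :=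
  inferInstanceAs (AddCommGroup ((SeparableClosure K)[X] ⊗[K[X]] M))

instance : Module (SeparableClosure K)[X] (SepExt Fq K M) :=
  inferInstanceAs (Module (SeparableClosure K)[X] ((SeparableClosure K)[X] ⊗[K[X]] M))

/-- `A = 𝔽_q[t]` acts on `M_{K^sep}` through `A ⊆ K^sep[t]`, `t ↦ t`. -/
instance : Module Fq[X] (SepExt Fq K M) :=
  Module.compHom (SepExt Fq K M) (Polynomial.mapRingHom (algebraMap Fq (SeparableClosure K)))

theorem smul_def (a : Fq[X]) (x : SepExt Fq K M) :
    a • x = (a.map (algebraMap Fq (SeparableClosure K))) • x := rfl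

variable {K M}

/-- The pure tensor `p ⊗ m`. -/
def tmul (p : (SeparableClosure K)[X]) (m : M) : SepExt Fq K M := p ⊗ₜ[K[X]] m

theorem smul_tmul (p p' : (SeparableClosure K)[X]) (m : M) :
    p • tmul Fq p' m = tmul Fq (p * p') m := rfl

variable {Fq} in
@[elab_as_elim]
theorem induction_on {P : SepExt Fq K M → Prop} (x : SepExt Fq K M) (h0 : P 0)
    (ht : ∀ p m, P (tmul Fq p m)) (ha : ∀ x y, P x → P y → P (x + y)) : P x :=
  TensorProduct.induction_on x h0 ht ha

/-- The `A`-linear map `p ⊗ m ↦ φ(p) ⊗ s(m)`, for ring endomorphisms `ψ` of `K` and `φ` of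
`K^sep` compatible with each other and trivial on `𝔽_q`, and a `ψ`-semilinear map `s`. -/
def map (φ : SeparableClosure K →ₐ[Fq] SeparableClosure K) (ψ : K →ₐ[Fq] K)
    (h : ∀ a : K, φ (algebraMap K (SeparableClosure K) a) = algebraMap K _ (ψ a))
    (s : M →+ M) (hs : ∀ (a : K[X]) (m : M), s (a • m) = (a.map (ψ : K →+* K)) • s m) :
    SepExt Fq K M →ₗ[Fq[X]] SepExt Fq K M :=
  let f : SepExt Fq K M →+ SepExt Fq K M :=
    TensorProduct.liftAddHom (R := K[X]) (M := (SeparableClosure K)[X]) (N := M)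
      (P := (SeparableClosure K)[X] ⊗[K[X]] M)
      (AddMonoidHom.mk' (fun p => AddMonoidHom.mk'
          (fun m => (p.map (φ : SeparableClosure K →+* SeparableClosure K)) ⊗ₜ[K[X]] s m)
          (fun m m' => by rw [map_add, TensorProduct.tmul_add]))
        (fun p p' => by
          ext m
          simp [Polynomial.map_add, TensorProduct.add_tmul]))
      (fun a p m => by
        have key : ((a • p).map (φ : SeparableClosure K →+* SeparableClosure K)) =
            (a.map (ψ : K →+* K)) •
              p.map (φ : SeparableClosure K →+* SeparableClosure K) := by
          rw [Algebra.smul_def, Algebra.smul_def, Polynomial.map_mul, Polynomial.algebraMap_def,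
            Polynomial.coe_mapRingHom, Polynomial.map_map, Polynomial.map_map]
          congr 2
          ext x
          simp [h]
        change ((a • p).map (φ : SeparableClosure K →+* SeparableClosure K)) ⊗ₜ[K[X]] s m =
          (p.map (φ : SeparableClosure K →+* SeparableClosure K)) ⊗ₜ[K[X]] s (a • m)
        rw [key, hs, TensorProduct.smul_tmul])
  { toFun := f
    map_add' := f.map_add
    map_smul' := fun c x => by
      have hc : (c.map (algebraMap Fq (SeparableClosure K))).map
          (φ : SeparableClosure K →+* SeparableClosure K) =
          c.map (algebraMap Fq (SeparableClosure K)) := by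
        rw [Polynomial.map_map]
        congr 1
        ext x
        simp
      have ht : ∀ (p : (SeparableClosure K)[X]) (m : M), f (tmul Fq p m) =
          tmul Fq (p.map (φ : SeparableClosure K →+* SeparableClosure K)) (s m) :=
        fun p m => rfl
      rw [RingHom.id_apply, smul_def, smul_def]
      induction x using SepExt.induction_on with
      | h0 => rw [smul_zero, map_zero, smul_zero]
      | ht p m => rw [smul_tmul, ht, ht, smul_tmul, Polynomial.map_mul, hc]
      | ha x y hx hy => rw [smul_add, map_add, hx, hy, map_add, smul_add] }

theorem map_tmul (φ : SeparableClosure K →ₐ[Fq] SeparableClosure K) (ψ : K →ₐ[Fq] K)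
    (h : ∀ a : K, φ (algebraMap K (SeparableClosure K) a) = algebraMap K _ (ψ a))
    (s : M →+ M) (hs : ∀ (a : K[X]) (m : M), s (a • m) = (a.map (ψ : K →+* K)) • s m)
    (p : (SeparableClosure K)[X]) (m : M) :
    map Fq φ ψ h s hs (tmul Fq p m) =
      tmul Fq (p.map (φ : SeparableClosure K →+* SeparableClosure K)) (s m) := rfl

/-- `σ` on `M_{K^sep}`: `p ⊗ m ↦ p^{(q)} ⊗ σ(m)`, with `p^{(q)}` obtained from `p` by raising the
coefficients to the `q`-th power. -/
def sigma [Fintype Fq] (σ : M →ₛₗ[coeffFrob Fq K] M) : SepExt Fq K M →ₗ[Fq[X]] SepExt Fq K M :=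
  map Fq (FiniteField.frobeniusAlgHom Fq (SeparableClosure K)) (FiniteField.frobeniusAlgHom Fq K)
    (fun a => by simp) σ.toAddMonoidHom (fun a m => σ.map_smulₛₗ a m)

/-- The action of `g ∈ Gal(K^sep/K)` on `M_{K^sep}` through the coefficients:
`p ⊗ m ↦ g(p) ⊗ m`. -/
def gal (g : Gal(SeparableClosure K/K)) : SepExt Fq K M →ₗ[Fq[X]] SepExt Fq K M :=
  map Fq ((g : SeparableClosure K →ₐ[K] SeparableClosure K).restrictScalars Fq) (AlgHom.id Fq K)
    (fun a => by simp) (AddMonoidHom.id M) (fun a m => by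
      have : a.map ((AlgHom.id Fq K : K →ₐ[Fq] K) : K →+* K) = a := by
        ext; simp
      rw [this]; rfl)

theorem sigma_tmul [Fintype Fq] (σ : M →ₛₗ[coeffFrob Fq K] M) (p : (SeparableClosure K)[X])
    (m : M) :
    sigma Fq σ (tmul Fq p m) = tmul Fq (coeffFrob Fq (SeparableClosure K) p) (σ m) := rfl

theorem gal_tmul (g : Gal(SeparableClosure K/K)) (p : (SeparableClosure K)[X]) (m : M) :
    gal Fq g (tmul Fq p m) =
      tmul Fq (p.map ((g : SeparableClosure K ≃+* SeparableClosure K) :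
        SeparableClosure K →+* SeparableClosure K)) m := rfl

theorem gal_one : gal (M := M) Fq (1 : Gal(SeparableClosure K/K)) = LinearMap.id := by
  ext x
  induction x using SepExt.induction_on with
  | h0 => simp
  | ht p m =>
    rw [gal_tmul, LinearMap.id_apply]
    congr 1
    ext
    simp
  | ha x y hx hy => rw [map_add, map_add, hx, hy]

theorem gal_mul (g h : Gal(SeparableClosure K/K)) :
    gal (M := M) Fq (g * h) = gal Fq g ∘ₗ gal Fq h := by
  ext x
  induction x using SepExt.induction_on with
  | h0 => simp
  | ht p m =>
    rw [LinearMap.comp_apply, gal_tmul, gal_tmul, gal_tmul, Polynomial.map_map]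
    rfl
  | ha x y hx hy => rw [map_add, map_add, hx, hy]

theorem sigma_comp_gal [Fintype Fq] (σ : M →ₛₗ[coeffFrob Fq K] M)
    (g : Gal(SeparableClosure K/K)) :
    sigma Fq σ ∘ₗ gal Fq g = gal Fq g ∘ₗ sigma Fq σ := by
  ext x
  induction x using SepExt.induction_on with
  | h0 => simp
  | ht p m =>
    rw [LinearMap.comp_apply, LinearMap.comp_apply, gal_tmul, sigma_tmul, sigma_tmul, gal_tmul]
    congr 1
    ext n
    simp [coeffFrob]
  | ha x y hx hy => rw [map_add, map_add, hx, hy]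

end SepExt

end SeparableExtension

section GaloisRepresentations

open IsDedekindDomain

variable {Fq : Type*} [Field Fq]

/-- `A_λ = lim A/λ^n`. -/
abbrev ALoc (l : HeightOneSpectrum Fq[X]) : Type _ := AdicCompletion l.asIdeal Fq[X]

/-- `F_λ = A_λ ⊗_A F`, with `F = 𝔽_q(t)`. -/
def FLoc (l : HeightOneSpectrum Fq[X]) : Type _ := ALoc l ⊗[Fq[X]] RatFunc Fq

instance (l : HeightOneSpectrum Fq[X]) : CommRing (FLoc l) :=
  inferInstanceAs (CommRing (ALoc l ⊗[Fq[X]] RatFunc Fq))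

instance (l : HeightOneSpectrum Fq[X]) : Algebra (ALoc l) (FLoc l) :=
  inferInstanceAs (Algebra (ALoc l) (ALoc l ⊗[Fq[X]] RatFunc Fq))

/-- The inclusion of `F` in `F_λ`. -/
def toFLoc (l : HeightOneSpectrum Fq[X]) : RatFunc Fq →+* FLoc l :=
  RingHomClass.toRingHom (Algebra.TensorProduct.includeRight :
    RatFunc Fq →ₐ[Fq[X]] ALoc l ⊗[Fq[X]] RatFunc Fq)

variable [Fintype Fq] {K : Type*} [Field K] [Algebra Fq K]
variable {M : Type*} [AddCommGroup M] [Module K[X] M]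

/-- `T_λ(M)`, the `A_λ`-module of `σ`-invariants in `lim M_{K^sep}/λ^n M_{K^sep}` (which is the
limit of the `σ`-invariants in `M_{K^sep}/λ^n M_{K^sep}`). -/
def tateModule (σ : M →ₛₗ[coeffFrob Fq K] M) (l : HeightOneSpectrum Fq[X]) :
    Submodule (ALoc l) (AdicCompletion l.asIdeal (SepExt Fq K M)) :=
  LinearMap.eqLocus (AdicCompletion.map l.asIdeal (SepExt.sigma Fq σ)) LinearMap.id

/-- The Galois action on `T_λ(M)`. -/
def tateModuleRep (σ : M →ₛₗ[coeffFrob Fq K] M) (l : HeightOneSpectrum Fq[X]) :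
    Representation (ALoc l) Gal(SeparableClosure K/K) (tateModule σ l) where
  toFun g := (AdicCompletion.map l.asIdeal (SepExt.gal Fq g)).restrict (fun x hx => by
    have hx' : AdicCompletion.map l.asIdeal (SepExt.sigma Fq σ) x = x := hx
    change AdicCompletion.map l.asIdeal (SepExt.sigma Fq σ)
      (AdicCompletion.map l.asIdeal (SepExt.gal Fq g) x) =
        AdicCompletion.map l.asIdeal (SepExt.gal Fq g) x
    rw [AdicCompletion.map_comp_apply, SepExt.sigma_comp_gal, ← AdicCompletion.map_comp_apply,
      hx'])
  map_one' := by
    ext x : 2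
    simp [SepExt.gal_one]
  map_mul' g h := by
    ext x : 2
    simp [SepExt.gal_mul, AdicCompletion.map_comp_apply]

/-- `V_λ(M) = T_λ(M) ⊗_{A_λ} F_λ`. -/
abbrev VLoc (σ : M →ₛₗ[coeffFrob Fq K] M) (l : HeightOneSpectrum Fq[X]) : Type _ :=
  FLoc l ⊗[ALoc l] tateModule σ l

/-- The Galois representation `V_λ(M)`. -/
def galoisRep (σ : M →ₛₗ[coeffFrob Fq K] M) (l : HeightOneSpectrum Fq[X]) :
    Representation (FLoc l) Gal(SeparableClosure K/K) (VLoc σ l) where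
  toFun g := (tateModuleRep σ l g).baseChange (FLoc l)
  map_one' := by rw [map_one]; exact LinearMap.baseChange_id
  map_mul' g h := by rw [map_mul]; exact LinearMap.baseChange_mul _ _

/-- The representation `V_λ(M^∨)`, the contragredient of `V_λ(M)`. -/
def dualGaloisRep (σ : M →ₛₗ[coeffFrob Fq K] M) (l : HeightOneSpectrum Fq[X]) :
    Representation (FLoc l) Gal(SeparableClosure K/K) (Module.Dual (FLoc l) (VLoc σ l)) :=
  (galoisRep σ l).dual

end GaloisRepresentations

section LFunctions

open IsDedekindDomain FunctionField

variable (Fq : Type*) [Field Fq] (K : Type*) [Field K] [Algebra Fq[X] K]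

/-- The finite places of `K`: the non-zero primes of `O_K`, the integral closure of `𝔽_q[θ]`. -/
abbrev FinitePlace : Type _ := HeightOneSpectrum (ringOfIntegers Fq K)

/-- The integral closure of `O_K` in `K^sep`. -/
abbrev SepIntegers : Type _ := integralClosure (ringOfIntegers Fq K) (SeparableClosure K)

instance : SMulCommClass Gal(SeparableClosure K/K) (ringOfIntegers Fq K) (SeparableClosure K) where
  smul_comm g a x := by
    change g ((a : K) • x) = (a : K) • g x
    exact map_smul g _ _

instance : SMulCommClass Gal(SeparableClosure K/K) (ringOfIntegers Fq K) (SepIntegers Fq K) where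
  smul_comm g a x := Subtype.ext (smul_comm g a (x : SeparableClosure K))

variable {Fq K}

/-- `i(λ)` is coprime with `v`, i.e. `λ` does not lie under `v`. -/
def IsCoprimeTo (l : HeightOneSpectrum Fq[X]) (v : FinitePlace Fq K) : Prop :=
  v.asIdeal.under Fq[X] ≠ l.asIdeal

/-- `𝒩v ∈ A`: the monic generator of the norm of `v` to `𝔽_q[θ]` (with `θ` replaced by `t`),
that is `p ^ f` with `p` the monic irreducible polynomial below `v` and `f` the degree of the
residue field extension. -/
def placeNorm (v : FinitePlace Fq K) : Fq[X] :=
  let p : Fq[X] := Submodule.IsPrincipal.generator (v.asIdeal.under Fq[X])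
  (p * Polynomial.C p.leadingCoeff⁻¹) ^ (v.asIdeal.inertiaDeg Fq[X])

variable (Fq) in
/-- `F_∞ = 𝔽_q((1/t))`, the completion of `F` at infinity. -/
abbrev FInfty : Type _ :=
  letI : DecidableEq (RatFunc Fq) := Classical.decEq _
  RatFunc.CompletionAtInfty Fq

variable {V : HeightOneSpectrum Fq[X] → Type*} [∀ l, AddCommGroup (V l)]
  [∀ l, Module (FLoc l) (V l)]
  (ρ : ∀ l, Representation (FLoc l) Gal(SeparableClosure K/K) (V l))

/-- `ρ_λ` is unramified at `v`: inertia at every place of `K^sep` over `v` acts trivially. -/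
def IsUnramifiedAt (l : HeightOneSpectrum Fq[X]) (v : FinitePlace Fq K) : Prop :=
  ∀ Q : Ideal (SepIntegers Fq K), Q.IsPrime → Q.under (ringOfIntegers Fq K) = v.asIdeal →
    ∀ g ∈ Q.inertia Gal(SeparableClosure K/K), ρ l g = 1

/-- `f` is an endomorphism of a finite free `R`-module, with `det (1 - X f) = P`. -/
def HasRevCharpoly {R W : Type*} [CommRing R] [AddCommGroup W] [Module R W]
    (f : W →ₗ[R] W) (P : R[X]) : Prop :=
  ∃ (n : ℕ) (b : Module.Basis (Fin n) R W), (LinearMap.toMatrix b b f).charpolyRev = P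

/-- `P = P_v(X) ∈ F[X]`: for every `λ` coprime with `v` one has `det(1 - X ρ_λ(Frob_v)) = P`,
where `Frob_v` is a geometric Frobenius at `v`, that is the inverse of a `g` in the Galois group
acting as `x ↦ x ^ #k(v)` modulo a place of `K^sep` over `v`. -/
def IsEulerPolynomial (v : FinitePlace Fq K) (P : (RatFunc Fq)[X]) : Prop :=
  ∀ l : HeightOneSpectrum Fq[X], IsCoprimeTo l v →
    ∀ Q : Ideal (SepIntegers Fq K), Q.IsPrime → Q.under (ringOfIntegers Fq K) = v.asIdeal →
      ∀ g : Gal(SeparableClosure K/K), IsArithFrobAt (ringOfIntegers Fq K) g Q →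
        HasRevCharpoly (ρ l g⁻¹) (P.map (toFLoc l))

/-- `S` is (the set of finite places in) an exceptional set of places for the system `(ρ_λ)_λ`:
it is finite, for `v ∉ S` and `λ` coprime with `v` the representation `ρ_λ` is unramified at `v`,
and the characteristic polynomial of Frobenius at `v` has coefficients in `F` and does not depend
on `λ`. The system is strictly compatible if such an `S` exists. -/
structure IsExceptionalSet (S : Set (FinitePlace Fq K)) : Prop where
  finite : S.Finite
  unramified : ∀ v ∉ S, ∀ l, IsCoprimeTo l v → IsUnramifiedAt ρ l v
  compatible : ∀ v ∉ S, ∃ P : (RatFunc Fq)[X], IsEulerPolynomial ρ v P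

/-- The Euler product `L_S(ρ, n) = ∏_{v ∉ S} P_v(𝒩v^{-n})^{-1}` over the finite places outside `S`
converges to `L` in `F_∞`: all the values
`P_v(𝒩v^{-n})` are non-zero and the product, independently of the order of the factors, has
limit `L ≠ 0`. -/
def EulerProductConvergesTo (S : Set (FinitePlace Fq K)) (n : ℤ)
    (L : FInfty Fq) : Prop :=
  ∃ P : FinitePlace Fq K → (RatFunc Fq)[X],
    (∀ v ∉ S, IsEulerPolynomial ρ v (P v)) ∧
    (∀ v ∉ S, (P v).eval ((algebraMap Fq[X] (RatFunc Fq) (placeNorm v)) ^ (-n)) ≠ 0) ∧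
    L ≠ 0 ∧
    HasProd (fun v : {v : FinitePlace Fq K // v ∉ S} =>
      algebraMap (RatFunc Fq) (FInfty Fq)
        ((P v).eval ((algebraMap Fq[X] (RatFunc Fq) (placeNorm v.1)) ^ (-n)))⁻¹) L

end LFunctions

end TMotive

end

/-! In a basis of M the map σ is given by a matrix A over K[t] with determinant α(t - θ)^m, and σ^N
by A_N = A A^(q) ⋯ A^(q^(N-1)) (`iterMat`). By Lang's theorem the Tate module at λ is free, with
basis the columns of an invertible solution of X = A X^(q) modulo the powers of λ
(`exists_lang_sequence`, `exists_basis_tateModule`).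

Let v have residue field with q^d elements, and suppose that A is integral at v and α a unit there.
Then X and its inverse are integral at v (`exists_integral_solution`). Reducing the relation X^γ = X
Φ for an arithmetic Frobenius γ shows that Φ is conjugate to the inverse of the reduction of A_d.
Hence P_v(X) = det(A_d - X) / det A_d; its coefficients lie in F because A conjugates A_d into its
Frobenius twist, and they do not depend on λ (`dvd_sub_of_frobenius`, `exists_map_eq_det_sub`,
`euler_factor_of_notMem`). Only finitely many v are left out, so an exceptional set exists, and
P_v(1) = det(1 - A_d^{-1}) at the other places.

Finite generation over K[τ] makes σ^{-1} contracting at t = ∞: some t^(c+1) is a combination of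
iterates of σ with coefficients of degree at most c, and the resulting recursion forces deg adj(A_N)
- mN to tend to -∞ (`adjugate_iterMat_degLE`). This bound survives reduction modulo every v. As det
A_d has degree md, the factors P_v(1) tend to 1 when the degree of v grows
(`degLE_det_sub_one_sub_det`). There are finitely many places of bounded degree, so the product
converges to a non-zero limit as soon as no factor vanishes (`exists_hasProd`).

The non-vanishing of P_v(1) is the harder point, since v may be a place where the chosen A has bad
reduction while the representations happen to be unramified (`IsUniformizer.det_one_sub_ne_zero`).
Take λ = (t - c) not below v and a matrix Y of power series in t - c with Y^(q) = Y A.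
Unramifiedness puts the coefficients of Y in the inertia ring, in which a uniformizer π of K at v is
still a uniformizer (`isUniformizer_inertiaRing`). Replacing the lattice by a saturated one makes
the reductions of Y and of the matrix of σ non-singular (`exists_saturated`,
`det_ne_zero_of_saturated`, `det_map_ne_zero`). If 1 were an eigenvalue of Frobenius, a power of σ
would fix a non-zero polynomial vector over the residue field, up to explicit scalars
(`exists_eigenvector`), and its degree would contradict the contraction of σ^{-N} at infinity
(`exists_adjugate_mulVec`).

The embedding of K in 𝔽_q((1/θ)) serves to make K separable over 𝔽_q(θ)
(`isSeparable_of_algHom_FInfty`). -/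

open scoped Polynomial TensorProduct
noncomputable section
namespace TMotive

/-! ### Iterates of Frobenius-semilinear matrices. -/

section SemilinearMatrices

variable {S : Type*} [CommRing S] {n : Type*} [Fintype n] [DecidableEq n]

/-- The matrix of the `N`-th iterate of the semilinear map `x ↦ A φ(x)`. -/
def iterMat (φ : S →+* S) (A : Matrix n n S) : ℕ → Matrix n n S
  | 0 => 1
  | N + 1 => A * (iterMat φ A N).map φ

/-- The product `g φ(g) ⋯ φ^(N-1)(g)`. -/
def iterProd (φ : S →+* S) (g : S) (N : ℕ) : S := ∏ i ∈ Finset.range N, (φ ^ i) g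

theorem iterProd_succ (φ : S →+* S) (g : S) (N : ℕ) :
    iterProd φ g (N + 1) = g * φ (iterProd φ g N) := by
  rw [iterProd, Finset.prod_range_succ', iterProd, map_prod, mul_comm]
  simp [-RingHom.coe_pow, pow_succ']

theorem iterProd_map {S' : Type*} [CommRing S'] (φ : S →+* S) (φ' : S' →+* S') (f : S →+* S')
    (h : ∀ x, f (φ x) = φ' (f x)) (g : S) (N : ℕ) :
    f (iterProd φ g N) = iterProd φ' (f g) N := by
  induction N with
  | zero => simp [iterProd]
  | succ N ih => rw [iterProd_succ, iterProd_succ, map_mul, h, ih]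

theorem iterMat_map {S' : Type*} [CommRing S'] (φ : S →+* S) (φ' : S' →+* S') (f : S →+* S')
    (h : ∀ x, f (φ x) = φ' (f x)) (A : Matrix n n S) (N : ℕ) :
    (iterMat φ A N).map f = iterMat φ' (A.map f) N := by
  induction N with
  | zero => simp [iterMat]
  | succ N ih =>
    rw [iterMat, iterMat, Matrix.map_mul, ← ih, Matrix.map_map, Matrix.map_map]
    congr 2
    funext x
    exact h x

/-- The cocycle rule for σ^(N+N') = σ^N σ^(N'): the second factor is twisted by `φ ^ N` because σ^N
is semilinear. -/
theorem iterMat_add (φ : S →+* S) (A : Matrix n n S) (N N' : ℕ) :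
    iterMat φ A (N + N') = iterMat φ A N * (iterMat φ A N').map (φ ^ N) := by
  induction N with
  | zero =>
    simp only [Nat.zero_add, iterMat, pow_zero, one_mul]
    ext
    simp
  | succ N ih =>
    rw [Nat.succ_add, iterMat, ih, iterMat, Matrix.map_mul, Matrix.map_map, mul_assoc]
    congr 3
    funext x
    simp [pow_succ']

theorem det_iterMat (φ : S →+* S) (A : Matrix n n S) (N : ℕ) :
    (iterMat φ A N).det = iterProd φ A.det N := by
  induction N with
  | zero => simp [iterMat, iterProd]
  | succ N ih =>
    rw [iterMat, Matrix.det_mul, iterProd_succ, ← ih, RingHom.map_det]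
    rfl

theorem iterMat_smul (φ : S →+* S) (g : S) (A : Matrix n n S) (N : ℕ) :
    iterMat φ (g • A) N = iterProd φ g N • iterMat φ A N := by
  induction N with
  | zero => simp [iterMat, iterProd]
  | succ N ih =>
    rw [iterMat, ih, iterMat, iterProd_succ]
    ext i j
    simp [Matrix.mul_apply, Finset.mul_sum]
    exact Finset.sum_congr rfl fun _ _ => by ring

/-- Iteration of a change of basis: if `U` carries the system `H` to the system `B`, it carries
their iterates to each other, up to the twist of `U` at the far end. -/
theorem mul_iterMat_of_intertwine (φ : S →+* S) {U H B : Matrix n n S}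
    (h : U * H = B * U.map φ) (N : ℕ) :
    U * iterMat φ H N = iterMat φ B N * U.map (φ ^ N) := by
  induction N with
  | zero =>
    simp only [iterMat, mul_one, pow_zero, one_mul]
    ext
    simp
  | succ N ih =>
    rw [iterMat, iterMat, ← mul_assoc, h, mul_assoc, ← Matrix.map_mul, ih, Matrix.map_mul,
      Matrix.map_map, ← mul_assoc]
    congr 2
    funext x
    simp [pow_succ']

theorem eq_iterMat_mul {m : Type*} (φ : S →+* S) {A : Matrix n n S} {X : Matrix n m S}
    (h : X = A * X.map φ) (N : ℕ) : X = iterMat φ A N * X.map (φ ^ N) := by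
  induction N with
  | zero =>
    ext
    simp [iterMat]
  | succ N ih =>
    have h2 : X.map φ = (iterMat φ A N).map φ * X.map (φ ^ (N + 1)) := by
      conv_lhs => rw [ih]
      rw [Matrix.map_mul, Matrix.map_map]
      congr 2
      funext x
      simp [pow_succ']
    rw [iterMat, Matrix.mul_assoc, ← h2]
    exact h

/-- Once the twist `φ ^ d` is invisible, σ^d is linear and its iterates are ordinary matrix powers.
This is the situation over a residue field with q^d elements. -/
theorem iterMat_mul_eq_pow (φ : S →+* S) (A : Matrix n n S) (d : ℕ)
    (h : (iterMat φ A d).map (φ ^ d) = iterMat φ A d) (N : ℕ) :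
    iterMat φ A (d * N) = iterMat φ A d ^ N := by
  induction N with
  | zero => simp [iterMat]
  | succ N ih =>
    rw [Nat.mul_succ, Nat.add_comm, iterMat_add, ih, pow_succ']
    congr 1
    have := (RingHom.mapMatrix (φ ^ d) : Matrix n n S →+* Matrix n n S).map_pow
      (iterMat φ A d) N
    simp only [RingHom.mapMatrix_apply, h] at this
    exact this

theorem iterProd_mul_eq_pow (φ : S →+* S) (g : S) (d : ℕ)
    (h : (φ ^ d) (iterProd φ g d) = iterProd φ g d) (N : ℕ) :
    iterProd φ g (d * N) = iterProd φ g d ^ N := by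
  induction N with
  | zero => simp [iterProd]
  | succ N ih =>
    have : iterProd φ g (d + d * N) = iterProd φ g d * (φ ^ d) (iterProd φ g (d * N)) := by
      simp [-RingHom.coe_pow, iterProd, Finset.prod_range_add, map_prod, pow_add]
    rw [Nat.mul_succ, Nat.add_comm, this, ih, map_pow, h, pow_succ']

end SemilinearMatrices

/-! ### Degree bounds with integer exponents, and contraction at infinity. -/

section Degree

variable {R : Type*} [CommRing R]

/-- The polynomial `p` has degree at most the integer `z`. -/
def DegLE (z : ℤ) (p : R[X]) : Prop := ∀ e : ℕ, z < e → p.coeff e = 0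

theorem DegLE.mono {z z' : ℤ} {p : R[X]} (h : DegLE z p) (hz : z ≤ z') : DegLE z' p :=
  fun e he => h e (lt_of_le_of_lt hz he)

theorem degLE_zero (z : ℤ) : DegLE z (0 : R[X]) := fun _ _ => by simp

theorem degLE_natDegree (p : R[X]) : DegLE p.natDegree p := fun _ he =>
  Polynomial.coeff_eq_zero_of_natDegree_lt (by exact_mod_cast he)

theorem degLE_of_natDegree_le {p : R[X]} {z : ℤ} (h : (p.natDegree : ℤ) ≤ z) : DegLE z p :=
  (degLE_natDegree p).mono h

theorem DegLE.natDegree_le {p : R[X]} {z : ℤ} (h : DegLE z p) (hp : p ≠ 0) :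
    (p.natDegree : ℤ) ≤ z := by
  by_contra hc
  exact hp (Polynomial.leadingCoeff_eq_zero.mp (h _ (not_le.mp hc)))

theorem DegLE.add {z : ℤ} {p p' : R[X]} (h : DegLE z p) (h' : DegLE z p') : DegLE z (p + p') :=
  fun e he => by rw [Polynomial.coeff_add, h e he, h' e he, add_zero]

theorem DegLE.neg {z : ℤ} {p : R[X]} (h : DegLE z p) : DegLE z (-p) :=
  fun e he => by rw [Polynomial.coeff_neg, h e he, neg_zero]

theorem DegLE.sum {ι : Type*} {z : ℤ} (s : Finset ι) {p : ι → R[X]} (h : ∀ i ∈ s, DegLE z (p i)) :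
    DegLE z (∑ i ∈ s, p i) := fun e he => by
  rw [Polynomial.finsetSum_coeff]
  exact Finset.sum_eq_zero fun i hi => h i hi e he

theorem DegLE.mul {z z' : ℤ} {p p' : R[X]} (h : DegLE z p) (h' : DegLE z' p') :
    DegLE (z + z') (p * p') := fun e he => by
  rw [Polynomial.coeff_mul]
  refine Finset.sum_eq_zero fun x hx => ?_
  rw [Finset.HasAntidiagonal.mem_antidiagonal] at hx
  rcases lt_or_ge z x.1 with h1 | h1
  · rw [h _ h1, zero_mul]
  · rw [h' x.2 (by omega), mul_zero]

theorem DegLE.C_mul {z : ℤ} {p : R[X]} (h : DegLE z p) (a : R) :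
    DegLE z (Polynomial.C a * p) := fun e he => by
  rw [Polynomial.coeff_C_mul, h e he, mul_zero]

theorem DegLE.map {R' : Type*} [CommRing R'] {z : ℤ} {p : R[X]} (h : DegLE z p) (f : R →+* R') :
    DegLE z (p.map f) := fun e he => by
  rw [Polynomial.coeff_map, h e he, map_zero]

theorem DegLE.of_X_pow_mul {z : ℤ} {c : ℕ} {p : R[X]} (h : DegLE z (Polynomial.X ^ c * p)) :
    DegLE (z - c) p := fun e he => by
  have := h (e + c) (by push_cast; omega)
  rwa [Polynomial.coeff_X_pow_mul] at this

theorem DegLE.prod {ι : Type*} (s : Finset ι) {p : ι → R[X]} {z : ι → ℤ}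
    (h : ∀ i ∈ s, DegLE (z i) (p i)) : DegLE (∑ i ∈ s, z i) (∏ i ∈ s, p i) := by
  classical
  induction s using Finset.induction_on with
  | empty =>
    intro e he
    rw [Finset.prod_empty, Polynomial.coeff_one, if_neg]
    rintro rfl
    simp at he
  | insert a s ha ih =>
    rw [Finset.sum_insert ha, Finset.prod_insert ha]
    exact (h a (Finset.mem_insert_self a s)).mul
      (ih fun i hi => h i (Finset.mem_insert_of_mem hi))

theorem degLE_matrix_mul {n : Type*} [Fintype n] {z z' : ℤ} {M M' : Matrix n n R[X]}
    (h : ∀ i j, DegLE z (M i j)) (h' : ∀ i j, DegLE z' (M' i j)) (i j : n) :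
    DegLE (z + z') ((M * M') i j) := by
  rw [Matrix.mul_apply]
  exact DegLE.sum _ fun l _ => (h i l).mul (h' l j)

theorem exists_degLE_matrix {n : Type*} [Finite n] (M : Matrix n n R[X]) :
    ∃ z : ℕ, ∀ i j, DegLE z (M i j) := by
  have := Fintype.ofFinite n
  refine ⟨∑ i, ∑ j, (M i j).natDegree, fun i j => degLE_of_natDegree_le ?_⟩
  norm_cast
  calc (M i j).natDegree ≤ ∑ j, (M i j).natDegree :=
        Finset.single_le_sum (f := fun j => (M i j).natDegree) (fun _ _ => Nat.zero_le _)
          (Finset.mem_univ j)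
    _ ≤ _ := Finset.single_le_sum (f := fun i => ∑ j, (M i j).natDegree)
          (fun _ _ => Nat.zero_le _) (Finset.mem_univ i)

theorem DegLE.map_pow {z : ℤ} {p : R[X]} (f : R →+* R) (h : DegLE z p) (l : ℕ) :
    DegLE z (((Polynomial.mapRingHom f) ^ l) p) := by
  induction l with
  | zero => simpa using h
  | succ l ih =>
    rw [pow_succ', RingHom.mul_def, RingHom.comp_apply]
    exact ih.map f

theorem degLE_iterProd {n : ℤ} {g : R[X]} (f : R →+* R) (h : DegLE n g) (N : ℕ) :
    DegLE (n * N) (iterProd (Polynomial.mapRingHom f) g N) := by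
  have := DegLE.prod (Finset.range N) (z := fun _ => n)
    (p := fun i => ((Polynomial.mapRingHom f) ^ i) g) fun i _ => h.map_pow f i
  rw [Finset.sum_const, Finset.card_range, nsmul_eq_mul, mul_comm] at this
  exact this

/-- If `t^(c+1)` is a combination of the iterates of a semilinear map with coefficients of degree
at most `c`, then the inverses of the iterates become arbitrarily small at infinity. -/
theorem adjugate_iterMat_degLE {n : Type*} [Fintype n] [DecidableEq n] (f : R →+* R)
    (A : Matrix n n R[X]) (m : ℕ) (hdet : DegLE m A.det) (c k : ℕ) (B : ℕ → Matrix n n R[X])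
    (hB : ∀ l i j, DegLE c (B l i j))
    (hsum : (Polynomial.X ^ (c + 1) : R[X]) • (1 : Matrix n n R[X]) =
      ∑ l ∈ Finset.range (k + 1), iterMat (Polynomial.mapRingHom f) A l * B l) (C : ℕ) :
    ∃ N₀ : ℕ, ∀ N ≥ N₀, ∀ i j,
      DegLE (m * N - C) ((iterMat (Polynomial.mapRingHom f) A N).adjugate i j) := by
  set φ := Polynomial.mapRingHom f
  set J : ℕ → Matrix n n R[X] := fun N => (iterMat φ A N).adjugate with hJ
  -- The hypothesis `hsum` multiplied by the adjugate of the `N`-th iterate. Its `l`-th term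
  -- involves only the adjugate of index `N - l`, since `J l` cancels the iterate of length `l` up
  -- to its determinant.
  have key : ∀ N, k ≤ N → (Polynomial.X ^ (c + 1) : R[X]) • J N =
      ∑ l ∈ Finset.range (k + 1),
        (iterMat φ A l).det • ((J (N - l)).map (φ ^ l) * B l) := by
    intro N hN
    have h1 : (Polynomial.X ^ (c + 1) : R[X]) • J N =
        J N * ((Polynomial.X ^ (c + 1) : R[X]) • (1 : Matrix n n R[X])) := by simp
    rw [h1, hsum, Finset.mul_sum]
    refine Finset.sum_congr rfl fun l hl => ?_
    have hl' : l ≤ N := by have := Finset.mem_range.mp hl; omega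
    have h2 : J N = (J (N - l)).map (φ ^ l) * J l := by
      have h3 := iterMat_add φ A l (N - l)
      rw [Nat.add_sub_cancel' hl'] at h3
      simp only [hJ]
      rw [h3, Matrix.adjugate_mul_distrib]
      congr 1
      exact ((φ ^ l).map_adjugate _).symm
    rw [h2, mul_assoc, ← mul_assoc (J l), Matrix.adjugate_mul]
    simp
  -- In terms of deg `J N` - m`N`, the recursion says that each value is smaller by at least one
  -- than the largest of the preceding `k` values.
  have step : ∀ (N : ℕ) (z : ℤ), k ≤ N →
      (∀ l, 1 ≤ l → l ≤ k → ∀ i j, DegLE (m * (N - l : ℕ) + z) (J (N - l) i j)) →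
      ∀ i j, DegLE (m * N + z - 1) (J N i j) := by
    intro N z hN hprev
    -- The term `l = 0` contains `J N` itself, so one application of the recursion lowers a given
    -- bound only by one. Starting from any bound, finitely many applications reach the bound
    -- imposed by the earlier terms.
    have descend : ∀ y : ℕ, (∀ i j, DegLE (m * N + z + y) (J N i j)) →
        ∀ i j, DegLE (m * N + z + y - 1) (J N i j) := by
      intro y hy i j
      have h1 : DegLE (m * N + z + y + c) ((Polynomial.X ^ (c + 1) : R[X]) * J N i j) := by
        have := congrFun (congrFun (key N hN) i) j
        rw [Matrix.smul_apply, smul_eq_mul] at this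
        rw [this, Matrix.sum_apply]
        refine DegLE.sum _ fun l hl => ?_
        have hlk : l ≤ k := by have := Finset.mem_range.mp hl; omega
        rw [Matrix.smul_apply, smul_eq_mul, det_iterMat]
        have h2 : ∀ i j, DegLE (m * (N - l : ℕ) + z + y) (((J (N - l)).map (φ ^ l)) i j) := by
          intro i j
          rw [Matrix.map_apply]
          refine DegLE.map_pow f ?_ l
          rcases Nat.eq_zero_or_pos l with rfl | hl1
          · exact hy i j
          · exact (hprev l hl1 hlk i j).mono (by omega)
        refine ((degLE_iterProd f hdet l).mul (degLE_matrix_mul h2 (hB l) i j)).mono ?_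
        have : ((N - l : ℕ) : ℤ) = N - l := by omega
        rw [this]
        exact le_of_eq (by ring)
      exact h1.of_X_pow_mul.mono (by push_cast; omega)
    obtain ⟨w, hw⟩ := exists_degLE_matrix (J N)
    have base : ∀ i j, DegLE (m * N + z + ((w + z.natAbs : ℕ) : ℤ)) (J N i j) := fun i j =>
      (hw i j).mono (by
        have h1 : (0 : ℤ) ≤ m * N := by positivity
        have h2 := neg_abs_le z
        push_cast
        linarith)
    have all : ∀ y : ℕ, (∀ i j, DegLE (m * N + z + y) (J N i j)) →
        ∀ i j, DegLE (m * N + z - 1) (J N i j) := by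
      intro y
      induction y with
      | zero => intro h; simpa using descend 0 h
      | succ y ih => intro h; exact ih fun i j => (descend _ h i j).mono (by push_cast; omega)
    exact all _ base
  -- The recursion starts at `k`; the finitely many earlier adjugates are bounded by the sum of
  -- their own bounds.
  have bound : ∃ b : ℕ, ∀ N : ℕ, ∀ i j, DegLE (m * N + b) (J N i j) := by
    choose w hw using fun N => exists_degLE_matrix (J N)
    refine ⟨∑ N ∈ Finset.range k, w N, fun N => ?_⟩
    induction N using Nat.strong_induction_on with
    | _ N ih =>
      rcases lt_or_ge N k with h | h
      · intro i j
        refine (hw N i j).mono ?_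
        have h1 : w N ≤ ∑ N ∈ Finset.range k, w N :=
          Finset.single_le_sum (f := w) (fun _ _ => Nat.zero_le _) (Finset.mem_range.mpr h)
        have : (0 : ℤ) ≤ m * N := by positivity
        push_cast at *
        zify at h1
        omega
      · intro i j
        exact (step N _ h (fun l h1 h2 => ih (N - l) (by omega)) i j).mono (by omega)
  obtain ⟨b, hb⟩ := bound
  -- Each further unit of decay costs at most `k` more indices.
  have main : ∀ C : ℕ, ∃ N₀ : ℕ, ∀ N ≥ N₀, ∀ i j, DegLE (m * N + b - C) (J N i j) := by
    intro C
    induction C with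
    | zero => exact ⟨0, fun N _ i j => by simpa using hb N i j⟩
    | succ C ih =>
      obtain ⟨N₀, h₀⟩ := ih
      refine ⟨N₀ + k, fun N hN i j => ?_⟩
      refine (step N (b - C) (by omega) (fun l h1 h2 i j => ?_) i j).mono (by push_cast; omega)
      exact (h₀ (N - l) (by omega) i j).mono (by omega)
  obtain ⟨N₀, h₀⟩ := main (C + b)
  exact ⟨N₀, fun N hN i j => (h₀ N hN i j).mono (by push_cast; omega)⟩

end Degree

end TMotive
end

open scoped Polynomial TensorProduct
noncomputable section
namespace TMotive

/-! ### Lang's theorem for vector spaces over a separably closed field. -/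

section Lang

variable (Fq : Type*) [Field Fq] [Fintype Fq]

/-- The `q`-th power map of an `𝔽_q`-algebra. -/
abbrev frobHom (R : Type*) [CommRing R] [Algebra Fq R] : R →+* R :=
  (FiniteField.frobeniusAlgHom Fq R : R →+* R)

theorem frobHom_apply (R : Type*) [CommRing R] [Algebra Fq R] (x : R) :
    frobHom Fq R x = x ^ Fintype.card Fq := by simp [frobHom]

theorem card_cast_eq_zero (R : Type*) [CommRing R] [Algebra Fq R] : (Fintype.card Fq : R) = 0 := by
  rw [← map_natCast (algebraMap Fq R), FiniteField.cast_card_eq_zero, map_zero]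

variable {L : Type*} [Field L] [Algebra Fq L]

/-- The additive polynomials solving the recursion for the coordinates of a fixed vector. -/
def fixedPoly (q : ℕ) (a : ℕ → L) : ℕ → L[X]
  | 0 => Polynomial.C (a 0) * Polynomial.X ^ q
  | i + 1 => fixedPoly q a i ^ q + Polynomial.C (a (i + 1)) * Polynomial.X ^ q

theorem natDegree_fixedPoly {q : ℕ} (hq : 1 < q) {a : ℕ → L} (ha : a 0 ≠ 0) (i : ℕ) :
    (fixedPoly q a i).natDegree = q ^ (i + 1) := by
  induction i with
  | zero => simp [fixedPoly, Polynomial.natDegree_C_mul_X_pow _ _ ha]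
  | succ i ih =>
    rw [fixedPoly, Polynomial.natDegree_add_eq_left_of_natDegree_lt, Polynomial.natDegree_pow, ih,
      pow_succ' _ (i + 1)]
    rw [Polynomial.natDegree_pow, ih]
    refine lt_of_le_of_lt (Polynomial.natDegree_C_mul_X_pow_le _ _) ?_
    have : 1 < q ^ (i + 1) := Nat.one_lt_pow (by omega) hq
    nlinarith

theorem derivative_fixedPoly {q : ℕ} (hqL : (q : L) = 0) (a : ℕ → L) (i : ℕ) :
    (fixedPoly q a i).derivative = 0 := by
  cases i <;> simp [fixedPoly, Polynomial.derivative_pow, hqL]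

theorem fixedPoly_coeff_zero {q : ℕ} (hq : 1 < q) (a : ℕ → L) (i : ℕ) :
    (fixedPoly q a i).coeff 0 = 0 := by
  have hq0 : q ≠ 0 := by omega
  induction i with
  | zero => simp [fixedPoly, Polynomial.coeff_zero_eq_eval_zero, hq0]
  | succ i ih =>
    rw [Polynomial.coeff_zero_eq_eval_zero] at *
    simp [fixedPoly, ih, hq0]

/-- Since q = 0 in `L`, the polynomial `fixedPoly q a i - X` has derivative -1 and is separable. It
is divisible by X; a root of the quotient cannot be 0, because the constant coefficient of the
quotient is the coefficient -1 of X. -/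
theorem exists_ne_zero_eval_fixedPoly_eq [IsSepClosed L] {q : ℕ} (hq : 1 < q) (hqL : (q : L) = 0)
    {a : ℕ → L} (ha : a 0 ≠ 0) (i : ℕ) : ∃ x ≠ 0, (fixedPoly q a i).eval x = x := by
  set P := fixedPoly q a i - Polynomial.X with hP
  have hder : P.derivative = -1 := by simp [hP, derivative_fixedPoly hqL]
  have hsep : P.Separable := by
    rw [Polynomial.separable_def, hder]
    exact ⟨0, -1, by simp⟩
  have hdeg : P.natDegree = q ^ (i + 1) := by
    rw [hP, Polynomial.natDegree_sub_eq_left_of_natDegree_lt, natDegree_fixedPoly hq ha]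
    rw [natDegree_fixedPoly hq ha, Polynomial.natDegree_X]
    exact Nat.one_lt_pow (by omega) hq
  have h0 : P.coeff 0 = 0 := by simp [hP, fixedPoly_coeff_zero hq]
  have hfac : P.divX * Polynomial.X = P := by
    conv_rhs => rw [← P.divX_mul_X_add, h0]
    simp
  have hsep' : P.divX.Separable := hsep.of_dvd ⟨_, hfac.symm⟩
  have hdeg' : P.divX.degree ≠ 0 := by
    intro h
    have h2 := Polynomial.natDegree_eq_of_degree_eq_some h
    rw [Polynomial.natDegree_divX_eq_natDegree_tsub_one, hdeg] at h2
    have h3 : 1 < q ^ (i + 1) := Nat.one_lt_pow (by omega) hq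
    change _ = 0 at h2
    omega
  obtain ⟨x, hx⟩ := IsSepClosed.exists_root P.divX hdeg' hsep'
  refine ⟨x, ?_, ?_⟩
  · rintro rfl
    rw [Polynomial.IsRoot.def, ← Polynomial.coeff_zero_eq_eval_zero, Polynomial.coeff_divX] at hx
    have h1 := congrArg (fun p => Polynomial.coeff p 0) hder
    simp only [Polynomial.coeff_derivative] at h1
    rw [hx] at h1
    simp at h1
  · have : P.eval x = 0 := by rw [← hfac, Polynomial.eval_mul, hx.eq_zero, zero_mul]
    rw [hP, Polynomial.eval_sub, Polynomial.eval_X] at this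
    exact sub_eq_zero.mp this

/-- Artin–Schreier equations are separable: the derivative is -1. -/
theorem exists_pow_card_sub_eq [IsSepClosed L] (b : L) :
    ∃ x : L, x ^ Fintype.card Fq - x = b := by
  set q := Fintype.card Fq
  have hq : 1 < q := Fintype.one_lt_card
  have hqL : (q : L) = 0 := card_cast_eq_zero Fq L
  set P : L[X] := Polynomial.X ^ q - Polynomial.X - Polynomial.C b with hP
  have hder : P.derivative = -1 := by simp [hP, Polynomial.derivative_pow, hqL]
  have hsep : P.Separable := by
    rw [Polynomial.separable_def, hder]
    exact ⟨0, -1, by simp⟩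
  have hdeg : P.natDegree = q := by
    rw [hP, sub_sub, Polynomial.natDegree_sub_eq_left_of_natDegree_lt] <;>
      simp [hq]
  obtain ⟨x, hx⟩ := IsSepClosed.exists_root P (fun h => by
    have h2 : P.natDegree = 0 := Polynomial.natDegree_eq_of_degree_eq_some h
    omega) hsep
  refine ⟨x, ?_⟩
  simp only [hP, Polynomial.IsRoot.def, Polynomial.eval_sub, Polynomial.eval_pow,
    Polynomial.eval_X, Polynomial.eval_C] at hx
  exact sub_eq_zero.mp hx

variable {V : Type*} [AddCommGroup V] [Module L V] [FiniteDimensional L V]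

variable {Fq}

/-- Extend the family to a basis. The images of the basis span the span of the range of `τ`, which
is everything, so by counting they form a basis again. -/
theorem linearIndependent_semilinear_comp (τ : V →ₛₗ[frobHom Fq L] V)
    (hτ : Submodule.span L (Set.range τ) = ⊤) {ι : Type*} {v : ι → V}
    (hv : LinearIndependent L v) : LinearIndependent L (fun i => τ (v i)) := by
  set b := Module.Basis.extend hv.linearIndepOn_id with hbdef
  have := Module.Finite.finite_basis b
  have := Fintype.ofFinite (hv.linearIndepOn_id.extend (Set.subset_univ _))
  have hspan : ⊤ ≤ Submodule.span L (Set.range fun i => τ (b i)) := by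
    rw [← hτ, Submodule.span_le]
    rintro _ ⟨x, rfl⟩
    rw [← b.sum_repr x, map_sum]
    refine Submodule.sum_mem _ fun i _ => ?_
    rw [map_smulₛₗ]
    exact Submodule.smul_mem _ _ (Submodule.subset_span ⟨i, rfl⟩)
  have hli := linearIndependent_of_top_le_span_of_card_eq_finrank hspan
    (Module.finrank_eq_card_basis b).symm
  have hmem : ∀ i, v i ∈ hv.linearIndepOn_id.extend (Set.subset_univ _) := fun i =>
    hv.linearIndepOn_id.subset_extend (Set.subset_univ _) ⟨i, rfl⟩
  have h2 := hli.comp (fun i : ι => (⟨v i, hmem i⟩ : hv.linearIndepOn_id.extend _))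
    (fun i j hij => hv.injective (by simpa using hij))
  have h3 : ∀ i : ι, b ⟨v i, hmem i⟩ = v i := fun i => by
    simp [hbdef, Module.Basis.extend_apply_self]
  simpa [Function.comp_def, h3] using h2

/-- Take the first linear relation τ^(k+1) v = ∑ a_i τ^i v. A vector ∑ c_i τ^i v is fixed when c_0 =
a_0 x^q and c_i = c_(i-1)^q + a_i x^q with x = c_k. Eliminating c_0, …, c_(k-1) leaves the single
equation solved by `exists_ne_zero_eval_fixedPoly_eq`. -/
theorem exists_ne_zero_fixed [IsSepClosed L] (τ : V →ₛₗ[frobHom Fq L] V)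
    (hτ : Submodule.span L (Set.range τ) = ⊤) [Nontrivial V] : ∃ w ≠ 0, τ w = w := by
  classical
  obtain ⟨v, hv⟩ := exists_ne (0 : V)
  have hex : ∃ k, ¬ LinearIndependent L (fun i : Fin (k + 1) => τ^[i] v) := by
    refine ⟨Module.finrank L V, fun h => ?_⟩
    have := h.fintype_card_le_finrank
    simp at this
  obtain ⟨k, hk1, hk2⟩ : ∃ k, LinearIndependent L (fun i : Fin (k + 1) => τ^[i] v) ∧
      ¬ LinearIndependent L (fun i : Fin (k + 2) => τ^[i] v) := by
    have hpos : Nat.find hex ≠ 0 := by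
      intro h0
      have := Nat.find_spec hex
      rw [h0] at this
      apply this
      simpa [linearIndependent_unique_iff] using hv
    obtain ⟨k, hk⟩ := Nat.exists_eq_succ_of_ne_zero hpos
    refine ⟨k, ?_, ?_⟩
    · have := Nat.find_min hex (m := k) (by omega)
      simpa using this
    · have := Nat.find_spec hex
      rw [hk] at this
      exact this
  have hmem : τ^[k + 1] v ∈ Submodule.span L (Set.range fun i : Fin (k + 1) => τ^[i] v) := by
    by_contra hc
    apply hk2
    rw [linearIndependent_finSucc']
    exact ⟨hk1, hc⟩
  obtain ⟨a', ha'⟩ := (Submodule.mem_span_range_iff_exists_fun L).mp hmem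
  set a : ℕ → L := fun i => if h : i < k + 1 then a' ⟨i, h⟩ else 0
  have ha : ∑ i ∈ Finset.range (k + 1), a i • τ^[i] v = τ^[k + 1] v := by
    rw [Finset.sum_range, ← ha']
    exact Finset.sum_congr rfl fun i _ => by simp only [a, dif_pos i.2]
  -- Otherwise τ^(k+1) v would depend on τ v, …, τ^k v, although `τ` preserves the independence of
  -- v, …, τ^k v.
  have ha0 : a 0 ≠ 0 := by
    intro h0
    have hli := linearIndependent_semilinear_comp τ hτ hk1
    have hlast : τ^[k + 1] v ∈
        Submodule.span L ((fun i : Fin (k + 1) => τ (τ^[i] v)) '' {i | i ≠ Fin.last k}) := by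
      rw [← ha, Finset.sum_range_succ', h0, zero_smul, add_zero]
      refine Submodule.sum_mem _ fun i hi => Submodule.smul_mem _ _ (Submodule.subset_span ?_)
      have hi' := Finset.mem_range.mp hi
      refine ⟨⟨i, by omega⟩, ?_, ?_⟩
      · simpa [Fin.ext_iff] using hi'.ne
      · simp only [Function.iterate_succ_apply']
    refine hli.notMem_span_image (s := {i | i ≠ Fin.last k}) (x := Fin.last k) (by simp) ?_
    simpa only [Fin.val_last, Function.iterate_succ_apply'] using hlast
  set q := Fintype.card Fq with hqdef
  obtain ⟨x, hx0, hx⟩ := exists_ne_zero_eval_fixedPoly_eq (q := q) Fintype.one_lt_card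
    (card_cast_eq_zero Fq L) ha0 k
  set c : ℕ → L := fun i => (fixedPoly q a i).eval x
  have hc0 : c 0 = a 0 * x ^ q := by simp [c, fixedPoly]
  have hcs : ∀ i, c (i + 1) = c i ^ q + a (i + 1) * x ^ q := fun i => by simp [c, fixedPoly]
  refine ⟨∑ i ∈ Finset.range (k + 1), c i • τ^[i] v, ?_, ?_⟩
  · intro h
    rw [Finset.sum_range] at h
    have := linearIndependent_iff'.mp hk1 Finset.univ (fun i => c i) h (Fin.last k)
      (Finset.mem_univ _)
    exact hx0 (hx.symm.trans this)
  · have h1 : τ (∑ i ∈ Finset.range (k + 1), c i • τ^[i] v) =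
        ∑ i ∈ Finset.range k, c i ^ q • τ^[i + 1] v + x ^ q • τ^[k + 1] v := by
      rw [map_sum, Finset.sum_range_succ]
      have hck : c k = x := hx
      simp only [map_smulₛₗ, frobHom_apply, ← Function.iterate_succ_apply' τ, hck]
      rfl
    rw [h1, ← ha, Finset.smul_sum, Finset.sum_range_succ' (fun i => x ^ q • a i • τ^[i] v),
      Finset.sum_range_succ' (fun i => c i • τ^[i] v), ← add_assoc, ← Finset.sum_add_distrib, hc0]
    congr 1
    · refine Finset.sum_congr rfl fun i _ => ?_
      rw [hcs, smul_smul, ← add_smul, mul_comm]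
    · rw [smul_smul, mul_comm]

/-- Lang's theorem: over a separably closed field, a vector space with an étale `q`-semilinear
endomorphism is spanned by its fixed vectors. -/
theorem span_fixed_eq_top [IsSepClosed L] (τ : V →ₛₗ[frobHom Fq L] V)
    (hτ : Submodule.span L (Set.range τ) = ⊤) : Submodule.span L {v | τ v = v} = ⊤ := by
  by_contra hne
  set U := Submodule.span L {v | τ v = v} with hU
  have hUτ : U ≤ U.comap τ := by
    rw [hU, Submodule.span_le]
    intro v hv
    have hv' : τ v = v := hv
    simp only [Submodule.comap_coe, Set.mem_preimage, SetLike.mem_coe, hv']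
    exact Submodule.subset_span hv
  set τ' : (V ⧸ U) →ₛₗ[frobHom Fq L] (V ⧸ U) := U.mapQ U τ hUτ
  have : Nontrivial (V ⧸ U) := Submodule.Quotient.nontrivial_iff.mpr hne
  have hτ' : Submodule.span L (Set.range τ') = ⊤ := by
    have h1 : Set.range τ' = U.mkQ '' Set.range τ := by
      ext y
      constructor
      · rintro ⟨x, rfl⟩
        obtain ⟨x, rfl⟩ := U.mkQ_surjective x
        exact ⟨τ x, ⟨x, rfl⟩, rfl⟩
      · rintro ⟨_, ⟨x, rfl⟩, rfl⟩
        exact ⟨U.mkQ x, rfl⟩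
    rw [h1, Submodule.span_image, hτ, Submodule.map_top, Submodule.range_mkQ]
  -- A fixed vector of the quotient lifts to `u` with `τ u - u` in `U`. If τ - 1 is onto `U`, then
  -- `u` can be corrected within `U` to a fixed vector; so `u` lies in `U`, against the choice of
  -- `w`.
  obtain ⟨w, hw0, hw⟩ := exists_ne_zero_fixed τ' hτ'
  obtain ⟨u, rfl⟩ := U.mkQ_surjective w
  have hu : τ u - u ∈ U := by
    have : U.mkQ (τ u) = U.mkQ u := hw
    exact (Submodule.Quotient.eq U).mp this
  have hsol : ∀ y ∈ U, ∃ z ∈ U, τ z - z = y := by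
    intro y hy
    induction hy using Submodule.span_induction with
    | zero => exact ⟨0, U.zero_mem, by simp⟩
    | add y y' _ _ h h' =>
      obtain ⟨z, hz, rfl⟩ := h
      obtain ⟨z', hz', rfl⟩ := h'
      exact ⟨z + z', U.add_mem hz hz', by rw [map_add]; abel⟩
    | mem v hv =>
      obtain ⟨x, hx⟩ := exists_pow_card_sub_eq Fq (1 : L)
      refine ⟨x • v, U.smul_mem _ (Submodule.subset_span hv), ?_⟩
      have hv' : τ v = v := hv
      rw [map_smulₛₗ, frobHom_apply, hv', ← sub_smul, hx, one_smul]
    | smul b y hy h =>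
      -- Solvability for `y` says nothing about its multiples, so a second induction treats all
      -- multiples of `y` simultaneously.
      clear h
      revert b
      induction hy using Submodule.span_induction with
      | zero => intro b; exact ⟨0, U.zero_mem, by simp⟩
      | add y y' _ _ h h' =>
        intro b
        obtain ⟨z, hz, h⟩ := h b
        obtain ⟨z', hz', h'⟩ := h' b
        exact ⟨z + z', U.add_mem hz hz', by rw [map_add, smul_add, ← h, ← h']; abel⟩
      | mem v hv =>
        intro b
        obtain ⟨x, hx⟩ := exists_pow_card_sub_eq Fq b
        refine ⟨x • v, U.smul_mem _ (Submodule.subset_span hv), ?_⟩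
        have hv' : τ v = v := hv
        rw [map_smulₛₗ, frobHom_apply, hv', ← sub_smul, hx]
      | smul b' y _ h =>
        intro b
        rw [smul_smul]
        exact h _
  obtain ⟨z, hz, hzu⟩ := hsol _ hu
  have hfix : u - z ∈ U := Submodule.subset_span (by
    change τ (u - z) = u - z
    rw [map_sub]
    have := hzu
    rw [sub_eq_sub_iff_add_eq_add] at this ⊢
    rw [add_comm u, this.symm])
  apply hw0
  have : u ∈ U := by simpa using U.add_mem hfix hz
  simpa using this

end Lang

end TMotive
end

open scoped Polynomial TensorProduct
noncomputable section
namespace TMotive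

/-! ### Lang's theorem modulo powers of a prime of 𝔽_q[t]. -/

section LangPolynomial

variable {Fq : Type*} [Field Fq] [Fintype Fq]

/-- In a domain X^q - X has at most q roots, and the q elements of `Fq` already are roots. -/
theorem exists_algebraMap_eq_of_pow_card_eq {R : Type*} [CommRing R] [IsDomain R] [Algebra Fq R]
    {x : R} (hx : x ^ Fintype.card Fq = x) : ∃ a : Fq, algebraMap Fq R a = x := by
  classical
  have hq : 1 < Fintype.card Fq := Fintype.one_lt_card
  obtain ⟨P, hP⟩ : ∃ P : R[X], P = Polynomial.X ^ Fintype.card Fq - Polynomial.X := ⟨_, rfl⟩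
  have hdeg : P.natDegree = Fintype.card Fq := by
    rw [hP, Polynomial.natDegree_sub_eq_left_of_natDegree_lt] <;> simp [hq]
  have hP0 : P ≠ 0 := by
    rintro rfl
    simp at hdeg
    omega
  have hroot : ∀ y : R, y ∈ P.roots.toFinset ↔ y ^ Fintype.card Fq = y := by
    intro y
    rw [Multiset.mem_toFinset, Polynomial.mem_roots hP0, hP, Polynomial.IsRoot.def,
      Polynomial.eval_sub, Polynomial.eval_pow, Polynomial.eval_X, sub_eq_zero]
  have hsub : Finset.univ.image (algebraMap Fq R) ⊆ P.roots.toFinset := by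
    intro y hy
    obtain ⟨a, -, rfl⟩ := Finset.mem_image.mp hy
    rw [hroot, ← map_pow, FiniteField.pow_card]
  have hcard : P.roots.toFinset.card ≤ (Finset.univ.image (algebraMap Fq R)).card := by
    rw [Finset.card_image_of_injective _ (algebraMap Fq R).injective, Finset.card_univ, ← hdeg]
    exact (Multiset.toFinset_card_le _).trans (Polynomial.card_roots' P)
  have heq := Finset.eq_of_subset_of_card_le hsub hcard
  have hxm := (hroot x).mpr hx
  rw [← heq] at hxm
  obtain ⟨a, -, ha⟩ := Finset.mem_image.mp hxm
  exact ⟨a, ha⟩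

variable {L : Type*} [Field L] [Algebra Fq L]

/-- Fixed vectors of a `q`-semilinear map which are independent over `𝔽_q` are independent. -/
theorem linearIndependent_of_fixed {V : Type*} [AddCommGroup V] [Module L V] [Module Fq V]
    [IsScalarTower Fq L V] (τ : V →ₛₗ[frobHom Fq L] V) {ι : Type*} {v : ι → V}
    (hfix : ∀ i, τ (v i) = v i) (hv : LinearIndependent Fq v) : LinearIndependent L v := by
  classical
  rw [linearIndependent_iff']
  intro s
  induction s using Finset.induction_on with
  | empty => intro g _ i hi; simp at hi
  | insert a s ha ih =>
    intro g hg
    have hga : g a = 0 := by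
      by_contra hne
      set h : ι → L := fun i => (g a)⁻¹ * g i with hh
      have hsum : ∑ i ∈ s, h i • v i = - v a := by
        rw [Finset.sum_insert ha] at hg
        have h2 := congrArg (fun y => (g a)⁻¹ • y) hg
        simp only [smul_add, smul_smul, inv_mul_cancel₀ hne, one_smul, smul_zero,
          Finset.smul_sum] at h2
        rw [eq_neg_iff_add_eq_zero, add_comm]
        exact h2
      have hsum' : ∑ i ∈ s, (h i ^ Fintype.card Fq) • v i = - v a := by
        have h2 := congrArg τ hsum
        rw [map_sum, map_neg, hfix] at h2
        rw [← h2]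
        refine Finset.sum_congr rfl fun i _ => ?_
        rw [map_smulₛₗ, hfix, frobHom_apply]
      -- Subtracting the normalised relation from its image under `τ` removes the vector `a`; by
      -- induction all coefficients are fixed by Frobenius, hence lie in `Fq`.
      have hfrob : ∀ i ∈ s, ∃ b : Fq, algebraMap Fq L b = h i := by
        intro i hi
        apply exists_algebraMap_eq_of_pow_card_eq
        have := ih (fun i => h i ^ Fintype.card Fq - h i) (by
          simp only [sub_smul, Finset.sum_sub_distrib, hsum, hsum', sub_self]) i hi
        exact sub_eq_zero.mp this
      choose! b hb using hfrob
      have := linearIndependent_iff'.mp hv (insert a s) (fun i => if i = a then 1 else b i) (by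
        rw [Finset.sum_insert ha]
        simp only [if_true, one_smul]
        have : ∑ i ∈ s, (if i = a then (1 : Fq) else b i) • v i = ∑ i ∈ s, h i • v i := by
          refine Finset.sum_congr rfl fun i hi => ?_
          rw [if_neg (by rintro rfl; exact ha hi), ← hb i hi, algebraMap_smul]
        rw [this, hsum, add_neg_cancel]) a (Finset.mem_insert_self a s)
      simp at this
    intro i hi
    rcases Finset.mem_insert.mp hi with rfl | hi
    · exact hga
    · refine ih g ?_ i hi
      rw [Finset.sum_insert ha, hga, zero_smul, zero_add] at hg
      exact hg

theorem dvd_det_sub_det {S n : Type*} [CommRing S] [Fintype n] [DecidableEq n] {a : S}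
    {M M' : Matrix n n S} (h : ∀ i j, a ∣ (M - M') i j) : a ∣ M.det - M'.det := by
  rw [← Ideal.mem_span_singleton, ← Ideal.Quotient.eq, RingHom.map_det, RingHom.map_det]
  congr 1
  ext i j
  rw [RingHom.mapMatrix_apply, RingHom.mapMatrix_apply, Matrix.map_apply, Matrix.map_apply,
    Ideal.Quotient.eq, Ideal.mem_span_singleton]
  exact h i j

theorem coeffFrob_map_algebraMap (p : Fq[X]) :
    coeffFrob Fq L (p.map (algebraMap Fq L)) = p.map (algebraMap Fq L) := by
  rw [coeffFrob, Polynomial.coe_mapRingHom, Polynomial.map_map]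
  congr 1
  ext x
  simp

variable {n : Type*} [Fintype n] [DecidableEq n]

/-- Lang's theorem over a finite algebra `W` over a separably closed field `L` which is
generated by a finite field `κ` of constants of the semilinear endomorphism `φ`. -/
theorem exists_eq_mul_map_of_constants [IsSepClosed L] {W κ : Type*} [CommRing W] [Field κ]
    [Algebra L W] [Algebra κ W] [Algebra Fq κ] [Algebra Fq W] [IsScalarTower Fq κ W]
    [IsScalarTower Fq L W] [FiniteDimensional L W] [FiniteDimensional Fq κ]
    (hdim : Module.finrank L W ≤ Module.finrank Fq κ) (φ : W →+* W)
    (hφL : ∀ c : L, φ (algebraMap L W c) = algebraMap L W (c ^ Fintype.card Fq))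
    (hφκ : ∀ c : κ, φ (algebraMap κ W c) = algebraMap κ W c)
    (hκ : Submodule.span L (Set.range (algebraMap κ W)) = ⊤)
    {A A' : Matrix n n W} (hA : A * A' = 1) :
    ∃ X X' : Matrix n n W, X * X' = 1 ∧ X = A * X.map φ := by
  -- `W` is not assumed to be a field, so the system x = A φ(x) is read as a semilinear map of the
  -- `L`-vector space of vectors over `W`.
  let τ : (n → W) →ₛₗ[frobHom Fq L] (n → W) :=
    { toFun := fun x => A.mulVec (fun i => φ (x i))
      map_add' := fun x y => by
        rw [← Matrix.mulVec_add]
        congr 1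
        ext i
        simp
      map_smul' := fun c x => by
        rw [← Matrix.mulVec_smul]
        congr 1
        ext i
        simp only [Pi.smul_apply, Algebra.smul_def, map_mul, hφL, frobHom_apply] }
  have hτ : ∀ x, τ x = A.mulVec (fun i => φ (x i)) := fun _ => rfl
  have hspan : Submodule.span L (Set.range τ) = ⊤ := by
    have hsingle : ∀ (i : n) (w : W),
        A.mulVec (Pi.single i w) ∈ Submodule.span L (Set.range τ) := by
      intro i w
      have hw : w ∈ Submodule.span L (Set.range (algebraMap κ W)) := by rw [hκ]; trivial
      induction hw using Submodule.span_induction with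
      | zero => rw [Pi.single_zero, Matrix.mulVec_zero]; exact Submodule.zero_mem _
      | add p p' _ _ h h' =>
        rw [Pi.single_add, Matrix.mulVec_add]
        exact Submodule.add_mem _ h h'
      | smul a p _ h =>
        rw [Pi.single_smul, Matrix.mulVec_smul]
        exact Submodule.smul_mem _ _ h
      | mem p hp =>
        obtain ⟨c, rfl⟩ := hp
        refine Submodule.subset_span ⟨Pi.single i (algebraMap κ W c), ?_⟩
        rw [hτ]
        congr 1
        ext j
        by_cases hj : j = i
        · subst hj
          rw [Pi.single_eq_same, hφκ]
        · rw [Pi.single_eq_of_ne hj, map_zero]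
    rw [eq_top_iff]
    rintro y -
    have h1 : y = A.mulVec (A'.mulVec y) := by
      rw [Matrix.mulVec_mulVec, hA, Matrix.one_mulVec]
    rw [h1, ← Finset.univ_sum_single (A'.mulVec y), Matrix.mulVec_sum]
    exact Submodule.sum_mem _ fun i _ => hsingle i _
  have hfix := span_fixed_eq_top τ hspan
  let T₀ : Submodule κ (n → W) :=
    { carrier := {x | τ x = x}
      add_mem' := fun {x y} hx hy => by
        change τ (x + y) = x + y
        rw [map_add, (hx : τ x = x), (hy : τ y = y)]
      zero_mem' := map_zero τ
      smul_mem' := fun c x hx => by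
        change τ (c • x) = c • x
        conv_rhs => rw [← (hx : τ x = x)]
        rw [hτ, hτ]
        have : (fun i => φ ((c • x) i)) = algebraMap κ W c • fun i => φ (x i) := by
          ext i
          rw [Pi.smul_apply, Pi.smul_apply, Algebra.smul_def, map_mul, hφκ, smul_eq_mul]
        rw [this, Matrix.mulVec_smul]
        ext i
        rw [Pi.smul_apply, Pi.smul_apply, smul_eq_mul, ← Algebra.smul_def] }
  -- Fixed vectors independent over `Fq` stay independent over `L`, which bounds dim T₀ over `Fq` by
  -- the `L`-dimension of the ambient space. Dividing by the degree of κ gives at most `n`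
  -- generators over κ.
  have hrankle : Module.rank Fq T₀ ≤
      ((Fintype.card n * Module.finrank Fq κ : ℕ) : Cardinal) := by
    apply rank_le
    intro s hs
    have h1 : LinearIndependent Fq (fun i : s => ((i : T₀) : n → W)) :=
      hs.map' (T₀.subtype.restrictScalars Fq) (LinearMap.ker_eq_bot.mpr Subtype.val_injective)
    have h2 := linearIndependent_of_fixed τ (fun i : s => (i : T₀).2) h1
    have h3 := h2.fintype_card_le_finrank
    rw [Module.finrank_pi_fintype, Finset.sum_const, Finset.card_univ, smul_eq_mul,
      Fintype.card_coe] at h3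
    exact h3.trans (Nat.mul_le_mul_left _ hdim)
  have : FiniteDimensional Fq T₀ := by
    rw [FiniteDimensional, ← Module.rank_lt_aleph0_iff]
    exact hrankle.trans_lt (Cardinal.natCast_lt_aleph0)
  have : FiniteDimensional κ T₀ := Module.Finite.right Fq κ T₀
  have hle : Module.finrank κ T₀ ≤ Fintype.card n := by
    have h1 : Module.finrank Fq T₀ ≤ Fintype.card n * Module.finrank Fq κ :=
      Module.finrank_le_of_rank_le hrankle
    rw [← Module.finrank_mul_finrank Fq κ T₀, mul_comm] at h1
    exact Nat.le_of_mul_le_mul_right h1 Module.finrank_pos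
  obtain ⟨x, hxT, hxspan⟩ : ∃ x : n → (n → W), (∀ j, τ (x j) = x j) ∧
      ∀ y, τ y = y → ∃ c : n → κ, y = ∑ j, c j • x j := by
    let b := Module.finBasis κ T₀
    let e : Fin (Module.finrank κ T₀) → n := fun i =>
      (Fintype.equivFin n).symm (Fin.castLE hle i)
    have he : Function.Injective e :=
      (Fintype.equivFin n).symm.injective.comp (Fin.castLE_injective hle)
    -- If a κ-basis of `T₀` has fewer than `n` elements, the missing columns are filled with zeros;
    -- only generation matters.
    refine ⟨Function.extend e (fun i => (b i : n → W)) 0, fun j => ?_, fun y hy => ?_⟩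
    · by_cases hj : ∃ i, e i = j
      · obtain ⟨i, rfl⟩ := hj
        rw [he.extend_apply]
        exact (b i).2
      · rw [Function.extend_apply' _ _ _ hj]
        exact map_zero τ
    · refine ⟨Function.extend e (b.repr ⟨y, hy⟩) 0, ?_⟩
      have h1 : y = ∑ i, (b.repr ⟨y, hy⟩) i • (b i : n → W) := by
        have := congrArg (T₀.subtype) (b.sum_repr ⟨y, hy⟩)
        rw [map_sum] at this
        exact this.symm
      have h2 : ∑ j, Function.extend e (b.repr ⟨y, hy⟩) 0 j •
          Function.extend e (fun i => (b i : n → W)) 0 j =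
          ∑ i, (b.repr ⟨y, hy⟩) i • (b i : n → W) := by
        rw [← Finset.sum_subset (Finset.subset_univ (Finset.univ.map ⟨e, he⟩)), Finset.sum_map]
        · refine Finset.sum_congr rfl fun i _ => ?_
          simp only [Function.Embedding.coeFn_mk, he.extend_apply]
        · intro j _ hj
          rw [Function.extend_apply' _ _ _ (by simpa using hj)]
          simp
      rw [h2]
      exact h1
  have hall : ∀ y : n → W, ∃ c : n → W, y = ∑ j, c j • x j := by
    intro y
    have hy : y ∈ Submodule.span L {v | τ v = v} := by rw [hfix]; trivial
    induction hy using Submodule.span_induction with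
    | zero => exact ⟨0, by simp⟩
    | add y y' _ _ h h' =>
      obtain ⟨c, rfl⟩ := h
      obtain ⟨c', rfl⟩ := h'
      exact ⟨c + c', by simp [add_smul, Finset.sum_add_distrib]⟩
    | smul a y _ h =>
      obtain ⟨c, rfl⟩ := h
      refine ⟨fun j => a • c j, ?_⟩
      rw [Finset.smul_sum]
      exact Finset.sum_congr rfl fun j _ => (smul_assoc _ _ _).symm
    | mem y hy =>
      obtain ⟨c, rfl⟩ := hxspan y hy
      refine ⟨fun j => algebraMap κ W (c j), Finset.sum_congr rfl fun j _ => ?_⟩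
      ext i
      rw [Pi.smul_apply, Pi.smul_apply, Algebra.smul_def, smul_eq_mul]
  -- The columns generate all vectors over `W`; writing the unit vectors in terms of them produces a
  -- right inverse of the matrix of columns.
  choose c hc using fun k : n => hall (Pi.single k 1)
  refine ⟨Matrix.of fun i j => x j i, Matrix.of fun j k => c k j, ?_, ?_⟩
  · ext i k
    rw [Matrix.mul_apply, Matrix.one_apply]
    have := congrFun (hc k) i
    rw [Finset.sum_apply, Pi.single_apply] at this
    rw [this]
    exact Finset.sum_congr rfl fun j _ => mul_comm _ _
  · ext i j
    have h2 := congrFun (hxT j) i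
    rw [hτ] at h2
    rw [Matrix.of_apply, ← h2]
    rfl

/-- Here `W` plays the role of L[t]/l and κ that of 𝔽_q[t]/l, known only through their reduction
maps. The powers of t come from κ, so κ spans `W` over `L`; solutions over `W` are lifted to
polynomials. -/
theorem exists_lang_matrix_of_quotient [IsSepClosed L] {W κ : Type*} [CommRing W] [Field κ]
    [Algebra L W] [Algebra κ W] [Algebra Fq κ] [Algebra Fq W] [IsScalarTower Fq κ W]
    [IsScalarTower Fq L W] [FiniteDimensional L W] [FiniteDimensional Fq κ]
    (hdim : Module.finrank L W ≤ Module.finrank Fq κ) (φ : W →+* W)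
    (mk : L[X] →+* W) (hmk : Function.Surjective mk) (mkκ : Fq[X] →+* κ)
    (hmkκ : Function.Surjective mkκ) (hmkC : ∀ c, mk (Polynomial.C c) = algebraMap L W c)
    (hmap : ∀ p, algebraMap κ W (mkκ p) = mk (p.map (algebraMap Fq L)))
    (hφ : ∀ p, φ (mk p) = mk (coeffFrob Fq L p)) {lL : L[X]} (hker : ∀ p, mk p = 0 ↔ lL ∣ p)
    {A : Matrix n n L[X]} (hA : IsCoprime A.det lL) :
    ∃ X : Matrix n n L[X], IsCoprime X.det lL ∧
      ∀ i j, lL ∣ (X - A * X.map (coeffFrob Fq L)) i j := by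
  obtain ⟨u, w, huw⟩ := hA
  have hAinv : (A.map mk) * (mk u • (A.map mk).adjugate) = 1 := by
    have h1 : (A.map mk).det = mk A.det := (RingHom.map_det mk A).symm
    have h3 : mk u * mk A.det = 1 := by
      rw [← map_mul, ← map_one mk, ← huw, map_add, map_mul mk w, (hker lL).mpr dvd_rfl, mul_zero,
        add_zero]
    rw [Matrix.mul_smul, Matrix.mul_adjugate, smul_smul, h1, h3, one_smul]
  obtain ⟨Xb, Xb', hXX', hXb⟩ := exists_eq_mul_map_of_constants (Fq := Fq) (L := L)
    (κ := κ) hdim φ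
    (fun c => by
      rw [← hmkC, ← hmkC, hφ]
      congr 1
      simp [coeffFrob])
    (fun c => by
      obtain ⟨p, rfl⟩ := hmkκ c
      rw [hmap, hφ, coeffFrob_map_algebraMap])
    (by
      rw [eq_top_iff]
      rintro w -
      obtain ⟨p, rfl⟩ := hmk w
      induction p using Polynomial.induction_on' with
      | add p p' h h' => rw [map_add]; exact Submodule.add_mem _ h h'
      | monomial k a =>
        have h1 : mk (Polynomial.monomial k a) = a • algebraMap κ W (mkκ (Polynomial.X ^ k)) := by
          rw [hmap, Polynomial.map_pow, Polynomial.map_X, ← Polynomial.C_mul_X_pow_eq_monomial,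
            map_mul, hmkC, Algebra.smul_def]
        rw [h1]
        exact Submodule.smul_mem _ _ (Submodule.subset_span ⟨_, rfl⟩))
    hAinv
  choose X hX using fun i j => hmk (Xb i j)
  have hXm : (Matrix.of X).map mk = Xb := by
    ext i j
    exact hX i j
  refine ⟨Matrix.of X, ?_, fun i j => ?_⟩
  · have h1 : mk (Matrix.of X).det * Xb'.det = 1 := by
      have : mk (Matrix.of X).det = Xb.det := by
        rw [RingHom.map_det, RingHom.mapMatrix_apply, hXm]
      rw [this, ← Matrix.det_mul, hXX', Matrix.det_one]
    obtain ⟨d, hd⟩ := hmk Xb'.det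
    rw [← hd, ← map_mul, ← sub_eq_zero, ← map_one mk, ← map_sub, hker] at h1
    obtain ⟨e, he⟩ := h1
    exact ⟨d, -e, by linear_combination he⟩
  · rw [← hker, Matrix.sub_apply, map_sub, sub_eq_zero]
    have h1 : mk ((A * (Matrix.of X).map (coeffFrob Fq L)) i j) = (A.map mk * Xb.map φ) i j := by
      rw [← hXm, Matrix.map_map, Matrix.mul_apply, Matrix.mul_apply, map_sum]
      exact Finset.sum_congr rfl fun k _ => by
        rw [map_mul, Matrix.map_apply, Matrix.map_apply, Matrix.map_apply, Function.comp_apply, hφ]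
    rw [h1, ← hXb]
    exact hX i j

/-- The degree of `l` is both the dimension of L[t]/l over `L` and the degree of the field 𝔽_q[t]/l
over `Fq`. Irreducibility of `l` enters through this field; the image of `l` over `L` may well
factor. -/
theorem exists_lang_matrix [IsSepClosed L] {l : Fq[X]} (hl : Irreducible l)
    {A : Matrix n n L[X]} (hA : IsCoprime A.det (l.map (algebraMap Fq L))) :
    ∃ X : Matrix n n L[X], IsCoprime X.det (l.map (algebraMap Fq L)) ∧
      ∀ i j, l.map (algebraMap Fq L) ∣ (X - A * X.map (coeffFrob Fq L)) i j := by
  have hfact : Fact (Irreducible l) := ⟨hl⟩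
  have hl0 : l.map (algebraMap Fq L) ≠ 0 := by
    rw [Polynomial.map_ne_zero_iff (algebraMap Fq L).injective]
    exact hl.ne_zero
  let f : AdjoinRoot l →+* AdjoinRoot (l.map (algebraMap Fq L)) :=
    AdjoinRoot.map (algebraMap Fq L) l _ dvd_rfl
  have hf : ∀ p, f (AdjoinRoot.mk l p) = AdjoinRoot.mk _ (p.map (algebraMap Fq L)) := by
    intro p
    simp only [f, AdjoinRoot.map, AdjoinRoot.lift_mk, Polynomial.eval₂_eq_eval_map]
    rw [← Polynomial.map_map, ← Polynomial.eval₂_eq_eval_map, ← AdjoinRoot.aeval_eq,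
      Polynomial.aeval_def]
    rfl
  let φ : AdjoinRoot (l.map (algebraMap Fq L)) →+* AdjoinRoot (l.map (algebraMap Fq L)) :=
    AdjoinRoot.map (frobHom Fq L) _ _ (by
      have := coeffFrob_map_algebraMap (L := L) l
      rw [coeffFrob, Polynomial.coe_mapRingHom] at this
      rw [this])
  have hφ : ∀ p, φ (AdjoinRoot.mk _ p) = AdjoinRoot.mk _ (coeffFrob Fq L p) := by
    intro p
    simp only [φ, AdjoinRoot.map, AdjoinRoot.lift_mk, Polynomial.eval₂_eq_eval_map]
    rw [← Polynomial.map_map, ← Polynomial.eval₂_eq_eval_map, ← AdjoinRoot.aeval_eq,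
      Polynomial.aeval_def]
    rfl
  let _ : Algebra (AdjoinRoot l) (AdjoinRoot (l.map (algebraMap Fq L))) := f.toAlgebra
  have _ : IsScalarTower Fq (AdjoinRoot l) (AdjoinRoot (l.map (algebraMap Fq L))) :=
    IsScalarTower.of_algebraMap_eq fun a => by
      rw [RingHom.algebraMap_toAlgebra, IsScalarTower.algebraMap_apply Fq L,
        AdjoinRoot.algebraMap_eq, AdjoinRoot.algebraMap_eq, ← AdjoinRoot.mk_C, ← AdjoinRoot.mk_C,
        hf, Polynomial.map_C]
  have hfr : Module.finrank L (AdjoinRoot (l.map (algebraMap Fq L))) = l.natDegree := by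
    rw [(AdjoinRoot.powerBasis hl0).finrank, AdjoinRoot.powerBasis_dim, Polynomial.natDegree_map]
  have hκfr : Module.finrank Fq (AdjoinRoot l) = l.natDegree := by
    rw [(AdjoinRoot.powerBasis hl.ne_zero).finrank, AdjoinRoot.powerBasis_dim]
  have _ : FiniteDimensional L (AdjoinRoot (l.map (algebraMap Fq L))) :=
    (AdjoinRoot.powerBasis hl0).finite
  have _ : FiniteDimensional Fq (AdjoinRoot l) := (AdjoinRoot.powerBasis hl.ne_zero).finite
  exact exists_lang_matrix_of_quotient (κ := AdjoinRoot l) (by rw [hfr, hκfr]) φ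
    (AdjoinRoot.mk (l.map (algebraMap Fq L))) AdjoinRoot.mk_surjective (AdjoinRoot.mk l)
    AdjoinRoot.mk_surjective (fun c => by rw [AdjoinRoot.mk_C, AdjoinRoot.algebraMap_eq])
    hf hφ (fun p => AdjoinRoot.mk_eq_zero) hA

theorem exists_coeffFrob_sub_eq [IsSepClosed L] (p : L[X]) : ∃ z, coeffFrob Fq L z - z = p := by
  induction p using Polynomial.induction_on' with
  | add p p' h h' =>
    obtain ⟨z, rfl⟩ := h
    obtain ⟨z', rfl⟩ := h'
    exact ⟨z + z', by rw [map_add]; ring⟩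
  | monomial k a =>
    obtain ⟨x, hx⟩ := exists_pow_card_sub_eq Fq a
    refine ⟨Polynomial.monomial k x, ?_⟩
    rw [← hx, map_sub]
    simp [coeffFrob]

/-- Hensel lifting. If X - A X^(q) = l^(N+1) C, look for X' = X (1 + l^(N+1) Z). The error vanishes
to the next order when Z^(q) - Z = X^{-1} C, which is an Artin–Schreier equation for each
coefficient; `u • X.adjugate` serves as the inverse of `X` modulo `l`. -/
theorem exists_lang_matrix_succ [IsSepClosed L] {l : Fq[X]} {A X : Matrix n n L[X]} {N : ℕ}
    (hX : IsCoprime X.det (l.map (algebraMap Fq L)))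
    (hN : ∀ i j, l.map (algebraMap Fq L) ^ (N + 1) ∣ (X - A * X.map (coeffFrob Fq L)) i j) :
    ∃ X' : Matrix n n L[X], IsCoprime X'.det (l.map (algebraMap Fq L)) ∧
      (∀ i j, l.map (algebraMap Fq L) ^ (N + 2) ∣ (X' - A * X'.map (coeffFrob Fq L)) i j) ∧
      ∀ i j, l.map (algebraMap Fq L) ^ (N + 1) ∣ (X' - X) i j := by
  have hφl : coeffFrob Fq L (l.map (algebraMap Fq L)) = l.map (algebraMap Fq L) :=
    coeffFrob_map_algebraMap l
  generalize l.map (algebraMap Fq L) = lL at *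
  choose C hC using hN
  obtain ⟨u, v, huv⟩ := hX
  have hC' : X - A * X.map (coeffFrob Fq L) = lL ^ (N + 1) • Matrix.of C := by
    ext1 i j
    exact hC i j
  choose Z hZ using fun i j => exists_coeffFrob_sub_eq (Fq := Fq)
    (((u • X.adjugate) * Matrix.of C) i j)
  have hZ' : (Matrix.of Z).map (coeffFrob Fq L) = Matrix.of Z + (u • X.adjugate) * Matrix.of C := by
    ext1 i j
    rw [Matrix.add_apply, ← hZ i j, Matrix.map_apply, Matrix.of_apply]
    ring
  have hXC : X * ((u • X.adjugate) * Matrix.of C) = Matrix.of C - (v * lL) • Matrix.of C := by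
    rw [Matrix.smul_mul, Matrix.mul_smul, ← Matrix.mul_assoc, Matrix.mul_adjugate, Matrix.smul_mul,
      Matrix.one_mul, smul_smul, eq_sub_iff_add_eq, ← add_smul, huv, one_smul]
  have hAX : A * X.map (coeffFrob Fq L) = X - lL ^ (N + 1) • Matrix.of C := by
    rw [← hC']
    abel
  refine ⟨X + lL ^ (N + 1) • (X * Matrix.of Z), ?_, ?_, fun i j => ?_⟩
  · have h1 : X + lL ^ (N + 1) • (X * Matrix.of Z) = X * (1 + lL ^ (N + 1) • Matrix.of Z) := by
      rw [mul_add, mul_one, Matrix.mul_smul]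
    rw [h1, Matrix.det_mul]
    refine IsCoprime.mul_left ⟨u, v, huv⟩ ?_
    obtain ⟨d, hd⟩ : lL ∣ (1 + lL ^ (N + 1) • Matrix.of Z).det - (1 : Matrix n n L[X]).det := by
      refine dvd_det_sub_det fun i j => ?_
      rw [add_sub_cancel_left, Matrix.smul_apply, smul_eq_mul, pow_succ']
      exact Dvd.intro _ (by rw [mul_assoc])
    rw [Matrix.det_one] at hd
    exact ⟨1, -d, by linear_combination hd⟩
  · have h1 : (lL ^ (N + 1) • (X * Matrix.of Z)).map (coeffFrob Fq L) =
        lL ^ (N + 1) • (X.map (coeffFrob Fq L) * (Matrix.of Z).map (coeffFrob Fq L)) := by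
      rw [← Matrix.map_mul]
      ext1 i j
      simp only [Matrix.map_apply, Matrix.smul_apply, smul_eq_mul, map_mul, map_pow, hφl]
    have h2 : (X + lL ^ (N + 1) • (X * Matrix.of Z)) -
        A * (X + lL ^ (N + 1) • (X * Matrix.of Z)).map (coeffFrob Fq L) =
        lL ^ (N + 2) • (v • Matrix.of C +
          lL ^ N • (Matrix.of C * (Matrix.of Z).map (coeffFrob Fq L))) := by
      rw [Matrix.map_add _ (fun a b => map_add (coeffFrob Fq L) a b), h1, mul_add, Matrix.mul_smul,
        ← Matrix.mul_assoc, hAX, Matrix.sub_mul, hZ', Matrix.mul_add X, hXC, Matrix.smul_mul]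
      module
    intro i j
    rw [h2, Matrix.smul_apply, smul_eq_mul]
    exact Dvd.intro _ rfl
  · rw [add_sub_cancel_left, Matrix.smul_apply, smul_eq_mul]
    exact Dvd.intro _ rfl

/-- Solutions of `X = A X^(q)` modulo the powers of `l`, compatible and invertible. -/
theorem exists_lang_sequence [IsSepClosed L] {l : Fq[X]} (hl : Irreducible l)
    {A : Matrix n n L[X]} (hA : IsCoprime A.det (l.map (algebraMap Fq L))) :
    ∃ X : ℕ → Matrix n n L[X], (∀ N, IsCoprime (X N).det (l.map (algebraMap Fq L))) ∧
      (∀ N i j, l.map (algebraMap Fq L) ^ (N + 1) ∣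
        (X N - A * (X N).map (coeffFrob Fq L)) i j) ∧
      ∀ N i j, l.map (algebraMap Fq L) ^ (N + 1) ∣ (X (N + 1) - X N) i j := by
  let P : ℕ → Matrix n n L[X] → Prop := fun N X => IsCoprime X.det (l.map (algebraMap Fq L)) ∧
    ∀ i j, l.map (algebraMap Fq L) ^ (N + 1) ∣ (X - A * X.map (coeffFrob Fq L)) i j
  have hstep : ∀ (N : ℕ) (X : {X // P N X}), ∃ X' : {X // P (N + 1) X},
      ∀ i j, l.map (algebraMap Fq L) ^ (N + 1) ∣ (X'.1 - X.1) i j := by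
    rintro N ⟨X, hX1, hX2⟩
    obtain ⟨X', h1, h2, h3⟩ := exists_lang_matrix_succ hX1 hX2
    exact ⟨⟨X', h1, h2⟩, h3⟩
  choose next hnext using hstep
  obtain ⟨X₀, h1, h2⟩ := exists_lang_matrix hl hA
  let seq : ∀ N, {X // P N X} := fun N =>
    Nat.rec ⟨X₀, h1, fun i j => by simpa using h2 i j⟩ (fun N X => next N X) N
  exact ⟨fun N => (seq N).1, fun N => (seq N).2.1, fun N => (seq N).2.2,
    fun N => hnext N (seq N)⟩

end LangPolynomial

end TMotive
end

open scoped Polynomial TensorProduct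
noncomputable section
namespace TMotive

/-! ### The matrix of σ, its determinant, and finite generation over K[τ]. -/

section MatrixOfMotive

variable {Fq : Type*} [Field Fq] [Fintype Fq] {K : Type*} [Field K] [Algebra Fq K]
variable {M : Type*} [AddCommGroup M] [Module K[X] M] {n : Type*} [Fintype n] [DecidableEq n]

theorem repr_sigma {σ : M →ₛₗ[coeffFrob Fq K] M} {b : Module.Basis n K[X] M}
    {A : Matrix n n K[X]} (hA : ∀ j, σ (b j) = ∑ i, A i j • b i) (x : M) :
    (b.repr (σ x) : n → K[X]) = A.mulVec (fun i => coeffFrob Fq K (b.repr x i)) := by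
  have h1 : σ x = ∑ i, A.mulVec (fun i => coeffFrob Fq K (b.repr x i)) i • b i := by
    conv_lhs => rw [← b.sum_repr x]
    rw [map_sum]
    simp only [map_smulₛₗ, hA, Finset.smul_sum, Matrix.mulVec, dotProduct, Finset.sum_smul]
    rw [Finset.sum_comm]
    refine Finset.sum_congr rfl fun i _ => Finset.sum_congr rfl fun k _ => ?_
    rw [smul_smul, mul_comm]
  rw [h1, b.repr_sum_self]

theorem repr_sigma_iterate {σ : M →ₛₗ[coeffFrob Fq K] M} {b : Module.Basis n K[X] M}
    {A : Matrix n n K[X]} (hA : ∀ j, σ (b j) = ∑ i, A i j • b i) (l : ℕ) (x : M) :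
    (b.repr (σ^[l] x) : n → K[X]) =
      (iterMat (coeffFrob Fq K) A l).mulVec (fun i => ((coeffFrob Fq K) ^ l) (b.repr x i)) := by
  induction l generalizing x with
  | zero => simp [iterMat]
  | succ l ih =>
    rw [Function.iterate_succ_apply, ih, repr_sigma hA, iterMat_add, ← Matrix.mulVec_mulVec]
    congr 1
    ext i
    simp only [Matrix.mulVec, dotProduct, map_sum, map_mul, pow_succ, RingHom.mul_def,
      RingHom.comp_apply, Matrix.map_apply]
    simp [iterMat]

/-- Finite generation over `K[τ]`, in terms of the matrix of `σ`. -/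
theorem exists_sum_iterMat_of_isFinitelyGeneratedOverTau {σ : M →ₛₗ[coeffFrob Fq K] M}
    {b : Module.Basis n K[X] M} {A : Matrix n n K[X]} (hA : ∀ j, σ (b j) = ∑ i, A i j • b i)
    (hfg : IsFinitelyGeneratedOverTau σ) :
    ∃ (c k : ℕ) (B : ℕ → Matrix n n K[X]), (∀ l i j, DegLE c (B l i j)) ∧
      (Polynomial.X ^ (c + 1) : K[X]) • (1 : Matrix n n K[X]) =
        ∑ l ∈ Finset.range (k + 1), iterMat (coeffFrob Fq K) A l * B l := by
  obtain ⟨s, hs⟩ := hfg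
  -- `c` bounds the coordinates of the generators. Constants and Frobenius do not raise degrees, so
  -- all coefficients met below have degree at most `c`; the target t^(c+1) lies just above this,
  -- and that gap of one drives the decay in `adjugate_iterMat_degLE`.
  obtain ⟨c, hc⟩ : ∃ c : ℕ, ∀ m ∈ s, ∀ i, DegLE c (b.repr m i) := by
    refine ⟨s.sup fun m => Finset.univ.sup fun i => (b.repr m i).natDegree, fun m hm i => ?_⟩
    apply degLE_of_natDegree_le
    have h1 := Finset.le_sup (f := fun i => (b.repr m i).natDegree) (Finset.mem_univ i)
    have h2 := Finset.le_sup (f := fun m => Finset.univ.sup fun i => (b.repr m i).natDegree) hm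
    exact_mod_cast h1.trans h2
  -- The identity is required for all large `k` so that representations of different lengths can be
  -- added and a common `k` found.
  have hall : ∀ x : M, ∃ y : ℕ → n → K[X], (∀ l i, DegLE c (y l i)) ∧ ∃ k₀, ∀ k ≥ k₀,
      (b.repr x : n → K[X]) =
        ∑ l ∈ Finset.range (k + 1), (iterMat (coeffFrob Fq K) A l).mulVec (y l) := by
    intro x
    have hx : x ∈ (⊤ : AddSubgroup M) := trivial
    rw [← hs] at hx
    induction hx using AddSubgroup.closure_induction with
    | zero => exact ⟨0, fun _ _ => degLE_zero _, 0, fun k _ => by simp⟩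
    | add x x' _ _ h h' =>
      obtain ⟨y, hy, k, hk⟩ := h
      obtain ⟨y', hy', k', hk'⟩ := h'
      refine ⟨y + y', fun l i => (hy l i).add (hy' l i), max k k', fun N hN => ?_⟩
      rw [map_add, Finsupp.coe_add, hk N (le_of_max_le_left hN), hk' N (le_of_max_le_right hN),
        ← Finset.sum_add_distrib]
      simp [Matrix.mulVec_add]
    | neg x _ h =>
      obtain ⟨y, hy, k, hk⟩ := h
      refine ⟨-y, fun l i => (hy l i).neg, k, fun N hN => ?_⟩
      rw [map_neg, Finsupp.coe_neg, hk N hN]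
      simp [Matrix.mulVec_neg]
    | mem x hx =>
      obtain ⟨a, j, m, hm, rfl⟩ := hx
      refine ⟨Pi.single j fun i => Polynomial.C a * (coeffFrob Fq K ^ j) (b.repr m i),
        fun l i => ?_, j, fun k hk => ?_⟩
      · by_cases hl : l = j
        · subst hl
          rw [Pi.single_eq_same]
          exact (DegLE.map_pow _ (hc m hm i) l).C_mul a
        · rw [Pi.single_eq_of_ne hl]
          exact degLE_zero _
      · rw [Finset.sum_eq_single_of_mem j (Finset.mem_range.mpr (by omega)), Pi.single_eq_same,
          map_smul, Finsupp.coe_smul, repr_sigma_iterate hA, ← Matrix.mulVec_smul]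
        · rfl
        · intro l _ hl
          rw [Pi.single_eq_of_ne hl, Matrix.mulVec_zero]
  choose y hy k hk using fun j => hall ((Polynomial.X ^ (c + 1) : K[X]) • b j)
  refine ⟨c, Finset.univ.sup k, fun l => Matrix.of fun i j => y j l i, fun l i j => hy j l i, ?_⟩
  ext1 i j
  have h1 := congrFun (hk j (Finset.univ.sup k) (Finset.le_sup (Finset.mem_univ j))) i
  rw [map_smul, b.repr_self, Finset.sum_apply] at h1
  rw [Matrix.sum_apply]
  calc _ = ((Polynomial.X ^ (c + 1) : K[X]) • Finsupp.single j (1 : K[X])) i := by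
        rw [Matrix.smul_apply, Finsupp.smul_apply, Matrix.one_apply, Finsupp.single_apply]
        simp only [eq_comm]
    _ = _ := h1
    _ = _ := rfl

/-- A finitely generated projective module over K[t] is free, and ∧^r σ multiplies b_1 ∧ ⋯ ∧ b_r by
det A. The isomorphism with K[t]e sends this generator to a unit, hence to a constant u, which only
changes α into u^q α u^{-1}. -/
theorem exists_basis_of_isEffective [Algebra Fq[X] K] {σ : M →ₛₗ[coeffFrob Fq K] M}
    (hM : IsEffective σ) :
    ∃ (r : ℕ) (b : Module.Basis (Fin r) K[X] M) (A : Matrix (Fin r) (Fin r) K[X]) (α : K) (m : ℕ),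
      (∀ j, σ (b j) = ∑ i, A i j • b i) ∧ α ≠ 0 ∧
      A.det = Polynomial.C α *
        (Polynomial.X - Polynomial.C (algebraMap Fq[X] K Polynomial.X)) ^ m := by
  obtain ⟨hfin, hproj, -, e, α, m, hα, he⟩ := hM
  have hfree : Module.Free K[X] M := Module.free_of_finite_type_torsion_free'
  let b : Module.Basis (Fin (Module.finrank K[X] M)) K[X] M := Module.finBasis K[X] M
  let f : M [⋀^Fin (Module.finrank K[X] M)]→ₗ[K[X]] K[X] :=
    (e : (⋀[K[X]]^(Module.finrank K[X] M) M) →ₗ[K[X]] K[X]).compAlternatingMap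
      (exteriorPower.ιMulti K[X] (Module.finrank K[X] M))
  have hf : ∀ v, f v = e (exteriorPower.ιMulti K[X] (Module.finrank K[X] M) v) := fun _ => rfl
  have hdet : ∀ v, f v = f b * b.det v := fun v => by
    conv_lhs => rw [AlternatingMap.eq_smul_basis_det b f]
    rfl
  -- Each value of `f` is a multiple of `f b`, and the decomposable elements span the exterior
  -- power, on which `e` takes the value 1.
  have hunit : IsUnit (f b) := by
    rw [isUnit_iff_dvd_one]
    obtain ⟨w, hw⟩ := e.surjective 1
    have hw' : w ∈ Submodule.span K[X]
        (Set.range (exteriorPower.ιMulti K[X] (M := M) (Module.finrank K[X] M))) := by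
      rw [exteriorPower.ιMulti_span]
      trivial
    rw [← hw]
    clear hw
    induction hw' using Submodule.span_induction with
    | zero => rw [map_zero]; exact dvd_zero _
    | add x y _ _ h h' => rw [map_add]; exact dvd_add h h'
    | smul a x _ h => rw [map_smul, smul_eq_mul]; exact dvd_mul_of_dvd_right h a
    | mem x hx =>
      obtain ⟨v, rfl⟩ := hx
      rw [← hf, hdet v]
      exact Dvd.intro _ rfl
  obtain ⟨u, hu, hub⟩ := Polynomial.isUnit_iff.mp hunit
  have hu0 : u ≠ 0 := hu.ne_zero
  let A : Matrix (Fin (Module.finrank K[X] M)) (Fin (Module.finrank K[X] M)) K[X] :=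
    b.toMatrix (fun j => σ (b j))
  have hA : ∀ j, σ (b j) = ∑ i, A i j • b i := fun j => (b.sum_repr (σ (b j))).symm
  refine ⟨_, b, A, u ^ Fintype.card Fq * α * u⁻¹, m, hA, by positivity, ?_⟩
  have h1 := he b
  rw [← hf, ← hf, hdet, Module.Basis.det_apply, ← hub] at h1
  have h2 : coeffFrob Fq K (Polynomial.C u) = Polynomial.C (u ^ Fintype.card Fq) := by
    simp [coeffFrob]
  rw [h2] at h1
  have h3 : (Polynomial.C u⁻¹ * Polynomial.C u : K[X]) = 1 := by
    rw [← Polynomial.C_mul, inv_mul_cancel₀ hu0, Polynomial.C_1]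
  have h4 : A.det = Polynomial.C u⁻¹ * (Polynomial.C u * A.det) := by
    rw [← mul_assoc, h3, one_mul]
  rw [h4, h1, Polynomial.C_mul, Polynomial.C_mul]
  ring

end MatrixOfMotive

end TMotive
end

open scoped Polynomial TensorProduct
noncomputable section
namespace TMotive

/-! ### Representatives of elements of adic completions. -/

section Approx

variable {R : Type*} [CommRing R] (I : Ideal R) {S : Type*} [AddCommGroup S] [Module R S]

/-- `m` represents `x` modulo `I ^ N`. -/
def IsApprox (N : ℕ) (x : AdicCompletion I S) (m : S) : Prop :=
  x.val N = Submodule.Quotient.mk m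

variable {I}

theorem exists_isApprox (N : ℕ) (x : AdicCompletion I S) : ∃ m, IsApprox I N x m := by
  obtain ⟨m, hm⟩ := Submodule.Quotient.mk_surjective _ (x.val N)
  exact ⟨m, hm.symm⟩

theorem IsApprox.add {N : ℕ} {x y : AdicCompletion I S} {m m' : S} (h : IsApprox I N x m)
    (h' : IsApprox I N y m') : IsApprox I N (x + y) (m + m') := by
  rw [IsApprox, AdicCompletion.val_add_apply, h, h', Submodule.Quotient.mk_add]

theorem isApprox_zero (N : ℕ) : IsApprox I N (0 : AdicCompletion I S) 0 := rfl

theorem isApprox_one (N : ℕ) : IsApprox I N (1 : AdicCompletion I R) 1 := rfl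

theorem IsApprox.sum {ι : Type*} (s : Finset ι) {N : ℕ} {x : ι → AdicCompletion I S} {m : ι → S}
    (h : ∀ i ∈ s, IsApprox I N (x i) (m i)) : IsApprox I N (∑ i ∈ s, x i) (∑ i ∈ s, m i) := by
  classical
  induction s using Finset.induction_on with
  | empty => exact isApprox_zero N
  | insert a s ha ih =>
    rw [Finset.sum_insert ha, Finset.sum_insert ha]
    exact (h a (Finset.mem_insert_self a s)).add
      (ih fun i hi => h i (Finset.mem_insert_of_mem hi))

theorem IsApprox.smul {N : ℕ} {a : AdicCompletion I R} {r : R} {x : AdicCompletion I S} {m : S}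
    (h : IsApprox I N a r) (h' : IsApprox I N x m) : IsApprox I N (a • x) (r • m) := by
  rw [IsApprox, AdicCompletion.smul_eval, h, h']
  rfl

theorem IsApprox.mul {N : ℕ} {a b : AdicCompletion I R} {r s : R}
    (h : IsApprox I N a r) (h' : IsApprox I N b s) : IsApprox I N (a * b) (r * s) :=
  h.smul h'

theorem IsApprox.map {S' : Type*} [AddCommGroup S'] [Module R S'] (f : S →ₗ[R] S') {N : ℕ}
    {x : AdicCompletion I S} {m : S} (h : IsApprox I N x m) :
    IsApprox I N (AdicCompletion.map I f x) (f m) := by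
  rw [IsApprox, AdicCompletion.map_val_apply, h]
  rfl

theorem IsApprox.iff_sub_mem {N : ℕ} {x : AdicCompletion I S} {m m' : S} (h : IsApprox I N x m) :
    IsApprox I N x m' ↔ m - m' ∈ (I ^ N • ⊤ : Submodule R S) := by
  rw [IsApprox, h, Submodule.Quotient.eq]

theorem eq_of_isApprox {x y : AdicCompletion I S}
    (h : ∀ N, ∃ m, IsApprox I N x m ∧ IsApprox I N y m) : x = y := by
  refine AdicCompletion.ext fun N => ?_
  obtain ⟨m, h1, h2⟩ := h N
  rw [h1, h2]

theorem exists_forall_isApprox {f : ℕ → S}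
    (hf : ∀ N, f (N + 1) - f N ∈ (I ^ N • ⊤ : Submodule R S)) :
    ∃ x : AdicCompletion I S, ∀ N, IsApprox I N x (f N) :=
  ⟨AdicCompletion.mk I S (AdicCompletion.AdicCauchySequence.mk I S f fun N =>
    (SModEq.sub_mem.mpr (hf N)).symm), fun _ => rfl⟩

theorem IsApprox.of_le {N N' : ℕ} (hN : N ≤ N') {x : AdicCompletion I S} {m : S}
    (h : IsApprox I N' x m) : IsApprox I N x m := by
  have h1 := AdicCompletion.transitionMap_comp_eval_apply I S hN x
  rw [h] at h1
  rw [IsApprox, ← h1]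
  rfl

theorem mem_pow_smul_top_iff {a : R} (hI : I = Ideal.span {a}) (N : ℕ) (x : S) :
    x ∈ (I ^ N • ⊤ : Submodule R S) ↔ ∃ y, a ^ N • y = x := by
  rw [hI, Ideal.span_singleton_pow, Submodule.ideal_span_singleton_smul,
    Submodule.mem_smul_pointwise_iff_exists]
  simp

theorem IsApprox.dvd_sub {a : R} (hI : I = Ideal.span {a}) {N : ℕ} {x : AdicCompletion I R}
    {r s : R} (h : IsApprox I N x r) (h' : IsApprox I N x s) : a ^ N ∣ r - s := by
  rw [h.iff_sub_mem, mem_pow_smul_top_iff hI] at h'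
  obtain ⟨y, hy⟩ := h'
  exact ⟨y, hy.symm⟩

end Approx

/-! ### Coordinates on the extension of M to the separable closure. -/

section SepBasis

attribute [local instance] Polynomial.algebra

variable {Fq : Type*} [Field Fq] {K : Type*} [Field K] [Algebra Fq K]
variable {M : Type*} [AddCommGroup M] [Module K[X] M] {n : Type*}

variable (Fq) in
/-- The basis of `M_{K^sep}` obtained from a basis of `M`. -/
def sepBasis (b : Module.Basis n K[X] M) :
    Module.Basis n (SeparableClosure K)[X] (SepExt Fq K M) :=
  Algebra.TensorProduct.basis (SeparableClosure K)[X] b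

theorem sepBasis_apply (b : Module.Basis n K[X] M) (i : n) :
    sepBasis Fq b i = SepExt.tmul Fq 1 (b i) :=
  Algebra.TensorProduct.basis_apply b i

theorem tmul_smul_right (p : (SeparableClosure K)[X]) (a : K[X]) (m : M) :
    SepExt.tmul Fq p (a • m) =
      a.map (algebraMap K (SeparableClosure K)) • SepExt.tmul Fq p m := by
  rw [SepExt.smul_tmul]
  change p ⊗ₜ[K[X]] (a • m) = _
  rw [← TensorProduct.smul_tmul, Algebra.smul_def, Polynomial.algebraMap_def]
  rfl

theorem tmul_sum {ι : Type*} (s : Finset ι) (p : (SeparableClosure K)[X]) (m : ι → M) :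
    SepExt.tmul Fq p (∑ i ∈ s, m i) = ∑ i ∈ s, SepExt.tmul Fq p (m i) :=
  TensorProduct.tmul_sum _ _ _

/-- `σ` on `M_{K^sep}` as a semilinear map. -/
def sepSigma [Fintype Fq] (σ : M →ₛₗ[coeffFrob Fq K] M) :
    SepExt Fq K M →ₛₗ[coeffFrob Fq (SeparableClosure K)] SepExt Fq K M where
  toFun := SepExt.sigma Fq σ
  map_add' := map_add _
  map_smul' c x := by
    induction x using SepExt.induction_on with
    | h0 => simp
    | ht p m =>
      rw [SepExt.smul_tmul, SepExt.sigma_tmul, SepExt.sigma_tmul, SepExt.smul_tmul, map_mul]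
    | ha x y hx hy => rw [smul_add, map_add, hx, hy, map_add, smul_add]

theorem sepSigma_sepBasis [Fintype Fq] [Fintype n] {σ : M →ₛₗ[coeffFrob Fq K] M}
    {b : Module.Basis n K[X] M} {A : Matrix n n K[X]} (hA : ∀ j, σ (b j) = ∑ i, A i j • b i)
    (j : n) : sepSigma σ (sepBasis Fq b j) =
      ∑ i, A.map (Polynomial.mapRingHom (algebraMap K (SeparableClosure K))) i j •
        sepBasis Fq b i := by
  rw [sepBasis_apply]
  change SepExt.sigma Fq σ _ = _
  rw [SepExt.sigma_tmul, map_one, hA, tmul_sum]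
  exact Finset.sum_congr rfl fun i _ => by rw [tmul_smul_right, sepBasis_apply]; rfl

theorem repr_gal [Fintype n] (b : Module.Basis n K[X] M) (g : Gal(SeparableClosure K/K))
    (x : SepExt Fq K M) (i : n) :
    (sepBasis Fq b).repr (SepExt.gal Fq g x) i =
      ((sepBasis Fq b).repr x i).map ((g : SeparableClosure K ≃+* SeparableClosure K) :
        SeparableClosure K →+* SeparableClosure K) := by
  classical
  have hs : ∀ (c : (SeparableClosure K)[X]) (x : SepExt Fq K M), SepExt.gal Fq g (c • x) =
      c.map ((g : SeparableClosure K ≃+* SeparableClosure K) :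
        SeparableClosure K →+* SeparableClosure K) • SepExt.gal Fq g x := by
    intro c x
    induction x using SepExt.induction_on with
    | h0 => simp
    | ht p m =>
      rw [SepExt.smul_tmul, SepExt.gal_tmul, SepExt.gal_tmul, SepExt.smul_tmul,
        Polynomial.map_mul]
    | ha x y hx hy => rw [smul_add, map_add, hx, hy, map_add, smul_add]
  have h1 : SepExt.gal Fq g x = ∑ i, (((sepBasis Fq b).repr x i).map
      ((g : SeparableClosure K ≃+* SeparableClosure K) :
        SeparableClosure K →+* SeparableClosure K)) • sepBasis Fq b i := by
    conv_lhs => rw [← (sepBasis Fq b).sum_repr x]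
    rw [map_sum]
    refine Finset.sum_congr rfl fun i _ => ?_
    rw [hs, sepBasis_apply, SepExt.gal_tmul, Polynomial.map_one]
  rw [h1, (sepBasis Fq b).repr_sum_self]

theorem mem_pow_smul_top_sepExt_iff [Fintype n] (b : Module.Basis n K[X] M) {I : Ideal Fq[X]}
    {l : Fq[X]} (hI : I = Ideal.span {l}) (N : ℕ) (x : SepExt Fq K M) :
    x ∈ (I ^ N • ⊤ : Submodule Fq[X] (SepExt Fq K M)) ↔
      ∀ i, l.map (algebraMap Fq (SeparableClosure K)) ^ N ∣ (sepBasis Fq b).repr x i := by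
  rw [mem_pow_smul_top_iff hI]
  constructor
  · rintro ⟨y, rfl⟩ i
    rw [SepExt.smul_def, map_smul, Polynomial.map_pow]
    exact Dvd.intro _ rfl
  · intro h
    choose y hy using h
    refine ⟨∑ i, y i • sepBasis Fq b i, ?_⟩
    rw [SepExt.smul_def, Polynomial.map_pow, Finset.smul_sum]
    conv_rhs => rw [← (sepBasis Fq b).sum_repr x]
    exact Finset.sum_congr rfl fun i _ => by rw [smul_smul, ← hy]

/-- The element of `M_{K^sep}` with given coordinates. -/
def sepVec [Fintype n] (b : Module.Basis n K[X] M) (x : n → (SeparableClosure K)[X]) :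
    SepExt Fq K M :=
  ∑ i, x i • sepBasis Fq b i

theorem repr_sepVec [Fintype n] (b : Module.Basis n K[X] M) (x : n → (SeparableClosure K)[X]) :
    ((sepBasis Fq b).repr (sepVec b x) : n → (SeparableClosure K)[X]) = x := by
  classical
  exact (sepBasis Fq b).repr_sum_self x

theorem sum_smul_sepVec [Fintype n] (b : Module.Basis n K[X] M)
    (X : Matrix n n (SeparableClosure K)[X]) (C : n → Fq[X]) :
    ∑ j, C j • sepVec b (fun i => X i j) = (sepVec b (X.mulVec fun j =>
      (C j).map (algebraMap Fq (SeparableClosure K))) : SepExt Fq K M) := by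
  simp only [sepVec, SepExt.smul_def, Finset.smul_sum, smul_smul, Matrix.mulVec, dotProduct,
    Finset.sum_smul]
  rw [Finset.sum_comm]
  exact Finset.sum_congr rfl fun i _ => Finset.sum_congr rfl fun j _ => by rw [mul_comm]

theorem IsApprox.iff_dvd [Fintype n] (b : Module.Basis n K[X] M) {I : Ideal Fq[X]}
    {l : Fq[X]} (hI : I = Ideal.span {l}) {N : ℕ} {y : AdicCompletion I (SepExt Fq K M)}
    {m m' : SepExt Fq K M} (h : IsApprox I N y m) :
    IsApprox I N y m' ↔ ∀ i, l.map (algebraMap Fq (SeparableClosure K)) ^ N ∣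
      (sepBasis Fq b).repr m i - (sepBasis Fq b).repr m' i := by
  rw [h.iff_sub_mem, mem_pow_smul_top_sepExt_iff b hI]
  simp only [map_sub, Finsupp.coe_sub, Pi.sub_apply]

end SepBasis

/-! ### Frobenius-invariants of polynomials modulo an element of 𝔽_q[t]. -/

section Reduction

variable {Fq : Type*} [Field Fq] {L : Type*} [Field L] [Algebra Fq L]

theorem dvd_of_map_dvd_mulVec {n : Type*} [Fintype n] [DecidableEq n] {lN : L[X]}
    {X : Matrix n n L[X]} (hX : IsCoprime X.det lN) {C : n → L[X]}
    (h : ∀ i, lN ∣ X.mulVec C i) (i : n) : lN ∣ C i := by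
  have h1 : X.det • C = X.adjugate.mulVec (X.mulVec C) := by
    rw [Matrix.mulVec_mulVec, Matrix.adjugate_mul, Matrix.smul_mulVec, Matrix.one_mulVec]
  have h2 : lN ∣ X.det * C i := by
    have h3 := congrFun h1 i
    rw [Pi.smul_apply, smul_eq_mul] at h3
    rw [h3]
    exact Finset.dvd_sum fun j _ => Dvd.dvd.mul_left (h j) _
  exact hX.symm.dvd_of_dvd_mul_left h2

variable [Fintype Fq]

theorem exists_map_eq_of_coeffFrob_eq {p : L[X]} (hp : coeffFrob Fq L p = p) :
    ∃ r : Fq[X], r.map (algebraMap Fq L) = p := by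
  have h : ∀ k, ∃ a : Fq, algebraMap Fq L a = p.coeff k := fun k => by
    apply exists_algebraMap_eq_of_pow_card_eq
    conv_rhs => rw [← hp]
    simp [coeffFrob]
  have h1 : p ∈ Polynomial.lifts (algebraMap Fq L) := by
    rw [Polynomial.lifts_iff_coeff_lifts]
    exact fun k => h k
  exact (Polynomial.mem_lifts p).mp h1

/-- A polynomial fixed by Frobenius modulo `l ∈ 𝔽_q[t]` is modulo `l` in `𝔽_q[t]`. -/
theorem exists_dvd_sub_map_of_dvd_coeffFrob_sub {l : Fq[X]} (hl : l ≠ 0) {p : L[X]}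
    (hp : l.map (algebraMap Fq L) ∣ coeffFrob Fq L p - p) :
    ∃ r : Fq[X], l.map (algebraMap Fq L) ∣ p - r.map (algebraMap Fq L) := by
  have hlL : l.map (algebraMap Fq L) ≠ 0 :=
    (Polynomial.map_ne_zero_iff (algebraMap Fq L).injective).mpr hl
  have hdiv := EuclideanDomain.div_add_mod p (l.map (algebraMap Fq L))
  -- Frobenius preserves degrees, so for the remainder the congruence becomes an equality.
  set s := p % l.map (algebraMap Fq L) with hs
  have hdeg : s.degree < (l.map (algebraMap Fq L)).degree := Polynomial.degree_mod_lt _ hlL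
  have hfix : coeffFrob Fq L s = s := by
    rw [← sub_eq_zero]
    apply Polynomial.eq_zero_of_dvd_of_degree_lt (p := l.map (algebraMap Fq L))
    · have h1 : coeffFrob Fq L s - s = (coeffFrob Fq L p - p) -
          l.map (algebraMap Fq L) * (coeffFrob Fq L (p / l.map (algebraMap Fq L)) -
            p / l.map (algebraMap Fq L)) := by
        have h2 := congrArg (coeffFrob Fq L) hdiv
        rw [map_add, map_mul, coeffFrob_map_algebraMap] at h2
        linear_combination h2 - hdiv
      rw [h1]
      exact dvd_sub hp (Dvd.intro _ rfl)
    · refine lt_of_le_of_lt (Polynomial.degree_sub_le _ _) (max_lt ?_ hdeg)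
      exact lt_of_le_of_lt Polynomial.degree_map_le hdeg
  obtain ⟨r, hr⟩ := exists_map_eq_of_coeffFrob_eq hfix
  refine ⟨r, p / l.map (algebraMap Fq L), ?_⟩
  rw [hr]
  linear_combination -hdiv

end Reduction

/-! ### Freeness of the Tate module and the matrices of the Galois action. -/

section TateModuleBasis

variable {Fq : Type*} [Field Fq] [Fintype Fq] {K : Type*} [Field K] [Algebra Fq K]
variable {M : Type*} [AddCommGroup M] [Module K[X] M] {n : Type*} [Fintype n] [DecidableEq n]

open IsDedekindDomain

/-- The Tate module is free: the columns of a solution of `X = A X^(q)` modulo the powers of `λ`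
are a basis. -/
theorem exists_basis_tateModule {σ : M →ₛₗ[coeffFrob Fq K] M} {b : Module.Basis n K[X] M}
    {A : Matrix n n K[X]} (hA : ∀ j, σ (b j) = ∑ i, A i j • b i)
    (lam : HeightOneSpectrum Fq[X]) {l : Fq[X]} (hl : lam.asIdeal = Ideal.span {l})
    {AL : Matrix n n (SeparableClosure K)[X]}
    (hAL : AL = A.map (Polynomial.mapRingHom (algebraMap K (SeparableClosure K))))
    (hcop : IsCoprime AL.det (l.map (algebraMap Fq (SeparableClosure K))))
    {X : ℕ → Matrix n n (SeparableClosure K)[X]}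
    (hX : ∀ N, IsCoprime (X N).det (l.map (algebraMap Fq (SeparableClosure K))))
    (hXA : ∀ N i j, l.map (algebraMap Fq (SeparableClosure K)) ^ (N + 1) ∣
        (X N - AL * (X N).map (coeffFrob Fq (SeparableClosure K))) i j)
    (hXs : ∀ N i j, l.map (algebraMap Fq (SeparableClosure K)) ^ (N + 1) ∣
      (X (N + 1) - X N) i j) :
    ∃ bT : Module.Basis n (ALoc lam) (tateModule σ lam),
      ∀ (g : Gal(SeparableClosure K/K)) (N : ℕ) (Φ : Matrix n n Fq[X]),
        (∀ i j, IsApprox lam.asIdeal N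
          (LinearMap.toMatrix bT bT (tateModuleRep σ lam g) i j) (Φ i j)) →
        ∀ i j, l.map (algebraMap Fq (SeparableClosure K)) ^ N ∣
          ((X N).map (Polynomial.mapRingHom ((g : SeparableClosure K ≃+* SeparableClosure K) :
              SeparableClosure K →+* SeparableClosure K)) -
            X N * Φ.map (Polynomial.mapRingHom (algebraMap Fq (SeparableClosure K)))) i j := by
  have hl0 : l ≠ 0 := by
    rintro rfl
    exact lam.ne_bot (by rw [hl, Ideal.span_singleton_zero])
  obtain ⟨lL, hlL⟩ : ∃ lL, lL = l.map (algebraMap Fq (SeparableClosure K)) := ⟨_, rfl⟩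
  simp only [← hlL] at hcop hX hXA hXs ⊢
  have hpow : ∀ (N : ℕ) (p : (SeparableClosure K)[X]), lL ^ (N + 1) ∣ p → lL ^ N ∣ p :=
    fun N p => (pow_dvd_pow lL (Nat.le_succ N)).trans
  have hrepr : ∀ x : SepExt Fq K M, ((sepBasis Fq b).repr (SepExt.sigma Fq σ x) : n → _) =
      AL.mulVec (fun i => coeffFrob Fq _ ((sepBasis Fq b).repr x i)) := by
    intro x
    rw [hAL]
    exact repr_sigma (sepSigma_sepBasis hA) x
  -- the elements of the completion given by the columns
  have he : ∀ j, ∃ e : AdicCompletion lam.asIdeal (SepExt Fq K M),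
      ∀ N, IsApprox lam.asIdeal N e (sepVec b fun i => X N i j) := by
    intro j
    refine exists_forall_isApprox fun N => ?_
    rw [mem_pow_smul_top_sepExt_iff b hl]
    intro i
    rw [map_sub, Finsupp.coe_sub, Pi.sub_apply, repr_sepVec, repr_sepVec, ← hlL]
    exact hpow _ _ (hXs N i j)
  choose e he using he
  have heT : ∀ j, e j ∈ tateModule σ lam := by
    intro j
    change AdicCompletion.map _ _ (e j) = e j
    refine eq_of_isApprox fun N => ⟨_, ((he j N).map _), ?_⟩
    rw [(he j N).iff_dvd b hl]
    intro i
    rw [hrepr, repr_sepVec, ← hlL]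
    exact hpow _ _ (hXA N i j)
  have hcomb : ∀ (N : ℕ) (c : n → ALoc lam) (C : n → Fq[X]),
      (∀ j, IsApprox lam.asIdeal N (c j) (C j)) → IsApprox lam.asIdeal N (∑ j, c j • e j)
        (sepVec b ((X N).mulVec fun j => (C j).map (algebraMap Fq _))) := by
    intro N c C h
    rw [← sum_smul_sepVec]
    exact IsApprox.sum _ fun j _ => (h j).smul (he j N)
  -- Uniqueness of coordinates modulo `l ^ N`: `X N` is invertible there, and divisibility over
  -- K^sep[t] between polynomials over 𝔽_q descends.
  have hdescend : ∀ (N : ℕ) (C : n → Fq[X]),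
      (∀ i, lL ^ N ∣ (X N).mulVec (fun j => (C j).map (algebraMap Fq _)) i) →
      ∀ j, l ^ N ∣ C j := by
    intro N C h j
    have h1 := dvd_of_map_dvd_mulVec ((hX N).pow_right (n := N)) h j
    rw [hlL, ← Polynomial.map_pow] at h1
    exact (Polynomial.map_dvd_map' (algebraMap Fq (SeparableClosure K))).mp h1
  -- independence and generation
  let v : n → tateModule σ lam := fun j => ⟨e j, heT j⟩
  have hvsum : ∀ c : n → ALoc lam, ((∑ j, c j • v j : tateModule σ lam) :
      AdicCompletion lam.asIdeal (SepExt Fq K M)) = ∑ j, c j • e j := by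
    intro c
    rw [Submodule.coe_sum]
    rfl
  have hli : LinearIndependent (ALoc lam) v := by
    rw [Fintype.linearIndependent_iff]
    intro c hc j
    have hc' : ∑ j, c j • e j = 0 := by rw [← hvsum, hc]; rfl
    refine eq_of_isApprox fun N => ⟨0, ?_, isApprox_zero N⟩
    choose C hC using fun j => exists_isApprox N (c j)
    have h1 := hcomb N c C hC
    rw [hc', (isApprox_zero N).iff_dvd b hl] at h1
    have h2 := hdescend N C (fun i => by
      have := h1 i
      rw [repr_sepVec, map_zero, Finsupp.coe_zero, Pi.zero_apply, zero_sub, dvd_neg, ← hlL] at this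
      exact this) j
    rw [(hC j).iff_sub_mem, mem_pow_smul_top_iff hl, sub_zero]
    obtain ⟨y, hy⟩ := h2
    exact ⟨y, hy.symm⟩
  have hspan : ⊤ ≤ Submodule.span (ALoc lam) (Set.range v) := by
    rintro ⟨x, hx⟩ -
    have hx' : AdicCompletion.map _ (SepExt.sigma Fq σ) x = x := hx
    choose y hy using fun N => exists_isApprox N x
    have hC : ∀ N, ∃ C : n → Fq[X], IsApprox lam.asIdeal N x
        (sepVec b ((X N).mulVec fun j => (C j).map (algebraMap Fq _))) := by
      intro N
      obtain ⟨Y, hY⟩ : ∃ Y : n → (SeparableClosure K)[X], Y = (sepBasis Fq b).repr (y N) := ⟨_, rfl⟩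
      have h1 : ∀ i, lL ^ N ∣ (Y - AL.mulVec fun i => coeffFrob Fq _ (Y i)) i := by
        have h2 := (hy N).map (SepExt.sigma Fq σ)
        rw [hx', (hy N).iff_dvd b hl] at h2
        intro i
        have := h2 i
        rw [hrepr, ← hlL, ← hY] at this
        exact this
      obtain ⟨u, w, huw⟩ : IsCoprime (X N).det (lL ^ N) := (hX N).pow_right
      -- The coordinates of `Y` in the columns of `X N` modulo `l ^ N`, with `u` times the adjugate
      -- as inverse. Invariance under σ forces C₀^(q) ≡ C₀, so they are congruent to polynomials
      -- over 𝔽_q.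
      set C₀ : n → (SeparableClosure K)[X] := u • (X N).adjugate.mulVec Y with hC₀
      have hXC : ∀ i, lL ^ N ∣ (Y - (X N).mulVec C₀) i := by
        intro i
        have : Y - (X N).mulVec C₀ = (w * lL ^ N) • Y := by
          rw [hC₀, Matrix.mulVec_smul, Matrix.mulVec_mulVec, Matrix.mul_adjugate,
            Matrix.smul_mulVec, Matrix.one_mulVec, smul_smul, sub_eq_iff_eq_add, ← add_smul,
            add_comm, huw, one_smul]
        rw [this, Pi.smul_apply, smul_eq_mul, mul_comm w, mul_assoc]
        exact Dvd.intro _ rfl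
      have hφl : coeffFrob Fq (SeparableClosure K) lL = lL := by
        rw [hlL, coeffFrob_map_algebraMap]
      -- `A X^(q) (C₀^(q) - C₀) ≡ 0`
      have h3 : ∀ i, lL ^ N ∣ ((AL * (X N).map (coeffFrob Fq _)).mulVec
          fun j => coeffFrob Fq _ (C₀ j) - C₀ j) i := by
        intro i
        have h4 : ((AL * (X N).map (coeffFrob Fq _)).mulVec
            fun j => coeffFrob Fq _ (C₀ j) - C₀ j) =
            (Y - (X N).mulVec C₀) - (Y - AL.mulVec fun i => coeffFrob Fq _ (Y i)) -
              AL.mulVec (fun i => coeffFrob Fq _ ((Y - (X N).mulVec C₀) i)) +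
              (X N - AL * (X N).map (coeffFrob Fq _)).mulVec C₀ := by
          have h5 : (fun i => coeffFrob Fq _ ((Y - (X N).mulVec C₀) i)) =
              (fun i => coeffFrob Fq _ (Y i)) - ((X N).map (coeffFrob Fq _)).mulVec
                fun j => coeffFrob Fq _ (C₀ j) := by
            ext1 i
            simp only [Pi.sub_apply, map_sub, Matrix.mulVec, dotProduct, map_sum, map_mul,
              Matrix.map_apply]
          have h6 : (fun j => coeffFrob Fq _ (C₀ j) - C₀ j) =
            (fun j => coeffFrob Fq _ (C₀ j)) - C₀ := rfl
          rw [h5, h6, Matrix.mulVec_sub, Matrix.mulVec_sub, Matrix.sub_mulVec,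
            ← Matrix.mulVec_mulVec]
          abel
        rw [h4]
        refine dvd_add (dvd_sub (dvd_sub (hXC i) (h1 i)) ?_) ?_
        · refine Finset.dvd_sum fun k _ => Dvd.dvd.mul_left ?_ _
          rw [← hφl, ← map_pow]
          exact map_dvd _ (hXC k)
        · exact Finset.dvd_sum fun k _ => Dvd.dvd.mul_right (hpow _ _ (hXA N i k)) _
      have hcop' : IsCoprime (AL * (X N).map (coeffFrob Fq _)).det (lL ^ N) := by
        rw [Matrix.det_mul]
        refine IsCoprime.pow_right (hcop.mul_left ?_)
        have h7 := (hX N).map (coeffFrob Fq (SeparableClosure K))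
        rw [hφl, RingHom.map_det] at h7
        exact h7
      have h8 : ∀ j, ∃ r : Fq[X], lL ^ N ∣ C₀ j - r.map (algebraMap Fq _) := by
        intro j
        have h9 := dvd_of_map_dvd_mulVec hcop' h3 j
        rw [hlL, ← Polynomial.map_pow] at h9 ⊢
        exact exists_dvd_sub_map_of_dvd_coeffFrob_sub (pow_ne_zero N hl0) h9
      choose C hC using h8
      refine ⟨C, ?_⟩
      rw [(hy N).iff_dvd b hl]
      intro i
      rw [repr_sepVec, ← hY, ← hlL]
      have h10 : Y i - (X N).mulVec (fun j => (C j).map (algebraMap Fq _)) i =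
          (Y - (X N).mulVec C₀) i +
            (X N).mulVec (fun j => C₀ j - (C j).map (algebraMap Fq _)) i := by
        have h11 : (fun j => C₀ j - (C j).map (algebraMap Fq (SeparableClosure K))) =
            C₀ - fun j => (C j).map (algebraMap Fq _) := rfl
        rw [h11, Matrix.mulVec_sub]
        simp only [Pi.sub_apply]
        ring
      rw [h10]
      exact dvd_add (hXC i) (Finset.dvd_sum fun k _ => Dvd.dvd.mul_left (hC k) _)
    choose C hC using hC
    -- Coordinates found at successive levels agree by uniqueness, so they assemble into elements of
    -- A_λ.
    have hc : ∀ j, ∃ c : ALoc lam, ∀ N, IsApprox lam.asIdeal N c (C N j) := by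
      intro j
      refine exists_forall_isApprox fun N => ?_
      rw [mem_pow_smul_top_iff hl]
      have h1 : l ^ N ∣ C (N + 1) j - C N j := by
        refine hdescend N (fun j => C (N + 1) j - C N j) (fun i => ?_) j
        have h2 := (hC (N + 1)).of_le (Nat.le_succ N)
        rw [(hC N).iff_dvd b hl] at h2
        have h3 := h2 i
        rw [repr_sepVec, repr_sepVec, ← hlL] at h3
        have h4 : (X N).mulVec (fun j => (C (N + 1) j - C N j).map (algebraMap Fq _)) i =
            -((X N).mulVec (fun j => (C N j).map (algebraMap Fq _)) i -
              (X (N + 1)).mulVec (fun j => (C (N + 1) j).map (algebraMap Fq _)) i) -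
            (X (N + 1) - X N).mulVec (fun j => (C (N + 1) j).map (algebraMap Fq _)) i := by
          simp only [Polynomial.map_sub, Matrix.sub_mulVec, Pi.sub_apply]
          have h5 : (fun j => (C (N + 1) j).map (algebraMap Fq (SeparableClosure K)) -
              (C N j).map (algebraMap Fq (SeparableClosure K))) =
            (fun j => (C (N + 1) j).map (algebraMap Fq _)) -
              fun j => (C N j).map (algebraMap Fq _) := rfl
          rw [h5, Matrix.mulVec_sub, Pi.sub_apply]
          ring
        rw [h4]
        refine dvd_sub (dvd_neg.mpr h3) ?_
        exact Finset.dvd_sum fun k _ => Dvd.dvd.mul_right (hpow _ _ (hXs N i k)) _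
      obtain ⟨z, hz⟩ := h1
      exact ⟨z, hz.symm⟩
    choose c hc using hc
    rw [Submodule.mem_span_range_iff_exists_fun]
    refine ⟨c, Subtype.ext ?_⟩
    rw [hvsum]
    exact eq_of_isApprox fun N => ⟨_, hcomb N c (C N) fun j => hc j N, hC N⟩
  refine ⟨Module.Basis.mk hli hspan, fun g N Φ hΦ i j => ?_⟩
  set bT := Module.Basis.mk hli hspan with hbT
  have h1 : AdicCompletion.map lam.asIdeal (SepExt.gal Fq g) (e j) =
      ∑ k, LinearMap.toMatrix bT bT (tateModuleRep σ lam g) k j • e k := by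
    have h2 : tateModuleRep σ lam g (bT j) =
        ∑ k, LinearMap.toMatrix bT bT (tateModuleRep σ lam g) k j • bT k := by
      conv_lhs => rw [← bT.sum_repr (tateModuleRep σ lam g (bT j))]
      exact Finset.sum_congr rfl fun k _ => by rw [LinearMap.toMatrix_apply]
    have h3 : ∀ k, bT k = v k := fun k => Module.Basis.mk_apply hli hspan k
    simp only [h3] at h2
    have h4 := congrArg Subtype.val h2
    rw [hvsum] at h4
    exact h4
  have h2 := hcomb N _ (fun k => Φ k j) fun k => hΦ k j
  rw [← h1, ((he j N).map _).iff_dvd b hl] at h2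
  have h3 := h2 i
  rw [repr_gal, repr_sepVec, repr_sepVec, ← hlL] at h3
  exact h3

end TateModuleBasis

end TMotive
end

open scoped Polynomial TensorProduct
noncomputable section
namespace TMotive

/-! ### Reversed characteristic polynomials. -/

section Charpoly

variable {R : Type*} [CommRing R] {n : Type*} [Fintype n] [DecidableEq n]

theorem charpolyRev_map {R' : Type*} [CommRing R'] (f : R →+* R') (M : Matrix n n R) :
    (M.map f).charpolyRev = M.charpolyRev.map f := by
  rw [Matrix.charpolyRev, Matrix.charpolyRev, ← Polynomial.coe_mapRingHom, RingHom.map_det]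
  congr 1
  ext1 i j
  by_cases h : i = j <;> simp [h]

theorem eval_one_charpolyRev (M : Matrix n n R) : M.charpolyRev.eval 1 = (1 - M).det := by
  rw [Matrix.charpolyRev, ← Polynomial.coe_evalRingHom, RingHom.map_det]
  congr 1
  ext1 i j
  by_cases h : i = j <;> simp [h]

theorem charpolyRev_transpose (M : Matrix n n R) : M.transpose.charpolyRev = M.charpolyRev := by
  rw [Matrix.charpolyRev, Matrix.charpolyRev, ← Matrix.det_transpose]
  congr 1
  ext1 i j
  by_cases h : i = j
  · subst h; simp
  · simp [h, Ne.symm h]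

/-- The reversed polynomial is determined by the characteristic polynomial of the endomorphism,
which does not depend on the basis. -/
theorem hasRevCharpoly_iff {W : Type*} [AddCommGroup W] [Module R W]
    (b : Module.Basis n R W) (f : W →ₗ[R] W) (P : R[X]) :
    HasRevCharpoly f P ↔ (LinearMap.toMatrix b b f).charpolyRev = P := by
  have hfin : Module.Finite R W := Module.Finite.of_basis b
  have hfree : Module.Free R W := Module.Free.of_basis b
  constructor
  · rintro ⟨k, b', rfl⟩
    rw [← Matrix.reverse_charpoly, ← Matrix.reverse_charpoly, LinearMap.charpoly_toMatrix,
      LinearMap.charpoly_toMatrix]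
  · rintro rfl
    refine ⟨Fintype.card n, b.reindex (Fintype.equivFin n), ?_⟩
    rw [← Matrix.reverse_charpoly, ← Matrix.reverse_charpoly, LinearMap.charpoly_toMatrix,
      LinearMap.charpoly_toMatrix]

theorem toMatrix_dual {W : Type*} [AddCommGroup W] [Module R W] (b : Module.Basis n R W)
    (f : W →ₗ[R] W) : LinearMap.toMatrix b.dualBasis b.dualBasis f.dualMap =
      (LinearMap.toMatrix b b f).transpose := by
  ext i j
  rw [LinearMap.toMatrix_apply, Matrix.transpose_apply, LinearMap.toMatrix_apply]
  simp

end Charpoly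

/-! ### The contragredient of V_λ in terms of the Tate module. -/

section DualRepresentation

open IsDedekindDomain

variable {Fq : Type*} [Field Fq]

/-- The inclusion of A in F stays injective after tensoring with the flat A-module A_λ. Identities
over F_λ may therefore be checked over A_λ. -/
theorem algebraMap_FLoc_injective (l : HeightOneSpectrum Fq[X]) :
    Function.Injective (algebraMap (ALoc l) (FLoc l)) :=
  Algebra.TensorProduct.includeLeft_injective (S := ALoc l) (A := ALoc l) (B := RatFunc Fq)
    (IsFractionRing.injective Fq[X] (RatFunc Fq))

theorem toFLoc_algebraMap (l : HeightOneSpectrum Fq[X]) (p : Fq[X]) :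
    toFLoc l (algebraMap Fq[X] (RatFunc Fq) p) =
      algebraMap (ALoc l) (FLoc l) (algebraMap Fq[X] (ALoc l) p) :=
  (Algebra.TensorProduct.includeRight :
    RatFunc Fq →ₐ[Fq[X]] ALoc l ⊗[Fq[X]] RatFunc Fq).commutes p

variable [Fintype Fq] {K : Type*} [Field K] [Algebra Fq K]
variable {M : Type*} [AddCommGroup M] [Module K[X] M] {n : Type*} [Fintype n] [DecidableEq n]
variable {σ : M →ₛₗ[coeffFrob Fq K] M} {l : HeightOneSpectrum Fq[X]}

/-- The inverse in the contragredient action cancels the one in the geometric Frobenius, so P_v is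
computed from an arithmetic Frobenius on the Tate module itself. -/
theorem dualGaloisRep_inv_apply (g : Gal(SeparableClosure K/K)) :
    dualGaloisRep σ l g⁻¹ = (galoisRep σ l g).dualMap := by
  refine LinearMap.ext fun f => LinearMap.ext fun x => ?_
  change f (galoisRep σ l g⁻¹⁻¹ x) = _
  rw [inv_inv]
  rfl

theorem toMatrix_galoisRep (bT : Module.Basis n (ALoc l) (tateModule σ l))
    (g : Gal(SeparableClosure K/K)) :
    LinearMap.toMatrix (Algebra.TensorProduct.basis (FLoc l) bT)
      (Algebra.TensorProduct.basis (FLoc l) bT) (galoisRep σ l g) =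
      (LinearMap.toMatrix bT bT (tateModuleRep σ l g)).map (algebraMap (ALoc l) (FLoc l)) :=
  LinearMap.toMatrix_baseChange _ _ _ _

theorem hasRevCharpoly_dualGaloisRep_inv_iff (bT : Module.Basis n (ALoc l) (tateModule σ l))
    (g : Gal(SeparableClosure K/K)) (P : (FLoc l)[X]) :
    HasRevCharpoly (dualGaloisRep σ l g⁻¹) P ↔
      (LinearMap.toMatrix bT bT (tateModuleRep σ l g)).charpolyRev.map
        (algebraMap (ALoc l) (FLoc l)) = P := by
  rw [hasRevCharpoly_iff (Algebra.TensorProduct.basis (FLoc l) bT).dualBasis,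
    dualGaloisRep_inv_apply, toMatrix_dual, charpolyRev_transpose, toMatrix_galoisRep,
    charpolyRev_map]

theorem dualGaloisRep_eq_one_iff (bT : Module.Basis n (ALoc l) (tateModule σ l))
    (g : Gal(SeparableClosure K/K)) :
    dualGaloisRep σ l g = 1 ↔ LinearMap.toMatrix bT bT (tateModuleRep σ l g) = 1 := by
  have h0 : dualGaloisRep σ l g = 1 ↔ dualGaloisRep σ l g⁻¹ = 1 := by
    constructor <;> intro h
    · have := map_mul (dualGaloisRep σ l) g⁻¹ g
      rw [inv_mul_cancel, map_one, h, mul_one] at this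
      exact this.symm
    · have := map_mul (dualGaloisRep σ l) g g⁻¹
      rw [mul_inv_cancel, map_one, h, mul_one] at this
      exact this.symm
  rw [h0]
  set bF := Algebra.TensorProduct.basis (FLoc l) bT
  rw [← (LinearMap.toMatrix bF.dualBasis bF.dualBasis).injective.eq_iff,
    dualGaloisRep_inv_apply, toMatrix_dual, toMatrix_galoisRep, LinearMap.toMatrix_one,
    ← Matrix.transpose_one, Matrix.transpose_inj]
  constructor <;> intro h
  · refine Matrix.map_injective (algebraMap_FLoc_injective l) ?_
    simpa using h
  · rw [h]
    simp

/-- The value P(1) is det(1 - g) on the Tate module, seen in F_λ; this moves the question of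
non-vanishing from F to A_λ. -/
theorem det_one_sub_eq_zero_of_eval_one (bT : Module.Basis n (ALoc l) (tateModule σ l))
    (g : Gal(SeparableClosure K/K)) {P : (RatFunc Fq)[X]}
    (hP : HasRevCharpoly (dualGaloisRep σ l g⁻¹) (P.map (toFLoc l))) (h1 : P.eval 1 = 0) :
    (1 - LinearMap.toMatrix bT bT (tateModuleRep σ l g)).det = 0 := by
  rw [hasRevCharpoly_dualGaloisRep_inv_iff bT] at hP
  apply algebraMap_FLoc_injective l
  rw [map_zero, ← eval_one_charpolyRev, ← Polynomial.eval_one_map, hP, Polynomial.eval_one_map, h1,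
    map_zero]

end DualRepresentation

end TMotive
end

open scoped Polynomial TensorProduct
noncomputable section
namespace TMotive

/-! ### Integrality of the solutions of X = A X^(q) at a place of good reduction. -/

section GoodReduction

variable {Fq : Type*} [Field Fq] [Fintype Fq] {n : Type*} [Fintype n] [DecidableEq n]

theorem coeffFrob_map {S T : Type*} [CommRing S] [CommRing T] [Algebra Fq S] [Algebra Fq T]
    (f : S →+* T) (p : S[X]) :
    coeffFrob Fq T (p.map f) = (coeffFrob Fq S p).map f := by
  ext i
  simp [coeffFrob]

theorem coeffFrob_map_algebraMap' {S : Type*} [CommRing S] [Algebra Fq S] (p : Fq[X]) :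
    coeffFrob Fq S (p.map (algebraMap Fq S)) = p.map (algebraMap Fq S) := by
  rw [coeffFrob, Polynomial.coe_mapRingHom, Polynomial.map_map]
  congr 1
  ext x
  simp

theorem coeffFrob_pow_apply {S : Type*} [CommRing S] [Algebra Fq S] (e : ℕ) (p : S[X]) (i : ℕ) :
    ((coeffFrob Fq S ^ e) p).coeff i = p.coeff i ^ Fintype.card Fq ^ e := by
  induction e generalizing p with
  | zero => simp
  | succ e ih =>
    rw [pow_succ, RingHom.mul_def, RingHom.comp_apply, ih, pow_succ', pow_mul]
    simp [coeffFrob]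

variable {L : Type*} [Field L] [Algebra Fq L] {B : Type*} [CommRing B] [IsDomain B]
  [ValuationRing B] [Algebra B L] [IsFractionRing B L] [Algebra Fq B] [IsScalarTower Fq B L]

theorem map_map_algebraMap_tower (p : Fq[X]) :
    (p.map (algebraMap Fq B)).map (algebraMap B L) = p.map (algebraMap Fq L) := by
  rw [Polynomial.map_map, IsScalarTower.algebraMap_eq Fq B L]

/-- Solutions modulo `l` of an integral linear system for `z^(q)` in terms of `z` are integral. -/
theorem exists_map_eq_of_coeffFrob_eq_mulVec {l : Fq[X]} (hl : l.Monic) {A : Matrix n n B[X]}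
    {z : n → L[X]} (hz : ∀ i, (z i).degree < (l.map (algebraMap Fq L)).degree)
    (hzA : ∀ i, l.map (algebraMap Fq L) ∣ coeffFrob Fq L (z i) -
      (A.map (Polynomial.mapRingHom (algebraMap B L))).mulVec z i) (i : n) :
    ∃ y : B[X], y.map (algebraMap B L) = z i := by
  classical
  set w := ValuationRing.valuation B L
  have hmem : ∀ x : L, w x ≤ 1 ↔ ∃ a : B, algebraMap B L a = x :=
    ValuationRing.mem_integer_iff B L
  have hlB : (l.map (algebraMap Fq B)).Monic := hl.map _
  suffices h : ∀ i k, w ((z i).coeff k) ≤ 1 by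
    have h1 : z i ∈ Polynomial.lifts (algebraMap B L) := by
      rw [Polynomial.lifts_iff_coeff_lifts]
      exact fun k => (hmem _).mp (h i k)
    exact (Polynomial.mem_lifts _).mp h1
  by_contra hcon
  push Not at hcon
  obtain ⟨i₀, k₀, h₀⟩ := hcon
  set D := (l.map (algebraMap Fq L)).natDegree with hD
  have hlt : ∀ i k, D ≤ k → (z i).coeff k = 0 := fun i k hk =>
    Polynomial.coeff_eq_zero_of_degree_lt (lt_of_lt_of_le (hz i)
      (Polynomial.degree_le_natDegree.trans (by exact_mod_cast hk)))
  -- A coefficient `c` of largest valuation, assumed non-integral, satisfies c^q = c · (integral),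
  -- which is absurd. The range has one index more than the degree needs, so that it is non-empty
  -- also for `D = 0`.
  obtain ⟨⟨i₁, k₁⟩, -, hmax⟩ := Finset.exists_max_image
    (Finset.univ ×ˢ Finset.range (D + 1)) (fun ik : n × ℕ => w ((z ik.1).coeff ik.2))
    ⟨(i₀, 0), by simp⟩
  have hmax' : ∀ i k, w ((z i).coeff k) ≤ w ((z i₁).coeff k₁) := by
    intro i k
    by_cases hk : k < D + 1
    · exact hmax (i, k) (by simp [hk])
    · rw [hlt i k (by omega), map_zero]
      exact zero_le
  set c := (z i₁).coeff k₁ with hc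
  have hc1 : 1 < w c := h₀.trans_le (hmax' i₀ k₀)
  have hc0 : c ≠ 0 := by
    rintro h
    rw [h, map_zero] at hc1
    exact not_lt_zero hc1
  have hdiv : ∀ i, ∃ y : B[X], Polynomial.C c * y.map (algebraMap B L) = z i := by
    intro i
    have h1 : Polynomial.C c⁻¹ * z i ∈ Polynomial.lifts (algebraMap B L) := by
      rw [Polynomial.lifts_iff_coeff_lifts]
      intro k
      rw [Polynomial.coeff_C_mul]
      refine (hmem _).mp ?_
      rw [map_mul, map_inv₀]
      calc (w c)⁻¹ * w ((z i).coeff k) ≤ (w c)⁻¹ * w c := by gcongr; exact hmax' i k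
        _ = 1 := inv_mul_cancel₀ (by rw [ne_eq, map_eq_zero]; exact hc0)
    obtain ⟨y, hy⟩ := (Polynomial.mem_lifts _).mp h1
    refine ⟨y, ?_⟩
    rw [hy, ← mul_assoc, ← Polynomial.C_mul, mul_inv_cancel₀ hc0, Polynomial.C_1, one_mul]
  choose y hy using hdiv
  have hfrob : coeffFrob Fq L (z i₁) =
      Polynomial.C c * ((A.mulVec y i₁) %ₘ l.map (algebraMap Fq B)).map (algebraMap B L) := by
    rw [← sub_eq_zero]
    apply Polynomial.eq_zero_of_dvd_of_degree_lt (p := l.map (algebraMap Fq L))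
    · have h1 : (A.map (Polynomial.mapRingHom (algebraMap B L))).mulVec z i₁ =
          Polynomial.C c * (A.mulVec y i₁).map (algebraMap B L) := by
        simp only [Matrix.mulVec, dotProduct, Polynomial.map_sum, Polynomial.map_mul,
          Matrix.map_apply, Polynomial.coe_mapRingHom, Finset.mul_sum]
        refine Finset.sum_congr rfl fun j _ => ?_
        rw [← hy j]
        ring
      have h2 := hzA i₁
      rw [h1] at h2
      have h3 := congrArg (Polynomial.map (algebraMap B L))
        (Polynomial.modByMonic_add_div (A.mulVec y i₁) (l.map (algebraMap Fq B)))
      rw [Polynomial.map_add, Polynomial.map_mul, map_map_algebraMap_tower] at h3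
      rw [← h3] at h2
      have h4 : coeffFrob Fq L (z i₁) - Polynomial.C c *
          ((A.mulVec y i₁) %ₘ l.map (algebraMap Fq B)).map (algebraMap B L) =
          (coeffFrob Fq L (z i₁) - Polynomial.C c *
            (((A.mulVec y i₁) %ₘ l.map (algebraMap Fq B)).map (algebraMap B L) +
              l.map (algebraMap Fq L) *
                ((A.mulVec y i₁) /ₘ l.map (algebraMap Fq B)).map (algebraMap B L))) +
          l.map (algebraMap Fq L) * (Polynomial.C c *
            ((A.mulVec y i₁) /ₘ l.map (algebraMap Fq B)).map (algebraMap B L)) := by ring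
      rw [h4]
      exact dvd_add h2 (Dvd.intro _ rfl)
    · refine lt_of_le_of_lt (Polynomial.degree_sub_le _ _) (max_lt ?_ ?_)
      · exact lt_of_le_of_lt Polynomial.degree_map_le (hz i₁)
      · rw [Polynomial.degree_C_mul hc0]
        refine lt_of_le_of_lt Polynomial.degree_map_le ?_
        refine lt_of_lt_of_eq (Polynomial.degree_modByMonic_lt _ hlB) ?_
        rw [hl.degree_map, hl.degree_map]
  have h5 := congrArg (fun p => w (p.coeff k₁)) hfrob
  have h6 : (coeffFrob Fq L (z i₁)).coeff k₁ = c ^ Fintype.card Fq := by simp [coeffFrob, hc]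
  simp only [h6, Polynomial.coeff_C_mul, Polynomial.coeff_map, map_mul, map_pow] at h5
  have h7 : w c ^ Fintype.card Fq ≤ w c := by
    rw [h5]
    calc _ ≤ w c * 1 := by gcongr; exact (hmem _).mpr ⟨_, rfl⟩
      _ = w c := mul_one _
  have h8 : w c < w c ^ Fintype.card Fq := by
    conv_lhs => rw [← pow_one (w c)]
    exact pow_lt_pow_right₀ hc1 Fintype.one_lt_card
  exact absurd h7 (not_le.mpr h8)

/-- Matrices congruent modulo `a`. -/
def MatCongr {S : Type*} [CommRing S] (a : S) (M M' : Matrix n n S) : Prop :=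
  ∃ C : Matrix n n S, M - M' = a • C

section MatCongr

variable {S : Type*} [CommRing S] {a : S} {M M' M'' M₁ M₁' : Matrix n n S}

theorem matCongr_iff : MatCongr a M M' ↔ ∀ i j, a ∣ (M - M') i j := by
  constructor
  · rintro ⟨C, hC⟩ i j
    rw [hC]
    exact Dvd.intro _ rfl
  · intro h
    choose C hC using h
    exact ⟨Matrix.of C, Matrix.ext hC⟩

theorem MatCongr.symm (h : MatCongr a M M') : MatCongr a M' M := by
  obtain ⟨C, hC⟩ := h
  exact ⟨-C, by rw [smul_neg, ← hC, neg_sub]⟩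

theorem MatCongr.refl (a : S) (M : Matrix n n S) : MatCongr a M M := ⟨0, by simp⟩

theorem MatCongr.trans (h : MatCongr a M M') (h' : MatCongr a M' M'') : MatCongr a M M'' := by
  obtain ⟨C, hC⟩ := h
  obtain ⟨C', hC'⟩ := h'
  exact ⟨C + C', by rw [smul_add, ← hC, ← hC', sub_add_sub_cancel]⟩

theorem MatCongr.mul (h : MatCongr a M M') (h' : MatCongr a M₁ M₁') :
    MatCongr a (M * M₁) (M' * M₁') := by
  obtain ⟨C, hC⟩ := h
  obtain ⟨C', hC'⟩ := h'
  refine ⟨C * M₁ + M' * C', ?_⟩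
  rw [smul_add, ← Matrix.smul_mul, ← Matrix.mul_smul, ← hC, ← hC', sub_mul, mul_sub,
    sub_add_sub_cancel]

theorem MatCongr.map {T : Type*} [CommRing T] (f : S →+* T) (h : MatCongr a M M') :
    MatCongr (f a) (M.map f) (M'.map f) := by
  obtain ⟨C, hC⟩ := h
  refine ⟨C.map f, ?_⟩
  ext i j
  have := congrArg f (congrFun (congrFun hC i) j)
  simpa using this

theorem MatCongr.map_eq {T : Type*} [CommRing T] (f : S →+* T) (hf : f a = 0)
    (h : MatCongr a M M') : M.map f = M'.map f := by
  obtain ⟨C, hC⟩ := h.map f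
  rw [hf, zero_smul, sub_eq_zero] at hC
  exact hC

end MatCongr

/-- Over a place of good reduction, a solution of `X = A X^(q)` modulo `l` is integral and
invertible modulo `l`. -/
theorem exists_integral_solution {l : Fq[X]} (hl : l.Monic) {A : Matrix n n B[X]}
    (hA : IsCoprime A.det (l.map (algebraMap Fq B))) {X : Matrix n n L[X]}
    (hX : IsCoprime X.det (l.map (algebraMap Fq L)))
    (hXA : MatCongr (l.map (algebraMap Fq L)) X
      (A.map (Polynomial.mapRingHom (algebraMap B L)) * X.map (coeffFrob Fq L))) :
    ∃ Z Y : Matrix n n B[X],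
      MatCongr (l.map (algebraMap Fq L)) X (Z.map (Polynomial.mapRingHom (algebraMap B L))) ∧
      MatCongr (l.map (algebraMap Fq B)) (Z * Y) 1 ∧
      MatCongr (l.map (algebraMap Fq B)) Z (A * Z.map (coeffFrob Fq B)) := by
  set lL := l.map (algebraMap Fq L) with hlL
  set lB := l.map (algebraMap Fq B) with hlB
  set ι := Polynomial.mapRingHom (algebraMap B L) with hι
  have hιl : ι lB = lL := map_map_algebraMap_tower l
  have hφl : coeffFrob Fq L lL = lL := coeffFrob_map_algebraMap l
  have hmonL : lL.Monic := hl.map _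
  have hmonB : lB.Monic := hl.map _
  have hinj : Function.Injective (algebraMap B L) := IsFractionRing.injective B L
  have hmod : ∀ M : Matrix n n L[X], MatCongr lL M (M.map (· %ₘ lL)) := fun M =>
    matCongr_iff.mpr fun i j => ⟨M i j /ₘ lL, by
      have := Polynomial.modByMonic_add_div (M i j) lL
      rw [Matrix.sub_apply, Matrix.map_apply]
      linear_combination -this⟩
  have hφcongr : ∀ {M M' : Matrix n n L[X]}, MatCongr lL M M' →
      MatCongr lL (M.map (coeffFrob Fq L)) (M'.map (coeffFrob Fq L)) := fun h => by
    have := h.map (coeffFrob Fq L)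
    rwa [hφl] at this
  have hlift : ∀ {M M' : Matrix n n B[X]}, MatCongr lL (M.map ι) (M'.map ι) →
      MatCongr lB M M' := fun {M M'} h => matCongr_iff.mpr fun i j => by
    have := matCongr_iff.mp h i j
    rw [← hιl] at this
    rw [← Polynomial.map_dvd_map (algebraMap B L) hinj hmonB]
    simpa [ι] using this
  obtain ⟨u, w, huw⟩ := hA
  -- the inverse of `A` modulo `l`
  set A' : Matrix n n B[X] := u • A.adjugate with hA'
  have hA'A : MatCongr lB (A' * A) 1 := ⟨-w • 1, by
    rw [hA', Matrix.smul_mul, Matrix.adjugate_mul, smul_smul, smul_smul, ← sub_eq_zero]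
    have : (u * A.det) • (1 : Matrix n n B[X]) = 1 - (w * lB) • 1 := by
      rw [eq_sub_iff_add_eq, ← add_smul, huw, one_smul]
    rw [this]
    module⟩
  have hA'AL : MatCongr lL (A'.map ι * A.map ι) 1 := by
    have := hA'A.map ι
    rwa [Matrix.map_mul, hιl, Matrix.map_one _ (map_zero ι) (map_one ι)] at this
  -- Inverting `A` modulo `l` brings the system into the form z^(q) ≡ A' z with integral `A'`, as
  -- the integrality criterion requires.
  have hφX : MatCongr lL (X.map (coeffFrob Fq L)) (A'.map ι * X) := by
    have h1 := (MatCongr.refl lL (A'.map ι)).mul hXA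
    have h2 := hA'AL.mul (MatCongr.refl lL (X.map (coeffFrob Fq L)))
    rw [one_mul, mul_assoc] at h2
    exact (h1.trans h2).symm
  set Z₀ := X.map (· %ₘ lL) with hZ₀
  have hXZ : MatCongr lL X Z₀ := hmod X
  have hZ₀A : MatCongr lL (Z₀.map (coeffFrob Fq L)) (A'.map ι * Z₀) :=
    ((hφcongr hXZ).symm.trans hφX).trans ((MatCongr.refl _ _).mul hXZ)
  have hZ : ∀ i j, ∃ y : B[X], y.map (algebraMap B L) = Z₀ i j := fun i j =>
    exists_map_eq_of_coeffFrob_eq_mulVec hl (A := A') (z := fun i => Z₀ i j)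
      (fun i => Polynomial.degree_modByMonic_lt _ hmonL)
      (fun i => matCongr_iff.mp hZ₀A i j) i
  choose Z hZ using hZ
  have hZι : (Matrix.of Z).map ι = Z₀ := Matrix.ext hZ
  obtain ⟨u', w', huw'⟩ := hX
  set Y₁ : Matrix n n L[X] := u' • X.adjugate with hY₁
  have hXY₁ : MatCongr lL (X * Y₁) 1 := ⟨-w' • 1, by
    rw [hY₁, Matrix.mul_smul, Matrix.mul_adjugate, smul_smul, smul_smul]
    have : (u' * X.det) • (1 : Matrix n n L[X]) = 1 - (w' * lL) • 1 := by
      rw [eq_sub_iff_add_eq, ← add_smul, huw', one_smul]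
    rw [this]
    module⟩
  have hY₁X : MatCongr lL (Y₁ * X) 1 := ⟨-w' • 1, by
    rw [hY₁, Matrix.smul_mul, Matrix.adjugate_mul, smul_smul, smul_smul]
    have : (u' * X.det) • (1 : Matrix n n L[X]) = 1 - (w' * lL) • 1 := by
      rw [eq_sub_iff_add_eq, ← add_smul, huw', one_smul]
    rw [this]
    module⟩
  set Y₀ := Y₁.map (· %ₘ lL) with hY₀
  have hYY : MatCongr lL Y₁ Y₀ := hmod Y₁
  have hXY : MatCongr lL (X * Y₀) 1 := ((MatCongr.refl _ X).mul hYY).symm.trans hXY₁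
  have hYX : MatCongr lL (Y₀ * X) 1 := (hYY.symm.mul (MatCongr.refl _ X)).trans hY₁X
  have hφXY : MatCongr lL (X.map (coeffFrob Fq L) * Y₀.map (coeffFrob Fq L)) 1 := by
    have := hφcongr hXY
    rwa [Matrix.map_mul, Matrix.map_one _ (map_zero _) (map_one _)] at this
  -- The inverse of `X` satisfies Y^(q) ≡ Y A, a system of the same kind for its rows. Integrality
  -- of both makes the solution invertible over `B`, so that it stays invertible after reduction.
  have hφY : MatCongr lL (Y₀.map (coeffFrob Fq L)) (Y₀ * A.map ι) := by
    have h1 := hYX.symm.trans ((MatCongr.refl _ Y₀).mul hXA)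
    have h2 := h1.mul (MatCongr.refl _ (Y₀.map (coeffFrob Fq L)))
    rw [one_mul, mul_assoc, mul_assoc, ← mul_assoc Y₀] at h2
    have h3 := (MatCongr.refl lL (Y₀ * A.map ι)).mul hφXY
    rw [mul_one] at h3
    exact h2.trans h3
  have hY : ∀ i j, ∃ y : B[X], y.map (algebraMap B L) = Y₀ i j := fun i j =>
    exists_map_eq_of_coeffFrob_eq_mulVec hl (A := A.transpose) (z := fun j => Y₀ i j)
      (fun i => Polynomial.degree_modByMonic_lt _ hmonL)
      (fun j => by
        have h1 := matCongr_iff.mp hφY i j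
        have h2 : (A.transpose.map (Polynomial.mapRingHom (algebraMap B L))).mulVec
            (fun j => Y₀ i j) j = (Y₀ * A.map ι) i j := by
          rw [Matrix.mul_apply, Matrix.mulVec, dotProduct]
          exact Finset.sum_congr rfl fun k _ => mul_comm _ _
        rw [h2]
        exact h1) j
  choose Y hY using hY
  have hYι : (Matrix.of Y).map ι = Y₀ := Matrix.ext hY
  refine ⟨Matrix.of Z, Matrix.of Y, by rwa [hZι], hlift ?_, hlift ?_⟩
  · rw [Matrix.map_mul, hZι, hYι, Matrix.map_one _ (map_zero ι) (map_one ι)]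
    exact (hXZ.symm.mul (MatCongr.refl _ _)).trans hXY
  · have h1 : ((Matrix.of Z).map (coeffFrob Fq B)).map ι = Z₀.map (coeffFrob Fq L) := by
      rw [← hZι]
      ext1 i j
      exact (coeffFrob_map (algebraMap B L) _).symm
    rw [Matrix.map_mul, h1, hZι]
    exact hXZ.symm.trans (hXA.trans ((MatCongr.refl _ _).mul (hφcongr hXZ)))

end GoodReduction

end TMotive
end

open scoped Polynomial TensorProduct
noncomputable section
namespace TMotive

/-! ### Frobenius and inertia at a place of good reduction. -/

section Frobenius

variable {Fq : Type*} [Field Fq] [Fintype Fq] {n : Type*} [Fintype n] [DecidableEq n]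

theorem exists_coeffFrob_adjoinRoot {k : Type*} [CommRing k] [Algebra Fq k] (l : Fq[X]) :
    ∃ φ : AdjoinRoot (l.map (algebraMap Fq k)) →+* AdjoinRoot (l.map (algebraMap Fq k)),
      ∀ p, φ (AdjoinRoot.mk _ p) = AdjoinRoot.mk _ (coeffFrob Fq k p) := by
  refine ⟨AdjoinRoot.map (frobHom Fq k) _ _ (by
      have := coeffFrob_map_algebraMap' (S := k) l
      rw [coeffFrob, Polynomial.coe_mapRingHom] at this
      rw [this]), fun p => ?_⟩
  simp only [AdjoinRoot.map, AdjoinRoot.lift_mk, Polynomial.eval₂_eq_eval_map]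
  rw [← Polynomial.map_map, ← Polynomial.eval₂_eq_eval_map, ← AdjoinRoot.aeval_eq,
    Polynomial.aeval_def]
  rfl

variable {L : Type*} [Field L] [Algebra Fq L] {B : Type*} [CommRing B] [IsDomain B]
  [ValuationRing B] [Algebra B L] [IsFractionRing B L] [Algebra Fq B] [IsScalarTower Fq B L]
  {k : Type*} [Field k] [Algebra Fq k]

/-- The relation between a lift `γ` of a power of Frobenius, its matrix `Φ` on the solutions of
`X = A X^(q)` modulo `l`, and the reduction of `A`. -/
theorem exists_reduction {l : Fq[X]} (hl : l.Monic) {A Z Y : Matrix n n B[X]} {X : Matrix n n L[X]}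
    (hXZ : MatCongr (l.map (algebraMap Fq L)) X
      (Z.map (Polynomial.mapRingHom (algebraMap B L))))
    (hZY : MatCongr (l.map (algebraMap Fq B)) (Z * Y) 1)
    (hZA : MatCongr (l.map (algebraMap Fq B)) Z (A * Z.map (coeffFrob Fq B)))
    (res : B →ₐ[Fq] k) (γ : L →ₐ[Fq] L) (γB : B →ₐ[Fq] B)
    (hγ : ∀ b, γ (algebraMap B L b) = algebraMap B L (γB b)) {e : ℕ}
    (hres : ∀ b, res (γB b) = res b ^ Fintype.card Fq ^ e) {Φ : Matrix n n Fq[X]}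
    (hΦ : MatCongr (l.map (algebraMap Fq L))
      (X.map (Polynomial.mapRingHom (γ : L →+* L)))
      (X * Φ.map (Polynomial.mapRingHom (algebraMap Fq L)))) :
    ∃ (φ : AdjoinRoot (l.map (algebraMap Fq k)) →+* AdjoinRoot (l.map (algebraMap Fq k)))
      (z y : Matrix n n (AdjoinRoot (l.map (algebraMap Fq k)))),
      (∀ p, φ (AdjoinRoot.mk _ p) = AdjoinRoot.mk _ (coeffFrob Fq k p)) ∧ z * y = 1 ∧
      z = iterMat φ ((A.map (Polynomial.mapRingHom (res : B →+* k))).map (AdjoinRoot.mk _)) e *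
        z.map (φ ^ e) ∧
      z.map (φ ^ e) = z * (Φ.map (Polynomial.mapRingHom (algebraMap Fq k))).map
        (AdjoinRoot.mk _) := by
  set lk := l.map (algebraMap Fq k) with hlk
  obtain ⟨φ, hφ⟩ : ∃ φ : AdjoinRoot lk →+* AdjoinRoot lk,
      ∀ p, φ (AdjoinRoot.mk lk p) = AdjoinRoot.mk lk (coeffFrob Fq k p) :=
    exists_coeffFrob_adjoinRoot (k := k) l
  set lL := l.map (algebraMap Fq L) with hlL
  set lB := l.map (algebraMap Fq B) with hlB
  have hmonB : lB.Monic := hl.map _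
  have hinj : Function.Injective (algebraMap B L) := IsFractionRing.injective B L
  let ψ : B[X] →+* AdjoinRoot lk :=
    (AdjoinRoot.mk lk).comp (Polynomial.mapRingHom (res : B →+* k))
  have hψ : ∀ p, ψ p = AdjoinRoot.mk lk (p.map (res : B →+* k)) := fun p => rfl
  have hresl : ∀ p : Fq[X], (p.map (algebraMap Fq B)).map (res : B →+* k) =
      p.map (algebraMap Fq k) := fun p => by
    rw [Polynomial.map_map]
    congr 1
    exact res.comp_algebraMap
  have hψl : ψ lB = 0 := by
    rw [hψ, hresl, ← hlk, AdjoinRoot.mk_self]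
  have hφψ : ∀ p, φ (ψ p) = ψ (coeffFrob Fq B p) := fun p => by
    rw [hψ, hψ, hφ, coeffFrob_map]
  have hφψe : ∀ p, (φ ^ e) (ψ p) = ψ ((coeffFrob Fq B ^ e) p) := by
    intro p
    generalize e = m
    induction m generalizing p with
    | zero => simp [RingHom.one_def]
    | succ m ih =>
      rw [pow_succ, pow_succ, RingHom.mul_def, RingHom.mul_def, RingHom.comp_apply,
        RingHom.comp_apply (coeffFrob Fq B ^ m), ← ih, hφψ]
  refine ⟨φ, Z.map ψ, Y.map ψ, hφ, ?_, ?_, ?_⟩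
  · rw [← Matrix.map_mul, hZY.map_eq ψ hψl, Matrix.map_one _ (map_zero ψ) (map_one ψ)]
  · apply eq_iterMat_mul
    have h1 := hZA.map_eq ψ hψl
    rw [Matrix.map_mul] at h1
    conv_lhs => rw [h1]
    congr 1
    ext1 i j
    exact (hφψ _).symm
  · have h1 : MatCongr lB (Z.map (Polynomial.mapRingHom (γB : B →+* B)))
        (Z * Φ.map (Polynomial.mapRingHom (algebraMap Fq B))) := by
      have hXZ' := hXZ.map (Polynomial.mapRingHom (γ : L →+* L))
      have hγl : Polynomial.mapRingHom (γ : L →+* L) lL = lL := by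
        rw [Polynomial.coe_mapRingHom, hlL, Polynomial.map_map]
        congr 1
        exact γ.comp_algebraMap
      rw [hγl] at hXZ'
      have h2 := (hXZ'.symm.trans hΦ).trans (hXZ.mul (MatCongr.refl _ _))
      rw [matCongr_iff] at h2 ⊢
      intro i j
      rw [← Polynomial.map_dvd_map (algebraMap B L) hinj hmonB, map_map_algebraMap_tower]
      have h3 : ((Z.map (Polynomial.mapRingHom (γB : B →+* B)) -
          Z * Φ.map (Polynomial.mapRingHom (algebraMap Fq B))) i j).map (algebraMap B L) =
          ((Z.map (Polynomial.mapRingHom (algebraMap B L))).map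
            (Polynomial.mapRingHom (γ : L →+* L)) -
          Z.map (Polynomial.mapRingHom (algebraMap B L)) *
            Φ.map (Polynomial.mapRingHom (algebraMap Fq L))) i j := by
        rw [Matrix.sub_apply, Matrix.sub_apply, Polynomial.map_sub, Matrix.mul_apply,
          Matrix.mul_apply, Polynomial.map_sum]
        congr 1
        · ext m
          simp [hγ]
        · refine Finset.sum_congr rfl fun m _ => ?_
          rw [Polynomial.map_mul]
          simp only [Matrix.map_apply, Polynomial.coe_mapRingHom]
          rw [map_map_algebraMap_tower]
      rw [h3]
      exact h2 i j
    have h4 := h1.map_eq ψ hψl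
    -- On residues `γB` is the q^e-power map, so its effect on the reduced solution is that of `φ ^
    -- e`.
    have h5 : (Z.map (Polynomial.mapRingHom (γB : B →+* B))).map ψ = (Z.map ψ).map (φ ^ e) := by
      ext1 i j
      rw [Matrix.map_apply, Matrix.map_apply, Matrix.map_apply, Matrix.map_apply, hφψe, hψ, hψ]
      congr 1
      ext m
      rw [Polynomial.coeff_map, Polynomial.coeff_map, coeffFrob_pow_apply,
        Polynomial.coe_mapRingHom, Polynomial.coeff_map]
      simpa using hres _
    rw [← h5, h4, Matrix.map_mul]
    congr 1
    ext1 i j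
    rw [Matrix.map_apply, Matrix.map_apply, Matrix.map_apply, Matrix.map_apply, hψ]
    congr 1
    exact hresl _

theorem dvd_of_mk_map_eq_zero {l : Fq[X]} {p : Fq[X]}
    (h : AdjoinRoot.mk (l.map (algebraMap Fq k)) (p.map (algebraMap Fq k)) = 0) : l ∣ p := by
  rw [AdjoinRoot.mk_eq_zero] at h
  exact (Polynomial.map_dvd_map' (algebraMap Fq k)).mp h

/-- An automorphism acting trivially on the residue field acts trivially modulo `l`. -/
theorem dvd_sub_one_of_inertia {l : Fq[X]} (hl : l.Monic) {A Z Y : Matrix n n B[X]}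
    {X : Matrix n n L[X]}
    (hXZ : MatCongr (l.map (algebraMap Fq L)) X
      (Z.map (Polynomial.mapRingHom (algebraMap B L))))
    (hZY : MatCongr (l.map (algebraMap Fq B)) (Z * Y) 1)
    (hZA : MatCongr (l.map (algebraMap Fq B)) Z (A * Z.map (coeffFrob Fq B)))
    (res : B →ₐ[Fq] k) (γ : L →ₐ[Fq] L) (γB : B →ₐ[Fq] B)
    (hγ : ∀ b, γ (algebraMap B L b) = algebraMap B L (γB b))
    (hres : ∀ b, res (γB b) = res b) {Φ : Matrix n n Fq[X]}
    (hΦ : MatCongr (l.map (algebraMap Fq L))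
      (X.map (Polynomial.mapRingHom (γ : L →+* L)))
      (X * Φ.map (Polynomial.mapRingHom (algebraMap Fq L)))) (i j : n) :
    l ∣ (Φ - 1) i j := by
  obtain ⟨φ, z, y, -, hzy, -, hz⟩ := exists_reduction hl hXZ hZY hZA res γ γB hγ (e := 0)
    (by simpa using hres) hΦ
  have h1 : z.map ⇑(φ ^ 0) = z := by
    ext1 i j
    simp [RingHom.one_def]
  rw [h1] at hz
  have hyz : y * z = 1 := mul_eq_one_comm.mp hzy
  have h2 := congrArg (fun w => y * w) hz
  beta_reduce at h2
  rw [← mul_assoc, hyz, one_mul] at h2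
  have h3 : (1 : Matrix n n _) i j = AdjoinRoot.mk _ ((Φ i j).map (algebraMap Fq k)) :=
    congrFun (congrFun h2 i) j
  apply dvd_of_mk_map_eq_zero (k := k)
  rw [Matrix.sub_apply, Polynomial.map_sub, map_sub, ← h3]
  by_cases hij : i = j
  · subst hij
    rw [Matrix.one_apply_eq, Matrix.one_apply_eq, Polynomial.map_one, map_one, sub_self]
  · rw [Matrix.one_apply_ne hij, Matrix.one_apply_ne hij, Polynomial.map_zero, map_zero, sub_self]

/-- The characteristic polynomial of Frobenius modulo `l`. -/
theorem dvd_sub_of_frobenius {l : Fq[X]} (hl : l.Monic) {A Z Y : Matrix n n B[X]}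
    {X : Matrix n n L[X]}
    (hXZ : MatCongr (l.map (algebraMap Fq L)) X
      (Z.map (Polynomial.mapRingHom (algebraMap B L))))
    (hZY : MatCongr (l.map (algebraMap Fq B)) (Z * Y) 1)
    (hZA : MatCongr (l.map (algebraMap Fq B)) Z (A * Z.map (coeffFrob Fq B)))
    (res : B →ₐ[Fq] k) (γ : L →ₐ[Fq] L) (γB : B →ₐ[Fq] B)
    (hγ : ∀ b, γ (algebraMap B L b) = algebraMap B L (γB b)) {e : ℕ}
    (hres : ∀ b, res (γB b) = res b ^ Fintype.card Fq ^ e) {Φ : Matrix n n Fq[X]}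
    (hΦ : MatCongr (l.map (algebraMap Fq L))
      (X.map (Polynomial.mapRingHom (γ : L →+* L)))
      (X * Φ.map (Polynomial.mapRingHom (algebraMap Fq L))))
    {D : Fq[X]} {G : Fq[X][X]}
    (hD : D.map (algebraMap Fq k) =
      (iterMat (coeffFrob Fq k) (A.map (Polynomial.mapRingHom (res : B →+* k))) e).det)
    (hG : G.map (Polynomial.mapRingHom (algebraMap Fq k)) =
      ((iterMat (coeffFrob Fq k) (A.map (Polynomial.mapRingHom (res : B →+* k))) e).map
        Polynomial.C - (Polynomial.X : k[X][X]) • 1).det) (m : ℕ) :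
    l ∣ D * Φ.charpolyRev.coeff m - G.coeff m := by
  obtain ⟨φ, z, y, hφ, hzy, hz, hzΦ⟩ := exists_reduction hl hXZ hZY hZA res γ γB hγ hres hΦ
  set mk := AdjoinRoot.mk (l.map (algebraMap Fq k))
  set Ak := A.map (Polynomial.mapRingHom (res : B →+* k)) with hAk
  set Φk := (Φ.map (Polynomial.mapRingHom (algebraMap Fq k))).map mk with hΦk
  have hiter : iterMat φ (Ak.map mk) e = (iterMat (coeffFrob Fq k) Ak e).map mk :=
    (iterMat_map (coeffFrob Fq k) φ mk (fun p => (hφ p).symm) Ak e).symm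
  rw [hiter] at hz
  set Ae := iterMat (coeffFrob Fq k) Ak e with hAe
  have hyz : y * z = 1 := mul_eq_one_comm.mp hzy
  -- From z = A_e z^(φ^e) and z^(φ^e) = z Φ: the reduction of A_e is z Φ^{-1} z^{-1}. Hence A_e - X
  -- = A_e z (1 - X Φ) z^{-1}, which is the asserted identity after taking determinants.
  have h1 : Ae.map mk * z * Φk * y = 1 := by
    rw [mul_assoc (Ae.map mk), ← hzΦ, ← hz, hzy]
  have key : Polynomial.C (Ae.map mk).det * Φk.charpolyRev =
      ((Ae.map mk).map Polynomial.C - (Polynomial.X : (AdjoinRoot (l.map (algebraMap Fq k)))[X]) • 1).det := by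
    set c : AdjoinRoot (l.map (algebraMap Fq k)) →+* (AdjoinRoot (l.map (algebraMap Fq k)))[X] :=
      Polynomial.C with hc
    have hzy' : z.map c * y.map c = 1 := by
      rw [← Matrix.map_mul, hzy, Matrix.map_one _ (map_zero c) (map_one c)]
    have h2 : ((Ae.map mk).map c - (Polynomial.X : (AdjoinRoot (l.map (algebraMap Fq k)))[X]) • 1) =
        (Ae.map mk).map c * (z.map c * (1 - (Polynomial.X : (AdjoinRoot (l.map (algebraMap Fq k)))[X]) • Φk.map c) *
          y.map c) := by
      have h3 : (Ae.map mk).map c * z.map c * Φk.map c * y.map c = 1 := by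
        rw [← Matrix.map_mul, ← Matrix.map_mul, ← Matrix.map_mul, h1,
          Matrix.map_one _ (map_zero c) (map_one c)]
      rw [mul_sub, mul_one, sub_mul, hzy', mul_sub, mul_one, Matrix.mul_smul, Matrix.smul_mul,
        Matrix.mul_smul, ← mul_assoc, ← mul_assoc, h3]
    rw [h2, Matrix.det_mul, Matrix.det_mul, Matrix.det_mul, mul_comm (z.map c).det, mul_assoc _ _
      (y.map c).det, ← Matrix.det_mul, hzy', Matrix.det_one, mul_one, Matrix.charpolyRev]
    congr 1
    exact RingHom.map_det c _
  have hΦrev : Φk.charpolyRev =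
      (Φ.charpolyRev.map (Polynomial.mapRingHom (algebraMap Fq k))).map mk := by
    rw [hΦk, charpolyRev_map, charpolyRev_map]
  have hGk : ((Ae.map mk).map Polynomial.C - (Polynomial.X : (AdjoinRoot (l.map (algebraMap Fq k)))[X]) • 1).det =
      (G.map (Polynomial.mapRingHom (algebraMap Fq k))).map mk := by
    rw [hG, ← Polynomial.coe_mapRingHom mk, RingHom.map_det]
    congr 1
    ext1 i j
    by_cases hij : i = j <;> simp [hij]
  have hDk : (Ae.map mk).det = mk (D.map (algebraMap Fq k)) := by
    rw [hD]
    exact (RingHom.map_det mk _).symm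
  rw [hΦrev, hGk, hDk] at key
  have h4 := congrArg (fun p => p.coeff m) key
  simp only [Polynomial.coeff_C_mul, Polynomial.coeff_map, Polynomial.coe_mapRingHom] at h4
  apply dvd_of_mk_map_eq_zero (k := k)
  rw [Polynomial.map_sub, Polynomial.map_mul, map_sub, map_mul]
  exact sub_eq_zero.mpr h4

end Frobenius

/-! ### Descent of the characteristic polynomial of σ^d to 𝔽_q[t]. -/

section FrobeniusInvariants

variable {Fq : Type*} [Field Fq] [Fintype Fq] {n : Type*} [Fintype n] [DecidableEq n]
  {k : Type*} [Field k] [Algebra Fq k]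

theorem coeffFrob_pow_eq_self {d : ℕ} (hd : ∀ x : k, x ^ Fintype.card Fq ^ d = x) (p : k[X]) :
    (coeffFrob Fq k ^ d) p = p := by
  ext i
  rw [coeffFrob_pow_apply, hd]

/-- Over `𝔽_{q^d}`, the characteristic polynomial of `A A^(q) ⋯ A^(q^(d-1))` has coefficients in
`𝔽_q[t]`. -/
theorem exists_map_eq_det_sub {d : ℕ} (hd : ∀ x : k, x ^ Fintype.card Fq ^ d = x)
    {A : Matrix n n k[X]} (hA : A.det ≠ 0) :
    ∃ G : Fq[X][X], G.map (Polynomial.mapRingHom (algebraMap Fq k)) =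
      ((iterMat (coeffFrob Fq k) A d).map Polynomial.C - (Polynomial.X : k[X][X]) • 1).det := by
  set Ad := iterMat (coeffFrob Fq k) A d with hAd
  set φ := coeffFrob Fq k with hφ
  set W := (Ad.map Polynomial.C - (Polynomial.X : k[X][X]) • 1).det with hW
  -- Two ways of writing the iterate of length d + 1, using that `φ ^ d` fixes `A`. Frobenius thus
  -- conjugates `Ad` by `A`, and its characteristic polynomial is Frobenius-invariant.
  have h1 : A * Ad.map φ = Ad * A := by
    have h2 := iterMat_add φ A 1 d
    have h3 := iterMat_add φ A d 1
    rw [add_comm, h3] at h2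
    have h4 : iterMat φ A 1 = A := by simp [iterMat]
    have h5 : A.map (φ ^ d) = A := by
      ext1 i j
      exact coeffFrob_pow_eq_self hd _
    rw [h4, h5, pow_one] at h2
    exact h2.symm
  have hfix : W.map φ = W := by
    have h2 : W.map φ = ((Ad.map φ).map Polynomial.C - (Polynomial.X : k[X][X]) • 1).det := by
      rw [hW, ← Polynomial.coe_mapRingHom, RingHom.map_det]
      congr 1
      ext1 i j
      by_cases hij : i = j <;> simp [hij]
    have h3 : A.map Polynomial.C * ((Ad.map φ).map Polynomial.C - (Polynomial.X : k[X][X]) • 1) =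
        (Ad.map Polynomial.C - (Polynomial.X : k[X][X]) • 1) * A.map Polynomial.C := by
      rw [mul_sub, sub_mul, ← Matrix.map_mul, ← Matrix.map_mul, h1, Matrix.mul_smul,
        Matrix.smul_mul, mul_one, one_mul]
    have h4 := congrArg Matrix.det h3
    rw [Matrix.det_mul, Matrix.det_mul, ← h2, mul_comm] at h4
    have h5 : (A.map (Polynomial.C : k[X] →+* k[X][X])).det ≠ 0 := by
      have : (A.map (Polynomial.C : k[X] →+* k[X][X])).det = Polynomial.C A.det :=
        (RingHom.map_det Polynomial.C A).symm
      rw [this]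
      exact Polynomial.C_ne_zero.mpr hA
    exact mul_right_cancel₀ h5 h4
  have h6 : W ∈ Polynomial.lifts (Polynomial.mapRingHom (algebraMap Fq k)) := by
    rw [Polynomial.lifts_iff_coeff_lifts]
    intro m
    refine exists_map_eq_of_coeffFrob_eq ?_
    conv_rhs => rw [← hfix]
    rw [Polynomial.coeff_map]
  exact (Polynomial.mem_lifts _).mp h6

theorem coeff_zero_det_sub (Ad : Matrix n n k[X]) :
    (Ad.map Polynomial.C - (Polynomial.X : k[X][X]) • 1).det.coeff 0 = Ad.det := by
  rw [Polynomial.coeff_zero_eq_eval_zero, ← Polynomial.coe_evalRingHom, RingHom.map_det]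
  congr 1
  ext1 i j
  by_cases hij : i = j <;> simp [hij]

end FrobeniusInvariants

end TMotive
end

open scoped Polynomial TensorProduct
noncomputable section
namespace TMotive

/-! ### Power series expansion in t - c. -/

section Expansion

variable {Fq : Type*} [Field Fq] {S T : Type*} [CommRing S] [Algebra Fq S] [CommRing T]
  [Algebra Fq T]

variable (S) in
/-- The expansion of a polynomial in powers of `t - c`. -/
def expand (c : Fq) : S[X] →+* PowerSeries S :=
  Polynomial.eval₂RingHom PowerSeries.C (PowerSeries.X + PowerSeries.C (algebraMap Fq S c))

theorem expand_C (c : Fq) (a : S) : expand S c (Polynomial.C a) = PowerSeries.C a := by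
  simp [expand]

theorem expand_X_sub_C (c : Fq) :
    expand S c (Polynomial.X - Polynomial.C (algebraMap Fq S c)) = PowerSeries.X := by
  simp [expand]

theorem expand_map (c : Fq) (f : S →ₐ[Fq] T) (p : S[X]) :
    expand T c (p.map (f : S →+* T)) = PowerSeries.map (f : S →+* T) (expand S c p) := by
  induction p using Polynomial.induction_on' with
  | add p p' h h' => simp only [Polynomial.map_add, map_add, h, h']
  | monomial k a => simp [expand, Polynomial.eval₂_monomial]

/-- The expansion is the Taylor shift at c followed by the inclusion of polynomials in power series.
-/
theorem expand_injective (c : Fq) : Function.Injective (expand S c) := by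
  have h : ∀ p, expand S c p = ((Polynomial.taylor (algebraMap Fq S c) p : S[X]) :
      PowerSeries S) := by
    intro p
    induction p using Polynomial.induction_on' with
    | add p p' h h' => rw [map_add, h, h', map_add, Polynomial.coe_add]
    | monomial k a =>
      rw [Polynomial.taylor_monomial, Polynomial.coe_mul, Polynomial.coe_pow, Polynomial.coe_add,
        Polynomial.coe_C, Polynomial.coe_X, Polynomial.coe_C]
      simp [expand, Polynomial.eval₂_monomial]
  intro p p' hp
  rw [h, h] at hp
  exact Polynomial.taylor_injective _ (Polynomial.coe_injective S hp)

variable (Fq S) in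
/-- The endomorphism of `S⟦s⟧` raising the coefficients to the `q`-th power. -/
abbrev seriesFrob [Fintype Fq] : PowerSeries S →+* PowerSeries S :=
  PowerSeries.map (frobHom Fq S)

theorem seriesFrob_expand [Fintype Fq] (c : Fq) (p : S[X]) :
    seriesFrob Fq S (expand S c p) = expand S c (coeffFrob Fq S p) :=
  (expand_map c (FiniteField.frobeniusAlgHom Fq S) p).symm

theorem seriesFrob_map [Fintype Fq] (f : S →ₐ[Fq] T) (p : PowerSeries S) :
    seriesFrob Fq T (PowerSeries.map (f : S →+* T) p) =
      PowerSeries.map (f : S →+* T) (seriesFrob Fq S p) := by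
  ext i
  simp

theorem coeff_seriesFrob_pow [Fintype Fq] (e : ℕ) (p : PowerSeries S) (i : ℕ) :
    PowerSeries.coeff i ((seriesFrob Fq S ^ e) p) =
      PowerSeries.coeff i p ^ Fintype.card Fq ^ e := by
  induction e generalizing p with
  | zero => simp [RingHom.one_def]
  | succ e ih =>
    rw [pow_succ, RingHom.mul_def, RingHom.comp_apply, ih, pow_succ', pow_mul]
    simp

end Expansion

/-! ### Extracting powers of a uniformizer from polynomials and power series. -/

section Primitive

variable {R k : Type*} [CommRing R] [IsDomain R] [Field k]

/-- `R` is a discrete valuation ring with uniformizer `π`, and `res` is the reduction to (an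
extension of) its residue field. -/
structure IsUniformizer (π : R) (res : R →+* k) : Prop where
  ne_zero : π ≠ 0
  res_eq_zero_iff : ∀ x, res x = 0 ↔ π ∣ x
  exists_pow : ∀ x, x ≠ 0 → ∃ (m : ℕ) (u : R), IsUnit u ∧ x = π ^ m * u

namespace IsUniformizer

variable {π : R} {res : R →+* k}

theorem finiteMultiplicity (h : IsUniformizer π res) {x : R} (hx : x ≠ 0) :
    FiniteMultiplicity π x := by
  obtain ⟨m, u, hu, rfl⟩ := h.exists_pow x hx
  refine ⟨m, fun hd => ?_⟩
  rw [pow_succ] at hd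
  have h1 := (h.res_eq_zero_iff u).mpr ((mul_dvd_mul_iff_left (pow_ne_zero _ h.ne_zero)).mp hd)
  exact (hu.map res).ne_zero h1

theorem C_dvd_iff (h : IsUniformizer π res) (p : R[X]) :
    Polynomial.C π ∣ p ↔ p.map res = 0 := by
  rw [Polynomial.C_dvd_iff_dvd_coeff, Polynomial.ext_iff]
  simp [h.res_eq_zero_iff]

theorem series_C_dvd_iff (h : IsUniformizer π res) (p : PowerSeries R) :
    PowerSeries.C π ∣ p ↔ PowerSeries.map res p = 0 := by
  constructor
  · rintro ⟨p', rfl⟩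
    rw [map_mul, PowerSeries.map_C, (h.res_eq_zero_iff π).mpr dvd_rfl, map_zero, zero_mul]
  · intro hp
    have hd : ∀ i, π ∣ PowerSeries.coeff i p := fun i =>
      (h.res_eq_zero_iff _).mp (by rw [← PowerSeries.coeff_map, hp]; simp)
    choose c hc using hd
    refine ⟨PowerSeries.mk c, ?_⟩
    ext i
    rw [PowerSeries.coeff_C_mul, PowerSeries.coeff_mk, hc]

theorem exists_eq_C_pow_mul (h : IsUniformizer π res) {p : R[X]} (hp : p ≠ 0) :
    ∃ (m : ℕ) (u : R[X]), p = Polynomial.C (π ^ m) * u ∧ u.map res ≠ 0 := by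
  have hc : p.leadingCoeff ≠ 0 := by simpa using hp
  obtain ⟨m, hm⟩ := h.finiteMultiplicity hc
  have hf : FiniteMultiplicity (Polynomial.C π) p := ⟨m, fun hd => hm (by
    rw [← Polynomial.C_pow, Polynomial.C_dvd_iff_dvd_coeff] at hd
    exact hd _)⟩
  obtain ⟨u, hu, hu0⟩ := hf.exists_eq_pow_mul_and_not_dvd
  exact ⟨_, u, by rwa [Polynomial.C_pow], by rwa [ne_eq, ← h.C_dvd_iff]⟩

/-- A single non-zero coefficient bounds the power of π that divides the whole series, so finiteness
of the series plays no role. -/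
theorem exists_eq_series_C_pow_mul (h : IsUniformizer π res) {p : PowerSeries R} (hp : p ≠ 0) :
    ∃ (m : ℕ) (u : PowerSeries R), p = PowerSeries.C (π ^ m) * u ∧ PowerSeries.map res u ≠ 0 := by
  obtain ⟨i, hi⟩ : ∃ i, PowerSeries.coeff i p ≠ 0 := by
    by_contra hi
    push Not at hi
    exact hp (PowerSeries.ext (by simpa using hi))
  obtain ⟨m, hm⟩ := h.finiteMultiplicity hi
  have hf : FiniteMultiplicity (PowerSeries.C π) p := ⟨m, fun ⟨v, hd⟩ => hm ⟨_, by
    rw [hd, ← map_pow, PowerSeries.coeff_C_mul]⟩⟩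
  obtain ⟨u, hu, hu0⟩ := hf.exists_eq_pow_mul_and_not_dvd
  exact ⟨_, u, by rwa [map_pow], by rwa [ne_eq, ← h.series_C_dvd_iff]⟩

end IsUniformizer

end Primitive

end TMotive
end

open scoped Polynomial TensorProduct
noncomputable section
namespace TMotive

/-! ### Saturated lattices and the reduction of σ at a possibly bad place. -/

section FrobeniusReduction

/-- A ring `P` with a prime element `ϖ` and its reduction `Pb`, mapping to a ring `S` in which `ϖ`
stays prime with reduction `Sb`, all of them with compatible lifts of Frobenius. -/
structure FrobeniusReduction (P Pb S Sb : Type*) [CommRing P] [CommRing Pb] [CommRing S]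
    [CommRing Sb] where
  E : P →+* S
  Eb : Pb →+* Sb
  r : P →+* Pb
  r' : S →+* Sb
  ϖ : P
  φ : P →+* P
  φb : Pb →+* Pb
  φS : S →+* S
  φSb : Sb →+* Sb
  q : ℕ
  d : ℕ
  two_le : 2 ≤ q
  d_pos : 0 < d
  ϖ_ne_zero : E ϖ ≠ 0
  r_surjective : Function.Surjective r
  Eb_injective : Function.Injective Eb
  r'_E : ∀ p, r' (E p) = Eb (r p)
  r_eq_zero_iff : ∀ p, r p = 0 ↔ ϖ ∣ p
  r'_eq_zero_iff : ∀ x, r' x = 0 ↔ E ϖ ∣ x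
  exists_pow : ∀ p, p ≠ 0 → ∃ (m : ℕ) (u : P), p = ϖ ^ m * u ∧ r u ≠ 0
  exists_pow' : ∀ x, x ≠ 0 → ∃ (m : ℕ) (u : S), x = E ϖ ^ m * u ∧ r' u ≠ 0
  φ_ϖ : φ ϖ = ϖ ^ q
  E_φ : ∀ p, E (φ p) = φS (E p)
  Eb_φ : ∀ p, Eb (φb p) = φSb (Eb p)
  r_φ : ∀ p, r (φ p) = φb (r p)
  r'_φ : ∀ x, r' (φS x) = φSb (r' x)
  φSb_injective : Function.Injective φSb
  φb_pow : ∀ p, (φb ^ d) p = p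

namespace FrobeniusReduction

variable {P Pb S Sb : Type*} [CommRing P] [CommRing Pb] [CommRing S] [CommRing Sb]
  (F : FrobeniusReduction P Pb S Sb) {n : Type*} [Fintype n] [DecidableEq n]

theorem r'_Eϖ : F.r' (F.E F.ϖ) = 0 := (F.r'_eq_zero_iff _).mpr dvd_rfl

theorem Eb_r_injective {p : P} (h : F.r' (F.E p) = 0) : F.r p = 0 := by
  rw [F.r'_E] at h
  exact F.Eb_injective (by rw [h, map_zero])

theorem det_updateCol_mulVec (Y : Matrix n n S) (c : n → S) (j : n) :
    (Y.updateCol j (Y.mulVec c)).det = c j * Y.det := by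
  rw [← Matrix.cramer_apply, Matrix.cramer_eq_adjugate_mulVec, Matrix.mulVec_mulVec,
    Matrix.adjugate_mul, Matrix.smul_mulVec, Matrix.one_mulVec, Pi.smul_apply, smul_eq_mul,
    mul_comm]

/-- The column `Y *ᵥ c` is not divisible by `ϖ` unless `c` is. -/
def Saturated (Y : Matrix n n S) : Prop :=
  ∀ c : n → P, (∀ i, F.E F.ϖ ∣ (Y.mulVec fun l => F.E (c l)) i) → ∀ i, F.r (c i) = 0

/-- Among all matrices obtained from `Y₀` by integral column operations and division by powers of ϖ,
take one whose determinant has the least power of ϖ. If a combination of columns with coefficient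
c_j not divisible by ϖ were divisible by ϖ, replacing column j by the quotient would lower that
power by one. -/
theorem exists_saturated [IsDomain S] [IsDomain Sb] {Y₀ : Matrix n n S} (hY₀ : Y₀.det ≠ 0) :
    ∃ (U : Matrix n n P) (a : ℕ) (Y : Matrix n n S),
      Y₀ * U.map F.E = F.E F.ϖ ^ a • Y ∧ Y.det ≠ 0 ∧ F.Saturated Y := by
  classical
  set p : ℕ → Prop := fun m => ∃ (U : Matrix n n P) (a : ℕ) (Y : Matrix n n S) (u : S),
    Y₀ * U.map F.E = F.E F.ϖ ^ a • Y ∧ Y.det = F.E F.ϖ ^ m * u ∧ F.r' u ≠ 0 with hp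
  have hex : ∃ m, p m := by
    obtain ⟨m, u, hu, hu0⟩ := F.exists_pow' _ hY₀
    exact ⟨m, 1, 0, Y₀, u, by simp, hu, hu0⟩
  obtain ⟨U, a, Y, u, hU, hY, hu⟩ := Nat.find_spec hex
  have hu0 : u ≠ 0 := fun h => hu (by rw [h, map_zero])
  refine ⟨U, a, Y, hU, ?_, ?_⟩
  · rw [hY]
    exact mul_ne_zero (pow_ne_zero _ F.ϖ_ne_zero) hu0
  intro c hc
  choose w hw using hc
  by_contra hne
  push Not at hne
  obtain ⟨j, hj⟩ := hne
  have hcol : (Y.mulVec fun l => F.E (c l)) = F.E F.ϖ • w := by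
    ext i
    rw [hw, Pi.smul_apply, smul_eq_mul]
  have hdet : F.E F.ϖ * (Y.updateCol j w).det = F.E (c j) * Y.det := by
    rw [← Matrix.det_updateCol_smul, ← hcol, det_updateCol_mulVec]
  have hcu : F.r' (F.E (c j) * u) ≠ 0 := by
    rw [map_mul]
    exact mul_ne_zero (fun h => hj (F.Eb_r_injective h)) hu
  -- At exponent zero no lowering is possible, but then the relation between columns would make ϖ
  -- divide the product of c_j with an element prime to ϖ.
  rcases hm : Nat.find hex with _ | m
  · rw [hm] at hY
    rw [hY, pow_zero, one_mul] at hdet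
    apply hcu
    rw [← hdet, map_mul, F.r'_Eϖ, zero_mul]
  · refine Nat.find_min hex (m := m) (by omega) ⟨(F.ϖ • U).updateCol j (U.mulVec c), a + 1,
      Y.updateCol j w, F.E (c j) * u, ?_, ?_, hcu⟩
    · have h1 : ((F.ϖ • U).updateCol j (U.mulVec c)).map F.E =
          (F.E F.ϖ • U.map F.E).updateCol j ((U.map F.E).mulVec fun l => F.E (c l)) := by
        ext i l
        by_cases hl : l = j
        · subst hl
          simp [Matrix.mulVec, dotProduct]
        · simp [Matrix.updateCol_ne hl]
      rw [h1, Matrix.mul_updateCol, Matrix.mulVec_mulVec, hU, Matrix.smul_mulVec, hcol,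
        Matrix.mul_smul, hU]
      ext i l
      by_cases hl : l = j
      · subst hl
        simp [pow_succ]
        ring
      · simp [Matrix.updateCol_ne hl, pow_succ]
        ring
    · apply mul_left_cancel₀ F.ϖ_ne_zero
      rw [hdet, hY, hm, pow_succ]
      ring

variable {F} in
theorem Saturated.exists_eq_mul [IsDomain S] {Y : Matrix n n S} (hY : F.Saturated Y) (e : ℕ)
    (c : n → P)
    (hc : ∀ i, F.E F.ϖ ^ e ∣ (Y.mulVec fun l => F.E (c l)) i) :
    ∃ c' : n → P, ∀ i, c i = F.ϖ ^ e * c' i := by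
  induction e with
  | zero => exact ⟨c, by simp⟩
  | succ e ih =>
    obtain ⟨c', hc'⟩ := ih fun i => (pow_dvd_pow _ (Nat.le_succ e)).trans (hc i)
    have h : ∀ i, F.r (c' i) = 0 := hY _ fun i => by
      have h1 := hc i
      have h2 : (Y.mulVec fun l => F.E (c l)) =
          F.E F.ϖ ^ e • (Y.mulVec fun l => F.E (c' l)) := by
        rw [← Matrix.mulVec_smul]
        congr 1
        ext l
        rw [hc', map_mul, map_pow, Pi.smul_apply, smul_eq_mul]
      rw [h2, Pi.smul_apply, smul_eq_mul, pow_succ] at h1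
      exact (mul_dvd_mul_iff_left (pow_ne_zero _ F.ϖ_ne_zero)).mp h1
    choose w hw using fun i => (F.r_eq_zero_iff _).mp (h i)
    exact ⟨w, fun i => by rw [hc', hw, pow_succ, mul_assoc]⟩

/-- The matrix of `σ` in a saturated lattice. -/
theorem exists_intertwine [IsDomain P] [IsDomain S] {Y₀ Y : Matrix n n S} {U A : Matrix n n P} {a : ℕ}
    (hA : Y₀.map F.φS = Y₀ * A.map F.E) (hU : Y₀ * U.map F.E = F.E F.ϖ ^ a • Y)
    (hYdet : Y.det ≠ 0) (hsat : F.Saturated Y) :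
    ∃ (H : Matrix n n P) (g : P) (a' : ℕ), F.r g ≠ 0 ∧ (∃ m, U.det = F.ϖ ^ m * g) ∧
      F.ϖ ^ a' • (U * H) = g • (A * U.map F.φ) ∧
      Y * H.map F.E = F.E g • Y.map F.φS := by
  have hπ := F.ϖ_ne_zero
  have hUdet : U.det ≠ 0 := by
    intro h
    have h1 := congrArg Matrix.det hU
    rw [Matrix.det_mul, Matrix.det_smul, ← RingHom.mapMatrix_apply, ← RingHom.map_det, h,
      map_zero, mul_zero] at h1
    exact mul_ne_zero (pow_ne_zero _ (pow_ne_zero _ hπ)) hYdet h1.symm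
  obtain ⟨e, g, hg, hg0⟩ := F.exists_pow _ hUdet
  have hφY : Y₀ * (A * U.map F.φ).map F.E = F.E F.ϖ ^ (a * F.q) • Y.map F.φS := by
    rw [Matrix.map_mul, ← Matrix.mul_assoc, ← hA, Matrix.map_map]
    have h1 : (F.E ∘ F.φ : P → S) = F.φS ∘ F.E := funext F.E_φ
    rw [h1, ← Matrix.map_map, ← Matrix.map_mul, hU]
    ext i j
    simp only [Matrix.map_apply, Matrix.smul_apply, smul_eq_mul, map_mul, map_pow]
    rw [← F.E_φ, F.φ_ϖ, map_pow, ← pow_mul, mul_comm F.q]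
  -- Frobenius raises ϖ to its q-th power, so twisting the relation for `Y` gains the surplus power
  -- a(q - 1).
  obtain ⟨b, hb⟩ : ∃ b, a * F.q = a + b := ⟨a * (F.q - 1), by
    obtain ⟨q, hq⟩ := Nat.exists_eq_add_of_le F.two_le
    rw [hq, show 2 + q - 1 = q + 1 by omega]
    ring⟩
  -- Up to det U this is U^{-1} A φ(U), the matrix of σ in the new lattice. Saturation allows all
  -- powers of ϖ to be divided out; the factor `g` of det U prime to ϖ remains as a denominator,
  -- since it is a polynomial and need not be a unit.
  set W := U.adjugate * (A * U.map F.φ) with hW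
  have hYW : Y * W.map F.E = F.E F.ϖ ^ (b + e) • (F.E g • Y.map F.φS) := by
    have h2 : F.E F.ϖ ^ a • (Y * W.map F.E) =
        F.E F.ϖ ^ a • (F.E F.ϖ ^ (b + e) • (F.E g • Y.map F.φS)) := by
      rw [← Matrix.smul_mul, ← hU, Matrix.mul_assoc, ← Matrix.map_mul, hW, ← Matrix.mul_assoc,
        Matrix.mul_adjugate, Matrix.smul_mul, Matrix.one_mul]
      have h3 : (U.det • (A * U.map F.φ)).map F.E = F.E U.det • (A * U.map F.φ).map F.E := by
        ext i j
        simp only [Matrix.map_apply, Matrix.smul_apply, smul_eq_mul, map_mul]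
      rw [h3, Matrix.mul_smul, hφY, hg, hb, map_mul, map_pow, smul_smul, smul_smul, smul_smul]
      congr 1
      ring
    ext i j
    exact mul_left_cancel₀ (pow_ne_zero a hπ) (by
      have := congrFun (congrFun h2 i) j
      simpa [Matrix.smul_apply] using this)
  have hcol : ∀ j, ∃ c' : n → P, ∀ i, W i j = F.ϖ ^ (b + e) * c' i := fun j =>
    hsat.exists_eq_mul (b + e) (fun i => W i j) fun i => by
      have h4 := congrFun (congrFun hYW i) j
      rw [Matrix.smul_apply, smul_eq_mul] at h4
      exact ⟨_, h4⟩
  choose H hH using hcol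
  have hWH : W = F.ϖ ^ (b + e) • (Matrix.of H).transpose := by
    ext i j
    rw [hH]
    simp
  refine ⟨(Matrix.of H).transpose, g, b, hg0, ⟨e, hg⟩, ?_, ?_⟩
  · have h5 : F.ϖ ^ e • (F.ϖ ^ b • (U * (Matrix.of H).transpose)) = F.ϖ ^ e • (g • (A * U.map F.φ)) := by
      rw [smul_smul, smul_smul, ← pow_add, add_comm e b, ← hg, ← Matrix.mul_smul, ← hWH, hW,
        ← Matrix.mul_assoc, Matrix.mul_adjugate, Matrix.smul_mul, Matrix.one_mul]
    ext i j
    have hϖ : F.ϖ ≠ 0 := fun h => hπ (by rw [h, map_zero])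
    exact mul_left_cancel₀ (pow_ne_zero e hϖ) (by
      have := congrFun (congrFun h5 i) j
      simpa [Matrix.smul_apply] using this)
  · rw [hWH] at hYW
    ext i j
    exact mul_left_cancel₀ (pow_ne_zero (b + e) hπ) (by
      have := congrFun (congrFun hYW i) j
      simpa [Matrix.mul_apply, Matrix.smul_apply, Finset.mul_sum, mul_left_comm] using this)

/-- Write a kernel vector of the reduced matrix as the Frobenius twist of a vector and lift the
latter to `c`. Then g φ(Y c) = Y H φ(c) reduces to 0, hence so does Y c, and saturation forces `c`
to reduce to 0. -/
theorem det_ne_zero_of_saturated [IsDomain Pb] [IsDomain Sb] {Y : Matrix n n S} {H : Matrix n n P} {g : P}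
    (hH : Y * H.map F.E = F.E g • Y.map F.φS) (hg : F.r g ≠ 0) (hsat : F.Saturated Y) :
    (H.map F.r).det ≠ 0 := by
  intro h0
  obtain ⟨v, hv0, hv⟩ := Matrix.exists_mulVec_eq_zero_iff.mpr h0
  -- The inverse of Frobenius on `Pb` is its power of exponent d - 1, since its d-th power is the
  -- identity.
  set v' : n → Pb := fun i => (F.φb ^ (F.d - 1)) (v i) with hv'
  have hφv : ∀ i, F.φb (v' i) = v i := fun i => by
    rw [hv', ← RingHom.comp_apply, ← RingHom.mul_def, ← pow_succ',
      Nat.sub_add_cancel F.d_pos, F.φb_pow]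
  choose c hc using fun i => F.r_surjective (v' i)
  have hrφ : ∀ i, F.r (F.φ (c i)) = v i := fun i => by rw [F.r_φ, hc, hφv]
  have key : ∀ i, F.E F.ϖ ∣ (Y.mulVec fun l => F.E (c l)) i := by
    intro i
    rw [← F.r'_eq_zero_iff]
    apply F.φSb_injective
    rw [map_zero, ← F.r'_φ]
    have h1 : F.E g * F.φS ((Y.mulVec fun l => F.E (c l)) i) =
        (Y.mulVec fun l => F.E ((H.mulVec fun l => F.φ (c l)) l)) i := by
      have h2 : (fun l => F.E ((H.mulVec fun l => F.φ (c l)) l)) =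
          (H.map F.E).mulVec fun l => F.φS (F.E (c l)) := by
        ext l
        simp [Matrix.mulVec, dotProduct, F.E_φ]
      rw [h2, Matrix.mulVec_mulVec, hH, Matrix.smul_mulVec, Pi.smul_apply, smul_eq_mul]
      simp [Matrix.mulVec, dotProduct]
    have h3 : F.r' (F.E g) * F.r' (F.φS ((Y.mulVec fun l => F.E (c l)) i)) = 0 := by
      rw [← map_mul, h1]
      have h4 : ∀ l, F.r' (F.E ((H.mulVec fun l => F.φ (c l)) l)) = 0 := fun l => by
        rw [F.r'_E]
        have h5 : F.r ((H.mulVec fun l => F.φ (c l)) l) = ((H.map F.r).mulVec v) l := by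
          simp [Matrix.mulVec, dotProduct, hrφ]
        rw [h5, hv, Pi.zero_apply, map_zero]
      simp only [Matrix.mulVec, dotProduct] at h4 ⊢
      rw [map_sum]
      exact Finset.sum_eq_zero fun l _ => by rw [map_mul, h4, mul_zero]
    exact (mul_eq_zero.mp h3).resolve_left fun h => hg (F.Eb_r_injective h)
  apply hv0
  ext i
  rw [← hφv, ← hc, hsat c key, map_zero, Pi.zero_apply]

/-- Compare powers of ϖ in det Y · det H = g^r φ(det Y), where r is the size of the matrices. With
ϖ^m the power in det Y, the left side has exponent m and the right side q m; since q ≥ 2 this forces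
m = 0. -/
theorem det_map_ne_zero [IsDomain Sb] [IsDomain S] {Y : Matrix n n S} {H : Matrix n n P} {g : P}
    (hH : Y * H.map F.E = F.E g • Y.map F.φS) (hY : Y.det ≠ 0)
    (hdet : (H.map F.r).det ≠ 0) : (Y.map F.r').det ≠ 0 := by
  obtain ⟨m, u, hu, hu0⟩ := F.exists_pow' _ hY
  have h1 := congrArg Matrix.det hH
  rw [Matrix.det_mul, Matrix.det_smul, ← RingHom.mapMatrix_apply, ← RingHom.map_det,
    ← RingHom.mapMatrix_apply, ← RingHom.map_det, hu, map_mul, map_pow, ← F.E_φ, F.φ_ϖ,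
    map_pow] at h1
  have h2 : F.r' (u * F.E H.det) ≠ 0 := by
    rw [map_mul, F.r'_E, RingHom.map_det, RingHom.mapMatrix_apply]
    exact mul_ne_zero hu0 ((map_ne_zero_iff _ F.Eb_injective).mpr hdet)
  rcases Nat.eq_zero_or_pos m with rfl | hm
  · rw [pow_zero, one_mul] at hu
    rw [← RingHom.mapMatrix_apply, ← RingHom.map_det, hu]
    exact hu0
  · exfalso
    apply h2
    obtain ⟨b, hb⟩ : ∃ b, F.q * m = m + (b + 1) := ⟨F.q * m - m - 1, by
      have := Nat.mul_le_mul_right m F.two_le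
      omega⟩
    have h3 : F.E F.ϖ ^ m * (u * F.E H.det) =
        F.E F.ϖ ^ m * (F.E F.ϖ * (F.E F.ϖ ^ b * F.E g ^ Fintype.card n * F.φS u)) := by
      rw [← mul_assoc, h1, ← pow_mul, hb]
      ring
    rw [mul_left_cancel₀ (pow_ne_zero _ F.ϖ_ne_zero) h3, map_mul, F.r'_Eϖ, zero_mul]

/-- A matrix whose product with a primitive matrix is divisible by `ϖ ^ e` is divisible. -/
theorem exists_eq_smul_of_mul [IsDomain P] [IsDomain Pb] {H : Matrix n n P} (hH : (H.map F.r).det ≠ 0)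
    (hϖ : F.ϖ ≠ 0) (e : ℕ) {Z : Matrix n n P} {W : Matrix n n P} (h : Z * H = F.ϖ ^ e • W) :
    ∃ Z', Z = F.ϖ ^ e • Z' := by
  induction e generalizing W with
  | zero => exact ⟨Z, by simp⟩
  | succ e ih =>
    obtain ⟨Z', rfl⟩ := ih (W := F.ϖ • W) (by rw [h, smul_smul, pow_succ])
    have h1 : Z' * H = F.ϖ • W := by
      ext i j
      exact mul_left_cancel₀ (pow_ne_zero e hϖ) (by
        have := congrFun (congrFun h i) j
        simpa [Matrix.smul_apply, pow_succ, mul_assoc] using this)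
    have h2 : ∀ i j, F.r (Z' i j) = 0 := by
      have h3 : Z'.map F.r * H.map F.r = 0 := by
        rw [← Matrix.map_mul, h1]
        ext i j
        simp [(F.r_eq_zero_iff F.ϖ).mpr dvd_rfl]
      have h4 : (H.map F.r).det • Z'.map F.r = 0 := by
        have := congrArg (· * (H.map F.r).adjugate) h3
        simpa [Matrix.mul_assoc, Matrix.mul_adjugate] using this
      intro i j
      have := congrFun (congrFun h4 i) j
      simpa [hH] using this
    choose W' hW' using fun i j => (F.r_eq_zero_iff _).mp (h2 i j)
    refine ⟨Matrix.of W', ?_⟩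
    ext i j
    simp [hW', pow_succ, mul_assoc]

/-- If the Frobenius `Ψ` has eigenvalue `1`, then so has the reduction of the matrix of `σ ^ d`. -/
theorem exists_eigenvector [IsDomain Sb] [IsDomain S] [IsDomain Pb] {Y : Matrix n n S} {H : Matrix n n P} {g : P}
    (hH : Y * H.map F.E = F.E g • Y.map F.φS) (hY : (Y.map F.r').det ≠ 0)
    {Ψ : Matrix n n Sb} (hΨ : (Y.map F.r').map (F.φSb ^ F.d) = Ψ * Y.map F.r')
    (h1 : (1 - Ψ).det = 0) :
    ∃ z : n → Pb, z ≠ 0 ∧ ∀ N, (iterMat F.φb (H.map F.r) (F.d * N)).mulVec z =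
      iterProd F.φb (F.r g) (F.d * N) • z := by
  set Yb := Y.map F.r' with hYb
  set Hb := H.map F.r with hHb
  have hHY : Yb * Hb.map F.Eb = F.Eb (F.r g) • Yb.map F.φSb := by
    have := congrArg (fun M => M.map F.r') hH
    simp only [Matrix.map_mul, Matrix.map_map] at this
    rw [hYb, hHb, Matrix.map_map, Matrix.map_map]
    have e1 : (F.Eb ∘ F.r : P → Sb) = F.r' ∘ F.E := funext fun p => (F.r'_E p).symm
    rw [e1, this]
    ext i j
    simp [F.r'_E, F.r'_φ]
  -- Iterating d times and inserting `hΨ` turns the intertwining relation into Yb · Hd = Gd · Ψ ·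
  -- Yb. Thus Hd - Gd is singular, and it has entries in the small ring `Pb`, where a kernel vector
  -- can be chosen.
  have hd := mul_iterMat_of_intertwine F.φSb (U := Yb) (H := Hb.map F.Eb)
    (B := F.Eb (F.r g) • 1) (by rw [hHY, Matrix.smul_mul, Matrix.one_mul]) F.d
  have hone : iterMat F.φSb (1 : Matrix n n Sb) F.d = 1 := by
    generalize F.d = d
    induction d with
    | zero => rfl
    | succ d ih => rw [iterMat, ih, Matrix.one_mul, Matrix.map_one _ (map_zero _) (map_one _)]
  rw [iterMat_smul, hone, Matrix.smul_mul, Matrix.one_mul, hΨ,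
    ← iterMat_map F.φb F.φSb F.Eb F.Eb_φ, ← iterProd_map F.φb F.φSb F.Eb F.Eb_φ] at hd
  set Hd := iterMat F.φb Hb F.d with hHd
  set Gd := iterProd F.φb (F.r g) F.d with hGd
  have hdet : (Hd - Gd • 1).det = 0 := by
    apply F.Eb_injective
    rw [map_zero, RingHom.map_det, RingHom.mapMatrix_apply]
    have h2 : Yb * (Hd - Gd • 1).map F.Eb = (F.Eb Gd • (Ψ - 1)) * Yb := by
      have h3 : (Hd - Gd • 1).map F.Eb = Hd.map F.Eb - F.Eb Gd • 1 := by
        ext i j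
        by_cases hij : i = j
        · subst hij; simp
        · simp [hij]
      rw [h3, Matrix.mul_sub, hd, Matrix.mul_smul, Matrix.mul_one, Matrix.smul_mul, Matrix.sub_mul,
        Matrix.one_mul, smul_sub]
    have h4 := congrArg Matrix.det h2
    have h5 : (Ψ - 1).det = 0 := by rw [← neg_sub, Matrix.det_neg, h1, mul_zero]
    rw [Matrix.det_mul, Matrix.det_mul, Matrix.det_smul, h5, mul_zero, zero_mul] at h4
    exact (mul_eq_zero.mp h4).resolve_left hY
  obtain ⟨z, hz, hzz⟩ := Matrix.exists_mulVec_eq_zero_iff.mpr hdet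
  refine ⟨z, hz, fun N => ?_⟩
  have hzd : Hd.mulVec z = Gd • z := by
    rw [Matrix.sub_mulVec, Matrix.smul_mulVec, Matrix.one_mulVec, sub_eq_zero] at hzz
    exact hzz
  rw [iterMat_mul_eq_pow _ _ _ (by ext i j; simp [-RingHom.coe_pow, F.φb_pow]), iterProd_mul_eq_pow _ _ _ (F.φb_pow _)]
  induction N with
  | zero => simp
  | succ N ih =>
    rw [pow_succ, ← Matrix.mulVec_mulVec, hzd, Matrix.mulVec_smul, ih, smul_smul, pow_succ']

theorem exists_iterProd_eq (m N : ℕ) : ∃ m', iterProd F.φ (F.ϖ ^ m) N = F.ϖ ^ m' := by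
  induction N with
  | zero => exact ⟨0, by simp [iterProd]⟩
  | succ N ih =>
    obtain ⟨m', hm'⟩ := ih
    exact ⟨m + F.q * m', by rw [iterProd_succ, hm', map_pow, F.φ_ϖ, ← pow_mul, pow_add]⟩

theorem exists_pow_φ_eq (m N : ℕ) : ∃ m', (F.φ ^ N) (F.ϖ ^ m) = F.ϖ ^ m' := by
  induction N with
  | zero => exact ⟨m, by simp⟩
  | succ N ih =>
    obtain ⟨m', hm'⟩ := ih
    exact ⟨F.q * m', by
      rw [pow_succ', RingHom.mul_def, RingHom.comp_apply, hm', map_pow, F.φ_ϖ, ← pow_mul]⟩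

theorem iterProd_mul (φ : P →+* P) (x y : P) (N : ℕ) :
    iterProd φ (x * y) N = iterProd φ x N * iterProd φ y N := by
  simp [iterProd, Finset.prod_mul_distrib]

/-- The adjugate of the matrix of `σ ^ N` in the saturated lattice, evaluated on the
eigenvector. -/
theorem exists_adjugate_mulVec [IsDomain P] [IsDomain Pb] {U A H : Matrix n n P}
    {g h : P} {a m m' N : ℕ} (hϖ : F.ϖ ≠ 0)
    (hUH : F.ϖ ^ a • (U * H) = g • (A * U.map F.φ)) (hU : U.det = F.ϖ ^ m * g)
    (hA : A.det = F.ϖ ^ m' * h) (hH : (H.map F.r).det ≠ 0) (hg : F.r g ≠ 0)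
    (hφb : Function.Injective F.φb)
    {z : n → Pb} (hz : (iterMat F.φb (H.map F.r) N).mulVec z = iterProd F.φb (F.r g) N • z) :
    ∃ (J : Matrix n n P) (e e' : ℕ),
      F.ϖ ^ e • ((U.map (F.φ ^ N)).adjugate * (iterMat F.φ A N).adjugate * U) = F.ϖ ^ e' • J ∧
      (J.map F.r).mulVec z = F.r (iterProd F.φ h N * (F.φ ^ N) g) • z := by
  obtain ⟨e, he⟩ := F.exists_iterProd_eq a N
  obtain ⟨e₁, he₁⟩ := F.exists_iterProd_eq m' N
  obtain ⟨e₂, he₂⟩ := F.exists_pow_φ_eq m N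
  set J₀ := (U.map (F.φ ^ N)).adjugate * (iterMat F.φ A N).adjugate * U with hJ₀
  set HN := iterMat F.φ H N with hHN
  set GN := iterProd F.φ g N with hGN
  set hN := iterProd F.φ h N with hhN
  -- Up to scalars `J₀` is the matrix of σ^{-N} in the saturated lattice, so its product with the
  -- matrix of σ^N is scalar. As that matrix has non-zero reduction determinant, the power of ϖ on
  -- the right already divides ϖ^e J₀.
  have hmul : (F.ϖ ^ e • J₀) * HN =
      F.ϖ ^ (e₁ + e₂) • ((GN * (hN * (F.φ ^ N) g)) • (1 : Matrix n n P)) := by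
    have h1 := mul_iterMat_of_intertwine F.φ (U := U) (H := F.ϖ ^ a • H) (B := g • A)
      (by rw [Matrix.mul_smul, hUH, Matrix.smul_mul]) N
    rw [iterMat_smul, iterMat_smul, he, Matrix.mul_smul] at h1
    have h2 : (F.ϖ ^ e • J₀) * HN = (U.map (F.φ ^ N)).adjugate *
        ((iterMat F.φ A N).adjugate * (F.ϖ ^ e • (U * HN))) := by
      rw [hJ₀, Matrix.smul_mul, Matrix.mul_smul, Matrix.mul_smul]
      simp only [Matrix.mul_assoc]
    rw [h2, h1, Matrix.smul_mul, Matrix.mul_smul, ← Matrix.mul_assoc (Matrix.adjugate _),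
      Matrix.adjugate_mul, det_iterMat, hA, iterProd_mul, he₁, Matrix.smul_mul, Matrix.one_mul,
      Matrix.mul_smul, Matrix.mul_smul, Matrix.adjugate_mul, ← RingHom.mapMatrix_apply,
      ← RingHom.map_det, hU, map_mul, he₂, smul_smul, smul_smul, smul_smul, pow_add]
    congr 1
    ring
  have hHNr : HN.map F.r = iterMat F.φb (H.map F.r) N := iterMat_map _ _ _ F.r_φ _ _
  have hGNr : F.r GN = iterProd F.φb (F.r g) N := iterProd_map _ _ _ F.r_φ _ _
  have hinj : ∀ i, Function.Injective (F.φb ^ i : Pb →+* Pb) := fun i => by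
    rw [RingHom.coe_pow]
    exact hφb.iterate i
  have hprod : ∀ x : Pb, x ≠ 0 → iterProd F.φb x N ≠ 0 := fun x hx =>
    Finset.prod_ne_zero_iff.mpr fun i _ => (map_ne_zero_iff _ (hinj i)).mpr hx
  have hHNdet : (HN.map F.r).det ≠ 0 := by
    rw [hHNr, det_iterMat]
    exact hprod _ hH
  obtain ⟨J, hJ⟩ := F.exists_eq_smul_of_mul hHNdet hϖ (e₁ + e₂) hmul
  refine ⟨J, e, e₁ + e₂, hJ, ?_⟩
  have hJH : J * HN = (GN * (hN * (F.φ ^ N) g)) • (1 : Matrix n n P) := by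
    rw [hJ, Matrix.smul_mul] at hmul
    ext i j
    exact mul_left_cancel₀ (pow_ne_zero (e₁ + e₂) hϖ) (by
      have := congrFun (congrFun hmul i) j
      simpa [-RingHom.coe_pow, Matrix.smul_apply] using this)
  have hJr : J.map F.r * HN.map F.r =
      (F.r GN * F.r (hN * (F.φ ^ N) g)) • (1 : Matrix n n Pb) := by
    rw [← Matrix.map_mul, hJH]
    ext i j
    by_cases hij : i = j
    · subst hij; simp [-RingHom.coe_pow]
    · simp [hij]
  have h6 := congrArg (fun M => M.mulVec z) hJr
  simp only [← Matrix.mulVec_mulVec, hHNr, hz, Matrix.mulVec_smul, Matrix.smul_mulVec,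
    Matrix.one_mulVec, hGNr] at h6
  ext i
  refine mul_left_cancel₀ (hprod _ hg) ?_
  have h7 := congrFun h6 i
  simpa [-RingHom.coe_pow, mul_assoc] using h7

end FrobeniusReduction

end FrobeniusReduction

end TMotive
end

open scoped Polynomial TensorProduct
noncomputable section
namespace TMotive

/-! ### Frobenius does not have the eigenvalue 1: the degree argument. -/

section NonVanishing

variable {Fq : Type*} [Field Fq] [Fintype Fq] {R R' k k' : Type*}
  [CommRing R] [IsDomain R] [Algebra Fq R] [CommRing R'] [IsDomain R'] [Algebra Fq R']
  [Field k] [Algebra Fq k] [Field k'] [Algebra Fq k']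
  [Algebra R R'] [IsScalarTower Fq R R'] [Algebra k k'] [IsScalarTower Fq k k']

variable (R R') in
/-- The expansion in powers of `t - c`, with coefficients in an `R`-algebra `R'`. -/
def expandMap (c : Fq) : R[X] →+* PowerSeries R' :=
  (expand R' c).comp (Polynomial.mapRingHom (algebraMap R R'))

theorem expandMap_C (c : Fq) (a : R) :
    expandMap R R' c (Polynomial.C a) = PowerSeries.C (algebraMap R R' a) := by
  simp [expandMap, expand_C]

theorem expandMap_coeffFrob (c : Fq) (p : R[X]) :
    expandMap R R' c (coeffFrob Fq R p) = seriesFrob Fq R' (expandMap R R' c p) := by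
  rw [expandMap, RingHom.comp_apply, RingHom.comp_apply, Polynomial.coe_mapRingHom,
    ← coeffFrob_map, seriesFrob_expand]

theorem expandMap_injective (c : Fq) (h : Function.Injective (algebraMap R R')) :
    Function.Injective (expandMap R R' c) :=
  (expand_injective c).comp (Polynomial.map_injective _ h)

/-- Polynomials over a discrete valuation ring `R` with finite residue field, expanded over an
unramified extension `R'`. -/
def IsUniformizer.frobeniusReduction {π : R} {res : R →ₐ[Fq] k} {res' : R' →ₐ[Fq] k'}
    (h : IsUniformizer π (res : R →+* k))
    (h' : IsUniformizer (algebraMap R R' π) (res' : R' →+* k'))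
    (hres : ∀ x, res' (algebraMap R R' x) = algebraMap k k' (res x))
    (hsurj : Function.Surjective res) {d : ℕ} (hd0 : 0 < d)
    (hd : ∀ x : k, x ^ Fintype.card Fq ^ d = x) (c : Fq) :
    FrobeniusReduction R[X] k[X] (PowerSeries R') (PowerSeries k') where
  E := expandMap R R' c
  Eb := expandMap k k' c
  r := Polynomial.mapRingHom (res : R →+* k)
  r' := PowerSeries.map (res' : R' →+* k')
  ϖ := Polynomial.C π
  φ := coeffFrob Fq R
  φb := coeffFrob Fq k
  φS := seriesFrob Fq R'
  φSb := seriesFrob Fq k'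
  q := Fintype.card Fq
  d := d
  two_le := Fintype.one_lt_card
  d_pos := hd0
  ϖ_ne_zero := by
    rw [expandMap_C, ne_eq, map_eq_zero_iff _ PowerSeries.C_injective]
    exact h'.ne_zero
  r_surjective := Polynomial.map_surjective _ hsurj
  Eb_injective := expandMap_injective c (algebraMap k k').injective
  r'_E p := by
    rw [expandMap, RingHom.comp_apply, ← expand_map, expandMap, RingHom.comp_apply]
    simp only [Polynomial.coe_mapRingHom, Polynomial.map_map]
    congr 2
    ext x
    simp [hres]
  r_eq_zero_iff p := (h.C_dvd_iff p).symm
  r'_eq_zero_iff x := by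
    rw [expandMap_C]
    exact (h'.series_C_dvd_iff x).symm
  exists_pow p hp := by
    obtain ⟨m, u, hu, hu0⟩ := h.exists_eq_C_pow_mul hp
    exact ⟨m, u, by rwa [← Polynomial.C_pow], hu0⟩
  exists_pow' p hp := by
    obtain ⟨m, u, hu, hu0⟩ := h'.exists_eq_series_C_pow_mul hp
    exact ⟨m, u, by rwa [expandMap_C, ← map_pow], hu0⟩
  φ_ϖ := by simp [coeffFrob]
  E_φ := expandMap_coeffFrob c
  Eb_φ := expandMap_coeffFrob c
  r_φ p := (coeffFrob_map _ p).symm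
  r'_φ p := (seriesFrob_map res' p).symm
  φSb_injective := by
    rw [injective_iff_map_eq_zero]
    intro p hp
    ext i
    have := congrArg (PowerSeries.coeff i) hp
    simpa using this
  φb_pow := coeffFrob_pow_eq_self hd

variable {n : Type*} [Fintype n] [DecidableEq n]

theorem natDegree_coeffFrob_pow (p : k[X]) (i : ℕ) :
    ((coeffFrob Fq k ^ i) p).natDegree = p.natDegree := by
  induction i with
  | zero => simp
  | succ i ih =>
    rw [pow_succ', RingHom.mul_def, RingHom.comp_apply, ← ih]
    exact Polynomial.natDegree_map_eq_of_injective
      (FiniteField.frobeniusAlgHom Fq k : k →+* k).injective _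

/-- `1` is not an eigenvalue of Frobenius. -/
theorem IsUniformizer.det_one_sub_ne_zero {π : R} {res : R →ₐ[Fq] k} {res' : R' →ₐ[Fq] k'}
    (h : IsUniformizer π (res : R →+* k))
    (h' : IsUniformizer (algebraMap R R' π) (res' : R' →+* k'))
    (hres : ∀ x, res' (algebraMap R R' x) = algebraMap k k' (res x))
    (hsurj : Function.Surjective res) {d : ℕ} (hd0 : 0 < d)
    (hd : ∀ x : k, x ^ Fintype.card Fq ^ d = x) (c : Fq)
    {A : Matrix n n R[X]} {α θ : R} {m : ℕ} (hα : α ≠ 0)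
    (hA : A.det = Polynomial.C α * (Polynomial.X - Polynomial.C θ) ^ m)
    (hdeg : ∀ C : ℕ, ∃ N₀ : ℕ, ∀ N ≥ N₀, ∀ i j,
      DegLE (m * N - C) ((iterMat (coeffFrob Fq R) A N).adjugate i j))
    {Y : Matrix n n (PowerSeries R')} (hYdet : Y.det ≠ 0)
    (hY : Y.map (seriesFrob Fq R') = Y * A.map (expandMap R R' c))
    (γ : R' →+* R') (hγR : ∀ x, γ (algebraMap R R' x) = algebraMap R R' x)
    (hγ : ∀ x, res' (γ x) = res' x ^ Fintype.card Fq ^ d)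
    {Ψ : Matrix n n (PowerSeries Fq)}
    (hΨ : Y.map (PowerSeries.map γ) = Ψ.map (PowerSeries.map (algebraMap Fq R')) * Y) :
    (1 - Ψ).det ≠ 0 := by
  intro h1
  set F := h.frobeniusReduction h' hres hsurj hd0 hd c with hF
  have hRR : Function.Injective (algebraMap R R') := by
    rw [injective_iff_map_eq_zero]
    intro x hx
    by_contra hx0
    obtain ⟨e, u, hu, rfl⟩ := h.exists_pow x hx0
    rw [map_mul, map_pow] at hx
    exact mul_ne_zero (pow_ne_zero _ h'.ne_zero) (hu.map (algebraMap R R')).ne_zero hx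
  obtain ⟨U, a, Y', hU, hY'det, hsat⟩ := F.exists_saturated hYdet
  obtain ⟨H, g, a', hg, ⟨e, hUdet⟩, hUH, hYH⟩ := F.exists_intertwine (A := A) hY hU hY'det hsat
  have hHdet := F.det_ne_zero_of_saturated hYH hg hsat
  have hY'b := F.det_map_ne_zero hYH hY'det hHdet
  -- The lattice change has entries over `R`, which γ fixes, so Y' satisfies the same Galois
  -- relation as `Y`; on residues γ is the q^d-power map.
  have hφγ : (Y'.map F.r').map (F.φSb ^ F.d) =
      (Ψ.map (PowerSeries.map (algebraMap Fq k'))) * Y'.map F.r' := by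
    have h2 : Y'.map (PowerSeries.map γ) = Ψ.map (PowerSeries.map (algebraMap Fq R')) * Y' := by
      have h3 : ∀ p : R[X], PowerSeries.map γ (F.E p) = F.E p := by
        intro p
        change PowerSeries.map γ (expandMap R R' c p) = expandMap R R' c p
        have hγFq : ∀ x : Fq, γ (algebraMap Fq R' x) = algebraMap Fq R' x := fun x => by
          rw [IsScalarTower.algebraMap_apply Fq R R', hγR]
        have h4 := (expand_map c (AlgHom.mk γ hγFq) (p.map (algebraMap R R'))).symm
        have h5 : (p.map (algebraMap R R')).map ((AlgHom.mk γ hγFq : R' →ₐ[Fq] R') : R' →+* R') =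
            p.map (algebraMap R R') := by
          rw [Polynomial.map_map]
          congr 1
          ext x
          exact hγR x
        rw [h5] at h4
        exact h4
      have h6 := congrArg (fun M => M.map (PowerSeries.map γ)) hU
      simp only [Matrix.map_mul, hΨ, Matrix.map_map] at h6
      rw [show (⇑(PowerSeries.map γ) ∘ ⇑F.E : R[X] → PowerSeries R') = F.E from funext h3,
        Matrix.mul_assoc, hU] at h6
      ext1 i j
      have h7 := congrFun (congrFun h6 i) j
      refine mul_left_cancel₀ (pow_ne_zero a F.ϖ_ne_zero) ?_
      rw [Matrix.mul_smul, Matrix.smul_apply, smul_eq_mul, Matrix.map_apply, Matrix.smul_apply,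
        smul_eq_mul, map_mul, map_pow, h3] at h7
      exact h7.symm
    have h8 := congrArg (fun M => M.map F.r') h2
    simp only [Matrix.map_mul, Matrix.map_map] at h8
    have h9 : (⇑F.r' ∘ ⇑(PowerSeries.map (algebraMap Fq R')) : PowerSeries Fq → PowerSeries k') =
        PowerSeries.map (algebraMap Fq k') := by
      funext p
      ext i
      change res' (algebraMap Fq R' _) = algebraMap Fq k' _
      exact res'.commutes _
    rw [h9] at h8
    rw [← h8]
    ext i j l
    change PowerSeries.coeff l ((seriesFrob Fq k' ^ d) _) = _
    rw [coeff_seriesFrob_pow]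
    exact (hγ _).symm
  have hΨ1 : (1 - Ψ.map (PowerSeries.map (algebraMap Fq k'))).det = 0 := by
    have h2 : 1 - Ψ.map (PowerSeries.map (algebraMap Fq k')) =
        (PowerSeries.map (algebraMap Fq k')).mapMatrix (1 - Ψ) := by
      rw [map_sub, map_one]
      rfl
    rw [h2, ← RingHom.map_det, h1, map_zero]
  obtain ⟨z, hz0, hz⟩ := F.exists_eigenvector hYH hY'b hφγ hΨ1
  obtain ⟨e', u, hu, rfl⟩ := h.exists_pow α hα
  set b : R[X] := Polynomial.C u * (Polynomial.X - Polynomial.C θ) ^ m with hb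
  have hAdet : A.det = F.ϖ ^ e' * b := by
    rw [hA, hb, ← mul_assoc]
    change _ = Polynomial.C π ^ e' * Polynomial.C u * _
    rw [← Polynomial.C_pow, ← Polynomial.C_mul]
  obtain ⟨D₁, hD₁⟩ := exists_degLE_matrix U.adjugate
  obtain ⟨D₂, hD₂⟩ := exists_degLE_matrix U
  obtain ⟨D₃, hD₃⟩ := exists_degLE_matrix (Matrix.of fun (i _ : n) => z i)
  -- The decay exceeds by one the combined degree bounds of adj U, U and z, none of which depends on
  -- N.
  obtain ⟨N₀, hN₀⟩ := hdeg (D₁ + D₂ + D₃ + 1)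
  -- The eigenvector relation is available for exponents divisible by d; as d is positive, this N is
  -- large enough.
  set N := d * N₀ with hN
  have hNN₀ : N₀ ≤ N := Nat.le_mul_of_pos_left _ hd0
  have hϖ : F.ϖ ≠ 0 := fun h => h'.ne_zero (by
    have h2 : π = 0 := by
      have h3 : Polynomial.C π = 0 := h
      simpa using h3
    rw [h2, map_zero])
  have hφinj : Function.Injective F.φb := by
    intro x y hxy
    have h2 := F.φb_pow x
    have h3 := F.φb_pow y
    change (F.φb ^ d) x = x at h2
    change (F.φb ^ d) y = y at h3
    rw [← h2, ← h3, ← Nat.sub_add_cancel hd0, pow_succ, RingHom.mul_def, RingHom.comp_apply,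
      RingHom.comp_apply, hxy]
  obtain ⟨J, f, f', hJ, hJz⟩ := F.exists_adjugate_mulVec (N := N) hϖ hUH hUdet hAdet hHdet hg hφinj
    (hz N₀)
  have hJdeg : ∀ i j, DegLE (D₁ + (m * N - (D₁ + D₂ + D₃ + 1 : ℕ)) + D₂) (J i j) := by
    intro i j
    have h2 : DegLE (D₁ + (m * N - (D₁ + D₂ + D₃ + 1 : ℕ)) + D₂)
        (((U.map (F.φ ^ N)).adjugate * (iterMat F.φ A N).adjugate * U) i j) := by
      refine degLE_matrix_mul (degLE_matrix_mul (fun i j => ?_) ?_) hD₂ i j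
      · have h3 : (U.map (F.φ ^ N)).adjugate = U.adjugate.map (F.φ ^ N) :=
          ((F.φ ^ N).map_adjugate U).symm
        rw [h3, Matrix.map_apply]
        exact (hD₁ i j).map_pow _ N
      · have := hN₀ N hNN₀
        exact this
    intro s hs
    have h4 := congrArg (fun p => Polynomial.coeff p s) (congrFun (congrFun hJ i) j)
    have h5 : ∀ (s' : ℕ) (p : R[X]), (F.ϖ ^ s' • p).coeff s = π ^ s' * p.coeff s := fun s' p => by
      change (Polynomial.C π ^ s' * p).coeff s = _
      rw [← Polynomial.C_pow, Polynomial.coeff_C_mul]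
    simp only [Matrix.smul_apply, h5] at h4
    rw [h2 s hs, mul_zero] at h4
    exact (mul_eq_zero.mp h4.symm).resolve_left (pow_ne_zero _ h.ne_zero)
  obtain ⟨i, hi⟩ := Function.ne_iff.mp hz0
  have hlow := congrFun hJz i
  -- The eigenvalue of the reduced adjugate on z contains the product of the N twists of (t - θ)^m,
  -- so it has degree at least m N, whereas the left side has degree at most m N - 1 by the choice
  -- of N₀.
  have hprod : F.r (iterProd F.φ b N * (F.φ ^ N) g) ≠ 0 ∧
      m * N ≤ (F.r (iterProd F.φ b N * (F.φ ^ N) g)).natDegree := by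
    have hinj : ∀ i, Function.Injective (F.φb ^ i : k[X] →+* k[X]) := fun i => by
      rw [RingHom.coe_pow]
      exact hφinj.iterate i
    have hrb : F.r b = Polynomial.C (res u) * (Polynomial.X - Polynomial.C (res θ)) ^ m := by
      change b.map (res : R →+* k) = _
      simp [hb]
    have hresu : res u ≠ 0 := (hu.map res).ne_zero
    have hb0 : F.r b ≠ 0 := by
      rw [hrb]
      exact mul_ne_zero (by simpa using hresu) (pow_ne_zero _ (Polynomial.X_sub_C_ne_zero _))
    have hbdeg : (F.r b).natDegree = m := by
      rw [hrb, Polynomial.natDegree_C_mul hresu, Polynomial.natDegree_pow,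
        Polynomial.natDegree_X_sub_C, mul_one]
    have hdegφ : ∀ i, ((F.φb ^ i) (F.r b)).natDegree = m := fun i => by
      rw [← hbdeg]
      exact natDegree_coeffFrob_pow _ i
    have h2 : F.r (iterProd F.φ b N) ≠ 0 := by
      rw [iterProd_map F.φ F.φb F.r F.r_φ]
      exact Finset.prod_ne_zero_iff.mpr fun i _ => (map_ne_zero_iff _ (hinj i)).mpr hb0
    have h3 : F.r ((F.φ ^ N) g) ≠ 0 := by
      have h4 : ∀ l, F.r ((F.φ ^ l) g) = (F.φb ^ l) (F.r g) := by
        intro l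
        induction l with
        | zero => simp
        | succ l ih =>
          rw [pow_succ', pow_succ', RingHom.mul_def, RingHom.mul_def, RingHom.comp_apply,
            RingHom.comp_apply, F.r_φ, ih]
      rw [h4]
      exact (map_ne_zero_iff _ (hinj N)).mpr hg
    rw [map_mul]
    refine ⟨mul_ne_zero h2 h3, ?_⟩
    rw [Polynomial.natDegree_mul h2 h3, iterProd_map F.φ F.φb F.r F.r_φ, iterProd,
      Polynomial.natDegree_prod _ _ fun i _ => (map_ne_zero_iff _ (hinj i)).mpr hb0]
    simp only [hdegφ, Finset.sum_const, Finset.card_range, smul_eq_mul]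
    rw [mul_comm N m]
    exact Nat.le_add_right _ _
  have hupp : DegLE (D₁ + (m * N - (D₁ + D₂ + D₃ + 1 : ℕ)) + D₂ + D₃)
      (((J.map F.r).mulVec z) i) := by
    rw [Matrix.mulVec, dotProduct]
    exact DegLE.sum _ fun l _ => ((hJdeg i l).map _).mul (hD₃ l l)
  rw [hlow, Pi.smul_apply, smul_eq_mul] at hupp
  have h2 := hupp.natDegree_le (mul_ne_zero hprod.1 hi)
  rw [Polynomial.natDegree_mul hprod.1 hi] at h2
  have h3 := hprod.2
  zify at h3
  push_cast at h2
  linarith [Int.natCast_nonneg (z i).natDegree]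

end NonVanishing

end TMotive
end

open scoped Polynomial TensorProduct
noncomputable section
namespace TMotive

/-! ### Integrality of power series solutions. -/

section SeriesIntegral

variable {Fq : Type*} [Field Fq] [Fintype Fq] {n : Type*} [Fintype n] [DecidableEq n]
variable {L : Type*} [Field L] [Algebra Fq L] {B : Type*} [CommRing B] [IsDomain B]
  [ValuationRing B] [Algebra B L] [IsFractionRing B L]

/-- Solutions of an integral system for `y^(q)` in terms of `y` are integral. -/
theorem exists_algebraMap_eq_coeff {A : Matrix n n (PowerSeries B)}
    {Y : Matrix n n (PowerSeries L)}
    (hY : Y.map (seriesFrob Fq L) = Y * A.map (PowerSeries.map (algebraMap B L))) (i j : n)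
    (e : ℕ) : ∃ y : B, algebraMap B L y = PowerSeries.coeff e (Y i j) := by
  set w := ValuationRing.valuation B L
  have hmem : ∀ x : L, w x ≤ 1 ↔ ∃ a : B, algebraMap B L a = x :=
    ValuationRing.mem_integer_iff B L
  rw [← hmem]
  induction e using Nat.strong_induction_on generalizing j with
  | _ e ih =>
    -- Take the largest coefficient y of degree e in row i. Coefficients of lower degree are
    -- integral by induction, so if y were not integral the equation would give w(y)^q ≤ w(y).
    obtain ⟨j₁, -, hmax⟩ := Finset.exists_max_image Finset.univ
      (fun j => w (PowerSeries.coeff e (Y i j))) ⟨j, Finset.mem_univ j⟩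
    refine (hmax j (Finset.mem_univ j)).trans ?_
    by_contra hcon
    push Not at hcon
    set y := PowerSeries.coeff e (Y i j₁) with hy
    have h1 : y ^ Fintype.card Fq = ∑ l, ∑ p ∈ Finset.HasAntidiagonal.antidiagonal e,
        PowerSeries.coeff p.1 (Y i l) * algebraMap B L (PowerSeries.coeff p.2 (A l j₁)) := by
      have h2 := congrArg (PowerSeries.coeff e) (congrFun (congrFun hY i) j₁)
      rw [Matrix.map_apply, PowerSeries.coeff_map, frobHom_apply, Matrix.mul_apply, map_sum] at h2
      rw [hy, h2]
      exact Finset.sum_congr rfl fun l _ => by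
        rw [PowerSeries.coeff_mul]
        rfl
    have h3 : w (y ^ Fintype.card Fq) ≤ w y := by
      rw [h1]
      refine Valuation.map_sum_le _ fun l _ => Valuation.map_sum_le _ fun p hp => ?_
      rw [map_mul]
      have h4 : w (algebraMap B L (PowerSeries.coeff p.2 (A l j₁))) ≤ 1 := (hmem _).mpr ⟨_, rfl⟩
      refine (mul_le_of_le_one_right' h4).trans ?_
      rw [Finset.HasAntidiagonal.mem_antidiagonal] at hp
      rcases (show p.1 ≤ e by omega).lt_or_eq with h5 | h5
      · exact (ih _ h5 l).trans hcon.le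
      · rw [h5]
        exact hmax l (Finset.mem_univ l)
    rw [map_pow] at h3
    exact absurd h3 (not_le.mpr (lt_self_pow₀ hcon Fintype.one_lt_card))

end SeriesIntegral

/-! ### Determinants and characteristic polynomials of approximations. -/

section ApproxDet

variable {R : Type*} [CommRing R] {I : Ideal R} {n : Type*} [Fintype n] [DecidableEq n]

theorem isApprox_iff_evalₐ (N : ℕ) (x : AdicCompletion I R) (m : R) :
    IsApprox I N x m ↔ AdicCompletion.evalₐ I N x = Ideal.Quotient.mk (I ^ N) m := by
  induction x using AdicCompletion.induction_on with
  | h a =>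
    have h1 : IsApprox I N (AdicCompletion.mk I R a) (a.val N) := rfl
    rw [h1.iff_sub_mem, AdicCompletion.evalₐ_mk, Ideal.Quotient.eq, smul_eq_mul, Ideal.mul_top]

theorem IsApprox.coeff_charpolyRev {N : ℕ} {M : Matrix n n (AdicCompletion I R)}
    {Φ : Matrix n n R} (h : ∀ i j, IsApprox I N (M i j) (Φ i j)) (m : ℕ) :
    IsApprox I N (M.charpolyRev.coeff m) (Φ.charpolyRev.coeff m) := by
  rw [isApprox_iff_evalₐ]
  have h1 : M.map (AdicCompletion.evalₐ I N : AdicCompletion I R →+* R ⧸ I ^ N) =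
      Φ.map (Ideal.Quotient.mk (I ^ N)) :=
    Matrix.ext fun i j => (isApprox_iff_evalₐ N _ _).mp (h i j)
  have h2 := congrArg Matrix.charpolyRev h1
  rw [charpolyRev_map, charpolyRev_map] at h2
  have h3 := congrArg (fun p => p.coeff m) h2
  simpa using h3

theorem IsApprox.det_one_sub {N : ℕ} {M : Matrix n n (AdicCompletion I R)}
    {Φ : Matrix n n R} (h : ∀ i j, IsApprox I N (M i j) (Φ i j)) :
    IsApprox I N (1 - M).det (1 - Φ).det := by
  rw [isApprox_iff_evalₐ]
  have h1 : M.map (AdicCompletion.evalₐ I N : AdicCompletion I R →+* R ⧸ I ^ N) =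
      Φ.map (Ideal.Quotient.mk (I ^ N)) :=
    Matrix.ext fun i j => (isApprox_iff_evalₐ N _ _).mp (h i j)
  have h2 := congrArg (fun M => M.charpolyRev.eval 1) h1
  simp only [charpolyRev_map, Polynomial.eval_one_map, eval_one_charpolyRev] at h2
  exact h2

end ApproxDet

/-! ### The Tate module at a prime of degree one in terms of power series. -/

section SeriesSolution

variable {Fq : Type*} [Field Fq] [Fintype Fq] {n : Type*} [Fintype n] [DecidableEq n]

theorem eq_of_forall_matCongr_X_pow {S : Type*} [CommRing S] {M M' : Matrix n n (PowerSeries S)}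
    (h : ∀ N, MatCongr (PowerSeries.X ^ (N + 1)) M M') : M = M' := by
  ext i j e
  have := PowerSeries.X_pow_dvd_iff.mp (matCongr_iff.mp (h e) i j) e (Nat.lt_succ_self e)
  rwa [Matrix.sub_apply, map_sub, sub_eq_zero] at this

theorem expand_map_X_sub_C {S : Type*} [CommRing S] [Algebra Fq S] (c : Fq) :
    expand S c ((Polynomial.X - Polynomial.C c).map (algebraMap Fq S)) = PowerSeries.X := by
  rw [Polynomial.map_sub, Polynomial.map_X, Polynomial.map_C, expand_X_sub_C]

variable {L : Type*} [Field L] [Algebra Fq L]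

/-- Expansion turns l = t - c into the series variable, so congruences modulo powers of l become
congruences of series; the k-th coefficient is stable from index k on. -/
theorem exists_series_of_sequence {c : Fq} {A : Matrix n n L[X]} {X : ℕ → Matrix n n L[X]}
    (hXA : ∀ N i j, (Polynomial.X - Polynomial.C c).map (algebraMap Fq L) ^ (N + 1) ∣
        (X N - A * (X N).map (coeffFrob Fq L)) i j)
    (hXs : ∀ N i j, (Polynomial.X - Polynomial.C c).map (algebraMap Fq L) ^ (N + 1) ∣
      (X (N + 1) - X N) i j) :
    ∃ S : Matrix n n (PowerSeries L),
      (∀ N, MatCongr (PowerSeries.X ^ (N + 1)) S ((X N).map (expand L c))) ∧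
      S = A.map (expand L c) * S.map (seriesFrob Fq L) := by
  have hstep : ∀ N, MatCongr (PowerSeries.X ^ (N + 1)) ((X (N + 1)).map (expand L c))
      ((X N).map (expand L c)) := fun N => by
    have := (matCongr_iff.mpr (hXs N)).map (expand L c)
    rwa [map_pow, expand_map_X_sub_C] at this
  have hstab : ∀ N k i j, k ≤ N → PowerSeries.coeff k (expand L c (X N i j)) =
      PowerSeries.coeff k (expand L c (X k i j)) := by
    intro N k i j hk
    induction N, hk using Nat.le_induction with
    | base => rfl
    | succ N hN ih =>
      rw [← ih]
      have := PowerSeries.X_pow_dvd_iff.mp (matCongr_iff.mp (hstep N) i j) k (by omega)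
      rwa [Matrix.sub_apply, map_sub, sub_eq_zero] at this
  set S : Matrix n n (PowerSeries L) := Matrix.of fun i j =>
    PowerSeries.mk fun k => PowerSeries.coeff k (expand L c (X k i j)) with hS
  have hSX : ∀ N, MatCongr (PowerSeries.X ^ (N + 1)) S ((X N).map (expand L c)) := fun N =>
    matCongr_iff.mpr fun i j => PowerSeries.X_pow_dvd_iff.mpr fun m hm => by
      rw [Matrix.sub_apply, map_sub, Matrix.map_apply, hstab N m i j (by omega), hS,
        Matrix.of_apply, PowerSeries.coeff_mk, sub_self]
  refine ⟨S, hSX, eq_of_forall_matCongr_X_pow fun N => (hSX N).trans ?_⟩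
  have h1 := (matCongr_iff.mpr (hXA N)).map (expand L c)
  rw [map_pow, expand_map_X_sub_C, Matrix.map_mul] at h1
  refine h1.trans ((MatCongr.refl _ _).mul ?_)
  have h2 := ((hSX N).map (seriesFrob Fq L)).symm
  rw [map_pow, PowerSeries.map_X] at h2
  convert h2 using 1
  ext1 i j
  exact (seriesFrob_expand c (X N i j)).symm

open IsDedekindDomain

variable {K : Type*} [Field K] [Algebra Fq K]
variable {M : Type*} [AddCommGroup M] [Module K[X] M]

theorem exists_algebraMap_eq_of_seriesFrob_eq {p : PowerSeries L} (h : seriesFrob Fq L p = p) :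
    ∃ r : PowerSeries Fq, PowerSeries.map (algebraMap Fq L) r = p := by
  have h1 : ∀ e, ∃ a : Fq, algebraMap Fq L a = PowerSeries.coeff e p := fun e =>
    exists_algebraMap_eq_of_pow_card_eq (by
      have := congrArg (PowerSeries.coeff e) h
      rwa [PowerSeries.coeff_map, frobHom_apply] at this)
  choose r hr using h1
  exact ⟨PowerSeries.mk r, by ext e; simp [hr]⟩

/-- For `λ = (t - c)` the Galois action on the Tate module is described by power series. -/
theorem exists_series_solution {σ : M →ₛₗ[coeffFrob Fq K] M} {b : Module.Basis n K[X] M}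
    {A : Matrix n n K[X]} (hA : ∀ j, σ (b j) = ∑ i, A i j • b i)
    (lam : HeightOneSpectrum Fq[X]) {c : Fq}
    (hl : lam.asIdeal = Ideal.span {Polynomial.X - Polynomial.C c})
    (hcop : IsCoprime (A.map (Polynomial.mapRingHom (algebraMap K (SeparableClosure K)))).det
      ((Polynomial.X - Polynomial.C c).map (algebraMap Fq (SeparableClosure K)))) :
    ∃ Y : Matrix n n (PowerSeries (SeparableClosure K)), Y.det ≠ 0 ∧
      Y.map (seriesFrob Fq (SeparableClosure K)) =
        Y * A.map (expandMap K (SeparableClosure K) c) ∧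
      ∃ bT : Module.Basis n (ALoc lam) (tateModule σ lam), ∀ g : Gal(SeparableClosure K/K),
        ∃ Ψ : Matrix n n (PowerSeries Fq),
          Y.map (PowerSeries.map ((g : SeparableClosure K ≃+* SeparableClosure K) :
            SeparableClosure K →+* SeparableClosure K)) =
            Ψ.map (PowerSeries.map (algebraMap Fq (SeparableClosure K))) * Y ∧
          ((1 - LinearMap.toMatrix bT bT (tateModuleRep σ lam g)).det = 0 → (1 - Ψ).det = 0) ∧
          (LinearMap.toMatrix bT bT (tateModuleRep σ lam g) = 1 →
            Y.map (PowerSeries.map ((g : SeparableClosure K ≃+* SeparableClosure K) :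
              SeparableClosure K →+* SeparableClosure K)) = Y) := by
  obtain ⟨X, hX, hXA, hXs⟩ := exists_lang_sequence (Polynomial.irreducible_X_sub_C c) hcop
  obtain ⟨bT, hbT⟩ := exists_basis_tateModule hA lam hl rfl hcop hX hXA hXs
  obtain ⟨S, hSX, hS⟩ := exists_series_of_sequence hXA hXs
  set AE := (A.map (Polynomial.mapRingHom (algebraMap K (SeparableClosure K)))).map (expand (SeparableClosure K) c) with hAE
  have hAE' : AE = A.map (expandMap K (SeparableClosure K) c) := by
    ext1 i j
    rfl
  have hSdet : IsUnit S.det := by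
    rw [PowerSeries.isUnit_iff_constantCoeff, isUnit_iff_ne_zero]
    intro h0
    have h1 : PowerSeries.constantCoeff (expand (SeparableClosure K) c (X 0).det) = 0 := by
      have h2 := (hSX 0).map_eq (PowerSeries.constantCoeff (R := (SeparableClosure K))) (by simp)
      have h3 := congrArg Matrix.det h2
      rw [← RingHom.mapMatrix_apply, ← RingHom.map_det, h0, ← RingHom.mapMatrix_apply,
        ← RingHom.mapMatrix_apply, ← RingHom.map_det, ← RingHom.map_det] at h3
      exact h3.symm
    obtain ⟨u, v, huv⟩ := hX 0
    have h4 := congrArg (fun p => PowerSeries.constantCoeff (expand (SeparableClosure K) c p)) huv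
    simp only [map_add, map_mul, h1, expand_map_X_sub_C, map_one] at h4
    simp at h4
  have hSS : S⁻¹ * S = 1 := Matrix.nonsing_inv_mul S hSdet
  have hSS' : S * S⁻¹ = 1 := Matrix.mul_nonsing_inv S hSdet
  set φ := seriesFrob Fq (SeparableClosure K) with hφ
  have hmapSS : ∀ f : PowerSeries (SeparableClosure K) →+* PowerSeries (SeparableClosure K), (S⁻¹).map f * S.map f = 1 := fun f => by
    rw [← Matrix.map_mul, hSS, Matrix.map_one _ (map_zero f) (map_one f)]
  have hYφ : (S⁻¹).map φ = S⁻¹ * AE := by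
    calc (S⁻¹).map φ = (S⁻¹ * S) * (S⁻¹).map φ := by rw [hSS, one_mul]
      _ = (S⁻¹ * (AE * S.map φ)) * (S⁻¹).map φ := by rw [← hS]
      _ = S⁻¹ * AE * (S * S⁻¹).map φ := by rw [Matrix.map_mul]; simp only [Matrix.mul_assoc]
      _ = S⁻¹ * AE := by rw [hSS', Matrix.map_one _ (map_zero φ) (map_one φ), mul_one]
  -- The inverse of the solution is used because it satisfies Y^(q) = Y A: a relation between
  -- columns of Y over K[t] can then be multiplied by the matrix of σ on the right.
  refine ⟨S⁻¹, ?_, by rw [hYφ, hAE'], bT, fun g => ?_⟩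
  · intro h0
    have h1 := congrArg Matrix.det hSS
    rw [Matrix.det_mul, h0, zero_mul, Matrix.det_one] at h1
    exact zero_ne_one h1
  set gR : (SeparableClosure K) →+* (SeparableClosure K) := ((g : (SeparableClosure K) ≃+* (SeparableClosure K)) : (SeparableClosure K) →+* (SeparableClosure K)) with hgR
  set γ : PowerSeries (SeparableClosure K) →+* PowerSeries (SeparableClosure K) := PowerSeries.map gR with hγ
  have hγφ : ∀ p, γ (φ p) = φ (γ p) := fun p => by
    ext e
    simp [hγ, hφ]
  have hγE : ∀ p : (SeparableClosure K)[X], γ (expand (SeparableClosure K) c p) = expand (SeparableClosure K) c (p.map gR) := fun p =>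
    (expand_map c ((g : (SeparableClosure K) →ₐ[K] (SeparableClosure K)).restrictScalars Fq) p).symm
  have hγAE : AE.map γ = AE := by
    rw [hAE, Matrix.map_map, Matrix.map_map, Matrix.map_map]
    ext1 i j
    simp only [Matrix.map_apply, Function.comp_apply, hγE]
    congr 1
    rw [Polynomial.coe_mapRingHom, Polynomial.map_map]
    congr 1
    exact RingHom.ext fun x => g.commutes x
  have hcomm : ∀ Z : Matrix n n (PowerSeries (SeparableClosure K)), (Z.map γ).map φ = (Z.map φ).map γ := fun Z => by
    rw [Matrix.map_map, Matrix.map_map]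
    ext1 i j
    exact (hγφ _).symm
  have hfixed : ∀ Z : Matrix n n (PowerSeries (SeparableClosure K)), Z.map φ = Z →
      ∃ Z' : Matrix n n (PowerSeries Fq), Z'.map (PowerSeries.map (algebraMap Fq (SeparableClosure K))) = Z := by
    intro Z hZ
    choose Z' hZ' using fun i j =>
      exists_algebraMap_eq_of_seriesFrob_eq (congrFun (congrFun hZ i) j)
    exact ⟨Matrix.of Z', Matrix.ext hZ'⟩
  -- The defects of g-invariance of S^{-1} and of S are fixed by Frobenius because A is defined over
  -- K, so they have coefficients in 𝔽_q. They are inverse to each other, and Φ is the action of g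
  -- on the Tate module.
  obtain ⟨Ψ, hΨ⟩ := hfixed ((S⁻¹).map γ * S) (by
    rw [Matrix.map_mul, hcomm, hYφ, Matrix.map_mul, hγAE, Matrix.mul_assoc, ← hS])
  obtain ⟨Φ, hΦ⟩ := hfixed (S⁻¹ * S.map γ) (by
    rw [Matrix.map_mul, hcomm, hYφ, Matrix.mul_assoc]
    congr 1
    have h1 := congrArg (fun Z => Z.map γ) hS
    simp only [Matrix.map_mul, hγAE] at h1
    exact h1.symm)
  have hFqinj : Function.Injective (PowerSeries.map (algebraMap Fq (SeparableClosure K))) := by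
    intro x y hxy
    ext e
    apply (algebraMap Fq (SeparableClosure K)).injective
    have := congrArg (PowerSeries.coeff e) hxy
    simpa using this
  have hΨΦ : Ψ * Φ = 1 := by
    refine Matrix.map_injective hFqinj ?_
    dsimp only
    rw [Matrix.map_mul, hΨ, hΦ, Matrix.map_one _ (map_zero _) (map_one _), Matrix.mul_assoc,
      ← Matrix.mul_assoc S, hSS', Matrix.one_mul, hmapSS]
  -- `Φ` is the expansion of the matrix of `g`
  have happrox : ∀ (N : ℕ) (Φ' : Matrix n n Fq[X]), (∀ i j, IsApprox lam.asIdeal (N + 1)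
      (LinearMap.toMatrix bT bT (tateModuleRep σ lam g) i j) (Φ' i j)) →
      MatCongr (PowerSeries.X ^ (N + 1)) Φ (Φ'.map (expand Fq c)) := by
    intro N Φ' hΦ'
    have h1 := (matCongr_iff.mpr (hbT g (N + 1) Φ' hΦ')).map (expand (SeparableClosure K) c)
    rw [map_pow, expand_map_X_sub_C, Matrix.map_mul] at h1
    have hle : ∀ {Z Z' : Matrix n n (PowerSeries (SeparableClosure K))},
        MatCongr (PowerSeries.X ^ (N + 1 + 1)) Z Z' → MatCongr (PowerSeries.X ^ (N + 1)) Z Z' :=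
      fun h => matCongr_iff.mpr fun i j => (pow_dvd_pow _ (Nat.le_succ _)).trans
        (matCongr_iff.mp h i j)
    have h2 := hle (hSX (N + 1))
    have h3 := h2.map γ
    rw [map_pow, PowerSeries.map_X] at h3
    have h4 : ((X (N + 1)).map (expand (SeparableClosure K) c)).map γ =
        ((X (N + 1)).map (Polynomial.mapRingHom gR)).map (expand (SeparableClosure K) c) := by
      rw [Matrix.map_map, Matrix.map_map]
      ext1 i j
      exact hγE _
    rw [h4] at h3
    have h5 := h3.trans (h1.trans (h2.symm.mul (MatCongr.refl _ _)))
    have h6 := (MatCongr.refl (PowerSeries.X ^ (N + 1)) S⁻¹).mul h5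
    rw [← Matrix.mul_assoc S⁻¹ S, hSS, Matrix.one_mul, ← hΦ] at h6
    have h7 : (Φ'.map (Polynomial.mapRingHom (algebraMap Fq (SeparableClosure K)))).map (expand (SeparableClosure K) c) =
        (Φ'.map (expand Fq c)).map (PowerSeries.map (algebraMap Fq (SeparableClosure K))) := by
      rw [Matrix.map_map, Matrix.map_map]
      ext1 i j
      exact expand_map c (Algebra.ofId Fq (SeparableClosure K)) _
    rw [h7] at h6
    refine matCongr_iff.mpr fun i j => PowerSeries.X_pow_dvd_iff.mpr fun m hm => ?_
    have h8 := PowerSeries.X_pow_dvd_iff.mp (matCongr_iff.mp h6 i j) m hm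
    apply (algebraMap Fq (SeparableClosure K)).injective
    rw [map_zero, ← h8]
    simp
  have hexists : ∀ N : ℕ, ∃ Φ' : Matrix n n Fq[X], ∀ i j, IsApprox lam.asIdeal (N + 1)
      (LinearMap.toMatrix bT bT (tateModuleRep σ lam g) i j) (Φ' i j) := fun N => by
    choose Φ' hΦ' using fun i j => exists_isApprox (I := lam.asIdeal) (N + 1)
      (LinearMap.toMatrix bT bT (tateModuleRep σ lam g) i j)
    exact ⟨Matrix.of Φ', hΦ'⟩
  refine ⟨Ψ, ?_, ?_, ?_⟩
  · rw [hΨ, Matrix.mul_assoc, hSS', Matrix.mul_one]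
  · intro hdet
    have hΦ1 : (1 - Φ).det = 0 := by
      ext e
      obtain ⟨Φ', hΦ'⟩ := hexists e
      have h1 := IsApprox.det_one_sub hΦ'
      rw [hdet] at h1
      have h2 := h1.dvd_sub hl (isApprox_zero _)
      rw [sub_zero] at h2
      have h3 := map_dvd (expand Fq c) h2
      have hX' : expand Fq c (Polynomial.X - Polynomial.C c) = PowerSeries.X :=
        expand_X_sub_C (S := Fq) c
      rw [map_pow, hX'] at h3
      have h4 : (PowerSeries.X ^ (e + 1) : PowerSeries Fq) ∣
          (1 - Φ).det - expand Fq c (1 - Φ').det := by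
        have h5 : MatCongr (PowerSeries.X ^ (e + 1)) (1 - Φ) ((1 - Φ').map (expand Fq c)) := by
          obtain ⟨C, hC⟩ := happrox e Φ' hΦ'
          refine ⟨-C, ?_⟩
          have h6 : (1 - Φ').map (expand Fq c) = 1 - Φ'.map (expand Fq c) := by
            rw [Matrix.map_sub _ (fun a b => map_sub (expand Fq c) a b),
              Matrix.map_one _ (map_zero _) (map_one _)]
          rw [h6, smul_neg, ← hC]
          abel
        have h7 := dvd_det_sub_det (matCongr_iff.mp h5)
        rwa [← RingHom.mapMatrix_apply, ← RingHom.map_det] at h7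
      have h8 := (dvd_add h4 h3)
      rw [sub_add_cancel] at h8
      rw [map_zero]
      exact PowerSeries.X_pow_dvd_iff.mp h8 e (Nat.lt_succ_self e)
    have h9 : 1 - Ψ = Ψ * -(1 - Φ) := by
      rw [neg_sub, Matrix.mul_sub, hΨΦ, Matrix.mul_one]
    rw [h9, Matrix.det_mul, Matrix.det_neg, hΦ1, mul_zero, mul_zero]
  · intro h1
    have hΦ1 : Φ = 1 := eq_of_forall_matCongr_X_pow fun N => by
      have h2 := happrox N 1 (by
        intro i j
        rw [h1]
        by_cases hij : i = j
        · subst hij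
          rw [Matrix.one_apply_eq, Matrix.one_apply_eq]
          exact isApprox_one _
        · rw [Matrix.one_apply_ne hij, Matrix.one_apply_ne hij]
          exact isApprox_zero _)
      rwa [Matrix.map_one _ (map_zero _) (map_one _)] at h2
    rw [hΦ1, mul_one] at hΨΦ
    rw [hΨΦ, Matrix.map_one _ (map_zero _) (map_one _)] at hΨ
    calc (S⁻¹).map γ = ((S⁻¹).map γ * S) * S⁻¹ := by rw [Matrix.mul_assoc, hSS', Matrix.mul_one]
      _ = S⁻¹ := by rw [← hΨ, Matrix.one_mul]

end SeriesSolution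

end TMotive
end

open scoped Polynomial TensorProduct
noncomputable section
namespace TMotive

/-! ### The inertia field in a finite Galois extension is unramified. -/

section InertiaField

theorem finite_quotient_of_liesOver {R T : Type*} [CommRing R] [CommRing T] [Algebra R T]
    [Module.Finite R T] (p : Ideal R) (P : Ideal T) [P.LiesOver p] [Finite (R ⧸ p)] :
    Finite (T ⧸ P) := by
  let := Ideal.Quotient.algebraOfLiesOver P p
  have : Module.Finite (R ⧸ p) (T ⧸ P) := Module.Finite.of_restrictScalars_finite R _ _
  exact Module.finite_of_finite (R ⧸ p)

/-- The factorisation into a unit and a power of a uniformizer holds in the discrete valuation ring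
T_P; clearing the denominator of the unit gives it in T. -/
theorem exists_mul_eq_pow_mul_of_maximalIdeal_eq {T : Type*} [CommRing T] [IsDedekindDomain T]
    {P : Ideal T} [P.IsPrime] (hP0 : P ≠ ⊥) {ϖ : T}
    (hmax : IsLocalRing.maximalIdeal (Localization.AtPrime P) =
      Ideal.span {algebraMap T (Localization.AtPrime P) ϖ}) {a : T} (ha : a ≠ 0) :
    ∃ (m : ℕ) (s u : T), s ∉ P ∧ u ∉ P ∧ s * a = ϖ ^ m * u := by
  set f := algebraMap T (Localization.AtPrime P) with hf
  have hdvr : IsDiscreteValuationRing (Localization.AtPrime P) :=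
    IsLocalization.AtPrime.isDiscreteValuationRing_of_dedekind_domain T hP0 _
  have hinj : Function.Injective f :=
    IsLocalization.injective (Localization.AtPrime P) P.primeCompl_le_nonZeroDivisors
  have hirr := (IsDiscreteValuationRing.irreducible_iff_uniformizer _).mpr hmax
  obtain ⟨m, w, hw⟩ := IsDiscreteValuationRing.associated_pow_irreducible
    ((map_ne_zero_iff f hinj).mpr ha) hirr
  obtain ⟨⟨u, s⟩, hus⟩ := IsLocalization.surj P.primeCompl
    ((w⁻¹ : (Localization.AtPrime P)ˣ) : Localization.AtPrime P)
  have hu : u ∉ P := fun hu => by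
    have h1 : IsUnit (f u) := by
      rw [← hus]
      exact (Units.isUnit _).mul (IsLocalization.map_units _ s)
    exact (IsLocalization.AtPrime.isUnit_to_map_iff (Localization.AtPrime P) P u).mp h1 hu
  refine ⟨m, s, u, s.2, hu, hinj ?_⟩
  have hww : (w : Localization.AtPrime P) * ((w⁻¹ : (Localization.AtPrime P)ˣ) :
      Localization.AtPrime P) = 1 := Units.mul_inv w
  rw [map_mul, map_mul, map_pow, ← hw, ← hus]
  linear_combination (-(f s * f a)) * hww

variable {O K L' : Type*} [CommRing O] [IsDedekindDomain O] [Field K] [Algebra O K]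
  [IsFractionRing O K] [Field L'] [Algebra K L'] [Algebra O L'] [IsScalarTower O K L']
  [FiniteDimensional K L'] [IsGalois K L']

/-- As π is not in p², one has (π) = p J with J not contained in p. An element s of J outside p
becomes a unit in the localization and carries p into (π). -/
theorem map_eq_span_of_localization {T : Type*} [CommRing T] [Algebra O T] (p : Ideal O)
    [p.IsPrime] (P : Ideal T) [P.IsPrime] [P.LiesOver p] {π : O} (hπ : π ∈ p)
    (hπ2 : π ∉ p ^ 2) :
    p.map (algebraMap O (Localization.AtPrime P)) =
      Ideal.span {algebraMap O (Localization.AtPrime P) π} := by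
  refine le_antisymm ?_ ?_
  · obtain ⟨J, hJ⟩ := Ideal.dvd_span_singleton.mpr hπ
    have hJp : ¬ J ≤ p := fun hle => hπ2 (by
      have h1 : π ∈ p * J := by
        rw [← hJ]
        exact Ideal.mem_span_singleton_self π
      rw [sq]
      exact Ideal.mul_mono_right hle h1)
    obtain ⟨s, hsJ, hsp⟩ := Set.not_subset.mp hJp
    rw [Ideal.map_le_iff_le_comap]
    intro x hx
    have h2 : s * x ∈ Ideal.span {π} := by
      rw [hJ, mul_comm]
      exact Ideal.mul_mem_mul hsJ hx
    obtain ⟨y, hy⟩ := Ideal.mem_span_singleton'.mp h2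
    have hs : IsUnit (algebraMap O (Localization.AtPrime P) s) := by
      rw [IsScalarTower.algebraMap_apply O T (Localization.AtPrime P)]
      refine IsLocalization.map_units (Localization.AtPrime P) (⟨algebraMap O T s, fun h => hsp ?_⟩ :
        P.primeCompl)
      rw [SetLike.mem_coe, Ideal.over_def P p]
      exact h
    rw [Ideal.mem_comap, Ideal.mem_span_singleton, ← hs.dvd_mul_left, ← map_mul, ← hy]
    exact map_dvd _ (Dvd.intro_left _ rfl)
  · rw [Ideal.span_singleton_le_iff_mem]
    exact Ideal.mem_map_of_mem _ hπ

/-- Elements fixed by the inertia group are, up to units, powers of a uniformizer of the base. -/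
theorem exists_mul_eq_pow_mul_of_inertia
    [SMulCommClass Gal(L'/K) O L'] (Q : Ideal (integralClosure O L')) [Q.IsPrime]
    (p : Ideal O) [p.IsPrime] [Q.LiesOver p] (hp : p ≠ ⊥) [Finite (O ⧸ p)] {π : O} (hπ : π ∈ p)
    (hπ2 : π ∉ p ^ 2) {a : integralClosure O L'} (ha0 : a ≠ 0)
    (ha : ∀ g ∈ Q.inertia Gal(L'/K), g • a = a) :
    ∃ (m : ℕ) (s u : integralClosure O L'), s ∉ Q ∧ u ∉ Q ∧
      s * a = algebraMap O _ π ^ m * u := by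
  let E : IntermediateField K L' := FixedPoints.intermediateField (Q.inertia Gal(L'/K))
  let T := integralClosure O E
  have hTower : IsScalarTower O E L' := IsScalarTower.of_algebraMap_eq fun _ => rfl
  let algTS : Algebra T (integralClosure O L') := ((IsScalarTower.toAlgHom O E L').mapIntegralClosure).toAlgebra
  have : IsScalarTower O T (integralClosure O L') := IsScalarTower.of_algHom _
  have tow1 : IsScalarTower T E L' := IsScalarTower.of_algebraMap_eq fun _ => rfl
  have tow2 : IsScalarTower T (integralClosure O L') L' := IsScalarTower.of_algebraMap_eq fun _ => rfl
  have hDT : IsDedekindDomain T := integralClosure.isDedekindDomain O K E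
  have hDS : IsDedekindDomain (integralClosure O L') := integralClosure.isDedekindDomain O K L'
  have hfT : Module.Finite O T := IsIntegralClosure.finite O K E T
  have hfS : Module.Finite O (integralClosure O L') := IsIntegralClosure.finite O K L' (integralClosure O L')
  have hfTS : Module.Finite T (integralClosure O L') := Module.Finite.of_restrictScalars_finite O T (integralClosure O L')
  have frT : IsFractionRing T E := integralClosure.isFractionRing_of_finite_extension K E
  have frS : IsFractionRing (integralClosure O L') L' := integralClosure.isFractionRing_of_finite_extension K L'
  have gal1 : IsGaloisGroup (Q.inertia Gal(L'/K)) E L' := IsGaloisGroup.subgroup Gal(L'/K) K L' (Q.inertia Gal(L'/K))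
  have gal2 : IsGaloisGroup (Q.inertia Gal(L'/K)) T (integralClosure O L') := IsGaloisGroup.of_isFractionRing (Q.inertia Gal(L'/K)) T (integralClosure O L') E L'
  have gal3 : IsGaloisGroup Gal(L'/K) O (integralClosure O L') := IsGaloisGroup.of_isFractionRing Gal(L'/K) O (integralClosure O L') K L'
  have : FaithfulSMul O K := inferInstance
  have hinjTS : Function.Injective (algebraMap T (integralClosure O L')) := by
    intro x y hxy
    apply Subtype.ext
    apply (algebraMap E L').injective
    exact congrArg (fun z : (integralClosure O L') => (z : L')) hxy
  have tfTS : Module.IsTorsionFree T (integralClosure O L') := by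
    rw [Module.isTorsionFree_iff_faithfulSMul]
    exact (faithfulSMul_iff_algebraMap_injective T (integralClosure O L')).mpr hinjTS
  have tfOS : Module.IsTorsionFree O (integralClosure O L') := by
    rw [Module.isTorsionFree_iff_faithfulSMul]
    refine (faithfulSMul_iff_algebraMap_injective O (integralClosure O L')).mpr fun x y hxy => ?_
    apply IsFractionRing.injective O K
    apply (algebraMap K L').injective
    rw [← IsScalarTower.algebraMap_apply, ← IsScalarTower.algebraMap_apply]
    exact congrArg (fun z : (integralClosure O L') => (z : L')) hxy
  set P := Q.under T with hP
  have hPprime : P.IsPrime := Ideal.IsPrime.under T Q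
  have hPp : P.LiesOver p := ⟨by rw [hP, Ideal.under_under]; exact Q.over_def p⟩
  have hpm : p.IsMaximal := Ring.DimensionLEOne.maximalOfPrime hp inferInstance
  have hOT : FaithfulSMul O T := by
    refine (faithfulSMul_iff_algebraMap_injective O T).mpr fun x y hxy => ?_
    apply IsFractionRing.injective O K
    apply (algebraMap K E).injective
    rw [← IsScalarTower.algebraMap_apply, ← IsScalarTower.algebraMap_apply]
    exact congrArg (fun z : T => (z : E)) hxy
  have hP0 : P ≠ ⊥ := Ideal.ne_bot_of_liesOver_of_ne_bot hp P
  have hPm : P.IsMaximal := Ring.DimensionLEOne.maximalOfPrime hP0 inferInstance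
  have hfinP : Finite (T ⧸ P) := finite_quotient_of_liesOver p P
  have hQP : Q.LiesOver P := ⟨rfl⟩
  have hpf : PerfectField p.ResidueField := inferInstance
  have hPf : PerfectField P.ResidueField := inferInstance
  have e1 : Nat.card (Q.inertia Gal(L'/K)) = Q.ramificationIdx O := by
    rw [Ideal.card_inertia_eq_ramificationIdxIn p,
      Ideal.ramificationIdxIn_eq_ramificationIdx p Q Gal(L'/K)]
  have e2 : Nat.card (Q.inertia (Q.inertia Gal(L'/K))) = Q.ramificationIdx T := by
    rw [Ideal.card_inertia_eq_ramificationIdxIn P,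
      Ideal.ramificationIdxIn_eq_ramificationIdx P Q (Q.inertia Gal(L'/K))]
  -- Over its own fixed field the inertia group is entirely inertial, so the ramification index of Q
  -- is the same over K and over the inertia field. By multiplicativity P is unramified over p.
  have e3 : Nat.card (Q.inertia (Q.inertia Gal(L'/K))) = Nat.card (Q.inertia Gal(L'/K)) := by
    have : Q.inertia (Q.inertia Gal(L'/K)) = ⊤ := by
      rw [eq_top_iff]
      rintro ⟨g, hg⟩ - x
      exact hg x
    rw [this]
    exact Nat.card_congr (Subgroup.topEquiv).toEquiv
  have e4 := Ideal.ramificationIdx_tower (R := O) P Q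
  have e5 : P.ramificationIdx O = 1 := by
    rw [← e1, ← e2, e3] at e4
    have : 0 < Nat.card (Q.inertia Gal(L'/K)) := Nat.card_pos
    exact Nat.eq_of_mul_eq_mul_right this (by rw [one_mul]; exact e4.symm)
  have hmax : IsLocalRing.maximalIdeal (Localization.AtPrime P) =
      Ideal.span {algebraMap O (Localization.AtPrime P) π} := by
    rw [← map_eq_span_of_localization p P hπ hπ2]
    rw [Ideal.ramificationIdx_eq p P, ENat.toNat_eq_iff_eq_natCast, Nat.cast_one,
      Module.length_eq_one_iff, isSimpleModule_iff_isCoatom, ← Ideal.isMaximal_def,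
      IsLocalRing.isMaximal_iff] at e5
    exact e5.symm
  obtain ⟨a', ha'⟩ : ∃ a' : T, algebraMap T (integralClosure O L') a' = a := by
    have haE : (a : L') ∈ E := fun g => congrArg Subtype.val (ha g.1 g.2)
    have haint : IsIntegral O (⟨(a : L'), haE⟩ : E) := by
      rw [← isIntegral_algebraMap_iff (algebraMap E L').injective]
      exact a.2
    exact ⟨⟨⟨(a : L'), haE⟩, haint⟩, rfl⟩
  have hmax' : IsLocalRing.maximalIdeal (Localization.AtPrime P) =
      Ideal.span {algebraMap T (Localization.AtPrime P) (algebraMap O T π)} := by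
    rw [hmax, ← IsScalarTower.algebraMap_apply]
  obtain ⟨m, s, u, hs, hu, hsu⟩ := exists_mul_eq_pow_mul_of_maximalIdeal_eq hP0 hmax' (a := a') (by
    rintro rfl
    exact ha0 (by rw [← ha', map_zero]))
  refine ⟨m, algebraMap T _ s, algebraMap T _ u, hs, hu, ?_⟩
  rw [← ha', IsScalarTower.algebraMap_apply O T, ← map_pow, ← map_mul, ← map_mul, hsu]

end InertiaField

end TMotive
end

open scoped Polynomial TensorProduct
noncomputable section
namespace TMotive

/-! ### Inertia and Frobenius elements in profinite groups. -/

section Profinite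

open scoped Pointwise

variable {B : Type*} [CommRing B] {G : Type*} [Group G] [MulSemiringAction G B]
  [TopologicalSpace G] [CompactSpace G] [TotallyDisconnectedSpace G] [IsTopologicalGroup G]
  [TopologicalSpace B] [DiscreteTopology B] [ContinuousSMul G B]

/-- An element acting trivially modulo `Q` on the invariants of a closed subgroup agrees with an
element of the inertia group up to that subgroup. -/
theorem exists_mul_mem_inertia (N : Subgroup G) (hN : IsClosed (N : Set G)) (Q : Ideal B)
    [Q.IsPrime] (g : G) (hg : ∀ c : B, (∀ n ∈ N, n • c = c) → g • c - c ∈ Q) :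
    ∃ n ∈ N, g * n ∈ Q.inertia G := by
  set C := FixedPoints.subalgebra ℤ B N with hC
  have hCinv : Algebra.IsInvariant C B N := ⟨fun b hb => ⟨⟨b, hb⟩, rfl⟩⟩
  have hcomm : SMulCommClass N C B := ⟨fun n c b => by
    change n • ((c : B) * b) = (c : B) * n • b
    rw [smul_mul', c.2 n]⟩
  have hNc : CompactSpace N := isCompact_iff_compactSpace.mp hN.isCompact
  have hg' : ∀ c : C, g • (c : B) - c ∈ Q := fun c => hg c fun n hn => c.2 ⟨n, hn⟩
  have hunder : (g⁻¹ • Q).under C = Q.under C := by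
    ext c
    change (c : B) ∈ g⁻¹ • Q ↔ (c : B) ∈ Q
    rw [Ideal.mem_inv_pointwise_smul_iff]
    constructor <;> intro h
    · simpa using Q.sub_mem h (hg' c)
    · simpa using Q.add_mem (hg' c) h
  -- N acts transitively on the primes above a prime of its invariants, and g^{-1}Q and Q lie over
  -- the same one. So g n stabilises Q for some n in N.
  obtain ⟨n, hn⟩ := Algebra.IsInvariant.exists_smul_of_under_eq_of_profinite (A := C) (G := N) Q
    (g⁻¹ • Q) hunder.symm
  have hgn : (g * n) • Q = Q := by
    have h1 : g⁻¹ • Q = (n : G) • Q := hn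
    rw [mul_smul, ← h1, smul_inv_smul]
  have hgnC : ∀ c : C, (g * n) • (c : B) - c ∈ Q := fun c => by
    have h1 : (n : G) • (c : B) = c := c.2 n
    rw [mul_smul, h1]
    exact hg' c
  let e : (B ⧸ Q) ≃ₐ[C ⧸ Q.under C] (B ⧸ Q) :=
    AlgEquiv.ofRingEquiv (f := Ideal.quotientEquiv Q Q
      (MulSemiringAction.toRingEquiv G B (g * n)) (by
        conv_lhs => rw [← hgn]
        rfl)) (by
        intro x
        obtain ⟨c, rfl⟩ := Ideal.Quotient.mk_surjective x
        exact (Ideal.Quotient.eq (I := Q)).mpr (hgnC c))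
  -- The automorphism induced by g n on the residue ring is trivial on the residues of the
  -- invariants, hence is already induced by some n' in N; dividing by n' leaves an inertial
  -- element.
  obtain ⟨⟨n', hn'Q⟩, hn'⟩ :=
    Ideal.Quotient.stabilizerHom_surjective_of_profinite (A := C) (G := N) (Q.under C) Q e
  refine ⟨n * (n' : G)⁻¹, N.mul_mem n.2 (N.inv_mem n'.2), fun x => ?_⟩
  have h1 := DFunLike.congr_fun hn' (Ideal.Quotient.mk Q ((n' : G)⁻¹ • x))
  have h2 : Ideal.Quotient.mk Q ((n' : G) • (n' : G)⁻¹ • x) =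
      Ideal.Quotient.mk Q ((g * n) • (n' : G)⁻¹ • x) := h1
  rw [smul_inv_smul, Ideal.Quotient.eq] at h2
  rw [← mul_assoc, mul_smul, ← neg_sub]
  exact Q.neg_mem h2

/-- Frobenius elements exist. -/
theorem exists_isArithFrobAt_of_profinite {A : Type*} [CommRing A] [Algebra A B]
    [SMulCommClass G A B] [Algebra.IsInvariant A B G] [Algebra.IsIntegral A B] (Q : Ideal B)
    [Q.IsPrime] (hm : (Q.under A).IsMaximal) [Finite (A ⧸ Q.under A)] :
    ∃ g : G, IsArithFrobAt A g Q := by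
  have hQm : Q.IsMaximal := Ideal.isMaximal_of_isIntegral_of_isMaximal_comap Q hm
  let := Ideal.Quotient.field Q
  let := Ideal.Quotient.field (Q.under A)
  have := Fintype.ofFinite (A ⧸ Q.under A)
  have : Algebra.IsIntegral (A ⧸ Q.under A) (B ⧸ Q) := inferInstance
  obtain ⟨⟨g, hgQ⟩, hg⟩ :=
    Ideal.Quotient.stabilizerHom_surjective_of_profinite (G := G) (Q.under A) Q
      (FiniteField.frobeniusAlgEquivOfAlgebraic (A ⧸ Q.under A) (B ⧸ Q))
  refine ⟨g, fun x => ?_⟩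
  have h1 := DFunLike.congr_fun hg (Ideal.Quotient.mk Q x)
  rw [FiniteField.coe_frobeniusAlgEquivOfAlgebraic] at h1
  rw [← Ideal.Quotient.eq, map_pow, Nat.card_eq_fintype_card]
  exact h1

end Profinite

/-! ### Passage from finite to infinite Galois extensions. -/

section InfiniteGalois

variable {O K L : Type*} [CommRing O] [IsDedekindDomain O] [Field K] [Algebra O K]
  [IsFractionRing O K] [Field L] [Algebra K L] [Algebra O L] [IsScalarTower O K L]
  [IsGalois K L] [SMulCommClass Gal(L/K) O L]

theorem isInvariant_integralClosure :
    Algebra.IsInvariant O (integralClosure O L) Gal(L/K) := by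
  refine ⟨fun b hb => ?_⟩
  obtain ⟨x, hx⟩ := (InfiniteGalois.mem_bot_iff_fixed (k := K) (b : L)).mpr
    fun g => congrArg Subtype.val (hb g)
  have hint : IsIntegral O x := by
    rw [← isIntegral_algebraMap_iff (algebraMap K L).injective]
    have h1 : algebraMap K L x = b := hx
    rw [h1]
    exact b.2
  obtain ⟨a, rfl⟩ := IsIntegrallyClosed.isIntegral_iff.mp hint
  exact ⟨a, Subtype.ext ((IsScalarTower.algebraMap_apply O K L a).trans hx)⟩

theorem isOpen_stabilizer (x : L) : IsOpen {g : Gal(L/K) | g x = x} := by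
  have hfin : FiniteDimensional K (IntermediateField.adjoin K {x}) :=
    IntermediateField.adjoin.finiteDimensional (Algebra.IsIntegral.isIntegral x)
  have h1 : {g : Gal(L/K) | g x = x} =
      ((IntermediateField.adjoin K {x}).fixingSubgroup : Set Gal(L/K)) := by
    ext g
    rw [SetLike.mem_coe, Set.mem_ofPred_eq]
    constructor
    · intro h
      rw [IntermediateField.mem_fixingSubgroup_iff]
      intro y hy
      have h2 : IntermediateField.adjoin K {x} ≤
          IntermediateField.fixedField (Subgroup.zpowers g) := by
        rw [IntermediateField.adjoin_le_iff, Set.singleton_subset_iff]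
        rintro ⟨k, hk⟩
        have h3 : g ∈ MulAction.stabilizer Gal(L/K) x := h
        exact (Subgroup.zpowers_le.mpr h3) hk
      exact h2 hy ⟨g, Subgroup.mem_zpowers g⟩
    · intro h
      exact (IntermediateField.mem_fixingSubgroup_iff _ g).mp h x
        (IntermediateField.mem_adjoin_simple_self K x)
  rw [h1]
  exact IntermediateField.fixingSubgroup_isOpen _

theorem continuousSMul_integralClosure [TopologicalSpace (integralClosure O L)]
    [DiscreteTopology (integralClosure O L)] :
    ContinuousSMul Gal(L/K) (integralClosure O L) := by
  rw [continuousSMul_iff_stabilizer_isOpen]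
  intro x
  convert isOpen_stabilizer (K := K) (x : L) using 1
  ext g
  exact Subtype.ext_iff

theorem exists_isArithFrobAt (Q : Ideal (integralClosure O L)) [Q.IsPrime]
    (hm : (Q.under O).IsMaximal) [Finite (O ⧸ Q.under O)] :
    ∃ g : Gal(L/K), IsArithFrobAt O g Q := by
  let : TopologicalSpace (integralClosure O L) := ⊥
  have : DiscreteTopology (integralClosure O L) := ⟨rfl⟩
  have := continuousSMul_integralClosure (O := O) (K := K) (L := L)
  have := isInvariant_integralClosure (O := O) (K := K) (L := L)
  exact exists_isArithFrobAt_of_profinite Q hm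

/-- Elements fixed by the inertia group are, up to units, powers of a uniformizer of the base. -/
theorem exists_mul_eq_pow_mul_of_inertia_sep (Q : Ideal (integralClosure O L)) [Q.IsPrime]
    (p : Ideal O) [p.IsPrime] [Q.LiesOver p] (hp : p ≠ ⊥) [Finite (O ⧸ p)] {π : O} (hπ : π ∈ p)
    (hπ2 : π ∉ p ^ 2) {a : integralClosure O L} (ha0 : a ≠ 0)
    (ha : ∀ g ∈ Q.inertia Gal(L/K), g • a = a) :
    ∃ (m : ℕ) (s u : integralClosure O L), s ∉ Q ∧ u ∉ Q ∧
      s * a = algebraMap O _ π ^ m * u := by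
  let : TopologicalSpace (integralClosure O L) := ⊥
  have : DiscreteTopology (integralClosure O L) := ⟨rfl⟩
  have := continuousSMul_integralClosure (O := O) (K := K) (L := L)
  set L' := FiniteGaloisIntermediateField.adjoin K {(a : L)} with hL'
  have haL' : (a : L) ∈ L'.toIntermediateField :=
    FiniteGaloisIntermediateField.subset_adjoin K {(a : L)} (Set.mem_singleton _)
  have tow : IsScalarTower O L' L := IsScalarTower.of_algebraMap_eq fun _ => rfl
  have hcomm : SMulCommClass Gal(L'/K) O L' := ⟨fun g r x => by
    rw [Algebra.smul_def, Algebra.smul_def, smul_mul', IsScalarTower.algebraMap_apply O K L']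
    congr 1
    exact g.commutes _⟩
  set ι : integralClosure O L' →ₐ[O] integralClosure O L :=
    (IsScalarTower.toAlgHom O L' L).mapIntegralClosure with hι
  have hιinj : Function.Injective ι := fun x y hxy =>
    Subtype.ext (Subtype.ext (congrArg (fun z : integralClosure O L => (z : L)) hxy))
  set Q' := Q.comap ι with hQ'
  have hQ'p : Q'.IsPrime := Ideal.comap_isPrime ι Q
  have hlies : Q'.LiesOver p := ⟨by
    rw [Ideal.over_def Q p]
    ext x
    change algebraMap O _ x ∈ Q ↔ ι (algebraMap O _ x) ∈ Q
    rw [ι.commutes]⟩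
  have haint : IsIntegral O (⟨(a : L), haL'⟩ : L') := by
    rw [← isIntegral_algebraMap_iff (algebraMap L' L).injective]
    exact a.2
  set a' : integralClosure O L' := ⟨⟨(a : L), haL'⟩, haint⟩ with ha'
  have hιa : ι a' = a := rfl
  -- An inertial element of the finite layer L' lifts to L and can be corrected by an automorphism
  -- trivial on L' so that it becomes inertial at Q. As `a` lies in L', invariance under the inertia
  -- group of Q suffices.
  have hfix : ∀ g' ∈ Q'.inertia Gal(L'/K), g' • a' = a' := by
    intro g' hg'
    obtain ⟨g, hg⟩ := AlgEquiv.restrictNormalHom_surjective (F := K) (K₁ := L') L g'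
    have hres : ∀ x : integralClosure O L', g • ι x = ι (g' • x) := fun x => by
      apply Subtype.ext
      change g ((x : L') : L) = ((g' (x : L') : L') : L)
      rw [← hg]
      exact (AlgEquiv.restrictNormal_commutes g L' (x : L')).symm
    obtain ⟨n, hn, hgn⟩ := exists_mul_mem_inertia L'.toIntermediateField.fixingSubgroup
      (InfiniteGalois.fixingSubgroup_isClosed _) Q g (fun c hc => by
        have hcL' : (c : L) ∈ L'.toIntermediateField := by
          rw [← InfiniteGalois.fixedField_fixingSubgroup L'.toIntermediateField]
          exact fun n => congrArg Subtype.val (hc n.1 n.2)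
        have hcint : IsIntegral O (⟨(c : L), hcL'⟩ : L') := by
          rw [← isIntegral_algebraMap_iff (algebraMap L' L).injective]
          exact c.2
        have h1 := hg' ⟨⟨(c : L), hcL'⟩, hcint⟩
        have h2 : c = ι ⟨⟨(c : L), hcL'⟩, hcint⟩ := rfl
        rw [h2, hres, ← map_sub]
        exact h1)
    have h3 := ha _ hgn
    have h4 : n • a = a := Subtype.ext
      ((IntermediateField.mem_fixingSubgroup_iff _ n).mp hn _ haL')
    rw [mul_smul, h4, ← hιa, hres] at h3
    exact hιinj h3
  obtain ⟨m, s, u, hs, hu, hsu⟩ := exists_mul_eq_pow_mul_of_inertia Q' p hp hπ hπ2 (a := a')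
    (by
      intro h
      exact ha0 (by rw [← hιa, h, map_zero])) hfix
  refine ⟨m, ι s, ι u, hs, hu, ?_⟩
  rw [← hιa, ← map_mul, hsu, map_mul, map_pow, ι.commutes]

end InfiniteGalois

end TMotive
end

open scoped Polynomial TensorProduct
noncomputable section
namespace TMotive

/-! ### The valuation ring of a prime of the integral closure. -/

section PlaceRing

variable {O : Type*} (K : Type*) {L : Type*} [CommRing O] [IsDedekindDomain O] [Field K]
  [Algebra O K] [IsFractionRing O K] [Field L] [Algebra K L] [Algebra O L] [IsScalarTower O K L]
  [Algebra.IsSeparable K L]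

/-- In the localization at P, a discrete valuation ring unless P = 0, one of two elements divides
the other; denominators outside P are then cleared. -/
theorem exists_notMem_mul_dvd_or_dvd {T : Type*} [CommRing T] [IsDedekindDomain T] (P : Ideal T)
    [P.IsPrime] {a b : T} (hb : b ≠ 0) :
    ∃ s, s ∉ P ∧ (b ∣ s * a ∨ (a ≠ 0 ∧ a ∣ s * b)) := by
  by_cases hP0 : P = ⊥
  · exact ⟨b, by rwa [hP0, Ideal.mem_bot], Or.inl (Dvd.intro _ rfl)⟩
  by_cases ha : a = 0
  · exact ⟨1, fun h => (Ideal.IsPrime.ne_top ‹_›) ((Ideal.eq_top_iff_one P).mpr h),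
      Or.inl (by rw [ha, mul_zero]; exact dvd_zero b)⟩
  have hdvr : IsDiscreteValuationRing (Localization.AtPrime P) :=
    IsLocalization.AtPrime.isDiscreteValuationRing_of_dedekind_domain T hP0 _
  set f := algebraMap T (Localization.AtPrime P) with hf
  have hinj : Function.Injective f :=
    IsLocalization.injective (Localization.AtPrime P) P.primeCompl_le_nonZeroDivisors
  have key : ∀ x y : T, f x ∣ f y → ∃ s, s ∉ P ∧ x ∣ s * y := by
    rintro x y ⟨z, hz⟩
    obtain ⟨⟨u, s⟩, hus⟩ := IsLocalization.surj P.primeCompl z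
    refine ⟨s, s.2, u, hinj ?_⟩
    rw [map_mul, map_mul, hz, ← hus]
    ring
  rcases ValuationRing.dvd_total (f b) (f a) with h | h
  · obtain ⟨s, hs, hd⟩ := key _ _ h
    exact ⟨s, hs, Or.inl hd⟩
  · obtain ⟨s, hs, hd⟩ := key _ _ h
    exact ⟨s, hs, Or.inr ⟨ha, hd⟩⟩

/-- The valuation ring of the place of `L` given by a prime of the integral closure of `O`. -/
def placeRing (Q : Ideal (integralClosure O L)) [Q.IsPrime] : ValuationSubring L where
  carrier := {x | ∃ a s : integralClosure O L, s ∉ Q ∧ (s : L) * x = a}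
  mul_mem' := by
    rintro x y ⟨a, s, hs, hx⟩ ⟨b, t, ht, hy⟩
    refine ⟨a * b, s * t, fun h => ((Ideal.IsPrime.mem_or_mem ‹_› h).elim hs ht), ?_⟩
    push_cast
    rw [← hx, ← hy]
    ring
  one_mem' := ⟨1, 1, (Ideal.ne_top_iff_one Q).mp (Ideal.IsPrime.ne_top ‹_›), by simp⟩
  add_mem' := by
    rintro x y ⟨a, s, hs, hx⟩ ⟨b, t, ht, hy⟩
    refine ⟨t * a + s * b, s * t, fun h => ((Ideal.IsPrime.mem_or_mem ‹_› h).elim hs ht), ?_⟩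
    push_cast
    rw [← hx, ← hy]
    ring
  zero_mem' := ⟨0, 1, (Ideal.ne_top_iff_one Q).mp (Ideal.IsPrime.ne_top ‹_›), by simp⟩
  neg_mem' := by
    rintro x ⟨a, s, hs, hx⟩
    refine ⟨-a, s, hs, ?_⟩
    push_cast
    rw [← hx]
    ring
  mem_or_inv_mem' := by
    intro x
    -- The integral closure in L is in general not Dedekind, but x lies in the finite extension
    -- K(x), where it is.
    set E := IntermediateField.adjoin K {x} with hE
    have hfin : FiniteDimensional K E :=
      IntermediateField.adjoin.finiteDimensional (Algebra.IsIntegral.isIntegral x)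
    have hsep : Algebra.IsSeparable K E := inferInstance
    have tow : IsScalarTower O E L := IsScalarTower.of_algebraMap_eq fun _ => rfl
    have hDT : IsDedekindDomain (integralClosure O E) := integralClosure.isDedekindDomain O K E
    have frT : IsFractionRing (integralClosure O E) E :=
      integralClosure.isFractionRing_of_finite_extension K E
    set ι : integralClosure O E →ₐ[O] integralClosure O L :=
      (IsScalarTower.toAlgHom O E L).mapIntegralClosure with hι
    have hιinj : Function.Injective ι := fun x y hxy =>
      Subtype.ext (Subtype.ext (congrArg (fun z : integralClosure O L => (z : L)) hxy))
    have hPp : (Q.comap ι).IsPrime := Ideal.comap_isPrime ι Q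
    obtain ⟨a, b, hb, hab⟩ := IsFractionRing.div_surjective (integralClosure O E)
      (⟨x, IntermediateField.mem_adjoin_simple_self K x⟩ : E)
    have hb0 := nonZeroDivisors.ne_zero hb
    have hιb0 : (ι b : L) ≠ 0 := fun h => hb0 (hιinj (by
      rw [map_zero]
      exact Subtype.ext h))
    have hx : x * (ι b : L) = ι a := by
      have h1 : x = (ι a : L) / ι b := congrArg (fun z : E => (z : L)) hab.symm
      rw [h1, div_mul_cancel₀ _ hιb0]
    obtain ⟨s, hs, ⟨c, hc⟩ | ⟨ha, c, hc⟩⟩ := exists_notMem_mul_dvd_or_dvd (Q.comap ι) (a := a) hb0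
    · refine Or.inl ⟨ι c, ι s, hs, mul_right_cancel₀ hιb0 ?_⟩
      have h2 : (ι s : L) * ι a = ι b * ι c := by exact_mod_cast congrArg (fun z => (ι z : L)) hc
      rw [mul_assoc, hx, h2, mul_comm]
    · have hιa0 : (ι a : L) ≠ 0 := fun h => ha (hιinj (by
        rw [map_zero]
        exact Subtype.ext h))
      refine Or.inr ⟨ι c, ι s, hs, mul_right_cancel₀ hιa0 ?_⟩
      have h2 : (ι s : L) * ι b = ι a * ι c := by exact_mod_cast congrArg (fun z => (ι z : L)) hc
      have hx0 : x ≠ 0 := by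
        rintro rfl
        rw [zero_mul] at hx
        exact hιa0 hx.symm
      have h3 : x⁻¹ * (ι a : L) = ι b := by rw [← hx, inv_mul_cancel_left₀ hx0]
      rw [mul_assoc, h3, h2, mul_comm]

variable (Q : Ideal (integralClosure O L)) [Q.IsPrime]

theorem one_notMem_of_isPrime : (1 : integralClosure O L) ∉ Q :=
  (Ideal.ne_top_iff_one Q).mp (Ideal.IsPrime.ne_top ‹_›)

/-- The inclusion of the integers in the valuation ring. -/
def toPlaceRing : integralClosure O L →+* placeRing K Q where
  toFun a := ⟨a, a, 1, one_notMem_of_isPrime Q, by simp⟩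
  map_one' := rfl
  map_mul' _ _ := rfl
  map_zero' := rfl
  map_add' _ _ := rfl

theorem isUnit_toPlaceRing_iff (a : integralClosure O L) :
    IsUnit (toPlaceRing K Q a) ↔ a ∉ Q := by
  constructor
  · intro h ha
    obtain ⟨⟨y, c, s, hs, hy⟩, hay⟩ := h.exists_right_inv
    have h1 : (a : L) * y = 1 := congrArg Subtype.val hay
    apply hs
    have h2 : s = a * c := by
      apply Subtype.ext
      push_cast
      rw [← hy, mul_left_comm, h1, mul_one]
    rw [h2]
    exact Q.mul_mem_right _ ha
  · intro h
    have ha0 : (a : L) ≠ 0 := fun h0 => h (by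
      have : a = 0 := Subtype.ext h0
      rw [this]
      exact Q.zero_mem)
    exact IsUnit.of_mul_eq_one (⟨(a : L)⁻¹, 1, a, h, by simp [ha0]⟩ : placeRing K Q)
      (Subtype.ext (mul_inv_cancel₀ ha0))

theorem residue_eq_zero_of_mem {x : placeRing K Q} {a s : integralClosure O L} (hs : s ∉ Q)
    (ha : a ∈ Q) (h : (s : L) * x = a) : IsLocalRing.residue (placeRing K Q) x = 0 := by
  rw [IsLocalRing.residue_eq_zero_iff, IsLocalRing.mem_maximalIdeal, mem_nonunits_iff]
  intro hx
  have h1 : toPlaceRing K Q a = toPlaceRing K Q s * x := Subtype.ext h.symm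
  exact (isUnit_toPlaceRing_iff K Q a).mp
    (h1 ▸ ((isUnit_toPlaceRing_iff K Q s).mpr hs).mul hx) ha

theorem residue_toPlaceRing_eq_zero_iff (a : integralClosure O L) :
    IsLocalRing.residue (placeRing K Q) (toPlaceRing K Q a) = 0 ↔ a ∈ Q := by
  rw [IsLocalRing.residue_eq_zero_iff, IsLocalRing.mem_maximalIdeal, mem_nonunits_iff,
    isUnit_toPlaceRing_iff, not_not]

variable {K Q} in
/-- An automorphism acting as `x ↦ x ^ N` modulo `Q` does so on the valuation ring. -/
theorem exists_placeRing_hom [SMulCommClass Gal(L/K) O L] {g : Gal(L/K)} {N : ℕ}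
    (hg : ∀ a : integralClosure O L, g • a - a ^ N ∈ Q) :
    ∃ γ : placeRing K Q →+* placeRing K Q, (∀ x, (γ x : L) = g x) ∧
      ∀ x, IsLocalRing.residue (placeRing K Q) (γ x) =
        IsLocalRing.residue (placeRing K Q) x ^ N := by
  have hgs : ∀ s : integralClosure O L, s ∉ Q → g • s ∉ Q := fun s hs h => by
    have h1 := Q.sub_mem h (hg s)
    rw [sub_sub_cancel] at h1
    exact hs (Ideal.IsPrime.mem_of_pow_mem ‹_› _ h1)
  have hmem : ∀ x : placeRing K Q, g (x : L) ∈ placeRing K Q := by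
    rintro ⟨x, a, s, hs, hx⟩
    refine ⟨g • a, g • s, hgs s hs, ?_⟩
    change g (s : L) * g x = g (a : L)
    rw [← map_mul, hx]
  set γ : placeRing K Q →+* placeRing K Q :=
    ((g : L →+* L).comp (placeRing K Q).subtype).codRestrict (placeRing K Q) hmem with hγ
  refine ⟨γ, fun x => rfl, fun x => ?_⟩
  rw [← sub_eq_zero, ← map_pow, ← map_sub]
  obtain ⟨a, s, hs, hx⟩ := x.2
  refine residue_eq_zero_of_mem K Q (a := g • a * s ^ N - a ^ N * g • s) (s := g • s * s ^ N)
    (fun h => ?_) ?_ ?_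
  · exact (Ideal.IsPrime.mem_or_mem ‹_› h).elim (hgs s hs)
      (fun h => hs (Ideal.IsPrime.mem_of_pow_mem ‹_› _ h))
  · have h1 : g • a * s ^ N - a ^ N * g • s =
        (g • a - a ^ N) * s ^ N - a ^ N * (g • s - s ^ N) := by ring
    rw [h1]
    exact Q.sub_mem (Q.mul_mem_right _ (hg a)) (Q.mul_mem_left _ (hg s))
  · have h2 : (g • a : integralClosure O L) = (g (s : L) * g (x : L) : L) := by
      rw [← map_mul, hx]
      rfl
    push_cast
    rw [h2]
    change g (s : L) * (s : L) ^ N * (g (x : L) - (x : L) ^ N) =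
      g (s : L) * g (x : L) * (s : L) ^ N - (a : L) ^ N * g (s : L)
    rw [← hx]
    ring

end PlaceRing

end TMotive
end

open scoped Polynomial TensorProduct
noncomputable section
namespace TMotive

/-! ### The inertia ring is unramified over the base. -/

section InertiaRing

variable {O : Type*} (K : Type*) {L : Type*} [CommRing O] [IsDedekindDomain O] [Field K]
  [Algebra O K] [IsFractionRing O K] [Field L] [Algebra K L] [Algebra O L] [IsScalarTower O K L]

theorem isUniformizer_localization (p : Ideal O) [p.IsPrime] (hp : p ≠ ⊥) {π : O} (hπ : π ∈ p)
    (hπ2 : π ∉ p ^ 2) :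
    IsUniformizer (algebraMap O (Localization.AtPrime p) π)
      (IsLocalRing.residue (Localization.AtPrime p)) := by
  have hdvr : IsDiscreteValuationRing (Localization.AtPrime p) :=
    IsLocalization.AtPrime.isDiscreteValuationRing_of_dedekind_domain O hp _
  have hinj : Function.Injective (algebraMap O (Localization.AtPrime p)) :=
    IsLocalization.injective (Localization.AtPrime p) p.primeCompl_le_nonZeroDivisors
  have h0 : algebraMap O (Localization.AtPrime p) π ≠ 0 := fun h => hπ2 (by
    rw [hinj (h.trans (map_zero _).symm)]
    exact Ideal.zero_mem _)
  have hlies : p.LiesOver p := ⟨rfl⟩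
  have hmax : IsLocalRing.maximalIdeal (Localization.AtPrime p) =
      Ideal.span {algebraMap O (Localization.AtPrime p) π} := by
    rw [← map_eq_span_of_localization p p hπ hπ2, Localization.AtPrime.map_eq_maximalIdeal]
  have hirr : Irreducible (algebraMap O (Localization.AtPrime p) π) :=
    (IsDiscreteValuationRing.irreducible_iff_uniformizer _).mpr hmax
  refine ⟨h0, fun x => ?_, fun x hx => ?_⟩
  · rw [IsLocalRing.residue_eq_zero_iff, hmax, Ideal.mem_span_singleton]
  · obtain ⟨m, u, hu⟩ := IsDiscreteValuationRing.eq_unit_mul_pow_irreducible hx hirr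
    exact ⟨m, u, u.isUnit, by rw [hu, mul_comm]⟩

variable [Algebra.IsSeparable K L] [SMulCommClass Gal(L/K) O L]
variable (Q : Ideal (integralClosure O L)) [Q.IsPrime]

/-- The elements of the valuation ring fixed by the inertia group. -/
def inertiaRing : Subring (placeRing K Q) where
  carrier := {x | ∀ g ∈ Q.inertia Gal(L/K), g (x : L) = x}
  mul_mem' hx hy g hg := by
    have h1 := hx g hg
    have h2 := hy g hg
    rw [MulMemClass.coe_mul, map_mul, h1, h2]
  one_mem' g _ := map_one g
  add_mem' hx hy g hg := by
    have h1 := hx g hg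
    have h2 := hy g hg
    rw [AddMemClass.coe_add, map_add, h1, h2]
  zero_mem' g _ := map_zero g
  neg_mem' hx g hg := by
    have h1 := hx g hg
    rw [NegMemClass.coe_neg, map_neg, h1]

theorem isUnit_inertiaRing {x : inertiaRing K Q} (h : IsUnit (x : placeRing K Q)) : IsUnit x := by
  obtain ⟨y, hy⟩ := h.exists_right_inv
  have hxy : ((x : placeRing K Q) : L) * y = 1 := congrArg Subtype.val hy
  have hx0 : ((x : placeRing K Q) : L) ≠ 0 := left_ne_zero_of_mul_eq_one hxy
  refine IsUnit.of_mul_eq_one (⟨y, fun g hg => mul_left_cancel₀ hx0 ?_⟩ : inertiaRing K Q)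
    (Subtype.ext hy)
  conv_lhs => rw [← x.2 g hg]
  rw [← map_mul, hxy, map_one]

/-- The base ring, as a subring of the inertia ring. -/
def toInertiaRing : O →+* inertiaRing K Q :=
  ((toPlaceRing K Q).comp (algebraMap O (integralClosure O L))).codRestrict _ fun x g _ => by
    change g (algebraMap O L x) = algebraMap O L x
    rw [IsScalarTower.algebraMap_apply O K L]
    exact g.commutes _

/-- Write an inertia-fixed x as a quotient of an inertia-fixed integral element by an element of O.
Both are powers of π up to elements outside Q, so x is a power of π times a unit of the valuation
ring, and this unit is again inertia-fixed. -/
theorem isUniformizer_inertiaRing [IsGalois K L] (p : Ideal O) [p.IsPrime] [Q.LiesOver p]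
    (hp : p ≠ ⊥) [Finite (O ⧸ p)] {π : O} (hπ : π ∈ p) (hπ2 : π ∉ p ^ 2) :
    IsUniformizer (toInertiaRing K Q π)
      ((IsLocalRing.residue (placeRing K Q)).comp (inertiaRing K Q).subtype) := by
  have hinjL : Function.Injective (algebraMap O L) := by
    rw [IsScalarTower.algebraMap_eq O K L]
    exact (algebraMap K L).injective.comp (IsFractionRing.injective O K)
  have hπ0 : π ≠ 0 := fun h => hπ2 (by rw [h]; exact Ideal.zero_mem _)
  have hπQ : algebraMap O (integralClosure O L) π ∈ Q := by
    rw [Ideal.over_def Q p] at hπ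
    exact hπ
  have hπL : algebraMap O L π ≠ 0 := fun h => hπ0 (hinjL (h.trans (map_zero _).symm))
  have hresπ : IsLocalRing.residue (placeRing K Q) (toInertiaRing K Q π) = 0 :=
    (residue_toPlaceRing_eq_zero_iff K Q (algebraMap O _ π)).mpr hπQ
  have key : ∀ x : inertiaRing K Q, x ≠ 0 →
      ∃ (m : ℕ) (u : inertiaRing K Q), IsUnit u ∧ x = toInertiaRing K Q π ^ m * u := by
    intro x hx
    have hx0 : ((x : placeRing K Q) : L) ≠ 0 := fun h => hx (Subtype.ext (Subtype.ext h))
    have halg : IsAlgebraic O ((x : placeRing K Q) : L) :=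
      (IsFractionRing.isAlgebraic_iff O K L).mpr (Algebra.IsAlgebraic.isAlgebraic _)
    obtain ⟨d, hd0, hdint⟩ := halg.exists_integral_multiple
    have hdL : algebraMap O L d ≠ 0 := fun h => hd0 (hinjL (h.trans (map_zero _).symm))
    have hgO : ∀ (g : Gal(L/K)) (y : O), g (algebraMap O L y) = algebraMap O L y := fun g y => by
      rw [IsScalarTower.algebraMap_apply O K L]
      exact g.commutes _
    set a : integralClosure O L := ⟨d • ((x : placeRing K Q) : L), hdint⟩ with ha
    have haL : (a : L) = algebraMap O L d * (x : placeRing K Q) := Algebra.smul_def _ _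
    have ha0 : a ≠ 0 := fun h => mul_ne_zero hdL hx0 (by rw [← haL, h]; rfl)
    obtain ⟨m, s, u, hs, hu, hsu⟩ := exists_mul_eq_pow_mul_of_inertia_sep (K := K) Q p hp hπ hπ2
      ha0 (fun g hg => Subtype.ext (by
        change g (a : L) = a
        rw [haL, map_mul, hgO, x.2 g hg]))
    obtain ⟨j, s', u', hs', hu', hsu'⟩ := exists_mul_eq_pow_mul_of_inertia_sep (K := K) Q p hp hπ hπ2
      (a := algebraMap O (integralClosure O L) d) (fun h => hdL (congrArg Subtype.val h))
      (fun g _ => Subtype.ext (hgO g d))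
    have e1 : (s : L) * (algebraMap O L d * (x : placeRing K Q)) = algebraMap O L π ^ m * u := by
      rw [← haL]
      exact congrArg Subtype.val hsu
    have e2 : (s' : L) * algebraMap O L d = algebraMap O L π ^ j * u' := congrArg Subtype.val hsu'
    have e3 : algebraMap O L π ^ j * ((s * u' : integralClosure O L) * (x : placeRing K Q) : L) =
        algebraMap O L π ^ m * (u * s' : integralClosure O L) := by
      push_cast
      linear_combination (s' : L) * e1 - (s : L) * (x : placeRing K Q) * e2
    have hw1 := (isUnit_toPlaceRing_iff K Q (s * u')).mpr
      fun h => (Ideal.IsPrime.mem_or_mem ‹_› h).elim hs hu'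
    have hw2 := (isUnit_toPlaceRing_iff K Q (u * s')).mpr
      fun h => (Ideal.IsPrime.mem_or_mem ‹_› h).elim hu hs'
    -- A negative exponent would make π divide a unit of the valuation ring.
    have hjm : j ≤ m := by
      by_contra hlt
      obtain ⟨e, rfl⟩ := Nat.exists_eq_add_of_lt (not_le.mp hlt)
      have e4 : (toPlaceRing K Q (u * s')) = (toInertiaRing K Q π : placeRing K Q) *
          ((toInertiaRing K Q π : placeRing K Q) ^ e * (toPlaceRing K Q (s * u') * x)) := by
        apply Subtype.ext
        have hc := pow_ne_zero m hπL
        apply mul_left_cancel₀ hc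
        refine e3.symm.trans ?_
        change _ = algebraMap O L π ^ m * (algebraMap O L π * (algebraMap O L π ^ e *
          (((s * u' : integralClosure O L) : L) * (x : placeRing K Q))))
        ring
      have e5 : IsLocalRing.residue (placeRing K Q) (toPlaceRing K Q (u * s')) = 0 := by
        rw [e4, map_mul, hresπ, zero_mul]
      exact ((IsLocalRing.residue_ne_zero_iff_isUnit _).mpr hw2) e5
    obtain ⟨e, rfl⟩ := Nat.exists_eq_add_of_le hjm
    obtain ⟨w, hw⟩ := hw1.exists_right_inv
    have hwL : ((s * u' : integralClosure O L) : L) * w = 1 := congrArg Subtype.val hw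
    have hxe : ((x : placeRing K Q) : L) =
        algebraMap O L π ^ e * ((u * s' : integralClosure O L) * w) := by
      apply mul_left_cancel₀ (pow_ne_zero j hπL)
      apply mul_left_cancel₀ (left_ne_zero_of_mul_eq_one hwL)
      linear_combination e3 - algebraMap O L π ^ j * algebraMap O L π ^ e *
        (u * s' : integralClosure O L) * hwL
    have hwu : IsUnit (toPlaceRing K Q (u * s') * w) :=
      hw2.mul (IsUnit.of_mul_eq_one_right _ hw)
    have hfix : toPlaceRing K Q (u * s') * w ∈ inertiaRing K Q := fun g hg => by
      apply mul_left_cancel₀ (pow_ne_zero e hπL)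
      have h1 : ((toPlaceRing K Q (u * s') * w : placeRing K Q) : L) =
        (u * s' : integralClosure O L) * w := rfl
      have h2 := x.2 g hg
      rw [hxe, map_mul, map_pow, hgO] at h2
      rw [h1]
      exact h2
    exact ⟨e, ⟨_, hfix⟩, isUnit_inertiaRing K Q hwu, Subtype.ext (Subtype.ext hxe)⟩
  refine ⟨fun h => hπL (congrArg (fun z : inertiaRing K Q => ((z : placeRing K Q) : L)) h),
    fun x => ⟨fun hx => ?_, ?_⟩, key⟩
  · by_cases hx0 : x = 0
    · rw [hx0]
      exact dvd_zero _
    obtain ⟨m, u, hu, rfl⟩ := key x hx0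
    rcases m with _ | m
    · rw [pow_zero, one_mul] at hx
      exact absurd hx ((hu.map ((IsLocalRing.residue (placeRing K Q)).comp
        (inertiaRing K Q).subtype)).ne_zero)
    · rw [pow_succ', mul_assoc]
      exact Dvd.intro _ rfl
  · rintro ⟨y, rfl⟩
    rw [RingHom.comp_apply, map_mul, map_mul]
    refine mul_eq_zero_of_left ?_ _
    exact hresπ

end InertiaRing

end TMotive
end

open scoped Polynomial TensorProduct
noncomputable section
namespace TMotive

/-! ### Integral models of σ. -/

theorem DegLE.of_map {R R' : Type*} [CommRing R] [CommRing R'] {z : ℤ} {p : R[X]} {f : R →+* R'}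
    (hf : Function.Injective f) (h : DegLE z (p.map f)) : DegLE z p := fun e he =>
  hf (by rw [← Polynomial.coeff_map, h e he, map_zero])

/-- Rescaling the matrix by a constant rescales its iterates by constants, so degree estimates
survive the passage to an integral model. -/
theorem exists_iterProd_C_eq {R : Type*} [CommRing R] (f : R →+* R) (b : R) (N : ℕ) :
    ∃ a, iterProd (Polynomial.mapRingHom f) (Polynomial.C b) N = Polynomial.C a := by
  induction N with
  | zero => exact ⟨1, by simp [iterProd]⟩
  | succ N ih =>
    obtain ⟨a, ha⟩ := ih
    exact ⟨b * f a, by rw [iterProd_succ, ha, Polynomial.coe_mapRingHom, Polynomial.map_C, map_mul]⟩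

/-- A matrix of polynomials has a common denominator. -/
theorem exists_map_eq_smul {O K n : Type*} [CommRing O] [IsDomain O] [Field K] [Algebra O K]
    [IsFractionRing O K] [Fintype n] (A : Matrix n n K[X]) :
    ∃ (b : O) (A' : Matrix n n O[X]), b ≠ 0 ∧
      A'.map (Polynomial.mapRingHom (algebraMap O K)) = Polynomial.C (algebraMap O K b) • A := by
  classical
  obtain ⟨b, hb⟩ := IsLocalization.exist_integer_multiples (nonZeroDivisors O)
    ((Finset.univ : Finset (n × n)).sigma fun ij => (A ij.1 ij.2).support)
    (fun x => (A x.1.1 x.1.2).coeff x.2)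
  have h : ∀ i j, ∃ p : O[X], p.map (algebraMap O K) =
      Polynomial.C (algebraMap O K b) * A i j := fun i j => by
    rw [← Polynomial.mem_lifts, Polynomial.lifts_iff_coeff_lifts]
    intro e
    rw [Polynomial.coeff_C_mul]
    by_cases he : e ∈ (A i j).support
    · obtain ⟨y, hy⟩ := hb ⟨(i, j), e⟩ (Finset.mem_sigma.mpr ⟨Finset.mem_univ _, he⟩)
      refine ⟨y, hy.trans ?_⟩
      exact Algebra.smul_def _ _
    · rw [Polynomial.notMem_support_iff.mp he, mul_zero]
      exact ⟨0, map_zero _⟩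
  choose A' hA' using h
  exact ⟨b, A', nonZeroDivisors.ne_zero b.2, by ext1 i j; exact hA' i j⟩

/-- Scaling the matrix of a Frobenius-linear map to make it integral. -/
theorem exists_integral_smul {Fq : Type*} [Field Fq] [Fintype Fq] {O K n : Type*} [CommRing O]
    [IsDomain O] [Field K] [Algebra O K] [IsFractionRing O K] [Algebra Fq O] [Algebra Fq K]
    [IsScalarTower Fq O K] [Fintype n] [DecidableEq n] {A : Matrix n n K[X]} {α : K} {θ : O} {m : ℕ}
    (hα : α ≠ 0)
    (hA : A.det = Polynomial.C α * (Polynomial.X - Polynomial.C (algebraMap O K θ)) ^ m)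
    (hdeg : ∀ C : ℕ, ∃ N₀ : ℕ, ∀ N ≥ N₀, ∀ i j,
      DegLE (m * N - C) ((iterMat (coeffFrob Fq K) A N).adjugate i j)) :
    ∃ (b : O) (A' : Matrix n n O[X]) (α' : O), b ≠ 0 ∧ α' ≠ 0 ∧
      A'.map (Polynomial.mapRingHom (algebraMap O K)) =
        Polynomial.C (algebraMap O K b ^ (Fintype.card Fq - 1)) • A ∧
      A'.det = Polynomial.C α' * (Polynomial.X - Polynomial.C θ) ^ m ∧
      ∀ C : ℕ, ∃ N₀ : ℕ, ∀ N ≥ N₀, ∀ i j,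
        DegLE (m * N - C) ((iterMat (coeffFrob Fq O) A' N).adjugate i j) := by
  obtain ⟨b, A₁, hb, hA₁⟩ := exists_map_eq_smul (O := O) A
  have hinj : Function.Injective (algebraMap O K) := IsFractionRing.injective O K
  have hbK : algebraMap O K b ≠ 0 := fun h => hb (hinj (h.trans (map_zero _).symm))
  have hq : Fintype.card Fq - 1 = Fintype.card Fq - 2 + 1 := by
    have := Fintype.one_lt_card (α := Fq)
    omega
  -- The scaling factor is b^(q-1) rather than b because it comes from replacing a solution Y by bY:
  -- (bY)^(q) = (bY) · b^(q-1) A. One factor b clears the denominators and the other q - 2 are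
  -- harmless.
  set A' : Matrix n n O[X] := Polynomial.C (b ^ (Fintype.card Fq - 2)) • A₁ with hA'
  have hmap : A'.map (Polynomial.mapRingHom (algebraMap O K)) =
      Polynomial.C (algebraMap O K b ^ (Fintype.card Fq - 1)) • A := by
    have h1 : A'.map (Polynomial.mapRingHom (algebraMap O K)) =
        Polynomial.C (algebraMap O K b ^ (Fintype.card Fq - 2)) •
          A₁.map (Polynomial.mapRingHom (algebraMap O K)) := by
      ext1 i j
      simp [hA']
    rw [h1, hA₁, smul_smul, ← Polynomial.C_mul, ← pow_succ, ← hq]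
  have hdet : A'.det.map (algebraMap O K) =
      Polynomial.C ((algebraMap O K b ^ (Fintype.card Fq - 1)) ^ Fintype.card n * α) *
        (Polynomial.X - Polynomial.C (algebraMap O K θ)) ^ m := by
    rw [← Polynomial.coe_mapRingHom, RingHom.map_det, RingHom.mapMatrix_apply, hmap,
      Matrix.det_smul, hA, ← Polynomial.C_pow, ← mul_assoc, ← Polynomial.C_mul]
  -- Since (t - θ)^m is monic, the constant in front is the leading coefficient of a polynomial over
  -- O, hence integral.
  have hlead : algebraMap O K A'.det.leadingCoeff =
      (algebraMap O K b ^ (Fintype.card Fq - 1)) ^ Fintype.card n * α := by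
    rw [← Polynomial.leadingCoeff_map_of_injective hinj, hdet, Polynomial.leadingCoeff_mul,
      Polynomial.leadingCoeff_C, ((Polynomial.monic_X_sub_C _).pow m).leadingCoeff, mul_one]
  refine ⟨b, A', A'.det.leadingCoeff, hb, fun h => ?_, hmap, ?_, fun C => ?_⟩
  · rw [h, map_zero] at hlead
    exact mul_ne_zero (pow_ne_zero _ (pow_ne_zero _ hbK)) hα hlead.symm
  · apply Polynomial.map_injective _ hinj
    rw [hdet, ← hlead]
    simp
  · obtain ⟨N₀, hN₀⟩ := hdeg C
    refine ⟨N₀, fun N hN i j => DegLE.of_map hinj ?_⟩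
    obtain ⟨a, ha⟩ := exists_iterProd_C_eq (frobHom Fq K)
      (algebraMap O K b ^ (Fintype.card Fq - 1)) N
    have h2 : ((iterMat (coeffFrob Fq O) A' N).adjugate.map
        (Polynomial.mapRingHom (algebraMap O K))) =
        Polynomial.C (a ^ (Fintype.card n - 1)) • (iterMat (coeffFrob Fq K) A N).adjugate := by
      rw [← RingHom.mapMatrix_apply, RingHom.map_adjugate, RingHom.mapMatrix_apply,
        iterMat_map (coeffFrob Fq O) (coeffFrob Fq K) (Polynomial.mapRingHom (algebraMap O K))
          (fun p => by
            rw [Polynomial.coe_mapRingHom]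
            exact (coeffFrob_map (algebraMap O K) p).symm), hmap, iterMat_smul,
        Matrix.adjugate_smul]
      congr 1
      exact (congrArg (· ^ (Fintype.card n - 1)) ha).trans Polynomial.C_pow.symm
    have h3 := congrFun (congrFun h2 i) j
    rw [Matrix.map_apply, Polynomial.coe_mapRingHom, Matrix.smul_apply, smul_eq_mul] at h3
    rw [h3]
    exact (hN₀ N hN i j).C_mul _

/-! ### The eigenvalue 1 is excluded at every unramified place. -/

section Nonvanishing

variable {Fq : Type*} [Field Fq] [Fintype Fq] {O K L : Type*} [CommRing O] [IsDedekindDomain O]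
  [Field K] [Algebra O K] [IsFractionRing O K] [Field L] [Algebra K L] [Algebra O L]
  [IsScalarTower O K L] [Algebra.IsSeparable K L] [SMulCommClass Gal(L/K) O L]
  (Q : Ideal (integralClosure O L)) [Q.IsPrime]

instance placeRing.instAlgebra [Algebra Fq O] : Algebra Fq (placeRing K Q) :=
  RingHom.toAlgebra ((toPlaceRing K Q).comp
    ((algebraMap O (integralClosure O L)).comp (algebraMap Fq O)))

instance inertiaRing.instAlgebra [Algebra Fq O] : Algebra Fq (inertiaRing K Q) :=
  RingHom.toAlgebra ((toInertiaRing K Q).comp (algebraMap Fq O))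

instance placeRing.instIsScalarTower [Algebra Fq O] [Algebra Fq L] [IsScalarTower Fq O L] :
    IsScalarTower Fq (placeRing K Q) L :=
  IsScalarTower.of_algebraMap_eq fun x => IsScalarTower.algebraMap_apply Fq O L x

/-- The inertia ring is stable under Frobenius. -/
theorem exists_inertiaRing_hom {g : Gal(L/K)} {N : ℕ}
    (hg : ∀ a : integralClosure O L, g • a - a ^ N ∈ Q) :
    ∃ γ : inertiaRing K Q →+* inertiaRing K Q,
      (∀ x, ((γ x : placeRing K Q) : L) = g (x : placeRing K Q)) ∧
      ∀ x, IsLocalRing.residue (placeRing K Q) (γ x) =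
        IsLocalRing.residue (placeRing K Q) x ^ N := by
  obtain ⟨γ, hγ, hγr⟩ := exists_placeRing_hom hg
  have hinv : ∀ z ∈ Q, g⁻¹ • z ∈ Q := fun z hz => by
    have h1 := hg (g⁻¹ • z)
    rw [smul_inv_smul] at h1
    have h2 := Q.sub_mem hz h1
    rw [sub_sub_cancel] at h2
    exact Ideal.IsPrime.mem_of_pow_mem ‹_› _ h2
  have hmem : ∀ x : inertiaRing K Q, γ x ∈ inertiaRing K Q := fun x h hh => by
    -- Frobenius stabilises Q, so it normalises the inertia group.
    have h1 : g⁻¹ * h * g ∈ Q.inertia Gal(L/K) := fun y => by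
      have h2 := hinv _ (hh (g • y))
      rw [smul_sub, inv_smul_smul] at h2
      rw [mul_smul, mul_smul]
      exact h2
    have h3 : (g⁻¹ * h * g) ((x : placeRing K Q) : L) = x := x.2 _ h1
    rw [hγ]
    conv_rhs => rw [← h3]
    exact (AlgEquiv.apply_symm_apply g _).symm
  exact ⟨(γ.comp (inertiaRing K Q).subtype).codRestrict _ hmem, fun x => hγ x, fun x => hγr x⟩

/-- A Frobenius at an unramified place does not have the eigenvalue `1`. -/
theorem det_one_sub_ne_zero_of_inertia [IsGalois K L] [Algebra Fq O] [Algebra Fq K] [Algebra Fq L]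
    [IsScalarTower Fq O K] [IsScalarTower Fq O L] (p : Ideal O)
    [p.IsPrime] [Q.LiesOver p] (hp : p ≠ ⊥) [Finite (O ⧸ p)] {n : Type*} [Fintype n]
    [DecidableEq n] {A : Matrix n n K[X]} {α : K} {θ : O} {m : ℕ} (hα : α ≠ 0)
    (hA : A.det = Polynomial.C α * (Polynomial.X - Polynomial.C (algebraMap O K θ)) ^ m)
    (hdeg : ∀ C : ℕ, ∃ N₀ : ℕ, ∀ N ≥ N₀, ∀ i j,
      DegLE (m * N - C) ((iterMat (coeffFrob Fq K) A N).adjugate i j))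
    {c : Fq} {Y : Matrix n n (PowerSeries L)} (hYdet : Y.det ≠ 0)
    (hY : Y.map (seriesFrob Fq L) = Y * A.map (expandMap K L c))
    (hin : ∀ g ∈ Q.inertia Gal(L/K), Y.map (PowerSeries.map ((g : L ≃+* L) : L →+* L)) = Y)
    {g : Gal(L/K)} (hg : ∀ a : integralClosure O L, g • a - a ^ Nat.card (O ⧸ p) ∈ Q)
    {Ψ : Matrix n n (PowerSeries Fq)}
    (hΨ : Y.map (PowerSeries.map ((g : L ≃+* L) : L →+* L)) =
      Ψ.map (PowerSeries.map (algebraMap Fq L)) * Y) :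
    (1 - Ψ).det ≠ 0 := by
  obtain ⟨π, hπ, hπ2⟩ := Ideal.exists_mem_pow_notMem_pow_succ p hp (Ideal.IsPrime.ne_top ‹_›) 1
  rw [pow_one] at hπ
  have hinjL : Function.Injective (algebraMap O L) := by
    rw [IsScalarTower.algebraMap_eq O K L]
    exact (algebraMap K L).injective.comp (IsFractionRing.injective O K)
  have towK : IsScalarTower Fq K L := IsScalarTower.of_algebraMap_eq fun x => by
    rw [IsScalarTower.algebraMap_apply Fq O K, ← IsScalarTower.algebraMap_apply O K L,
      ← IsScalarTower.algebraMap_apply Fq O L]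
  obtain ⟨b, A', α', hb, hα', hA', hA'det, hA'deg⟩ := exists_integral_smul hα hA hdeg
  have hres' := isUniformizer_inertiaRing K Q p hp hπ hπ2
  have hres := isUniformizer_localization p hp hπ hπ2
  set R := Localization.AtPrime p with hR
  have hunit : ∀ s : p.primeCompl, IsUnit (toInertiaRing K Q s) := fun s => by
    apply isUnit_inertiaRing
    refine (isUnit_toPlaceRing_iff K Q (algebraMap O _ (s : O))).mpr fun h => s.2 ?_
    have h1 : (s : O) ∈ Q.under O := h
    rwa [← Ideal.over_def Q p] at h1
  let _ : Algebra R (inertiaRing K Q) :=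
    RingHom.toAlgebra (IsLocalization.lift (M := p.primeCompl) (S := R) hunit)
  have hRR' : ∀ x : O, algebraMap R (inertiaRing K Q) (algebraMap O R x) = toInertiaRing K Q x :=
    fun x => IsLocalization.lift_eq hunit x
  have tow : IsScalarTower Fq R (inertiaRing K Q) := IsScalarTower.of_algebraMap_eq fun x => by
    rw [IsScalarTower.algebraMap_apply Fq O R, hRR']
    rfl
  let res : R →ₐ[Fq] IsLocalRing.ResidueField R :=
    { IsLocalRing.residue R with commutes' := fun _ => rfl }
  let res' : inertiaRing K Q →ₐ[Fq] IsLocalRing.ResidueField (placeRing K Q) :=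
    { (IsLocalRing.residue (placeRing K Q)).comp (inertiaRing K Q).subtype with
      commutes' := fun _ => rfl }
  have hloc : IsLocalHom ((res' : inertiaRing K Q →+* _).comp
      (algebraMap R (inertiaRing K Q))) := ⟨fun x hx => by
    by_contra hu
    have h1 : IsLocalRing.residue R x = 0 := by
      rw [IsLocalRing.residue_eq_zero_iff]
      exact hu
    obtain ⟨y, hy⟩ := (hres.res_eq_zero_iff x).mp h1
    refine hx.ne_zero (M₀ := IsLocalRing.ResidueField (placeRing K Q)) ?_
    rw [hy, RingHom.comp_apply, map_mul, map_mul]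
    refine mul_eq_zero_of_left ?_ _
    rw [hRR']
    exact (hres'.res_eq_zero_iff _).mpr dvd_rfl⟩
  let _ : Algebra (IsLocalRing.ResidueField R) (IsLocalRing.ResidueField (placeRing K Q)) :=
    RingHom.toAlgebra (IsLocalRing.ResidueField.lift ((res' : inertiaRing K Q →+* _).comp
      (algebraMap R (inertiaRing K Q))))
  have hcomp : ∀ x, res' (algebraMap R (inertiaRing K Q) x) = algebraMap _ _ (res x) :=
    fun x => rfl
  have tow' : IsScalarTower Fq (IsLocalRing.ResidueField R)
      (IsLocalRing.ResidueField (placeRing K Q)) := IsScalarTower.of_algebraMap_eq fun x => by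
    have h1 := hcomp (algebraMap Fq R x)
    rw [← IsScalarTower.algebraMap_apply, res'.commutes, res.commutes] at h1
    exact h1
  have hpm : p.IsMaximal := Ideal.IsPrime.isMaximal ‹_› hp
  have hbij := Ideal.bijective_algebraMap_quotient_residueField p
  have hkfin : Finite (IsLocalRing.ResidueField R) := Finite.of_surjective _ hbij.2
  have hkcard : Nat.card (O ⧸ p) = Nat.card (IsLocalRing.ResidueField R) :=
    Nat.card_congr (Equiv.ofBijective _ hbij)
  have := Fintype.ofFinite (IsLocalRing.ResidueField R)
  obtain ⟨d, hd⟩ : ∃ d, d = Module.finrank Fq (IsLocalRing.ResidueField R) := ⟨_, rfl⟩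
  have hfinmod : Module.Finite Fq (IsLocalRing.ResidueField R) := Module.Finite.of_finite
  have hcard : Fintype.card (IsLocalRing.ResidueField R) = Fintype.card Fq ^ d := by
    rw [hd]
    exact Module.card_eq_pow_finrank
  obtain ⟨γ, hγ, hγr⟩ := exists_inertiaRing_hom Q hg
  let ι : inertiaRing K Q →ₐ[Fq] L :=
    { (placeRing K Q).subtype.comp (inertiaRing K Q).subtype with
      commutes' := fun x => (IsScalarTower.algebraMap_apply Fq O L x).symm }
  have hι : Function.Injective ι := Subtype.val_injective.comp Subtype.val_injective
  have hιmap : Function.Injective (PowerSeries.map (ι : inertiaRing K Q →+* L)) :=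
    PowerSeries.map_injective _ hι
  have hβ : ∀ f : L →+* L, (∀ x : O, f (algebraMap O L x) = algebraMap O L x) →
      PowerSeries.map f (PowerSeries.C (algebraMap O L b)) = PowerSeries.C (algebraMap O L b) :=
    fun f hf => by rw [PowerSeries.map_C, hf]
  have hgO : ∀ (g : Gal(L/K)) (y : O), g (algebraMap O L y) = algebraMap O L y := fun g y => by
    rw [IsScalarTower.algebraMap_apply O K L]
    exact g.commutes _
  -- Multiplying Y by the constant b of the integral model gives a solution of an equation with
  -- integral coefficients, so `exists_algebraMap_eq_coeff` applies.
  set β : PowerSeries L := PowerSeries.C (algebraMap O L b) with hβdef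
  have hexp : ∀ q : O[X], expandMap K L c (q.map (algebraMap O K)) =
      expand L c (q.map (algebraMap O L)) := fun q => by
    rw [expandMap, RingHom.comp_apply, Polynomial.coe_mapRingHom, Polynomial.map_map,
      ← IsScalarTower.algebraMap_eq]
  have hβY : (β • Y).map (seriesFrob Fq L) =
      (β • Y) * (A'.map (fun q => expand L c (q.map (algebraMap O L)))) := by
    have h1 : A'.map (fun q => expand L c (q.map (algebraMap O L))) =
        β ^ (Fintype.card Fq - 1) • A.map (expandMap K L c) := by
      ext1 i j
      have h2 := congrArg (expandMap K L c) (congrFun (congrFun hA' i) j)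
      rw [Matrix.map_apply, Polynomial.coe_mapRingHom, hexp, Matrix.smul_apply, smul_eq_mul,
        map_mul, expandMap_C, map_pow, map_pow, ← IsScalarTower.algebraMap_apply O K L] at h2
      exact h2
    have h3 : seriesFrob Fq L β = β * β ^ (Fintype.card Fq - 1) := by
      rw [← pow_succ', Nat.sub_add_cancel Fintype.card_pos]
      ext e
      rw [← pow_one (seriesFrob Fq L), coeff_seriesFrob_pow, pow_one, hβdef, ← map_pow PowerSeries.C,
        PowerSeries.coeff_C, PowerSeries.coeff_C]
      split_ifs
      · rfl
      · rw [zero_pow Fintype.card_ne_zero]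
    rw [h1, Matrix.smul_mul, Matrix.mul_smul, ← hY, smul_smul, ← h3]
    ext1 i j
    simp only [Matrix.map_apply, Matrix.smul_apply, smul_eq_mul, map_mul]
  have hint := fun i j e => exists_algebraMap_eq_coeff (B := placeRing K Q)
    (A := A'.map (fun q => expand (placeRing K Q) c (q.map ((toPlaceRing K Q).comp
      (algebraMap O (integralClosure O L)))))) (Y := β • Y) (by
    rw [hβY]
    congr 1
    ext1 i j
    simp only [Matrix.map_apply]
    have h4 := expand_map c (IsScalarTower.toAlgHom Fq (placeRing K Q) L)
      ((A' i j).map ((toPlaceRing K Q).comp (algebraMap O (integralClosure O L))))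
    rw [Polynomial.map_map] at h4
    exact h4) i j e
  choose y hy using hint
  -- b comes from O and inertia fixes Y, so the coefficients of βY lie not just in the valuation
  -- ring but in its inertia-fixed part, where π is still a uniformizer.
  have hyfix : ∀ i j e, y i j e ∈ inertiaRing K Q := fun i j e h hh => by
    have h1 : ((y i j e : placeRing K Q) : L) = _ := hy i j e
    have h2 := congrArg (PowerSeries.coeff e) (congrFun (congrFun (hin h hh) i) j)
    rw [Matrix.map_apply, PowerSeries.coeff_map] at h2
    rw [h1, Matrix.smul_apply, smul_eq_mul, hβdef, PowerSeries.coeff_C_mul, map_mul, hgO]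
    congr 1
  set Y₁ : Matrix n n (PowerSeries (inertiaRing K Q)) :=
    fun i j => PowerSeries.mk fun e => ⟨y i j e, hyfix i j e⟩ with hY₁
  have hY₁Y : Y₁.map (PowerSeries.map (ι : inertiaRing K Q →+* L)) = β • Y := by
    ext1 i j
    ext e
    rw [Matrix.map_apply, PowerSeries.coeff_map, hY₁, PowerSeries.coeff_mk]
    exact hy i j e
  have hβ0 : β ≠ 0 := fun h => hb (hinjL (by
    rw [map_zero]
    exact PowerSeries.C_injective (h.trans (map_zero _).symm)))
  have hARexp : ∀ q : O[X], PowerSeries.map (ι : inertiaRing K Q →+* L)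
      (expandMap R (inertiaRing K Q) c (q.map (algebraMap O R))) =
        expand L c (q.map (algebraMap O L)) := fun q => by
    rw [expandMap, RingHom.comp_apply, Polynomial.coe_mapRingHom, ← expand_map,
      Polynomial.map_map, Polynomial.map_map]
    congr 2
    ext x
    exact congrArg ι (hRR' x)
  have hmapinj : Function.Injective fun Z : Matrix n n (PowerSeries (inertiaRing K Q)) =>
      Z.map (PowerSeries.map (ι : inertiaRing K Q →+* L)) := Matrix.map_injective hιmap
  refine IsUniformizer.det_one_sub_ne_zero (R := R) (R' := inertiaRing K Q) (res := res)
    (res' := res') (π := algebraMap O R π) (d := d) (m := m) (θ := algebraMap O R θ)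
    (α := algebraMap O R α') (A := A'.map (Polynomial.mapRingHom (algebraMap O R))) (Y := Y₁)
    hres ?_ hcomp IsLocalRing.residue_surjective ?_ ?_ c ?_ ?_ ?_ ?_ ?_ γ ?_ ?_ ?_
  · rw [hRR']
    exact hres'
  · rw [hd]
    exact Module.finrank_pos
  · intro x
    rw [← hcard]
    exact FiniteField.pow_card x
  · exact fun h => hα' (IsLocalization.injective R p.primeCompl_le_nonZeroDivisors
      (h.trans (map_zero _).symm))
  · rw [← RingHom.mapMatrix_apply, ← RingHom.map_det, hA'det]
    simp
  · intro C
    obtain ⟨N₀, hN₀⟩ := hA'deg C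
    refine ⟨N₀, fun N hN i j => ?_⟩
    have h1 : (iterMat (coeffFrob Fq O) A' N).adjugate.map (Polynomial.mapRingHom (algebraMap O R)) =
        (iterMat (coeffFrob Fq R) (A'.map (Polynomial.mapRingHom (algebraMap O R))) N).adjugate := by
      rw [← RingHom.mapMatrix_apply, RingHom.map_adjugate, RingHom.mapMatrix_apply,
        iterMat_map (coeffFrob Fq O) (coeffFrob Fq R) (Polynomial.mapRingHom (algebraMap O R))
          (fun p => by
            rw [Polynomial.coe_mapRingHom]
            exact (coeffFrob_map (algebraMap O R) p).symm)]
    rw [← h1]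
    exact (hN₀ N hN i j).map _
  · intro h
    have h1 := congrArg (PowerSeries.map (ι : inertiaRing K Q →+* L)) h
    rw [RingHom.map_det, RingHom.mapMatrix_apply, hY₁Y, Matrix.det_smul, map_zero] at h1
    exact mul_ne_zero (pow_ne_zero _ hβ0) hYdet h1
  · apply hmapinj
    have h1 : (Y₁.map (seriesFrob Fq (inertiaRing K Q))).map
        (PowerSeries.map (ι : inertiaRing K Q →+* L)) =
        (Y₁.map (PowerSeries.map (ι : inertiaRing K Q →+* L))).map (seriesFrob Fq L) := by
      ext1 i j
      exact (seriesFrob_map ι _).symm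
    change (Y₁.map (seriesFrob Fq (inertiaRing K Q))).map
        (PowerSeries.map (ι : inertiaRing K Q →+* L)) = (Y₁ * _).map _
    rw [h1, hY₁Y, hβY, Matrix.map_mul, hY₁Y]
    congr 1
    ext1 i j
    exact (hARexp _).symm
  · intro x
    obtain ⟨⟨u, s⟩, hus⟩ := IsLocalization.surj p.primeCompl x
    have hγO : ∀ z : O, γ (toInertiaRing K Q z) = toInertiaRing K Q z := fun z =>
      Subtype.ext (Subtype.ext ((hγ _).trans (hgO g z)))
    have h1 := congrArg (algebraMap R (inertiaRing K Q)) hus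
    rw [map_mul, hRR', hRR'] at h1
    have h2 := congrArg γ h1
    rw [map_mul, hγO, hγO, ← h1] at h2
    exact (hunit s).mul_right_cancel h2
  · intro x
    rw [← hcard, ← Nat.card_eq_fintype_card, ← hkcard]
    exact hγr x
  · apply hmapinj
    change (Y₁.map (PowerSeries.map γ)).map (PowerSeries.map (ι : inertiaRing K Q →+* L)) =
      (Ψ.map (PowerSeries.map (algebraMap Fq (inertiaRing K Q))) * Y₁).map _
    have h1 : (Y₁.map (PowerSeries.map γ)).map (PowerSeries.map (ι : inertiaRing K Q →+* L)) =
        (Y₁.map (PowerSeries.map (ι : inertiaRing K Q →+* L))).map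
          (PowerSeries.map ((g : L ≃+* L) : L →+* L)) := by
      ext1 i j
      ext e
      simp only [Matrix.map_apply, PowerSeries.coeff_map]
      exact hγ _
    have h2 : (Ψ.map (PowerSeries.map (algebraMap Fq (inertiaRing K Q)))).map
        (PowerSeries.map (ι : inertiaRing K Q →+* L)) =
        Ψ.map (PowerSeries.map (algebraMap Fq L)) := by
      ext1 i j
      ext e
      simp only [Matrix.map_apply, PowerSeries.coeff_map]
      exact ι.commutes _
    rw [Matrix.map_mul, h1, h2, hY₁Y, Matrix.mul_smul, ← hΨ]
    ext1 i j
    rw [Matrix.map_apply, Matrix.smul_apply, smul_eq_mul, map_mul, hβ _ (hgO g)]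
    rfl

end Nonvanishing

end TMotive
end

open scoped Polynomial TensorProduct
noncomputable section
namespace TMotive

/-! ### Separability of finite extensions of 𝔽_q(θ) inside 𝔽_q((1/θ)). -/

section Separability

open WithZero

/-- `1, x, …, x ^ (p - 1)` are independent over `p`-th powers when `x` has valuation `exp 1`. -/
theorem eq_zero_of_sum_pow_mul_pow {E : Type*} [Field E] (v : Valuation E ℤᵐ⁰) {x : E}
    (hx : v x = exp 1) {p : ℕ} (hp : p ≠ 0) {z : ℕ → E}
    (h : ∑ k ∈ Finset.range p, z k ^ p * x ^ k = 0) {k : ℕ} (hk : k < p) : z k = 0 := by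
  classical
  by_contra hzk
  have hx0 : x ≠ 0 := fun h0 => by
    rw [h0, map_zero] at hx
    exact exp_ne_zero hx.symm
  have hval : ∀ i, z i ≠ 0 → v (z i ^ p * x ^ i) = exp (p * log (v (z i)) + i) := fun i hi => by
    rw [map_mul, map_pow, map_pow, hx, exp_add, ← nsmul_eq_mul, exp_nsmul,
      exp_log ((Valuation.ne_zero_iff v).mpr hi), ← exp_nsmul, nsmul_one]
  set S := (Finset.range p).filter fun i => z i ≠ 0 with hS
  have hSk : k ∈ S := Finset.mem_filter.mpr ⟨Finset.mem_range.mpr hk, hzk⟩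
  obtain ⟨i, hi, hmax⟩ := S.exists_max_image (fun i => v (z i ^ p * x ^ i)) ⟨k, hSk⟩
  have hi0 := (Finset.mem_filter.mp hi).2
  have hip := Finset.mem_range.mp (Finset.mem_filter.mp hi).1
  have hsum : ∑ k ∈ S, z k ^ p * x ^ k = 0 := by
    rw [← h]
    refine Finset.sum_subset (Finset.filter_subset _ _) fun l hl hlS => ?_
    have hl0 : z l = 0 := by
      by_contra hne
      exact hlS (Finset.mem_filter.mpr ⟨hl, hne⟩)
    rw [hl0, zero_pow hp, zero_mul]
  rw [← Finset.add_sum_erase _ _ hi] at hsum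
  have hti : v (z i ^ p * x ^ i) ≠ 0 :=
    (Valuation.ne_zero_iff v).mpr (mul_ne_zero (pow_ne_zero _ hi0) (pow_ne_zero _ hx0))
  -- The k-th non-zero term has exponent congruent to k modulo p, so no two of them have equal
  -- valuation and the largest dominates strictly.
  have hlt : v (∑ k ∈ S.erase i, z k ^ p * x ^ k) < v (z i ^ p * x ^ i) := by
    refine Valuation.map_sum_lt v hti fun l hl => ?_
    obtain ⟨hli, hlS⟩ := Finset.mem_erase.mp hl
    have hl0 := (Finset.mem_filter.mp hlS).2
    have hlp := Finset.mem_range.mp (Finset.mem_filter.mp hlS).1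
    refine lt_of_le_of_ne (hmax l hlS) fun heq => hli ?_
    rw [hval l hl0, hval i hi0] at heq
    have h1 := congrArg (· % (p : ℤ)) (exp_injective heq)
    simp only [Int.mul_add_emod_self_left] at h1
    rw [Int.emod_eq_of_lt (by omega) (by omega), Int.emod_eq_of_lt (by omega) (by omega)] at h1
    exact_mod_cast h1
  rw [eq_neg_of_add_eq_zero_left hsum, Valuation.map_neg] at hlt
  exact lt_irrefl _ hlt

variable {Fq : Type*} [Field Fq] [Finite Fq] (p : ℕ) [Fact p.Prime] [CharP Fq p]

/-- Coefficients have p-th roots because a finite field is perfect, and exponents are split by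
division by p. -/
theorem exists_sum_pow_mul_pow_polynomial (a : Fq[X]) :
    ∃ b : ℕ → Fq[X], a = ∑ k ∈ Finset.range p, b k ^ p * Polynomial.X ^ k := by
  have hp0 : p ≠ 0 := (Fact.out : p.Prime).ne_zero
  induction a using Polynomial.induction_on' with
  | add a a' h h' =>
    obtain ⟨b, hb⟩ := h
    obtain ⟨b', hb'⟩ := h'
    refine ⟨b + b', ?_⟩
    rw [hb, hb', ← Finset.sum_add_distrib]
    refine Finset.sum_congr rfl fun k _ => ?_
    rw [Pi.add_apply, add_pow_char, add_mul]
  | monomial e c =>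
    obtain ⟨d, hd⟩ := surjective_frobenius Fq p c
    refine ⟨Pi.single (e % p) (Polynomial.monomial (e / p) d), ?_⟩
    rw [Finset.sum_eq_single (e % p)]
    · rw [Pi.single_eq_same, Polynomial.monomial_pow, Polynomial.X_pow_eq_monomial,
        Polynomial.monomial_mul_monomial, mul_one, mul_comm, Nat.div_add_mod, ← hd, frobenius_def]
    · intro k _ hk
      rw [Pi.single_eq_of_ne hk, zero_pow hp0, zero_mul]
    · intro h
      exact absurd (Finset.mem_range.mpr (Nat.mod_lt _ (Nat.pos_of_ne_zero hp0))) h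

theorem exists_sum_pow_mul_pow_ratFunc (a : RatFunc Fq) :
    ∃ b : ℕ → RatFunc Fq, a = ∑ k ∈ Finset.range p, b k ^ p * RatFunc.X ^ k := by
  have hp0 : p ≠ 0 := (Fact.out : p.Prime).ne_zero
  obtain ⟨b, hb⟩ := exists_sum_pow_mul_pow_polynomial p (a.num * a.denom ^ (p - 1))
  have hd : algebraMap Fq[X] (RatFunc Fq) a.denom ≠ 0 := by
    simpa using a.denom_ne_zero
  refine ⟨fun k => algebraMap Fq[X] (RatFunc Fq) (b k) / algebraMap Fq[X] (RatFunc Fq) a.denom, ?_⟩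
  have h1 := congrArg (algebraMap Fq[X] (RatFunc Fq)) hb
  rw [map_mul, map_pow, map_sum] at h1
  have h2 : a = algebraMap Fq[X] (RatFunc Fq) a.num *
      algebraMap Fq[X] (RatFunc Fq) a.denom ^ (p - 1) /
        algebraMap Fq[X] (RatFunc Fq) a.denom ^ p := by
    conv_lhs => rw [← RatFunc.num_div_denom a]
    rw [div_eq_div_iff hd (pow_ne_zero _ hd), mul_assoc, ← pow_succ,
      Nat.sub_add_cancel (Nat.pos_of_ne_zero hp0)]
  refine h2.trans ?_
  rw [h1, Finset.sum_div]
  refine Finset.sum_congr rfl fun k _ => ?_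
  rw [map_mul, map_pow, map_pow, RatFunc.algebraMap_X, div_pow]
  ring

/-- A finite extension of `𝔽_q(θ)` inside a field with a discrete valuation for which `θ⁻¹` is a
uniformizer is separable. -/
theorem isSeparable_of_algHom {K E : Type*} [Field K] [Algebra (RatFunc Fq) K]
    [FiniteDimensional (RatFunc Fq) K] [Field E] [Algebra (RatFunc Fq) E] (v : Valuation E ℤᵐ⁰)
    (hv : v (algebraMap (RatFunc Fq) E RatFunc.X) = exp 1) (j : K →ₐ[RatFunc Fq] E) :
    Algebra.IsSeparable (RatFunc Fq) K := by
  obtain ⟨p, hchar⟩ := CharP.exists Fq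
  have hpp : Fact p.Prime := ⟨(CharP.char_is_prime_or_zero Fq p).resolve_right
    (CharP.char_ne_zero_of_finite Fq p)⟩
  have hp0 : p ≠ 0 := hpp.out.ne_zero
  have hcharF : CharP (RatFunc Fq) p :=
    charP_of_injective_algebraMap (algebraMap Fq (RatFunc Fq)).injective p
  have hcharE : CharP E p := charP_of_injective_algebraMap (algebraMap (RatFunc Fq) E).injective p
  refine ⟨fun x => ?_⟩
  have hint : IsIntegral (RatFunc Fq) x := Algebra.IsIntegral.isIntegral x
  -- In the inseparable case the minimal polynomial is g(X^p). Expanding the coefficients of g as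
  -- sums of b^p θ^k turns its equation into a relation ∑ z_k^p θ^k = 0, so every z_k vanishes.
  rcases Polynomial.separable_or p (minpoly.irreducible hint) with h | ⟨-, g, hgirr, hg⟩
  · exact h
  exfalso
  choose b hb using fun i => exists_sum_pow_mul_pow_ratFunc p (g.coeff i)
  set y := j x with hy
  set z : ℕ → E := fun k => ∑ i ∈ Finset.range (g.natDegree + 1),
    algebraMap (RatFunc Fq) E (b i k) * y ^ i with hz
  have h0 : ∑ k ∈ Finset.range p, z k ^ p * (algebraMap (RatFunc Fq) E RatFunc.X) ^ k = 0 := by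
    have h1 : Polynomial.aeval y (minpoly (RatFunc Fq) x) = 0 := by
      rw [hy, Polynomial.aeval_algHom_apply, minpoly.aeval, map_zero]
    rw [← hg, Polynomial.expand_aeval, Polynomial.aeval_eq_sum_range] at h1
    rw [← h1]
    have h2 : ∀ k, z k ^ p = ∑ i ∈ Finset.range (g.natDegree + 1),
        algebraMap (RatFunc Fq) E (b i k) ^ p * (y ^ p) ^ i := fun k => by
      rw [hz, sum_pow_char]
      refine Finset.sum_congr rfl fun i _ => ?_
      rw [mul_pow, pow_right_comm]
    simp_rw [h2, Finset.sum_mul]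
    rw [Finset.sum_comm]
    refine Finset.sum_congr rfl fun i _ => ?_
    rw [Algebra.smul_def]
    conv_rhs => rw [hb i, map_sum, Finset.sum_mul]
    refine Finset.sum_congr rfl fun k _ => ?_
    rw [map_mul, map_pow, map_pow]
    ring
  -- The equation z_k = 0 is a polynomial relation for x of degree at most deg g, less than the
  -- degree p · deg g of the minimal polynomial, so all its coefficients vanish.
  have hb0 : ∀ k < p, ∀ i, i ≤ g.natDegree → b i k = 0 := by
    intro k hk i hi
    set f : (RatFunc Fq)[X] := ∑ i ∈ Finset.range (g.natDegree + 1),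
      Polynomial.monomial i (b i k) with hf
    have hfx : Polynomial.aeval x f = 0 := by
      apply j.toRingHom.injective
      have h1 := eq_zero_of_sum_pow_mul_pow v hv hp0 h0 hk
      rw [map_zero, ← h1, hz, hf, map_sum, map_sum]
      refine Finset.sum_congr rfl fun i _ => ?_
      rw [Polynomial.aeval_monomial, map_mul, map_pow]
      congr 1
      exact j.commutes _
    have hfdeg : f.natDegree ≤ g.natDegree :=
      Polynomial.natDegree_sum_le_of_forall_le _ _ fun i hi =>
        (Polynomial.natDegree_monomial_le _).trans (by rw [Finset.mem_range] at hi; omega)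
    have hf0 : f = 0 := by
      by_contra hne
      have h2 := Polynomial.natDegree_le_of_dvd (minpoly.dvd (RatFunc Fq) x hfx) hne
      rw [← hg, Polynomial.natDegree_expand] at h2
      have h3 := hgirr.natDegree_pos
      have h4 := hpp.out.two_le
      nlinarith
    have h5 := congrArg (fun q : (RatFunc Fq)[X] => q.coeff i) hf0
    simp only [hf, Polynomial.finsetSum_coeff, Polynomial.coeff_monomial, Polynomial.coeff_zero]
      at h5
    rwa [Finset.sum_ite_eq' (Finset.range (g.natDegree + 1)) i, if_pos
      (Finset.mem_range.mpr (by omega))] at h5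
  apply hgirr.ne_zero
  rw [← Polynomial.leadingCoeff_eq_zero, Polynomial.leadingCoeff, hb]
  refine Finset.sum_eq_zero fun k hk => ?_
  rw [hb0 k (Finset.mem_range.mp hk) _ le_rfl, zero_pow hp0, zero_mul]

end Separability

/-! ### The valuation of the completion at infinity. -/

section Infinity

open WithZero

variable {Fq : Type*} [Field Fq]

theorem valued_algebraMap_FInfty (x : RatFunc Fq) (hx : x ≠ 0) :
    (Valued.v : Valuation (FInfty Fq) ℤᵐ⁰) (algebraMap (RatFunc Fq) (FInfty Fq) x) =
      exp x.intDegree := by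
  let _ : DecidableEq (RatFunc Fq) := Classical.decEq _
  rw [RatFunc.valuedCompletionAtInfty.def]
  refine (@Valued.extensionValuation_apply_coe _ _ _ _ (RatFunc.inftyValued Fq) x).trans ?_
  exact RatFunc.inftyValuation_of_nonzero (F := Fq) hx

theorem isSeparable_of_algHom_FInfty [Finite Fq] {K : Type*} [Field K] [Algebra (RatFunc Fq) K]
    [FiniteDimensional (RatFunc Fq) K] (j : K →ₐ[RatFunc Fq] FInfty Fq) :
    Algebra.IsSeparable (RatFunc Fq) K :=
  isSeparable_of_algHom (Valued.v : Valuation (FInfty Fq) ℤᵐ⁰)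
    (by rw [valued_algebraMap_FInfty _ RatFunc.X_ne_zero, RatFunc.intDegree_X]) j

end Infinity

end TMotive
end

open scoped Polynomial TensorProduct
noncomputable section
namespace TMotive

open FunctionField IsDedekindDomain

/-! ### Residue fields, places above, Frobenius elements. -/

section FinitePlaces

variable {Fq : Type*} [Field Fq]

theorem finite_quotient_of_ne_bot [Finite Fq] (I : Ideal Fq[X]) (hI : I ≠ ⊥) :
    Finite (Fq[X] ⧸ I) := by
  obtain ⟨f, rfl⟩ := (IsPrincipalIdealRing.principal I).principal
  have hf : f ≠ 0 := fun h => hI (by rw [h]; simp)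
  have h1 : Module.Finite Fq (AdjoinRoot f) := (AdjoinRoot.powerBasis hf).finite
  exact Module.finite_of_finite Fq (M := AdjoinRoot f)

theorem exists_prime_under_eq {O L : Type*} [CommRing O] [Field L] [Algebra O L]
    (h : Function.Injective (algebraMap O L)) (p : Ideal O) [p.IsPrime] :
    ∃ Q : Ideal (integralClosure O L), Q.IsPrime ∧ Q.under O = p := by
  have hle : Ideal.comap (algebraMap O (integralClosure O L)) ⊥ ≤ p := by
    intro x hx
    have h1 : algebraMap O L x = 0 := congrArg Subtype.val (Ideal.mem_bot.mp (Ideal.mem_comap.mp hx))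
    rw [h (h1.trans (map_zero _).symm)]
    exact Ideal.zero_mem _
  obtain ⟨Q, -, hQ, hQp⟩ := Ideal.exists_ideal_over_prime_of_isIntegral p _ hle
  exact ⟨Q, hQ, hQp⟩

variable {K : Type*} [Field K] [Algebra Fq[X] K]

theorem exists_sepPlace (v : FinitePlace Fq K) :
    ∃ Q : Ideal (SepIntegers Fq K), Q.IsPrime ∧ Q.under (ringOfIntegers Fq K) = v.asIdeal := by
  refine exists_prime_under_eq ?_ v.asIdeal
  rw [IsScalarTower.algebraMap_eq (ringOfIntegers Fq K) K (SeparableClosure K)]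
  exact (algebraMap K (SeparableClosure K)).injective.comp Subtype.val_injective

/-- There is a place of degree one of `𝔽_q(t)` coprime with `v`. -/
theorem exists_isCoprimeTo (v : FinitePlace Fq K) :
    ∃ (c : Fq) (l : HeightOneSpectrum Fq[X]),
      l.asIdeal = Ideal.span {Polynomial.X - Polynomial.C c} ∧ IsCoprimeTo l v := by
  have hl : ∀ c : Fq, ∃ l : HeightOneSpectrum Fq[X],
      l.asIdeal = Ideal.span {Polynomial.X - Polynomial.C c} := fun c =>
    ⟨⟨Ideal.span {Polynomial.X - Polynomial.C c},
      (Ideal.span_singleton_prime (Polynomial.X_sub_C_ne_zero c)).mpr (Polynomial.prime_X_sub_C c),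
      by simpa using Polynomial.X_sub_C_ne_zero c⟩, rfl⟩
  obtain ⟨l₀, hl₀⟩ := hl 0
  obtain ⟨l₁, hl₁⟩ := hl 1
  -- The primes t and t - 1 cannot both lie below v, since they generate the unit ideal.
  by_cases h : IsCoprimeTo l₀ v
  · exact ⟨0, l₀, hl₀, h⟩
  refine ⟨1, l₁, hl₁, fun h1 => ?_⟩
  rw [IsCoprimeTo, not_not] at h
  apply v.isPrime.under Fq[X] |>.ne_top
  rw [Ideal.eq_top_iff_one]
  have e0 : (Polynomial.X - Polynomial.C 0 : Fq[X]) ∈ v.asIdeal.under Fq[X] := by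
    rw [h, hl₀]
    exact Ideal.mem_span_singleton_self _
  have e1 : (Polynomial.X - Polynomial.C 1 : Fq[X]) ∈ v.asIdeal.under Fq[X] := by
    rw [h1, hl₁]
    exact Ideal.mem_span_singleton_self _
  have e2 := Ideal.sub_mem _ e0 e1
  simpa using e2

variable [Algebra (RatFunc Fq) K] [IsScalarTower Fq[X] (RatFunc Fq) K]

theorem algebraMap_polynomial_injective : Function.Injective (algebraMap Fq[X] K) := by
  rw [IsScalarTower.algebraMap_eq Fq[X] (RatFunc Fq) K]
  exact (algebraMap (RatFunc Fq) K).injective.comp (IsFractionRing.injective Fq[X] (RatFunc Fq))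

theorem under_ne_bot (v : FinitePlace Fq K) : v.asIdeal.under Fq[X] ≠ ⊥ :=
  have : Algebra.IsIntegral Fq[X] (ringOfIntegers Fq K) := IsIntegralClosure.isIntegral_algebra Fq[X] K
  Ideal.IsIntegral.comap_ne_bot Fq[X] v.ne_bot

variable [FiniteDimensional (RatFunc Fq) K] [Algebra.IsSeparable (RatFunc Fq) K]

theorem finite_residue [Finite Fq] (v : FinitePlace Fq K) :
    Finite (ringOfIntegers Fq K ⧸ v.asIdeal) := by
  have := finite_quotient_of_ne_bot _ (under_ne_bot v)
  have : v.asIdeal.LiesOver (v.asIdeal.under Fq[X]) := ⟨rfl⟩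
  exact finite_quotient_of_liesOver (v.asIdeal.under Fq[X]) v.asIdeal

theorem exists_frobenius [Finite Fq] (v : FinitePlace Fq K) (Q : Ideal (SepIntegers Fq K))
    [Q.IsPrime] (hQ : Q.under (ringOfIntegers Fq K) = v.asIdeal) :
    ∃ g : Gal(SeparableClosure K/K), IsArithFrobAt (ringOfIntegers Fq K) g Q := by
  have h1 : (Q.under (ringOfIntegers Fq K)).IsMaximal := by
    rw [hQ]
    exact v.isMaximal
  have h2 : Finite (ringOfIntegers Fq K ⧸ Q.under (ringOfIntegers Fq K)) := by
    rw [hQ]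
    exact finite_residue v
  exact exists_isArithFrobAt Q h1

end FinitePlaces

/-! ### Non-vanishing of the Euler factors at 1. -/

section Nonvanishing

variable {Fq : Type*} [Field Fq] [Fintype Fq] {K : Type*} [Field K] [Algebra Fq K]
  [Algebra Fq[X] K] [Algebra (RatFunc Fq) K] [IsScalarTower Fq Fq[X] K]
  [IsScalarTower Fq[X] (RatFunc Fq) K] [FiniteDimensional (RatFunc Fq) K]
  [Algebra.IsSeparable (RatFunc Fq) K] {M : Type*} [AddCommGroup M] [Module K[X] M]
  {σ : M →ₛₗ[coeffFrob Fq K] M}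

/-- `P_v(1) ≠ 0` wherever `P_v` is defined. -/
theorem eval_one_ne_zero (hM : IsEffective σ) (hfg : IsFinitelyGeneratedOverTau σ)
    {v : FinitePlace Fq K}
    (hunr : ∀ l, IsCoprimeTo l v → IsUnramifiedAt (dualGaloisRep σ) l v) {P : (RatFunc Fq)[X]}
    (hP : IsEulerPolynomial (dualGaloisRep σ) v P) : P.eval 1 ≠ 0 := by
  intro hP1
  obtain ⟨r, b, A, α, m, hA, hα, hdet⟩ := exists_basis_of_isEffective hM
  obtain ⟨c₀, k, B, hB, hsum⟩ := exists_sum_iterMat_of_isFinitelyGeneratedOverTau hA hfg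
  have hdegdet : DegLE m A.det := by
    refine degLE_of_natDegree_le ?_
    rw [hdet]
    refine Nat.cast_le.mpr ((Polynomial.natDegree_C_mul_le _ _).trans ?_)
    rw [Polynomial.natDegree_pow, Polynomial.natDegree_X_sub_C, mul_one]
  have hdeg := adjugate_iterMat_degLE (frobHom Fq K) A m hdegdet c₀ k B hB hsum
  -- One prime λ suffices, and degree one lets the Tate module be described by power series over
  -- K^sep. No good reduction of M at v is assumed; unramifiedness at this λ is the only input.
  obtain ⟨c, l, hl, hlv⟩ := exists_isCoprimeTo v
  obtain ⟨Q, hQp, hQ⟩ := exists_sepPlace v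
  obtain ⟨g, hg⟩ := exists_frobenius v Q hQ
  -- θ is transcendental over 𝔽_q, so det A is prime to t - c.
  have hθ : algebraMap Fq[X] K Polynomial.X ≠ algebraMap Fq K c := fun h => by
    have h1 : algebraMap Fq[X] K (Polynomial.X - Polynomial.C c) = 0 := by
      rw [map_sub, h, ← Polynomial.algebraMap_eq, ← IsScalarTower.algebraMap_apply, sub_self]
    exact Polynomial.X_sub_C_ne_zero c
      (algebraMap_polynomial_injective (K := K) (h1.trans (map_zero _).symm))
  have hcop : IsCoprime (A.map (Polynomial.mapRingHom (algebraMap K (SeparableClosure K)))).det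
      ((Polynomial.X - Polynomial.C c).map (algebraMap Fq (SeparableClosure K))) := by
    have h1 : (A.map (Polynomial.mapRingHom (algebraMap K (SeparableClosure K)))).det =
        Polynomial.C (algebraMap K _ α) * (Polynomial.X -
          Polynomial.C (algebraMap K (SeparableClosure K) (algebraMap Fq[X] K Polynomial.X))) ^ m := by
      rw [← RingHom.mapMatrix_apply, ← RingHom.map_det, hdet]
      simp
    rw [h1, Polynomial.map_sub, Polynomial.map_X, Polynomial.map_C]
    have h2 : IsUnit (Polynomial.C (algebraMap K (SeparableClosure K) α)) :=
      (((map_ne_zero _).mpr hα).isUnit).map _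
    rw [isCoprime_mul_unit_left_left h2]
    refine IsCoprime.pow_left (Polynomial.isCoprime_X_sub_C_of_isUnit_sub ?_)
    rw [isUnit_iff_ne_zero, sub_ne_zero, IsScalarTower.algebraMap_apply Fq K (SeparableClosure K)]
    exact fun h => hθ ((algebraMap K (SeparableClosure K)).injective h)
  obtain ⟨Y, hYdet, hY, bT, hbT⟩ := exists_series_solution hA l hl hcop
  obtain ⟨Ψ, hΨ, hΨ0, -⟩ := hbT g
  have hfin := finite_residue v
  have hlies : Q.LiesOver v.asIdeal := ⟨hQ.symm⟩
  refine det_one_sub_ne_zero_of_inertia (O := ringOfIntegers Fq K) Q v.asIdeal v.ne_bot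
    (θ := algebraMap Fq[X] (ringOfIntegers Fq K) Polynomial.X) hα hdet hdeg hYdet hY
    (fun h hh => ?_) (g := g) (fun a => ?_) hΨ (hΨ0 ?_)
  · obtain ⟨-, -, -, h3⟩ := hbT h
    exact h3 ((dualGaloisRep_eq_one_iff bT h).mp (hunr l hlv Q hQp hQ h hh))
  · rw [← hQ]
    exact hg a
  · exact det_one_sub_eq_zero_of_eval_one bT g (hP l hlv Q hQp hQ g hg) hP1

end Nonvanishing

end TMotive
end

open scoped Polynomial TensorProduct
noncomputable section
namespace TMotive

open IsDedekindDomain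

theorem eq_of_forall_dvd_sub {R : Type*} [CommRing R] {I : Ideal R} {a : R}
    (hI : I = Ideal.span {a}) {x y : AdicCompletion I R}
    (h : ∀ N, ∃ r s, IsApprox I N x r ∧ IsApprox I N y s ∧ a ^ N ∣ r - s) : x = y := by
  refine eq_of_isApprox fun N => ?_
  obtain ⟨r, s, hr, hs, hrs⟩ := h N
  refine ⟨s, (hr.iff_sub_mem).mpr ?_, hs⟩
  rw [hI, Ideal.span_singleton_pow, smul_eq_mul, Ideal.mul_top]
  exact Ideal.mem_span_singleton.mpr hrs

theorem isApprox_algebraMap {R : Type*} [CommRing R] (I : Ideal R) (N : ℕ) (r : R) :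
    IsApprox I N (algebraMap R (AdicCompletion I R) r) r := rfl

/-! ### The Tate module at a place of good reduction. -/

section GoodReduction

variable {Fq : Type*} [Field Fq] [Fintype Fq] {K : Type*} [Field K] [Algebra Fq K]
  {B : Type*} [CommRing B] [IsDomain B] [ValuationRing B] [Algebra B (SeparableClosure K)]
  [IsFractionRing B (SeparableClosure K)] [Algebra Fq B] [IsScalarTower Fq B (SeparableClosure K)]
  {k : Type*} [Field k] [Algebra Fq k]
  {M : Type*} [AddCommGroup M] [Module K[X] M] {n : Type*} [Fintype n] [DecidableEq n]

/-- At a place of good reduction inertia acts trivially on the Tate module, and the characteristic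
polynomial of Frobenius is read off the reduction. -/
theorem exists_basis_of_goodReduction {σ : M →ₛₗ[coeffFrob Fq K] M} {b : Module.Basis n K[X] M}
    {A : Matrix n n K[X]} (hA : ∀ j, σ (b j) = ∑ i, A i j • b i)
    (lam : HeightOneSpectrum Fq[X]) {l : Fq[X]} (hlirr : Irreducible l) (hlm : l.Monic)
    (hl : lam.asIdeal = Ideal.span {l}) {AB : Matrix n n B[X]}
    (hAB : AB.map (Polynomial.mapRingHom (algebraMap B (SeparableClosure K))) =
      A.map (Polynomial.mapRingHom (algebraMap K (SeparableClosure K))))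
    (hcop : IsCoprime AB.det (l.map (algebraMap Fq B))) (res : B →ₐ[Fq] k) :
    ∃ bT : Module.Basis n (ALoc lam) (tateModule σ lam),
      ∀ (g : Gal(SeparableClosure K/K)) (γB : B →ₐ[Fq] B),
        (∀ x, g (algebraMap B (SeparableClosure K) x) = algebraMap B _ (γB x)) →
        ((∀ x, res (γB x) = res x) → LinearMap.toMatrix bT bT (tateModuleRep σ lam g) = 1) ∧
        ∀ e : ℕ, (∀ x, res (γB x) = res x ^ Fintype.card Fq ^ e) →
        ∀ (D : Fq[X]) (G : Fq[X][X]), D.map (algebraMap Fq k) = (iterMat (coeffFrob Fq k)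
            (AB.map (Polynomial.mapRingHom (res : B →+* k))) e).det →
          G.map (Polynomial.mapRingHom (algebraMap Fq k)) = ((iterMat (coeffFrob Fq k)
            (AB.map (Polynomial.mapRingHom (res : B →+* k))) e).map Polynomial.C -
              (Polynomial.X : k[X][X]) • 1).det →
          ∀ m, algebraMap Fq[X] (ALoc lam) D *
            (LinearMap.toMatrix bT bT (tateModuleRep σ lam g)).charpolyRev.coeff m =
              algebraMap Fq[X] (ALoc lam) (G.coeff m) := by
  have hcopL : IsCoprime
      (A.map (Polynomial.mapRingHom (algebraMap K (SeparableClosure K)))).det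
      (l.map (algebraMap Fq (SeparableClosure K))) := by
    have h1 := hcop.map (Polynomial.mapRingHom (algebraMap B (SeparableClosure K)))
    have h2 : Polynomial.mapRingHom (algebraMap B (SeparableClosure K)) (l.map (algebraMap Fq B)) =
        l.map (algebraMap Fq (SeparableClosure K)) := by
      rw [Polynomial.coe_mapRingHom, Polynomial.map_map, ← IsScalarTower.algebraMap_eq]
    rwa [RingHom.map_det, RingHom.mapMatrix_apply, hAB, h2] at h1
  obtain ⟨X, hX, hXA, hXs⟩ := exists_lang_sequence hlirr hcopL
  obtain ⟨bT, hbT⟩ := exists_basis_tateModule hA lam hl rfl hcopL hX hXA hXs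
  -- The integrality argument uses only that the modulus is monic and prime to the determinant, so
  -- it applies to every power of l.
  have hsol : ∀ N, ∃ Z Y : Matrix n n B[X],
      MatCongr ((l ^ N).map (algebraMap Fq (SeparableClosure K))) (X N)
        (Z.map (Polynomial.mapRingHom (algebraMap B (SeparableClosure K)))) ∧
      MatCongr ((l ^ N).map (algebraMap Fq B)) (Z * Y) 1 ∧
      MatCongr ((l ^ N).map (algebraMap Fq B)) Z (AB * Z.map (coeffFrob Fq B)) := fun N => by
    refine exists_integral_solution (hlm.pow N) ?_ ?_ ?_
    · rw [Polynomial.map_pow]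
      exact hcop.pow_right
    · rw [Polynomial.map_pow]
      exact (hX N).pow_right
    · rw [hAB, Polynomial.map_pow]
      exact matCongr_iff.mpr fun i j => (pow_dvd_pow _ (Nat.le_succ _)).trans (hXA N i j)
  refine ⟨bT, fun g γB hγB => ?_⟩
  set γ : SeparableClosure K →ₐ[Fq] SeparableClosure K :=
    (g : SeparableClosure K →ₐ[K] SeparableClosure K).restrictScalars Fq with hγ
  have happ : ∀ N : ℕ, ∃ Φ : Matrix n n Fq[X],
      (∀ i j, IsApprox lam.asIdeal N
        (LinearMap.toMatrix bT bT (tateModuleRep σ lam g) i j) (Φ i j)) ∧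
      MatCongr ((l ^ N).map (algebraMap Fq (SeparableClosure K)))
        ((X N).map (Polynomial.mapRingHom (γ : SeparableClosure K →+* SeparableClosure K)))
        (X N * Φ.map (Polynomial.mapRingHom (algebraMap Fq (SeparableClosure K)))) := fun N => by
    choose Φ hΦ using fun i j => exists_isApprox (I := lam.asIdeal) N
      (LinearMap.toMatrix bT bT (tateModuleRep σ lam g) i j)
    refine ⟨Φ, hΦ, ?_⟩
    rw [Polynomial.map_pow]
    exact matCongr_iff.mpr (hbT g N Φ hΦ)
  refine ⟨fun hres => ?_, fun e hres D G hD hG m => ?_⟩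
  · ext1 i j
    refine eq_of_forall_dvd_sub hl fun N => ?_
    obtain ⟨Φ, hΦ, hΦX⟩ := happ N
    obtain ⟨Z, Y, hXZ, hZY, hZA⟩ := hsol N
    refine ⟨Φ i j, (1 : Matrix n n Fq[X]) i j, hΦ i j, ?_,
      dvd_sub_one_of_inertia (hlm.pow N) hXZ hZY hZA res γ γB hγB hres hΦX i j⟩
    by_cases hij : i = j
    · subst hij
      rw [Matrix.one_apply_eq, Matrix.one_apply_eq]
      exact isApprox_one _
    · rw [Matrix.one_apply_ne hij, Matrix.one_apply_ne hij]
      exact isApprox_zero _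
  · refine eq_of_forall_dvd_sub hl fun N => ?_
    obtain ⟨Φ, hΦ, hΦX⟩ := happ N
    obtain ⟨Z, Y, hXZ, hZY, hZA⟩ := hsol N
    exact ⟨_, _, (isApprox_algebraMap _ N D).mul (IsApprox.coeff_charpolyRev hΦ m),
      isApprox_algebraMap _ N _,
      dvd_sub_of_frobenius (hlm.pow N) hXZ hZY hZA res γ γB hγB hres hΦX hD hG m⟩

end GoodReduction

end TMotive
end

open scoped Polynomial TensorProduct
noncomputable section
namespace TMotive

/-! ### Degree of det(M - 1) compared with det M. -/

section DegreeEstimates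

variable {R : Type*} [CommRing R]

/-- Replace the factors one at a time; each replacement lowers the degree bound by C. -/
theorem DegLE.prod_sub_prod {ι : Type*} (s : Finset ι) {p p' : ι → R[X]} {z C : ℤ}
    (h : ∀ i ∈ s, DegLE z (p i)) (h' : ∀ i ∈ s, DegLE z (p' i))
    (hd : ∀ i ∈ s, DegLE (z - C) (p i - p' i)) :
    DegLE (s.card * z - C) (∏ i ∈ s, p i - ∏ i ∈ s, p' i) := by
  classical
  induction s using Finset.induction_on with
  | empty => simpa using degLE_zero _
  | insert a s ha ih =>
    rw [Finset.prod_insert ha, Finset.prod_insert ha, Finset.card_insert_of_notMem ha]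
    have h1 : p a * ∏ i ∈ s, p i - p' a * ∏ i ∈ s, p' i =
        (p a - p' a) * ∏ i ∈ s, p i + p' a * (∏ i ∈ s, p i - ∏ i ∈ s, p' i) := by ring
    have h2 := DegLE.prod s (z := fun _ => z) (p := p)
      fun i hi => h i (Finset.mem_insert_of_mem hi)
    rw [Finset.sum_const, nsmul_eq_mul] at h2
    have h3 := (hd a (Finset.mem_insert_self a s)).mul h2
    have h4 := (h' a (Finset.mem_insert_self a s)).mul
      (ih (fun i hi => h i (Finset.mem_insert_of_mem hi))
        (fun i hi => h' i (Finset.mem_insert_of_mem hi))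
        fun i hi => hd i (Finset.mem_insert_of_mem hi))
    rw [h1]
    refine (h3.mono (le_of_eq ?_)).add (h4.mono (le_of_eq ?_)) <;> push_cast <;> ring

theorem DegLE.det_sub_det {n : Type*} [Fintype n] [DecidableEq n] {M M' : Matrix n n R[X]}
    {z C : ℤ} (h : ∀ i j, DegLE z (M i j)) (h' : ∀ i j, DegLE z (M' i j))
    (hd : ∀ i j, DegLE (z - C) (M i j - M' i j)) :
    DegLE (Fintype.card n * z - C) (M.det - M'.det) := by
  rw [Matrix.det_apply', Matrix.det_apply', ← Finset.sum_sub_distrib]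
  refine DegLE.sum _ fun τ _ => ?_
  rw [← mul_sub, ← Polynomial.C_eq_intCast]
  exact (DegLE.prod_sub_prod Finset.univ (fun i _ => h (τ i) i) (fun i _ => h' (τ i) i)
    fun i _ => hd (τ i) i).C_mul _

theorem DegLE.of_mul_left [IsDomain R] {z : ℤ} {p p' : R[X]} (hp : p ≠ 0)
    (h : DegLE z (p * p')) : DegLE (z - p.natDegree) p' := by
  by_cases hp' : p' = 0
  · rw [hp']
    exact degLE_zero _
  · have h1 := h.natDegree_le (mul_ne_zero hp hp')
    rw [Polynomial.natDegree_mul hp hp'] at h1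
    push_cast at h1
    exact degLE_of_natDegree_le (by omega)

theorem natDegree_iterProd {k : Type*} [Field k] (f : k →+* k) {g : k[X]} (hg : g ≠ 0) (N : ℕ) :
    iterProd (Polynomial.mapRingHom f) g N ≠ 0 ∧
      (iterProd (Polynomial.mapRingHom f) g N).natDegree = g.natDegree * N := by
  induction N with
  | zero => simp [iterProd]
  | succ N ih =>
    have h1 := (Polynomial.map_ne_zero_iff f.injective).mpr ih.1
    rw [iterProd_succ, Polynomial.coe_mapRingHom]
    refine ⟨mul_ne_zero hg h1, ?_⟩
    rw [Polynomial.natDegree_mul hg h1, Polynomial.natDegree_map, ih.2]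
    ring

/-- If the entries of `adj(M) / det M` have small degree then `det (M - 1) / det M` is close
to `1`. -/
theorem degLE_det_sub_one_sub_det {k n : Type*} [Field k] [Fintype n] [DecidableEq n]
    {M : Matrix n n k[X]} (hM : M.det ≠ 0) {C : ℕ}
    (h : ∀ i j, DegLE (M.det.natDegree - C) (M.adjugate i j)) :
    DegLE (M.det.natDegree - C) ((M - 1).det - M.det) := by
  rcases isEmpty_or_nonempty n with hn | hn
  · rw [Matrix.det_isEmpty, Matrix.det_isEmpty, sub_self]
    exact degLE_zero _
  have hcard : Fintype.card n = Fintype.card n - 1 + 1 :=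
    (Nat.sub_add_cancel Fintype.card_pos).symm
  -- Multiplying M - 1 by adj M, of determinant det M^(r-1) for matrices of size r, gives det M -
  -- adj M, a perturbation of a scalar matrix by entries of small degree.
  have h1 : M.det ^ (Fintype.card n - 1) * ((M - 1).det - M.det) =
      (M.det • (1 : Matrix n n k[X]) - M.adjugate).det - (M.det • (1 : Matrix n n k[X])).det := by
    rw [mul_sub, ← Matrix.det_adjugate, mul_comm, ← Matrix.det_mul, Matrix.sub_mul,
      Matrix.mul_adjugate, Matrix.one_mul, Matrix.det_smul, Matrix.det_one, mul_one,
      Matrix.det_adjugate, ← pow_succ, ← hcard]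
  have hone : ∀ i j, DegLE M.det.natDegree ((M.det • (1 : Matrix n n k[X])) i j) := fun i j => by
    rw [Matrix.smul_apply, smul_eq_mul]
    by_cases hij : i = j
    · rw [hij, Matrix.one_apply_eq, mul_one]
      exact degLE_natDegree _
    · rw [Matrix.one_apply_ne hij, mul_zero]
      exact degLE_zero _
  have h2 := DegLE.det_sub_det (C := C)
    (M := M.det • (1 : Matrix n n k[X]) - M.adjugate) (M' := M.det • (1 : Matrix n n k[X]))
    (fun i j => by
      rw [Matrix.sub_apply, sub_eq_add_neg]
      exact (hone i j).add ((h i j).mono (by omega)).neg) hone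
    (fun i j => by
      rw [Matrix.sub_apply, sub_sub_cancel_left]
      exact (h i j).neg)
  rw [← h1] at h2
  refine (h2.of_mul_left (pow_ne_zero _ hM)).mono (le_of_eq ?_)
  rw [Polynomial.natDegree_pow]
  conv_lhs => rw [hcard]
  push_cast
  ring

end DegreeEstimates

/-! ### Euler factors of reductions of an integral model. -/

section Reduction

variable {Fq : Type*} [Field Fq] [Fintype Fq] {O k : Type*} [CommRing O] [Algebra Fq O] [Field k]
  [Algebra Fq k] {n : Type*} [Fintype n] [DecidableEq n]

/-- The Euler factor of the reduction of an integral matrix, with an estimate for its value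
at `1`. -/
theorem exists_euler_factor (π : O →ₐ[Fq] k) {A : Matrix n n O[X]} {α β θ : O} {m d : ℕ}
    (hA : A.det = Polynomial.C α * (Polynomial.X - Polynomial.C θ) ^ m) (hα : π α ≠ 0)
    (hβ : π β ≠ 0) (hd : ∀ x : k, x ^ Fintype.card Fq ^ d = x) :
    ∃ (D : Fq[X]) (G : Fq[X][X]),
      D.map (algebraMap Fq k) = (iterMat (coeffFrob Fq k) (Polynomial.C (π β)⁻¹ •
        A.map (Polynomial.mapRingHom (π : O →+* k))) d).det ∧
      G.map (Polynomial.mapRingHom (algebraMap Fq k)) =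
        ((iterMat (coeffFrob Fq k) (Polynomial.C (π β)⁻¹ •
          A.map (Polynomial.mapRingHom (π : O →+* k))) d).map Polynomial.C -
            (Polynomial.X : k[X][X]) • 1).det ∧
      D ≠ 0 ∧ D.natDegree = m * d ∧
      ∀ C : ℕ, (∀ i j, DegLE (m * d - C) ((iterMat (coeffFrob Fq O) A d).adjugate i j)) →
        DegLE (m * d - C) (G.eval 1 - D) := by
  set A' := Polynomial.C (π β)⁻¹ • A.map (Polynomial.mapRingHom (π : O →+* k)) with hA'
  have hA'det : A'.det = Polynomial.C ((π β)⁻¹ ^ Fintype.card n * π α) *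
      (Polynomial.X - Polynomial.C (π θ)) ^ m := by
    rw [hA', Matrix.det_smul, ← RingHom.mapMatrix_apply, ← RingHom.map_det, hA,
      Polynomial.C_mul, Polynomial.C_pow, mul_assoc]
    congr 1
    simp
  have hγ : (π β)⁻¹ ^ Fintype.card n * π α ≠ 0 :=
    mul_ne_zero (pow_ne_zero _ (inv_ne_zero hβ)) hα
  have hA'0 : A'.det ≠ 0 := by
    rw [hA'det]
    exact mul_ne_zero (Polynomial.C_ne_zero.mpr hγ)
      (pow_ne_zero _ (Polynomial.X_sub_C_ne_zero _))
  have hA'deg : A'.det.natDegree = m := by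
    rw [hA'det, Polynomial.natDegree_C_mul hγ, Polynomial.natDegree_pow,
      Polynomial.natDegree_X_sub_C, mul_one]
  -- G is the polynomial det(A_d - X) and D its constant coefficient det A_d, both descended to
  -- 𝔽_q[t].
  obtain ⟨G, hG⟩ := exists_map_eq_det_sub hd hA'0
  set Ad := iterMat (coeffFrob Fq k) A' d with hAd
  have hD : (G.coeff 0).map (algebraMap Fq k) = Ad.det := by
    rw [← coeff_zero_det_sub, ← hG, Polynomial.coeff_map, Polynomial.coe_mapRingHom]
  have hAddet := natDegree_iterProd (frobHom Fq k) hA'0 d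
  have hAd' : Ad.det = iterProd (Polynomial.mapRingHom (frobHom Fq k)) A'.det d :=
    det_iterMat _ _ _
  rw [← hAd', hA'deg] at hAddet
  have hinj := (algebraMap Fq k).injective
  have hDdeg : (G.coeff 0).natDegree = m * d := by
    rw [← hAddet.2, ← hD, Polynomial.natDegree_map]
  refine ⟨G.coeff 0, G, hD, hG, fun h => hAddet.1 (by rw [← hD, h, Polynomial.map_zero]), hDdeg,
    fun C hC => DegLE.of_map hinj ?_⟩
  have h1 : (G.eval 1).map (algebraMap Fq k) = (Ad - 1).det := by
    have h2 := congrArg (Polynomial.evalRingHom (1 : k[X])) hG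
    rw [RingHom.map_det, RingHom.mapMatrix_apply, Polynomial.coe_evalRingHom,
      Polynomial.eval_map, Polynomial.eval₂_at_one] at h2
    rw [← Polynomial.coe_mapRingHom, h2]
    congr 1
    ext1 i j
    simp [Matrix.one_apply, apply_ite (Polynomial.eval (1 : k[X]))]
  obtain ⟨a, ha⟩ := exists_iterProd_C_eq (frobHom Fq k) (π β)⁻¹ d
  -- Undoing the scaling by β multiplies the adjugate by a constant, so the bound over O passes to
  -- every residue field.
  have h3 : Ad.adjugate = Polynomial.C (a ^ (Fintype.card n - 1)) •
      (iterMat (coeffFrob Fq O) A d).adjugate.map (Polynomial.mapRingHom (π : O →+* k)) := by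
    rw [← RingHom.mapMatrix_apply, RingHom.map_adjugate, RingHom.mapMatrix_apply,
      iterMat_map (coeffFrob Fq O) (coeffFrob Fq k) (Polynomial.mapRingHom (π : O →+* k))
        (fun p => by
          rw [Polynomial.coe_mapRingHom]
          exact (coeffFrob_map (π : O →+* k) p).symm), hAd, hA', iterMat_smul,
      Matrix.adjugate_smul]
    congr 1
    exact (congrArg (· ^ (Fintype.card n - 1)) ha).trans Polynomial.C_pow.symm
  rw [Polynomial.map_sub, h1, hD]
  have h4 := degLE_det_sub_one_sub_det hAddet.1 (C := C) fun i j => by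
    rw [hAddet.2, h3, Matrix.smul_apply, smul_eq_mul]
    push_cast
    exact ((hC i j).map (π : O →+* k)).C_mul _
  rw [hAddet.2] at h4
  exact_mod_cast h4

end Reduction

end TMotive
end

open scoped Polynomial TensorProduct
noncomputable section
namespace TMotive

open IsDedekindDomain FunctionField

theorem isCoprime_X_sub_C_of_isUnit_eval {R : Type*} [CommRing R] {a : R} {p : R[X]}
    (h : IsUnit (p.eval a)) : IsCoprime (Polynomial.X - Polynomial.C a) p := by
  obtain ⟨w, hw⟩ := Polynomial.X_sub_C_dvd_sub_C_eval (a := a) (p := p)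
  obtain ⟨u, hu⟩ := h.exists_right_inv
  refine ⟨-(Polynomial.C u * w), Polynomial.C u, ?_⟩
  have h1 : Polynomial.C (p.eval a) * Polynomial.C u = (1 : R[X]) := by
    rw [← Polynomial.C_mul, hu, Polynomial.C_1]
  linear_combination Polynomial.C u * hw + h1

/-! ### Good reduction away from the scaling factor and the determinant. -/

section Generic

variable {Fq : Type*} [Field Fq] [Fintype Fq]

/-- The determinants attached to the reduction are compatible with field extensions. -/
theorem map_det_iterMat {k k' : Type*} [Field k] [Field k'] [Algebra Fq k] [Algebra Fq k']
    {n : Type*} [Fintype n] [DecidableEq n] (f : k →ₐ[Fq] k') (A : Matrix n n k[X]) (d : ℕ)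
    {D : Fq[X]} {G : Fq[X][X]} (hD : D.map (algebraMap Fq k) = (iterMat (coeffFrob Fq k) A d).det)
    (hG : G.map (Polynomial.mapRingHom (algebraMap Fq k)) =
        ((iterMat (coeffFrob Fq k) A d).map Polynomial.C - (Polynomial.X : k[X][X]) • 1).det) :
    D.map (algebraMap Fq k') =
      (iterMat (coeffFrob Fq k') (A.map (Polynomial.mapRingHom (f : k →+* k'))) d).det ∧
    G.map (Polynomial.mapRingHom (algebraMap Fq k')) =
        ((iterMat (coeffFrob Fq k') (A.map (Polynomial.mapRingHom (f : k →+* k'))) d).map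
          Polynomial.C - (Polynomial.X : k'[X][X]) • 1).det := by
  have hf : (f : k →+* k').comp (algebraMap Fq k) = algebraMap Fq k' := f.comp_algebraMap
  have h1 : iterMat (coeffFrob Fq k') (A.map (Polynomial.mapRingHom (f : k →+* k'))) d =
      (iterMat (coeffFrob Fq k) A d).map (Polynomial.mapRingHom (f : k →+* k')) :=
    (iterMat_map (coeffFrob Fq k) (coeffFrob Fq k') (Polynomial.mapRingHom (f : k →+* k'))
      (fun p => by
        rw [Polynomial.coe_mapRingHom]
        exact (coeffFrob_map (f : k →+* k') p).symm) A d).symm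
  rw [h1]
  constructor
  · rw [← RingHom.mapMatrix_apply, ← RingHom.map_det, ← hD, Polynomial.coe_mapRingHom,
      Polynomial.map_map, hf]
  · have h2 := congrArg (Polynomial.mapRingHom (Polynomial.mapRingHom (f : k →+* k'))) hG
    rw [RingHom.map_det, RingHom.mapMatrix_apply] at h2
    have h3 : G.map (Polynomial.mapRingHom (algebraMap Fq k')) =
        Polynomial.mapRingHom (Polynomial.mapRingHom (f : k →+* k'))
          (G.map (Polynomial.mapRingHom (algebraMap Fq k))) := by
      rw [Polynomial.coe_mapRingHom, Polynomial.map_map, Polynomial.mapRingHom_comp, hf]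
    rw [h3, h2]
    congr 1
    ext1 i j
    simp [Matrix.one_apply, apply_ite (Polynomial.map (Polynomial.mapRingHom (f : k →+* k')))]

variable {O K : Type*} [CommRing O] [IsDedekindDomain O]
  [Field K] [Algebra O K] [IsFractionRing O K] [Algebra O (SeparableClosure K)]
  [IsScalarTower O K (SeparableClosure K)]
  [SMulCommClass Gal(SeparableClosure K/K) O (SeparableClosure K)]
  [Algebra Fq O] [Algebra Fq K] [IsScalarTower Fq O (SeparableClosure K)]
  (Q : Ideal (integralClosure O (SeparableClosure K))) [Q.IsPrime] (p : Ideal O) [Q.LiesOver p]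
  {M : Type*} [AddCommGroup M] [Module K[X] M] {n : Type*} [Fintype n] [DecidableEq n]
  {k : Type*} [Field k] [Algebra Fq k]

/-- The Tate module is studied over the valuation ring of Q, whose residue field contains the field
k of π. Over k the matrices were reduced and the polynomials D and G descended; the embedding f
transports that computation. -/
theorem exists_basis_of_notMem {σ : M →ₛₗ[coeffFrob Fq K] M} {b : Module.Basis n K[X] M}
    {A : Matrix n n K[X]} (hA : ∀ j, σ (b j) = ∑ i, A i j • b i)
    {A' : Matrix n n O[X]} {α β θ : O} {m : ℕ}
    (hA' : A'.map (Polynomial.mapRingHom (algebraMap O K)) = Polynomial.C (algebraMap O K β) • A)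
    (hdet : A'.det = Polynomial.C α * (Polynomial.X - Polynomial.C θ) ^ m) (hα : α ∉ p)
    (hβ : β ∉ p) (lam : HeightOneSpectrum Fq[X]) {l : Fq[X]} (hlirr : Irreducible l)
    (hlm : l.Monic) (hl : lam.asIdeal = Ideal.span {l}) (hlp : Polynomial.aeval θ l ∉ p)
    (π : O →ₐ[Fq] k) (f : k →ₐ[Fq] IsLocalRing.ResidueField (placeRing K Q))
    (hf : ∀ x, f (π x) = IsLocalRing.residue (placeRing K Q) (toPlaceRing K Q (algebraMap O _ x))) :
    ∃ bT : Module.Basis n (ALoc lam) (tateModule σ lam),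
      (∀ g ∈ Q.inertia Gal(SeparableClosure K/K),
        LinearMap.toMatrix bT bT (tateModuleRep σ lam g) = 1) ∧
      ∀ (g : Gal(SeparableClosure K/K)) (d : ℕ),
        (∀ a : integralClosure O (SeparableClosure K), g • a - a ^ Fintype.card Fq ^ d ∈ Q) →
        ∀ (D : Fq[X]) (G : Fq[X][X]),
          D.map (algebraMap Fq k) = (iterMat (coeffFrob Fq k) (Polynomial.C (π β)⁻¹ •
            A'.map (Polynomial.mapRingHom (π : O →+* k))) d).det →
          G.map (Polynomial.mapRingHom (algebraMap Fq k)) =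
            ((iterMat (coeffFrob Fq k) (Polynomial.C (π β)⁻¹ •
              A'.map (Polynomial.mapRingHom (π : O →+* k))) d).map Polynomial.C -
                (Polynomial.X : k[X][X]) • 1).det →
          ∀ m, algebraMap Fq[X] (ALoc lam) D *
            (LinearMap.toMatrix bT bT (tateModuleRep σ lam g)).charpolyRev.coeff m =
              algebraMap Fq[X] (ALoc lam) (G.coeff m) := by
  let ι : O →ₐ[Fq] placeRing K Q :=
    { (toPlaceRing K Q).comp (algebraMap O (integralClosure O (SeparableClosure K))) with
      commutes' := fun _ => rfl }
  have hιu : ∀ x, x ∉ p → IsUnit (ι x) := fun x hx => by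
    refine (isUnit_toPlaceRing_iff K Q (algebraMap O _ x)).mpr fun h => hx ?_
    rw [Ideal.over_def Q p]
    exact h
  let res : placeRing K Q →ₐ[Fq] IsLocalRing.ResidueField (placeRing K Q) :=
    { IsLocalRing.residue (placeRing K Q) with commutes' := fun _ => rfl }
  have hfres : ∀ x, res (ι x) = f (π x) := fun x => (hf x).symm
  -- β is invertible at Q, so the scaling can be undone there and the original matrix A is itself
  -- integral.
  obtain ⟨w, hw⟩ := (hιu β hβ).exists_right_inv
  set AB := Polynomial.C w • A'.map (Polynomial.mapRingHom (ι : O →+* placeRing K Q)) with hAB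
  have hABL : AB.map (Polynomial.mapRingHom (algebraMap (placeRing K Q) (SeparableClosure K))) =
      A.map (Polynomial.mapRingHom (algebraMap K (SeparableClosure K))) := by
    ext1 i j
    have h1 := congrArg (Polynomial.map (algebraMap K (SeparableClosure K)))
      (congrFun (congrFun hA' i) j)
    rw [Matrix.map_apply, Polynomial.coe_mapRingHom, Polynomial.map_map,
      ← IsScalarTower.algebraMap_eq, Matrix.smul_apply, smul_eq_mul, Polynomial.map_mul,
      Polynomial.map_C, ← IsScalarTower.algebraMap_apply] at h1
    have h2 : (algebraMap (placeRing K Q) (SeparableClosure K)).comp (ι : O →+* placeRing K Q) =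
        algebraMap O (SeparableClosure K) := rfl
    rw [hAB, Matrix.map_apply, Matrix.smul_apply, Matrix.map_apply, smul_eq_mul,
      Polynomial.coe_mapRingHom, Polynomial.coe_mapRingHom, Polynomial.map_mul,
      Polynomial.map_C, Polynomial.map_map, h2, h1, ← mul_assoc, ← Polynomial.C_mul]
    have h3 : algebraMap (placeRing K Q) (SeparableClosure K) w *
        algebraMap O (SeparableClosure K) β = 1 := by
      rw [mul_comm]
      exact congrArg Subtype.val hw
    rw [h3, Polynomial.C_1, one_mul]
    rfl
  have hABdet : AB.det = Polynomial.C (w ^ Fintype.card n * ι α) *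
      (Polynomial.X - Polynomial.C (ι θ)) ^ m := by
    rw [hAB, Matrix.det_smul, ← RingHom.mapMatrix_apply, ← RingHom.map_det, hdet,
      Polynomial.C_mul, Polynomial.C_pow, mul_assoc]
    congr 1
    simp
  have hcop : IsCoprime AB.det (l.map (algebraMap Fq (placeRing K Q))) := by
    have hu : IsUnit (Polynomial.C (w ^ Fintype.card n * ι α)) :=
      (((IsUnit.of_mul_eq_one_right _ hw).pow _).mul (hιu α hα)).map Polynomial.C
    rw [hABdet, isCoprime_mul_unit_left_left hu]
    refine IsCoprime.pow_left (isCoprime_X_sub_C_of_isUnit_eval ?_)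
    have h1 : (l.map (algebraMap Fq (placeRing K Q))).eval (ι θ) = ι (Polynomial.aeval θ l) := by
      rw [Polynomial.eval_map_algebraMap, Polynomial.aeval_algHom_apply]
    rw [h1]
    exact hιu _ hlp
  obtain ⟨bT, hbT⟩ := exists_basis_of_goodReduction hA lam hlirr hlm hl hABL hcop res
  have hγ : ∀ (g : Gal(SeparableClosure K/K)) (N : ℕ),
      (∀ a : integralClosure O (SeparableClosure K), g • a - a ^ N ∈ Q) →
      ∃ γB : placeRing K Q →ₐ[Fq] placeRing K Q,
        (∀ x, g (algebraMap (placeRing K Q) (SeparableClosure K) x) =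
          algebraMap (placeRing K Q) (SeparableClosure K) (γB x)) ∧
        ∀ x, res (γB x) = res x ^ N := fun g N hg => by
    obtain ⟨γ, hγ, hγr⟩ := exists_placeRing_hom hg
    refine ⟨{ γ with commutes' := fun x => Subtype.ext ((hγ _).trans ?_) },
      fun x => (hγ x).symm, hγr⟩
    change g (algebraMap O (SeparableClosure K) (algebraMap Fq O x)) =
      algebraMap O (SeparableClosure K) (algebraMap Fq O x)
    rw [IsScalarTower.algebraMap_apply O K (SeparableClosure K)]
    exact g.commutes _
  refine ⟨bT, fun g hg => ?_, fun g d hg D G hD hG => ?_⟩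
  · obtain ⟨γB, hγB, hγres⟩ := hγ g 1 fun a => by
      rw [pow_one]
      exact hg a
    exact (hbT g γB hγB).1 fun x => (hγres x).trans (pow_one _)
  · obtain ⟨γB, hγB, hγres⟩ := hγ g _ hg
    have h1 := map_det_iterMat f _ d hD hG
    have h2 : (Polynomial.C (π β)⁻¹ • A'.map (Polynomial.mapRingHom (π : O →+* k))).map
        (Polynomial.mapRingHom (f : k →+* IsLocalRing.ResidueField (placeRing K Q))) =
        AB.map (Polynomial.mapRingHom (res : placeRing K Q →+* _)) := by
      have h3 : f (π β)⁻¹ = res w := by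
        rw [map_inv₀, ← hfres]
        refine inv_eq_of_mul_eq_one_right ?_
        rw [← map_mul, hw, map_one]
      have h4 : (f : k →+* IsLocalRing.ResidueField (placeRing K Q)).comp (π : O →+* k) =
          (res : placeRing K Q →+* _).comp (ι : O →+* placeRing K Q) :=
        RingHom.ext fun x => (hfres x).symm
      ext1 i j
      rw [hAB, Matrix.map_apply, Matrix.map_apply, Matrix.smul_apply, Matrix.smul_apply,
        Matrix.map_apply, Matrix.map_apply, smul_eq_mul, smul_eq_mul, map_mul, map_mul]
      simp only [Polynomial.coe_mapRingHom]
      rw [Polynomial.map_C, Polynomial.map_C, Polynomial.map_map, Polynomial.map_map, h4]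
      congr 2
    rw [h2] at h1
    exact (hbT g γB hγB).2 d hγres D G h1.1 h1.2

end Generic

end TMotive
end

open scoped Polynomial TensorProduct
noncomputable section
namespace TMotive

open IsDedekindDomain FunctionField

/-! ### Euler polynomials at places of good reduction. -/

section GoodPlaces

variable {Fq : Type*} [Field Fq] [Fintype Fq] {K : Type*} [Field K] [Algebra Fq K]
  [Algebra Fq[X] K] [Algebra (RatFunc Fq) K] [IsScalarTower Fq Fq[X] K]
  [IsScalarTower Fq[X] (RatFunc Fq) K] [FiniteDimensional (RatFunc Fq) K]
  [Algebra.IsSeparable (RatFunc Fq) K] {M : Type*} [AddCommGroup M] [Module K[X] M]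
  {σ : M →ₛₗ[coeffFrob Fq K] M}

theorem exists_monic_generator (l : HeightOneSpectrum Fq[X]) :
    ∃ f : Fq[X], Irreducible f ∧ f.Monic ∧ l.asIdeal = Ideal.span {f} := by
  obtain ⟨f, hf⟩ := (IsPrincipalIdealRing.principal l.asIdeal).principal
  have hf0 : f ≠ 0 := fun h => l.ne_bot (by rw [hf, h]; simp)
  have hlead : IsUnit (Polynomial.C f.leadingCoeff⁻¹) :=
    ((inv_ne_zero (Polynomial.leadingCoeff_ne_zero.mpr hf0)).isUnit).map Polynomial.C
  have hspan : l.asIdeal = Ideal.span {f * Polynomial.C f.leadingCoeff⁻¹} := by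
    rw [Ideal.span_singleton_mul_right_unit hlead]
    exact hf
  have hm := Polynomial.monic_mul_leadingCoeff_inv hf0
  refine ⟨_, Prime.irreducible ?_, hm, hspan⟩
  rw [← Ideal.span_singleton_prime hm.ne_zero, ← hspan]
  exact l.isPrime

theorem isCoprimeTo_aeval_notMem {l : HeightOneSpectrum Fq[X]} {v : FinitePlace Fq K}
    (h : IsCoprimeTo l v) {f : Fq[X]} (hf : l.asIdeal = Ideal.span {f}) :
    Polynomial.aeval (algebraMap Fq[X] (ringOfIntegers Fq K) Polynomial.X) f ∉ v.asIdeal := by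
  rw [Polynomial.aeval_algebraMap_apply, Polynomial.aeval_X_left_apply]
  intro hmem
  have hle : l.asIdeal ≤ v.asIdeal.under Fq[X] := by
    rw [hf, Ideal.span_singleton_le_iff_mem]
    exact hmem
  exact h (l.isMaximal.eq_of_le (v.isPrime.under Fq[X]).ne_top hle).symm

/-- The number of elements of the residue field is a power of `q`. -/
theorem exists_card_residue_eq (v : FinitePlace Fq K) :
    ∃ d, 0 < d ∧ Nat.card (ringOfIntegers Fq K ⧸ v.asIdeal) = Fintype.card Fq ^ d := by
  have := finite_residue v
  have hne : Nontrivial (ringOfIntegers Fq K ⧸ v.asIdeal) :=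
    Ideal.Quotient.nontrivial_iff.mpr v.isPrime.ne_top
  have hfin : Module.Finite Fq (ringOfIntegers Fq K ⧸ v.asIdeal) := Module.Finite.of_finite
  refine ⟨Module.finrank Fq (ringOfIntegers Fq K ⧸ v.asIdeal), Module.finrank_pos, ?_⟩
  rw [Module.natCard_eq_pow_finrank (K := Fq), Nat.card_eq_fintype_card]

/-- D and G are constructed over O_K/v before any prime λ or place of K^sep is chosen; this is what
makes P_v independent of both. -/
theorem euler_factor_of_notMem {n : Type*} [Fintype n] [DecidableEq n]
    {b : Module.Basis n K[X] M} {A : Matrix n n K[X]} (hA : ∀ j, σ (b j) = ∑ i, A i j • b i)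
    {A' : Matrix n n (ringOfIntegers Fq K)[X]} {α β : ringOfIntegers Fq K} {m : ℕ}
    (hA' : A'.map (Polynomial.mapRingHom (algebraMap (ringOfIntegers Fq K) K)) =
      Polynomial.C (algebraMap (ringOfIntegers Fq K) K β) • A)
    (hdet : A'.det = Polynomial.C α * (Polynomial.X -
      Polynomial.C (algebraMap Fq[X] (ringOfIntegers Fq K) Polynomial.X)) ^ m)
    {v : FinitePlace Fq K} (hα : α ∉ v.asIdeal) (hβ : β ∉ v.asIdeal) {d : ℕ}
    (hd : Nat.card (ringOfIntegers Fq K ⧸ v.asIdeal) = Fintype.card Fq ^ d) :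
    (∀ l, IsCoprimeTo l v → IsUnramifiedAt (dualGaloisRep σ) l v) ∧
    ∃ (D : Fq[X]) (G : Fq[X][X]), D ≠ 0 ∧ D.natDegree = m * d ∧
      IsEulerPolynomial (dualGaloisRep σ) v
        (Polynomial.C (algebraMap Fq[X] (RatFunc Fq) D)⁻¹ *
          G.map (algebraMap Fq[X] (RatFunc Fq))) ∧
      ∀ C : ℕ, (∀ i j, DegLE (m * d - C)
        ((iterMat (coeffFrob Fq (ringOfIntegers Fq K)) A' d).adjugate i j)) →
        DegLE (m * d - C) (G.eval 1 - D) := by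
  have hfin := finite_residue v
  let _ : Field (ringOfIntegers Fq K ⧸ v.asIdeal) := Ideal.Quotient.field v.asIdeal
  have := Fintype.ofFinite (ringOfIntegers Fq K ⧸ v.asIdeal)
  set π : ringOfIntegers Fq K →ₐ[Fq] ringOfIntegers Fq K ⧸ v.asIdeal :=
    Ideal.Quotient.mkₐ Fq v.asIdeal with hπ
  have hπ0 : ∀ x, x ∉ v.asIdeal → π x ≠ 0 := fun x hx h => hx (Ideal.Quotient.eq_zero_iff_mem.mp h)
  have hpow : ∀ x : ringOfIntegers Fq K ⧸ v.asIdeal, x ^ Fintype.card Fq ^ d = x := fun x => by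
    rw [← hd, Nat.card_eq_fintype_card]
    exact FiniteField.pow_card x
  obtain ⟨D, G, hD, hG, hD0, hDdeg, hest⟩ :=
    exists_euler_factor π hdet (hπ0 α hα) (hπ0 β hβ) hpow
  have key : ∀ l, IsCoprimeTo l v → ∀ Q : Ideal (SepIntegers Fq K), Q.IsPrime →
      Q.under (ringOfIntegers Fq K) = v.asIdeal →
      ∃ bT : Module.Basis n (ALoc l) (tateModule σ l),
        (∀ g ∈ Q.inertia Gal(SeparableClosure K/K),
          LinearMap.toMatrix bT bT (tateModuleRep σ l g) = 1) ∧
        ∀ g : Gal(SeparableClosure K/K), IsArithFrobAt (ringOfIntegers Fq K) g Q →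
          ∀ m, algebraMap Fq[X] (ALoc l) D *
            (LinearMap.toMatrix bT bT (tateModuleRep σ l g)).charpolyRev.coeff m =
              algebraMap Fq[X] (ALoc l) (G.coeff m) := by
    intro l hl Q hQp hQ
    have hlies : Q.LiesOver v.asIdeal := ⟨hQ.symm⟩
    obtain ⟨f, hfirr, hfm, hf⟩ := exists_monic_generator l
    let κ : ringOfIntegers Fq K →ₐ[Fq] IsLocalRing.ResidueField (placeRing K Q) :=
      { (IsLocalRing.residue (placeRing K Q)).comp ((toPlaceRing K Q).comp
          (algebraMap (ringOfIntegers Fq K) (SepIntegers Fq K))) with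
        commutes' := fun _ => rfl }
    have hκ : ∀ x ∈ v.asIdeal, κ x = 0 := fun x hx => by
      refine (residue_toPlaceRing_eq_zero_iff K Q (algebraMap _ _ x)).mpr ?_
      rw [← hQ] at hx
      exact hx
    obtain ⟨bT, h1, h2⟩ := exists_basis_of_notMem Q v.asIdeal hA hA' hdet hα hβ l hfirr hfm hf
      (isCoprimeTo_aeval_notMem hl hf) π (Ideal.Quotient.liftₐ v.asIdeal κ hκ) (fun x => rfl)
    refine ⟨bT, h1, fun g hg => h2 g d (fun a => ?_) D G hD hG⟩
    have h3 := hg a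
    rw [hQ, hd] at h3
    exact h3
  refine ⟨fun l hl Q hQp hQ g hg => ?_, D, G, hD0, hDdeg, fun l hl Q hQp hQ g hg => ?_, hest⟩
  · obtain ⟨bT, h1, -⟩ := key l hl Q hQp hQ
    exact (dualGaloisRep_eq_one_iff bT g).mpr (h1 g hg)
  · obtain ⟨bT, -, h2⟩ := key l hl Q hQp hQ
    rw [hasRevCharpoly_dualGaloisRep_inv_iff bT]
    have hDu : IsUnit (toFLoc l (algebraMap Fq[X] (RatFunc Fq) D)) := by
      refine IsUnit.map _ (IsUnit.mk0 _ ?_)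
      simpa using hD0
    ext e
    refine hDu.mul_left_cancel ?_
    rw [Polynomial.coeff_map, Polynomial.coeff_map, Polynomial.coeff_C_mul, Polynomial.coeff_map,
      ← map_mul (toFLoc l), mul_inv_cancel_left₀ (by simpa using hD0), toFLoc_algebraMap,
      toFLoc_algebraMap, ← map_mul, h2 g hg e]

end GoodPlaces

end TMotive
end

open scoped Polynomial TensorProduct
noncomputable section
namespace TMotive

/-! ### Infinite products over a complete discretely valued field. -/

section Convergence

open WithZero Filter

variable {E : Type*} [Field E]

/-- The ultrametric inequality: units close to 1 have products equally close to 1. -/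
theorem prod_sub_one_le (v : Valuation E ℤᵐ⁰) {γ : ℤᵐ⁰} (hγ : γ ≤ 1) {ι : Type*} (s : Finset ι)
    {f : ι → E} (h : ∀ i ∈ s, v (f i - 1) ≤ γ) : v (∏ i ∈ s, f i - 1) ≤ γ := by
  classical
  induction s using Finset.induction_on with
  | empty => simp
  | insert a s ha ih =>
    have h1 := ih fun i hi => h i (Finset.mem_insert_of_mem hi)
    have h2 := h a (Finset.mem_insert_self a s)
    have h3 : v (∏ i ∈ s, f i) ≤ 1 := by
      have h4 := v.map_add_le (h1.trans hγ) (le_of_eq (map_one v))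
      rwa [sub_add_cancel] at h4
    rw [Finset.prod_insert ha]
    have h5 : f a * ∏ i ∈ s, f i - 1 = (f a - 1) * ∏ i ∈ s, f i + (∏ i ∈ s, f i - 1) := by ring
    rw [h5]
    refine v.map_add_le ?_ h1
    rw [map_mul]
    exact (mul_le_mul' h2 h3).trans (le_of_eq (mul_one γ))

theorem exists_exp_neg_lt {γ : ℤᵐ⁰} (hγ : γ ≠ 0) : ∃ C : ℕ, exp (-(C : ℤ)) < γ := by
  refine ⟨(1 - log γ).toNat, ?_⟩
  conv_rhs => rw [← exp_log hγ]
  rw [exp_lt_exp]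
  have := Int.self_le_toNat (1 - log γ)
  omega

/-- An infinite product of non-zero factors tending to `1` converges to a non-zero limit. -/
theorem exists_hasProd [Valued E ℤᵐ⁰] [CompleteSpace E] {ι : Type*} {f : ι → E}
    (h0 : ∀ i, f i ≠ 0)
    (h : ∀ C : ℕ, {i | ¬ (Valued.v : Valuation E ℤᵐ⁰) (f i - 1) ≤ exp (-(C : ℤ))}.Finite) :
    ∃ L, L ≠ 0 ∧ HasProd f L := by
  classical
  set v : Valuation E ℤᵐ⁰ := Valued.v with hv
  have hprod0 : ∀ s : Finset ι, v (∏ i ∈ s, f i) ≠ 0 := fun s =>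
    (Valuation.ne_zero_iff v).mpr (Finset.prod_ne_zero_iff.mpr fun i _ => h0 i)
  have hdiff : ∀ (C : ℕ) (s t : Finset ι), (h C).toFinset ⊆ s → s ⊆ t →
      v (∏ i ∈ t, f i - ∏ i ∈ s, f i) ≤ v (∏ i ∈ s, f i) * exp (-(C : ℤ)) := by
    intro C s t hs hst
    rw [← Finset.prod_sdiff hst]
    have h1 : (∏ i ∈ t \ s, f i) * ∏ i ∈ s, f i - ∏ i ∈ s, f i =
        (∏ i ∈ s, f i) * (∏ i ∈ t \ s, f i - 1) := by ring
    rw [h1, map_mul]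
    refine mul_le_mul' le_rfl (prod_sub_one_le v ?_ _ fun i hi => ?_)
    · rw [← exp_zero, exp_le_exp]
      omega
    · by_contra hc
      exact (Finset.mem_sdiff.mp hi).2 (hs ((Set.Finite.mem_toFinset _).mpr hc))
  set s₁ := (h 1).toFinset with hs₁
  -- Beyond the finitely many factors not close to 1, all partial products have the same valuation.
  -- This yields the Cauchy property and keeps the limit away from 0.
  have hconst : ∀ t, s₁ ⊆ t → v (∏ i ∈ t, f i) = v (∏ i ∈ s₁, f i) := fun t ht => by
    have h1 := hdiff 1 s₁ t subset_rfl ht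
    have h2 : v (∏ i ∈ t, f i - ∏ i ∈ s₁, f i) < v (∏ i ∈ s₁, f i) := by
      refine lt_of_le_of_lt h1 ?_
      conv_rhs => rw [← mul_one (v (∏ i ∈ s₁, f i))]
      refine mul_lt_mul_of_pos_left ?_ (zero_lt_iff.mpr (hprod0 s₁))
      rw [← exp_zero, exp_lt_exp]
      omega
    have h3 := v.map_add_eq_of_lt_left h2
    rwa [add_sub_cancel] at h3
  have hcauchy : Cauchy (map (fun s : Finset ι => ∏ i ∈ s, f i) atTop) := by
    rw [Valued.cauchy_iff]
    refine ⟨inferInstance, fun γ => ?_⟩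
    have hγ0 : MonoidWithZeroHom.ValueGroup₀.embedding γ.1 ≠ 0 := fun h0 => γ.ne_zero
      (MonoidWithZeroHom.ValueGroup₀.embedding_strictMono.injective (h0.trans (map_zero _).symm))
    have hγ : MonoidWithZeroHom.ValueGroup₀.embedding γ.1 / v (∏ i ∈ s₁, f i) ≠ 0 :=
      div_ne_zero hγ0 (hprod0 s₁)
    obtain ⟨C, hC⟩ := exists_exp_neg_lt hγ
    set s := s₁ ∪ (h C).toFinset with hs
    have hlt : ∀ t, s ⊆ t → v (∏ i ∈ t, f i - ∏ i ∈ s, f i) <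
        MonoidWithZeroHom.ValueGroup₀.embedding γ.1 := fun t ht => by
      refine (hdiff C s t Finset.subset_union_right ht).trans_lt ?_
      rw [hconst s Finset.subset_union_left, mul_comm]
      exact (lt_div_iff₀ (zero_lt_iff.mpr (hprod0 s₁))).mp hC
    refine ⟨_, image_mem_map (mem_atTop s), ?_⟩
    rintro _ ⟨t, ht, rfl⟩ _ ⟨t', ht', rfl⟩
    rw [Valuation.restrict_lt_iff_lt_embedding]
    have h1 := v.map_sub_lt (hlt t' ht') (hlt t ht)
    rwa [sub_sub_sub_cancel_right] at h1
  obtain ⟨L, hL⟩ := CompleteSpace.complete hcauchy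
  refine ⟨L, fun hL0 => ?_, hL⟩
  have hL' : Tendsto (fun s : Finset ι => ∏ i ∈ s, f i) atTop (nhds L) := hL
  rw [hL0] at hL'
  have hmem : {x : E | Valued.v.restrict x < Valued.v.restrict (∏ i ∈ s₁, f i)} ∈ nhds (0 : E) := by
    rw [Valued.mem_nhds_zero]
    refine ⟨Units.mk0 (Valued.v.restrict (∏ i ∈ s₁, f i)) fun h0 => hprod0 s₁ ?_, subset_rfl⟩
    rw [hv, ← Valuation.embedding_restrict, h0, map_zero]
  obtain ⟨t, ht⟩ := ((hL'.eventually hmem).and (eventually_ge_atTop s₁)).exists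
  exact absurd (hconst t ht.2) (ne_of_lt (Valuation.restrict_lt_iff _ |>.mp ht.1))

end Convergence
end TMotive
end

open scoped Polynomial TensorProduct
noncomputable section
namespace TMotive

open IsDedekindDomain FunctionField WithZero

/-! ### Finiteness of the set of places of bounded degree. -/

section FinitelyManyPlaces

variable {Fq : Type*} [Field Fq] [Fintype Fq] {K : Type*} [Field K]
  [Algebra Fq[X] K] [Algebra (RatFunc Fq) K]
  [IsScalarTower Fq[X] (RatFunc Fq) K] [FiniteDimensional (RatFunc Fq) K]
  [Algebra.IsSeparable (RatFunc Fq) K]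

theorem finite_setOf_mem_asIdeal {R : Type*} [CommRing R] [IsDedekindDomain R] {a : R}
    (ha : a ≠ 0) : {v : HeightOneSpectrum R | a ∈ v.asIdeal}.Finite := by
  have h := Ideal.finite_factors (I := Ideal.span {a}) (by simpa using ha)
  refine h.subset fun v hv => ?_
  exact Ideal.dvd_span_singleton.mpr hv

/-- There are only finitely many places of bounded degree. -/
theorem finite_setOf_card_residue (N : ℕ) :
    {v : FinitePlace Fq K | ∃ d, 0 < d ∧ d < N ∧
      Nat.card (ringOfIntegers Fq K ⧸ v.asIdeal) = Fintype.card Fq ^ d}.Finite := by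
  have hinj : Function.Injective (algebraMap Fq[X] (ringOfIntegers Fq K)) :=
    ringOfIntegers.algebraMap_injective Fq K
  -- All degrees below N divide N!, so every place in question contains this single non-zero
  -- element.
  have h0 : algebraMap Fq[X] (ringOfIntegers Fq K)
      (Polynomial.X ^ Fintype.card Fq ^ N.factorial - Polynomial.X) ≠ 0 := fun h =>
    FiniteField.X_pow_card_pow_sub_X_ne_zero Fq N.factorial_ne_zero Fintype.one_lt_card
      (hinj (h.trans (map_zero _).symm))
  refine (finite_setOf_mem_asIdeal h0).subset ?_
  rintro v ⟨d, hd0, hdN, hd⟩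
  have hfin := finite_residue v
  let _ : Field (ringOfIntegers Fq K ⧸ v.asIdeal) := Ideal.Quotient.field v.asIdeal
  have := Fintype.ofFinite (ringOfIntegers Fq K ⧸ v.asIdeal)
  obtain ⟨e, he⟩ := Nat.dvd_factorial hd0 hdN.le
  change _ ∈ v.asIdeal
  rw [← Ideal.Quotient.eq_zero_iff_mem, map_sub, map_pow, map_sub, map_pow, sub_eq_zero, he,
    pow_mul, ← hd, Nat.card_eq_fintype_card]
  exact FiniteField.pow_card_pow e _

end FinitelyManyPlaces

/-! ### Euler factors near 1 in F_∞. -/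

section Infinity

variable {Fq : Type*} [Field Fq]

theorem completeSpace_FInfty : CompleteSpace (FInfty Fq) := by
  let _ : DecidableEq (RatFunc Fq) := Classical.decEq _
  let _ : UniformSpace (RatFunc Fq) := (RatFunc.inftyValued Fq).toUniformSpace
  exact inferInstanceAs (CompleteSpace (UniformSpace.Completion (RatFunc Fq)))

/-- The hypothesis is one step stronger than the conclusion so that v(x - 1) < 1, hence v(x) = 1,
also when C = 0. -/
theorem valued_inv_sub_one_le {E : Type*} [Field E] (v : Valuation E ℤᵐ⁰) {x : E} {C : ℕ}
    (h : v (x - 1) ≤ exp (-((C + 1 : ℕ) : ℤ))) : v (x⁻¹ - 1) ≤ exp (-(C : ℤ)) := by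
  have h1 : v (x - 1) < v 1 := by
    refine h.trans_lt ?_
    rw [map_one, ← exp_zero, exp_lt_exp]
    omega
  have h2 : v x = 1 := by
    have h3 := v.map_add_eq_of_lt_left h1
    rwa [add_sub_cancel, map_one] at h3
  have hx : x ≠ 0 := fun h0 => by
    rw [h0, map_zero] at h2
    exact zero_ne_one h2
  have h4 : x⁻¹ - 1 = -((x - 1) * x⁻¹) := by
    rw [sub_mul, mul_inv_cancel₀ hx, one_mul, neg_sub]
  rw [h4, Valuation.map_neg, map_mul, map_inv₀, h2, inv_one, mul_one]
  refine h.trans ?_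
  rw [exp_le_exp]
  push_cast
  omega

/-- The valuation at infinity is read off the degree, so a degree drop by C in G - D becomes
closeness of G/D to 1. -/
theorem valued_div_sub_one_le {D G : Fq[X]} (hD : D ≠ 0) {C : ℕ}
    (h : DegLE (D.natDegree - C) (G - D)) :
    (Valued.v : Valuation (FInfty Fq) ℤᵐ⁰) (algebraMap (RatFunc Fq) (FInfty Fq)
      ((algebraMap Fq[X] (RatFunc Fq) D)⁻¹ * algebraMap Fq[X] (RatFunc Fq) G) - 1) ≤
        exp (-(C : ℤ)) := by
  have hD' : algebraMap Fq[X] (RatFunc Fq) D ≠ 0 := by simpa using hD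
  have h1 : algebraMap (RatFunc Fq) (FInfty Fq)
      ((algebraMap Fq[X] (RatFunc Fq) D)⁻¹ * algebraMap Fq[X] (RatFunc Fq) G) - 1 =
      algebraMap (RatFunc Fq) (FInfty Fq)
        ((algebraMap Fq[X] (RatFunc Fq) D)⁻¹ * algebraMap Fq[X] (RatFunc Fq) (G - D)) := by
    rw [map_sub (algebraMap Fq[X] (RatFunc Fq)), mul_sub, inv_mul_cancel₀ hD',
      map_sub (algebraMap (RatFunc Fq) (FInfty Fq)), map_one]
  rw [h1]
  by_cases h0 : G - D = 0
  · rw [h0, map_zero, mul_zero, map_zero, map_zero]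
    exact zero_le
  have h0' : algebraMap Fq[X] (RatFunc Fq) (G - D) ≠ 0 :=
    (map_ne_zero_iff _ (RatFunc.algebraMap_injective Fq)).mpr h0
  rw [valued_algebraMap_FInfty _ (mul_ne_zero (inv_ne_zero hD') h0'),
    RatFunc.intDegree_mul (inv_ne_zero hD') h0', RatFunc.intDegree_inv,
    RatFunc.intDegree_polynomial, RatFunc.intDegree_polynomial, exp_le_exp]
  have := h.natDegree_le h0
  omega

end Infinity

/-! ### Exceptional sets and convergence of the Euler product. -/

section Main

variable {Fq : Type*} [Field Fq] [Fintype Fq] {K : Type*} [Field K] [Algebra Fq K]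
  [Algebra Fq[X] K] [Algebra (RatFunc Fq) K] [IsScalarTower Fq Fq[X] K]
  [IsScalarTower Fq[X] (RatFunc Fq) K] [FiniteDimensional (RatFunc Fq) K]
  [Algebra.IsSeparable (RatFunc Fq) K] {M : Type*} [AddCommGroup M] [Module K[X] M]
  {σ : M →ₛₗ[coeffFrob Fq K] M}

/-- After rescaling, `σ` has an integral matrix whose determinant is known, and the adjugates of
its iterates have small degree. -/
theorem exists_integral_matrix (O : Type*) [CommRing O] [IsDomain O] [Algebra Fq[X] O]
    [Algebra Fq O] [Algebra O K] [IsScalarTower Fq[X] O K] [IsScalarTower Fq O K]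
    [IsFractionRing O K] (hM : IsEffective σ) (hfg : IsFinitelyGeneratedOverTau σ) :
    ∃ (r : ℕ) (b : Module.Basis (Fin r) K[X] M) (A : Matrix (Fin r) (Fin r) K[X])
      (A' : Matrix (Fin r) (Fin r) O[X]) (α β : O) (m : ℕ) (N : ℕ → ℕ),
      (∀ j, σ (b j) = ∑ i, A i j • b i) ∧
      A'.map (Polynomial.mapRingHom (algebraMap O K)) = Polynomial.C (algebraMap O K β) • A ∧
      A'.det = Polynomial.C α *
        (Polynomial.X - Polynomial.C (algebraMap Fq[X] O Polynomial.X)) ^ m ∧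
      α ≠ 0 ∧ β ≠ 0 ∧
      ∀ C, ∀ d ≥ N C, ∀ i j, DegLE (m * d - C) ((iterMat (coeffFrob Fq O) A' d).adjugate i j) := by
  obtain ⟨r, b, A, α, m, hA, hα, hdet⟩ := exists_basis_of_isEffective hM
  obtain ⟨c₀, k, B, hB, hsum⟩ := exists_sum_iterMat_of_isFinitelyGeneratedOverTau hA hfg
  have hdegdet : DegLE m A.det := by
    refine degLE_of_natDegree_le ?_
    rw [hdet]
    refine Nat.cast_le.mpr ((Polynomial.natDegree_C_mul_le _ _).trans ?_)
    rw [Polynomial.natDegree_pow, Polynomial.natDegree_X_sub_C, mul_one]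
  have hdeg := adjugate_iterMat_degLE (frobHom Fq K) A m hdegdet c₀ k B hB hsum
  rw [IsScalarTower.algebraMap_apply Fq[X] O K] at hdet
  obtain ⟨β, A', α', hβ, hα', hA', hA'det, hA'deg⟩ := exists_integral_smul (O := O) hα hdet hdeg
  choose N hN using hA'deg
  rw [← map_pow] at hA'
  exact ⟨r, b, A, A', α', _, m, N, hA, hA', hA'det, hα', pow_ne_zero _ hβ, hN⟩

/-- Outside a finite set of places the representations are unramified, and the Euler factors are
close to `1` at `1` when the degree of the place is large. -/
theorem exists_finite_euler_factor (hM : IsEffective σ) (hfg : IsFinitelyGeneratedOverTau σ) :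
    ∃ (S : Set (FinitePlace Fq K)) (N : ℕ → ℕ), S.Finite ∧ ∀ v ∉ S,
      (∀ l, IsCoprimeTo l v → IsUnramifiedAt (dualGaloisRep σ) l v) ∧
      ∃ P : (RatFunc Fq)[X], IsEulerPolynomial (dualGaloisRep σ) v P ∧
        ∀ d, Nat.card (ringOfIntegers Fq K ⧸ v.asIdeal) = Fintype.card Fq ^ d →
          ∀ C, N C ≤ d → (Valued.v : Valuation (FInfty Fq) ℤᵐ⁰)
            (algebraMap (RatFunc Fq) (FInfty Fq) (P.eval 1) - 1) ≤ exp (-(C : ℤ)) := by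
  obtain ⟨r, b, A, A', α, β, m, N, hA, hA', hA'det, hα, hβ, hN⟩ :=
    exists_integral_matrix (ringOfIntegers Fq K) hM hfg
  -- The excluded places divide the constant of the determinant or the scaling factor of the
  -- integral model.
  refine ⟨{v | α * β ∈ v.asIdeal}, N, finite_setOf_mem_asIdeal (mul_ne_zero hα hβ),
    fun v hv => ?_⟩
  have hvα : α ∉ v.asIdeal := fun h => hv (v.asIdeal.mul_mem_right _ h)
  have hvβ : β ∉ v.asIdeal := fun h => hv (v.asIdeal.mul_mem_left _ h)
  obtain ⟨d, -, hd⟩ := exists_card_residue_eq v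
  obtain ⟨hunr, D, G, hD, hDdeg, hP, hest⟩ := euler_factor_of_notMem hA hA' hA'det hvα hvβ hd
  refine ⟨hunr, _, hP, fun d' hd' C hC => ?_⟩
  obtain rfl : d' = d := Nat.pow_right_injective Fintype.one_lt_card (hd'.symm.trans hd)
  have h1 : (Polynomial.C (algebraMap Fq[X] (RatFunc Fq) D)⁻¹ *
      G.map (algebraMap Fq[X] (RatFunc Fq))).eval 1 =
      (algebraMap Fq[X] (RatFunc Fq) D)⁻¹ * algebraMap Fq[X] (RatFunc Fq) (G.eval 1) := by
    rw [Polynomial.eval_mul, Polynomial.eval_C, Polynomial.eval_map, Polynomial.eval₂_at_one]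
  rw [h1]
  refine valued_div_sub_one_le hD ?_
  rw [hDdeg]
  push_cast
  exact hest C (hN C d' hC)

theorem exists_isExceptionalSet (hM : IsEffective σ) (hfg : IsFinitelyGeneratedOverTau σ) :
    ∃ S : Set (FinitePlace Fq K), IsExceptionalSet (dualGaloisRep σ) S := by
  obtain ⟨S, N, hS, h⟩ := exists_finite_euler_factor hM hfg
  exact ⟨S, hS, fun v hv => (h v hv).1, fun v hv => ⟨_, (h v hv).2.choose_spec.1⟩⟩

/-- A given exceptional set need not contain the places where the integral model is bad. These are
finitely many, so they do not affect convergence; their factors only have to be non-zero, which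
`eval_one_ne_zero` gives for every Euler polynomial. -/
theorem exists_eulerProductConvergesTo (hM : IsEffective σ) (hfg : IsFinitelyGeneratedOverTau σ)
    {S : Set (FinitePlace Fq K)} (hS : IsExceptionalSet (dualGaloisRep σ) S) :
    ∃ L : FInfty Fq, EulerProductConvergesTo (dualGaloisRep σ) S 0 L := by
  classical
  obtain ⟨S₀, N, hS₀, h⟩ := exists_finite_euler_factor hM hfg
  -- Outside S₀ the explicit Euler polynomial with its estimate is chosen, elsewhere any one
  -- provided by S; no uniqueness of Euler polynomials is needed.
  have hchoice : ∀ v : FinitePlace Fq K, ∃ P : (RatFunc Fq)[X],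
      (v ∉ S → IsEulerPolynomial (dualGaloisRep σ) v P) ∧
      (v ∉ S₀ → ∀ d, Nat.card (ringOfIntegers Fq K ⧸ v.asIdeal) = Fintype.card Fq ^ d →
        ∀ C, N C ≤ d → (Valued.v : Valuation (FInfty Fq) ℤᵐ⁰)
          (algebraMap (RatFunc Fq) (FInfty Fq) (P.eval 1) - 1) ≤ exp (-(C : ℤ))) := by
    intro v
    by_cases hv : v ∈ S₀
    · by_cases hvS : v ∈ S
      · exact ⟨0, fun h => absurd hvS h, fun h => absurd hv h⟩
      · obtain ⟨P, hP⟩ := hS.compatible v hvS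
        exact ⟨P, fun _ => hP, fun h => absurd hv h⟩
    · obtain ⟨-, P, hP, hP'⟩ := h v hv
      exact ⟨P, fun _ => hP, fun _ => hP'⟩
  choose P hP hPest using hchoice
  have hne : ∀ v ∉ S, (P v).eval 1 ≠ 0 := fun v hv =>
    eval_one_ne_zero hM hfg (hS.unramified v hv) (hP v hv)
  have hcomplete := completeSpace_FInfty (Fq := Fq)
  obtain ⟨L, hL0, hL⟩ := exists_hasProd
    (f := fun v : {v : FinitePlace Fq K // v ∉ S} =>
      algebraMap (RatFunc Fq) (FInfty Fq) ((P v).eval 1)⁻¹)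
    (fun v => (map_ne_zero _).mpr (inv_ne_zero (hne v v.2))) (fun C => by
      -- A factor can be far from 1 only at a place of S₀ or of degree below N(C + 1); the shift by
      -- one pays for the inversion of P_v(1).
      refine Set.Finite.subset (Set.Finite.preimage Subtype.val_injective.injOn
        (hS₀.union (finite_setOf_card_residue (N (C + 1))))) fun v hv => ?_
      by_contra hc
      rw [Set.mem_preimage, Set.mem_union, not_or] at hc
      obtain ⟨d, hd0, hd⟩ := exists_card_residue_eq v.1
      refine hv ?_
      rw [map_inv₀]
      refine valued_inv_sub_one_le _ (hPest v.1 hc.1 d hd (C + 1) ?_)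
      by_contra hlt
      exact hc.2 ⟨d, hd0, not_le.mp hlt, hd⟩)
  refine ⟨L, P, hP, fun v hv => ?_, hL0, ?_⟩
  · rw [neg_zero, zpow_zero]
    exact hne v hv
  · simpa only [neg_zero, zpow_zero] using hL

end Main

end TMotive
end

theorem mainTheorem1
    {Fq : Type*} [Field Fq] [Fintype Fq]
    {K : Type*} [Field K]
    [Algebra Fq K] [Algebra Fq[X] K] [Algebra (RatFunc Fq) K]
    [IsScalarTower Fq Fq[X] K] [IsScalarTower Fq[X] (RatFunc Fq) K]
    [FiniteDimensional (RatFunc Fq) K]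
    (j : K →ₐ[RatFunc Fq] TMotive.FInfty Fq)
    {M : Type*} [AddCommGroup M] [Module K[X] M]
    (σ : M →ₛₗ[TMotive.coeffFrob Fq K] M)
    (hM : TMotive.IsEffective σ)
    (hfg : TMotive.IsFinitelyGeneratedOverTau σ) :
    (∃ S : Set (TMotive.FinitePlace Fq K),
      TMotive.IsExceptionalSet (TMotive.dualGaloisRep σ) S) ∧
    ∀ S : Set (TMotive.FinitePlace Fq K),
      TMotive.IsExceptionalSet (TMotive.dualGaloisRep σ) S →
        ∃ L : TMotive.FInfty Fq,
          TMotive.EulerProductConvergesTo (TMotive.dualGaloisRep σ) S 0 L := by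
  -- The embedding at infinity is used only for separability, on which the finiteness of the residue
  -- fields of O_K depends.
  have := TMotive.isSeparable_of_algHom_FInfty j
  exact ⟨TMotive.exists_isExceptionalSet hM hfg,
    fun S hS => TMotive.exists_eulerProductConvergesTo hM hfg hS⟩
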